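/- Let $N\ge 3$, $2^*=\frac{2N}{N-2}$, $X=H^1(\mathbb R^N)$ (real-valued functions). Assume: (V) $V\in L^\infty(\mathbb R^N)$ is $\mathbb Z^N$-periodic and $0\notin\sigma(-\Delta+V)$, the spectrum of the self-adjoint operator $-\Delta+V$ on $L^2(\mathbb R^N)$. (F1) $f:\mathbb R^N\times\mathbb R\to\mathbb R$ is measurable in $x$, continuous in $u$ for a.e. $x$, and $\mathbb Z^N$-periodic in $x$. (F2) There are $a>0$ and $2<p<2^*$ with $|f(x,u)|\le a(1+|u|^{p-1})$ for all $x,u$. (F3) $f(x,u)=o(u)$ as $u\to0$, uniformly in $x$. (F4) $F(x,u)/u^2\to\infty$ as $|u|\to\infty$, uniformly in $x$, where $F(x,u)=\int_0^u f(x,t)\,dt$. (F5) $u\mapsto f(x,u)/|u|$ is non-decreasing on $(-\infty,0)$ and on $(0,\infty)$. For $\mu\in\mathbb R$ and $u,v\in X$ put $B_\mu(u,v)=\int_{\mathbb R^N}\langle\nabla u,\nabla v\rangle+\big(V(x)-\frac{\mu}{|x|^2}\big)uv\,dx$ and $\mathcal J_\mu(u)=\frac12B_\mu(u,u)-\int_{\mathbb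 R^N}F(x,u)\,dx$. Let $X=X^+\oplus X^-$ be the decomposition of $X$ into the positive and the negative spectral subspace of $-\Delta+V$, so that $B_0$ is positive definite on $X^+$ and negative definite on $X^-$, and let $$\mu(V)^{\pm}=\sup\Big\{M>0:\ \pm B_0(u,u)\ge M\int_{\mathbb R^N}|\nabla u|^2dx\ \text{ for all }u\in X^{\pm}\Big\}\in(0,\infty]$$ (so $\mu(V)^-=\infty$ if $X^-=\{0\}$). Let $$\mathcal N_\mu=\{u\in X\setminus X^-:\ \mathcal J_\mu'(u)(u)=0\ \text{ and }\ \mathcal J_\mu'(u)(v)=0\ \text{ for all }v\in X^-\}.$$ A ground state of $\mathcal J_\mu$ is a critical point $u\neq0$ of $\mathcal J_\mu$ with $\mathcal J_\mu(u)=\inf_{\mathcal N_\mu}\mathcal J_\mu>0$. (a) Suppose that $-\frac{(N-2)^2}{4}\mu(V)^-<\mu<\frac{(N-2)^2}{4}\mu(V)^+$. If $u_\mu$ is a ground state of $\mathcal J_\mu$, then there are $t>0$ and $v\in X^-$ such that $tu_\mu+v\in\mathcal N_0$ and $$\inf_{\mathcal N_0}\mathcal J_0\le\inf_{\mathcal N_\mu}\mathcal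 J_\mu+\frac12\int_{\mathbb R^N}\frac{\mu}{|x|^2}|tu_\mu+v|^2dx.$$ If moreover $\mu\ge0$ and $u_0$ is a ground state of $\mathcal J_0$, then there are $t>0$ and $v\in X^-$ such that $tu_0+v\in\mathcal N_\mu$ and $$\inf_{\mathcal N_\mu}\mathcal J_\mu\le\inf_{\mathcal N_0}\mathcal J_0-\frac12\int_{\mathbb R^N}\frac{\mu}{|x|^2}|tu_0+v|^2dx.$$ Moreover, $\lim_{\mu\to0^+}\inf_{\mathcal N_\mu}\mathcal J_\mu=\inf_{\mathcal N_0}\mathcal J_0$. (b) Assume in addition (F6): $f(x,\cdot)$ is of class $C^1$ for a.e. $x$, and there are $b>0$ and $2<q\le p$ (with $p$ from (F2)) such that $f(x,u)u-2F(x,u)\ge b|u|^q$ for all $x,u$. Let $\mu_n>0$, $\mu_n\to0$, and let $u_{\mu_n}$ be a ground state of $\mathcal J_{\mu_n}$ for every $n$. Then, after passing to a subsequence, there are $x_n\in\mathbb Z^N$ and a ground state $u$ of $\mathcal J_0$ such that $u_{\mu_n}(\cdot+x_n)\to u$ strongly in $H^1(\mathbb R^N)$. (c) If $\mu<0$ and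 $0<\inf\sigma(-\Delta+V)$, then $\mathcal J_\mu$ has no ground state. -/

import Mathlib

open MeasureTheory Filter Topology Set
open scoped ContDiff

noncomputable section

namespace HardySchrodinger

/-- The Euclidean space `ℝ^N`. -/
abbrev Euc (N : ℕ) : Type := EuclideanSpace ℝ (Fin N)

/-- The real Hilbert space `L²(ℝ^N)`. -/
abbrev L2 (N : ℕ) : Type := Lp ℝ 2 (volume : Measure (Euc N))

/-- The real Hilbert space `L²(ℝ^N; ℝ^N)`. -/
abbrev L2vec (N : ℕ) : Type := Lp (Euc N) 2 (volume : Measure (Euc N))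

/-- `g` is the weak gradient of `u`, tested against smooth compactly supported functions. -/
def IsWeakGradient {N : ℕ} (u : L2 N) (g : L2vec N) : Prop :=
  ∀ φ : Euc N → ℝ, ContDiff ℝ ∞ φ → HasCompactSupport φ → ∀ e : Euc N,
    ∫ x, u x * fderiv ℝ φ x e = - ∫ x, inner ℝ (g x) e * φ x

theorem integrable_mul_fderiv {N : ℕ} (u : L2 N) {φ : Euc N → ℝ} (hφ : ContDiff ℝ ∞ φ)
    (hc : HasCompactSupport φ) (e : Euc N) :
    Integrable (fun x => u x * fderiv ℝ φ x e) volume := by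
  have h1 : Continuous (fun x => fderiv ℝ φ x e) :=
    (hφ.continuous_fderiv (by simp)).clm_apply continuous_const
  have h2 : HasCompactSupport (fun x => fderiv ℝ φ x e) := hc.fderiv_apply ℝ e
  have h3 : MemLp (fun x => fderiv ℝ φ x e) 2 (volume : Measure (Euc N)) :=
    h1.memLp_of_hasCompactSupport h2
  exact (Lp.memLp u).integrable_mul h3

theorem integrable_inner_mul {N : ℕ} (g : L2vec N) {φ : Euc N → ℝ} (hφ : ContDiff ℝ ∞ φ)
    (hc : HasCompactSupport φ) (e : Euc N) :
    Integrable (fun x => inner ℝ (g x) e * φ x) volume := by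
  have h3 : MemLp φ 2 (volume : Measure (Euc N)) :=
    hφ.continuous.memLp_of_hasCompactSupport hc
  exact ((Lp.memLp g).inner_const e).integrable_mul h3

theorem IsWeakGradient.zero {N : ℕ} : IsWeakGradient (0 : L2 N) (0 : L2vec N) := by
  intro φ _ _ e
  have h1 : (fun x => (0 : L2 N) x * fderiv ℝ φ x e) =ᵐ[volume] fun _ => 0 := by
    filter_upwards [Lp.coeFn_zero ℝ 2 (volume : Measure (Euc N))] with x hx
    rw [hx]
    simp
  have h2 : (fun x => inner ℝ ((0 : L2vec N) x) e * φ x) =ᵐ[volume] fun _ => 0 := by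
    filter_upwards [Lp.coeFn_zero (Euc N) 2 (volume : Measure (Euc N))] with x hx
    rw [hx]
    simp
  rw [integral_congr_ae h1, integral_congr_ae h2]
  simp

theorem IsWeakGradient.add {N : ℕ} {u v : L2 N} {g k : L2vec N} (hu : IsWeakGradient u g)
    (hv : IsWeakGradient v k) : IsWeakGradient (u + v) (g + k) := by
  intro φ hφ hc e
  have h1 : (fun x => (u + v) x * fderiv ℝ φ x e) =ᵐ[volume]
      fun x => u x * fderiv ℝ φ x e + v x * fderiv ℝ φ x e := by
    filter_upwards [Lp.coeFn_add u v] with x hx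
    rw [hx, Pi.add_apply, add_mul]
  have h2 : (fun x => inner ℝ ((g + k) x) e * φ x) =ᵐ[volume]
      fun x => inner ℝ (g x) e * φ x + inner ℝ (k x) e * φ x := by
    filter_upwards [Lp.coeFn_add g k] with x hx
    rw [hx, Pi.add_apply, inner_add_left, add_mul]
  rw [integral_congr_ae h1, integral_congr_ae h2,
    integral_add (integrable_mul_fderiv u hφ hc e) (integrable_mul_fderiv v hφ hc e),
    integral_add (integrable_inner_mul g hφ hc e) (integrable_inner_mul k hφ hc e),
    hu φ hφ hc e, hv φ hφ hc e]
  ring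

theorem IsWeakGradient.smul {N : ℕ} {u : L2 N} {g : L2vec N} (c : ℝ)
    (hu : IsWeakGradient u g) : IsWeakGradient (c • u) (c • g) := by
  intro φ hφ hc e
  have h1 : (fun x => (c • u) x * fderiv ℝ φ x e) =ᵐ[volume]
      fun x => c * (u x * fderiv ℝ φ x e) := by
    filter_upwards [Lp.coeFn_smul c u] with x hx
    rw [hx, Pi.smul_apply, smul_eq_mul, mul_assoc]
  have h2 : (fun x => inner ℝ ((c • g) x) e * φ x) =ᵐ[volume]
      fun x => c * (inner ℝ (g x) e * φ x) := by
    filter_upwards [Lp.coeFn_smul c g] with x hx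
    rw [hx, Pi.smul_apply, real_inner_smul_left, mul_assoc]
  rw [integral_congr_ae h1, integral_congr_ae h2, integral_const_mul, integral_const_mul,
    hu φ hφ hc e]
  ring

/-- `H¹(ℝ^N)`, realised as the space of pairs `(u, ∇u)` in `L² × L²` with the Hilbert norm
`‖u‖² = ∫ |u|² + |∇u|²`. A pair is determined by its first entry. -/
def sobolev (N : ℕ) : Submodule ℝ (WithLp 2 (L2 N × L2vec N)) where
  carrier := {p | IsWeakGradient p.fst p.snd}
  zero_mem' := IsWeakGradient.zero
  add_mem' := fun hu hv => IsWeakGradient.add hu hv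
  smul_mem' := fun c _ hu => IsWeakGradient.smul c hu

/-- The space `X = H¹(ℝ^N)`. -/
abbrev H1 (N : ℕ) : Type := ↥(sobolev N)

/-- The underlying element of `L²`. -/
def H1.toL2 {N : ℕ} (u : H1 N) : L2 N := u.1.fst

/-- The underlying function, defined almost everywhere. -/
def H1.val {N : ℕ} (u : H1 N) : Euc N → ℝ := u.toL2

/-- The weak gradient `∇u`. -/
def H1.grad {N : ℕ} (u : H1 N) : Euc N → Euc N := u.1.snd

/-- An integer vector as a point of `ℝ^N`. -/
def latticePoint {N : ℕ} (z : Fin N → ℤ) : Euc N := WithLp.toLp 2 (fun i => (z i : ℝ))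

/-- The bilinear form `B_μ(u,v) = ∫ ⟨∇u,∇v⟩ + (V - μ/|x|²) u v`. -/
def bform {N : ℕ} (V : Euc N → ℝ) (μ : ℝ) (u v : H1 N) : ℝ :=
  ∫ x, (inner ℝ (u.grad x) (v.grad x) + (V x - μ / ‖x‖ ^ 2) * (u.val x * v.val x))

/-! ### The Schrödinger operator and its spectrum -/

/-- `u` lies in the domain of the self-adjoint operator `-Δ + V` on `L²(ℝ^N)` and
`(-Δ + V) u = h`. The operator is the one associated with the closed form `B_0` on `H¹`. -/
def IsSchrodingerImage {N : ℕ} (V : Euc N → ℝ) (u h : L2 N) : Prop :=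
  ∃ w : H1 N, w.toL2 = u ∧ ∀ φ : H1 N, bform V 0 w φ = ∫ x, h x * φ.val x

/-- The spectrum `σ(-Δ + V)`: the set of `l` for which `-Δ + V - l` has no bounded inverse on `L²`.
The operator is self-adjoint with real coefficients, so its spectrum is real and may be computed
on the real space `L²`. -/
def schrodingerSpectrum {N : ℕ} (V : Euc N → ℝ) : Set ℝ :=
  {l | ¬ ∃ R : L2 N →L[ℝ] L2 N, ∀ u h : L2 N, IsSchrodingerImage V u (h + l • u) ↔ R h = u}

/-- `S ⊆ H¹` reduces `-Δ + V`: it has a complement in `H¹` that is orthogonal to `S` both in `L²`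
and for the form `B_0`. -/
def IsReducing {N : ℕ} (V : Euc N → ℝ) (S : Submodule ℝ (H1 N)) : Prop :=
  ∃ T : Submodule ℝ (H1 N), IsCompl S T ∧
    ∀ u ∈ S, ∀ v ∈ T, inner ℝ u.toL2 v.toL2 = 0 ∧ bform V 0 u v = 0

/-- `X⁺`, the positive spectral subspace of `-Δ + V` in `H¹`: the largest reducing subspace on
which `B_0` is nonnegative (if `0 ∉ σ(-Δ + V)`, then `H¹ = X⁺ ⊕ X⁻`, and `B_0` is positive definite
on `X⁺`). -/
def Xplus {N : ℕ} (V : Euc N → ℝ) : Submodule ℝ (H1 N) :=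
  sSup {S | IsReducing V S ∧ ∀ u ∈ S, 0 ≤ bform V 0 u u}

/-- `X⁻`, the negative spectral subspace of `-Δ + V` in `H¹`: the largest reducing subspace on
which `B_0` is nonpositive (if `0 ∉ σ(-Δ + V)`, then `H¹ = X⁺ ⊕ X⁻`, and `B_0` is negative definite
on `X⁻`). -/
def Xminus {N : ℕ} (V : Euc N → ℝ) : Submodule ℝ (H1 N) :=
  sSup {S | IsReducing V S ∧ ∀ u ∈ S, bform V 0 u u ≤ 0}

/-- `μ(V)⁺`. -/
def muPlus {N : ℕ} (V : Euc N → ℝ) : EReal :=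
  sSup ((fun M : ℝ => (M : EReal)) ''
    {M : ℝ | 0 < M ∧ ∀ u ∈ Xplus V, M * ∫ x, ‖u.grad x‖ ^ 2 ≤ bform V 0 u u})

/-- `μ(V)⁻`; it is `∞` if `X⁻ = {0}`. -/
def muMinus {N : ℕ} (V : Euc N → ℝ) : EReal :=
  sSup ((fun M : ℝ => (M : EReal)) ''
    {M : ℝ | 0 < M ∧ ∀ u ∈ Xminus V, M * ∫ x, ‖u.grad x‖ ^ 2 ≤ - bform V 0 u u})

/-! ### Assumptions on the potential and on the nonlinearity -/

/-- The primitive `F(x,s) = ∫_0^s f(x,t) dt`. -/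
def primitive {N : ℕ} (f : Euc N → ℝ → ℝ) (x : Euc N) (s : ℝ) : ℝ := ∫ t in (0 : ℝ)..s, f x t

/-- (V): `V ∈ L^∞` is `ℤ^N`-periodic and `0 ∉ σ(-Δ + V)`. -/
structure CondV {N : ℕ} (V : Euc N → ℝ) : Prop where
  bounded : MemLp V ⊤ volume
  periodic : ∀ z : Fin N → ℤ, ∀ᵐ x, V (x + latticePoint z) = V x
  gap : (0 : ℝ) ∉ schrodingerSpectrum V

/-- (F1): `f` is a Carathéodory function, `ℤ^N`-periodic in `x`. -/
structure CondF1 {N : ℕ} (f : Euc N → ℝ → ℝ) : Prop where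
  measurable : ∀ s : ℝ, AEMeasurable (fun x => f x s) volume
  continuous : ∀ᵐ x, Continuous (f x)
  periodic : ∀ (z : Fin N → ℤ) (x : Euc N) (s : ℝ), f (x + latticePoint z) s = f x s

/-- (F2): subcritical growth with exponent `p`, `2 < p < 2N/(N-2)`. -/
structure CondF2 {N : ℕ} (f : Euc N → ℝ → ℝ) (p : ℝ) : Prop where
  two_lt : 2 < p
  lt_critical : p < 2 * (N : ℝ) / ((N : ℝ) - 2)
  growth : ∃ a : ℝ, 0 < a ∧ ∀ (x : Euc N) (s : ℝ), |f x s| ≤ a * (1 + |s| ^ (p - 1))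

/-- (F3): `f(x,s) = o(s)` as `s → 0`, uniformly in `x`. -/
def CondF3 {N : ℕ} (f : Euc N → ℝ → ℝ) : Prop :=
  ∀ ε > 0, ∃ δ > 0, ∀ (x : Euc N) (s : ℝ), |s| < δ → |f x s| ≤ ε * |s|

/-- (F4): `F(x,s)/s² → ∞` as `|s| → ∞`, uniformly in `x`. -/
def CondF4 {N : ℕ} (f : Euc N → ℝ → ℝ) : Prop :=
  ∀ M : ℝ, ∃ R > 0, ∀ (x : Euc N) (s : ℝ), R ≤ |s| → M ≤ primitive f x s / s ^ 2

/-- (F5): `s ↦ f(x,s)/|s|` is non-decreasing on `(-∞,0)` and on `(0,∞)`. -/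
def CondF5 {N : ℕ} (f : Euc N → ℝ → ℝ) : Prop :=
  ∀ x : Euc N, MonotoneOn (fun s => f x s / |s|) (Iio 0) ∧
    MonotoneOn (fun s => f x s / |s|) (Ioi 0)

/-- (F6), with the exponent `p` of (F2). -/
structure CondF6 {N : ℕ} (f : Euc N → ℝ → ℝ) (p : ℝ) : Prop where
  smooth : ∀ᵐ x, ContDiff ℝ 1 (f x)
  lower : ∃ b q : ℝ, 0 < b ∧ 2 < q ∧ q ≤ p ∧
    ∀ (x : Euc N) (s : ℝ), b * |s| ^ q ≤ f x s * s - 2 * primitive f x s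

/-! ### Energy, Nehari–Pankov manifold, ground states -/

/-- The energy `J_μ`. -/
def energy {N : ℕ} (V : Euc N → ℝ) (f : Euc N → ℝ → ℝ) (μ : ℝ) (u : H1 N) : ℝ :=
  1 / 2 * (∫ x, (‖u.grad x‖ ^ 2 + (V x - μ / ‖x‖ ^ 2) * |u.val x| ^ 2))
    - ∫ x, primitive f x (u.val x)

/-- The Nehari–Pankov manifold `N_μ`, where `L` is the Fréchet derivative `J_μ'(u)`. -/
def nehariPankov {N : ℕ} (V : Euc N → ℝ) (f : Euc N → ℝ → ℝ) (μ : ℝ) : Set (H1 N) :=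
  {u | u ∉ Xminus V ∧ ∃ L : H1 N →L[ℝ] ℝ, HasFDerivAt (energy V f μ) L u ∧
    L u = 0 ∧ ∀ v ∈ Xminus V, L v = 0}

/-- The level `inf_{N_μ} J_μ`, an extended real number. -/
def level {N : ℕ} (V : Euc N → ℝ) (f : Euc N → ℝ → ℝ) (μ : ℝ) : EReal :=
  ⨅ u ∈ nehariPankov V f μ, (energy V f μ u : EReal)

/-- A ground state of `J_μ`: a nontrivial critical point `u` with
`J_μ(u) = inf_{N_μ} J_μ > 0`. -/
structure IsGroundState {N : ℕ} (V : Euc N → ℝ) (f : Euc N → ℝ → ℝ) (μ : ℝ) (u : H1 N) :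
    Prop where
  nontrivial : u ≠ 0
  critical : HasFDerivAt (energy V f μ) (0 : H1 N →L[ℝ] ℝ) u
  energy_eq : (energy V f μ u : EReal) = level V f μ
  level_pos : 0 < level V f μ

/-- The Hardy term `∫ (μ/|x|²) |u|²`. -/
def hardyTerm {N : ℕ} (μ : ℝ) (u : H1 N) : ℝ := ∫ x, μ / ‖x‖ ^ 2 * |u.val x| ^ 2

/-- `μ` lies in the interval `(-((N-2)²/4) μ(V)⁻, ((N-2)²/4) μ(V)⁺)`. -/
def Admissible {N : ℕ} (V : Euc N → ℝ) (μ : ℝ) : Prop :=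
  -(((((N : ℝ) - 2) ^ 2 / 4 : ℝ) : EReal) * muMinus V) < (μ : EReal) ∧
    (μ : EReal) < ((((N : ℝ) - 2) ^ 2 / 4 : ℝ) : EReal) * muPlus V

end HardySchrodinger

end

/-! The energy is half the form `B_μ` minus the potential `∫ F(x,u)`. Conditions (F3) and (F5) make
`f(x,·)` monotone, so the potential is nonnegative and convex, and (F4) makes it superquadratic
along rays. Two facts about the half spaces `ℝ₊u ⊕ X⁻` with `u ∉ X⁻` carry most of the proof. If
`B_μ` is coercive on `X⁺` and negative definite on `X⁻`, the energy attains its maximum there at a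
point of the Nehari–Pankov set (`exists_mem_nehariPankov`, from the abstract `exists_max_halfspace`;
uniform concavity along `X⁻` makes maximising sequences Cauchy). Conversely, (F5) makes every
Nehari–Pankov point a maximiser on its own half space as soon as `B_μ ≤ 0` on `X⁻` (`nehari_le`,
`energy_le_of_nehari`).

For (a), the energies for `0` and `μ` differ by half the Hardy term (`energy_zero_eq`). Moving a
ground state of one functional inside its half space to the Nehari–Pankov set of the other, and
using maximality, gives both comparisons. The same argument, applied to almost minimisers instead of
ground states, gives the limit of the levels, once the moved points are bounded uniformly in small
`μ ≥ 0`. This is `exists_norm_le_of_energy`: a normalised unbounded sequence would vanish in `L^p`,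
although its positive spectral parts stay away from zero, and then the energy along the rays through
these parts would be too large.

For (b), ground states are bounded and, having energy bounded away from zero, do not vanish; so
suitable lattice translates have a weak limit `u₀ ≠ 0`. The Hardy term is bounded on bounded sets
wherever the translates sit, so it drops out as `μ → 0` and `u₀` is critical for `J_0`. Its energy
is at least the level by minimality and at most the level by Fatou applied to `f(x,u)u/2 - F(x,u) ≥
0`. No mass is lost, (F6) turns this into convergence in `L^q` and then `L^p`, and coercivity of
`B_0` on both spectral summands upgrades it to `H¹` (`groundState_compactness`).

For (c), positive spectrum gives `X⁻ = {0}`, and the level for `μ < 0` would lie strictly above an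
energy on the Nehari set of `J_0`. Translating that point far from the origin makes the Hardy term
negligible and produces a Nehari point of `J_μ` below its level (`not_groundState_of_neg`).

The spectral decomposition comes from operator square roots: the splitting of an invertible
symmetric bounded `T` is read off from `|T|`, transported to `H¹` by a change of variables that
turns `B_0 + Λ⟨·,·⟩` into the inner product, and identified with `Xplus` and `Xminus` by maximality
(`spectral_split`). -/

open MeasureTheory Filter Topology Set
open scoped ContDiff

noncomputable section

namespace HardySchrodinger

/-! ### Shortcut instances on `H¹` -/

local instance {N : ℕ} : NormedAddCommGroup (H1 N) := Submodule.normedAddCommGroup _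

local instance {N : ℕ} : InnerProductSpace ℝ (H1 N) := Submodule.innerProductSpace _

local instance {N : ℕ} : SeminormedAddCommGroup (H1 N) := inferInstance

local instance {N : ℕ} : NormedSpace ℝ (H1 N) := inferInstance

local instance {N : ℕ} : Module ℝ (H1 N) := inferInstance

local instance {N : ℕ} : AddCommGroup (H1 N) := inferInstance

local instance {N : ℕ} : AddCommMonoid (H1 N) := inferInstance

local instance {N : ℕ} : TopologicalSpace (H1 N) := inferInstance

local instance {N : ℕ} : IsTopologicalAddGroup (H1 N) := inferInstance

local instance {N : ℕ} : ContinuousSMul ℝ (H1 N) := inferInstance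

local instance {N : ℕ} : SMul ℝ (H1 N) := inferInstance

local instance {N : ℕ} : Add (H1 N) := inferInstance

local instance {N : ℕ} : Sub (H1 N) := inferInstance

local instance {N : ℕ} : Zero (H1 N) := inferInstance

local instance {N : ℕ} : Norm (H1 N) := inferInstance

section

variable {N : ℕ}

/-! ### Basic facts about `H¹` -/

/-- The inclusion `H¹ → L²`. -/
def toL2L (N : ℕ) : H1 N →L[ℝ] L2 N :=
  (WithLp.fstL 2 ℝ (L2 N) (L2vec N)).comp (sobolev N).subtypeL

/-- The weak gradient as a bounded operator `H¹ → L²`. -/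
def gradL (N : ℕ) : H1 N →L[ℝ] L2vec N :=
  (WithLp.sndL 2 ℝ (L2 N) (L2vec N)).comp (sobolev N).subtypeL

theorem toL2L_apply (u : H1 N) : toL2L N u = u.toL2 := rfl

theorem coe_toL2L (u : H1 N) : (toL2L N u : Euc N → ℝ) = u.val := rfl

theorem coe_gradL (u : H1 N) : (gradL N u : Euc N → Euc N) = u.grad := rfl

theorem isWeakGradient (u : H1 N) : IsWeakGradient (toL2L N u) (gradL N u) := u.2

/-- The element of `H¹` with a given weak gradient. -/
def H1.mk (u : L2 N) (g : L2vec N) (h : IsWeakGradient u g) : H1 N := ⟨WithLp.toLp 2 (u, g), h⟩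

theorem H1.norm_sq (u : H1 N) : ‖u‖ ^ 2 = ‖toL2L N u‖ ^ 2 + ‖gradL N u‖ ^ 2 :=
  WithLp.prod_norm_sq_eq_of_L2 _

theorem norm_toL2L_le (u : H1 N) : ‖toL2L N u‖ ≤ ‖u‖ := by
  refine le_of_sq_le_sq ?_ (norm_nonneg _)
  rw [H1.norm_sq]; nlinarith [sq_nonneg ‖gradL N u‖]

theorem norm_gradL_le (u : H1 N) : ‖gradL N u‖ ≤ ‖u‖ := by
  refine le_of_sq_le_sq ?_ (norm_nonneg _)
  rw [H1.norm_sq]; nlinarith [sq_nonneg ‖toL2L N u‖]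

theorem memLp_val (u : H1 N) : MemLp u.val 2 volume := Lp.memLp (toL2L N u)

theorem memLp_grad (u : H1 N) : MemLp u.grad 2 volume := Lp.memLp (gradL N u)

theorem aesm_val (u : H1 N) : AEStronglyMeasurable u.val volume := (memLp_val u).1

theorem val_add (u v : H1 N) : (u + v).val =ᵐ[volume] fun x => u.val x + v.val x :=
  Lp.coeFn_add (toL2L N u) (toL2L N v)

theorem val_sub (u v : H1 N) : (u - v).val =ᵐ[volume] fun x => u.val x - v.val x := by
  have := Lp.coeFn_sub (toL2L N u) (toL2L N v)
  rwa [← map_sub] at this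

theorem val_smul (c : ℝ) (u : H1 N) : (c • u).val =ᵐ[volume] fun x => c * u.val x :=
  Lp.coeFn_smul c (toL2L N u)

theorem val_zero : (0 : H1 N).val =ᵐ[volume] fun _ => 0 :=
  Lp.coeFn_zero ℝ 2 (volume : Measure (Euc N))

theorem inner_toL2L (u v : H1 N) :
    inner ℝ (toL2L N u) (toL2L N v) = ∫ x, u.val x * v.val x := by
  rw [L2.inner_def]
  refine integral_congr_ae (Eventually.of_forall fun x => ?_)
  simp [coe_toL2L, mul_comm]

theorem inner_gradL (u v : H1 N) :
    inner ℝ (gradL N u) (gradL N v) = ∫ x, inner ℝ (u.grad x) (v.grad x) := rfl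

theorem integral_val_sq (u : H1 N) : ∫ x, u.val x ^ 2 = ‖toL2L N u‖ ^ 2 := by
  rw [← real_inner_self_eq_norm_sq, inner_toL2L]
  simp [sq]

theorem integral_grad_sq (u : H1 N) : ∫ x, ‖u.grad x‖ ^ 2 = ‖gradL N u‖ ^ 2 := by
  rw [← real_inner_self_eq_norm_sq, inner_gradL]
  simp

theorem integrable_val_sq (u : H1 N) : Integrable (fun x => u.val x ^ 2) volume :=
  (memLp_val u).integrable_sq

theorem integrable_val_mul (u v : H1 N) : Integrable (fun x => u.val x * v.val x) volume :=
  (memLp_val u).integrable_mul (memLp_val v)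

theorem integrable_grad_inner (u v : H1 N) :
    Integrable (fun x => inner ℝ (u.grad x) (v.grad x)) volume :=
  L2.integrable_inner (𝕜 := ℝ) (gradL N u) (gradL N v)

theorem integral_mul_toL2L (h : L2 N) (φ : H1 N) :
    ∫ x, h x * φ.val x = inner ℝ h (toL2L N φ) := by
  rw [L2.inner_def]
  refine integral_congr_ae (Eventually.of_forall fun x => ?_)
  simp [coe_toL2L, mul_comm]

/-- The weak gradient relation as an identity between inner products in `L²`. -/
theorem isWeakGradient_iff (u : L2 N) (g : L2vec N) : IsWeakGradient u g ↔
    ∀ (φ : Euc N → ℝ) (hφ : ContDiff ℝ ∞ φ) (hc : HasCompactSupport φ) (e : Euc N),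
      inner ℝ (((hφ.continuous_fderiv (by simp)).clm_apply
          (continuous_const (y := e))).memLp_of_hasCompactSupport
          (p := 2) (μ := volume) (hc.fderiv_apply ℝ e)).toLp u +
        inner ℝ (((hφ.continuous.smul (continuous_const (y := e))).memLp_of_hasCompactSupport
          (p := 2) (μ := volume) (hc.smul_right)).toLp) g = 0 := by
  refine forall_congr' fun φ => forall_congr' fun hφ => forall_congr' fun hc =>
    forall_congr' fun e => ?_
  have h1 : ∫ x, u x * fderiv ℝ φ x e = inner ℝ (((hφ.continuous_fderiv (by simp)).clm_apply
          (continuous_const (y := e))).memLp_of_hasCompactSupport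
          (p := 2) (μ := volume) (hc.fderiv_apply ℝ e)).toLp u := by
    rw [L2.inner_def]
    refine integral_congr_ae ?_
    filter_upwards [MemLp.coeFn_toLp (((hφ.continuous_fderiv (by simp)).clm_apply
          (continuous_const (y := e))).memLp_of_hasCompactSupport
          (p := 2) (μ := volume) (hc.fderiv_apply ℝ e))] with x hx
    simp [hx]
  have h2 : ∫ x, inner ℝ (g x) e * φ x = inner ℝ (((hφ.continuous.smul
      (continuous_const (y := e))).memLp_of_hasCompactSupport
          (p := 2) (μ := volume) (hc.smul_right)).toLp) g := by
    rw [L2.inner_def]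
    refine integral_congr_ae ?_
    filter_upwards [MemLp.coeFn_toLp ((hφ.continuous.smul
      (continuous_const (y := e))).memLp_of_hasCompactSupport
          (p := 2) (μ := volume) (hc.smul_right))] with x hx
    simp only [hx]
    simp only [Pi.smul_apply', real_inner_smul_left]
    rw [real_inner_comm, mul_comm]
  rw [h1, h2, eq_neg_iff_add_eq_zero]

/-- Each test function and direction imposes the vanishing of a continuous functional, so the graph
is an intersection of closed sets. Completeness of `H¹` follows. -/
theorem isClosed_sobolev : IsClosed (sobolev N : Set (WithLp 2 (L2 N × L2vec N))) := by
  have : (sobolev N : Set (WithLp 2 (L2 N × L2vec N))) =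
      {p | IsWeakGradient (WithLp.fstL 2 ℝ (L2 N) (L2vec N) p)
        (WithLp.sndL 2 ℝ (L2 N) (L2vec N) p)} := rfl
  rw [this]
  simp only [isWeakGradient_iff, ofPred_forall]
  refine isClosed_iInter fun φ => isClosed_iInter fun hφ => isClosed_iInter fun hc =>
    isClosed_iInter fun e => isClosed_eq ?_ continuous_const
  fun_prop

instance : CompleteSpace (H1 N) := isClosed_sobolev.completeSpace_coe

theorem H1.ext {u v : H1 N} (h1 : toL2L N u = toL2L N v) (h2 : gradL N u = gradL N v) :
    u = v := by
  rw [← sub_eq_zero, ← norm_eq_zero, ← sq_eq_zero_iff, H1.norm_sq, map_sub, map_sub, h1, h2]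
  simp

/-- The weak gradient is unique. -/
theorem IsWeakGradient.eq_zero {g : L2vec N} (h : IsWeakGradient 0 g) : g = 0 := by
  have key : ∀ e : Euc N, ∀ᵐ x, inner ℝ (g x) e = 0 := by
    intro e
    refine ae_eq_zero_of_integral_contDiff_smul_eq_zero ?_ fun φ hφ hc => ?_
    · exact ((Lp.memLp g).inner_const e).locallyIntegrable (by norm_num)
    · have := h φ hφ hc e
      have h1 : (fun x => (0 : L2 N) x * fderiv ℝ φ x e) =ᵐ[volume] fun _ => 0 := by
        filter_upwards [Lp.coeFn_zero ℝ 2 (volume : Measure (Euc N))] with x hx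
        rw [hx]; simp
      rw [integral_congr_ae h1, integral_zero, eq_comm, neg_eq_zero] at this
      rw [← this]
      simp [mul_comm]
  have key2 : ∀ᵐ x, ∀ i : Fin N, inner ℝ (g x) (EuclideanSpace.single i (1 : ℝ)) = 0 :=
    ae_all_iff.2 fun i => key _
  rw [Lp.eq_zero_iff_ae_eq_zero]
  filter_upwards [key2] with x hx
  ext i
  simpa [EuclideanSpace.inner_single_right] using hx i

/-- Uniqueness of the weak gradient. From here on elements of `H¹` may be compared through their
values alone. -/
theorem toL2L_injective : Function.Injective (toL2L N) := by
  rw [injective_iff_map_eq_zero]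
  intro u hu
  refine H1.ext (by simpa using hu) ?_
  have := isWeakGradient u
  rw [hu] at this
  simpa using this.eq_zero

theorem H1.ext_val {u v : H1 N} (h : u.val =ᵐ[volume] v.val) : u = v :=
  toL2L_injective (Lp.ext h)

/-- A smooth compactly supported function as an element of `H¹`. -/
def ofTest (φ : Euc N → ℝ) (hφ : ContDiff ℝ ∞ φ) (hc : HasCompactSupport φ) : H1 N :=
  H1.mk (hφ.continuous.memLp_of_hasCompactSupport (p := 2) (μ := volume) hc).toLp
    (((InnerProductSpace.toDual ℝ (Euc N)).symm.continuous.comp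
      (hφ.continuous_fderiv (by simp))).memLp_of_hasCompactSupport (p := 2) (μ := volume)
        ((hc.fderiv ℝ).comp_left (map_zero _))).toLp (by
  intro ψ hψ hcψ e
  have e1 : ∀ᵐ x, (MemLp.toLp φ
      (hφ.continuous.memLp_of_hasCompactSupport (p := 2) (μ := volume) hc)) x = φ x :=
    MemLp.coeFn_toLp _
  have e2 := MemLp.coeFn_toLp (((InnerProductSpace.toDual ℝ (Euc N)).symm.continuous.comp
      (hφ.continuous_fderiv (by simp))).memLp_of_hasCompactSupport (p := 2) (μ := volume)
        ((hc.fderiv ℝ).comp_left (map_zero _)))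
  have h1 : ∫ x, φ x * fderiv ℝ ψ x e = - ∫ x, fderiv ℝ φ x e * ψ x := by
    have cφ := hφ.continuous
    have cψ := hψ.continuous
    have dφ : Continuous fun x => fderiv ℝ φ x e :=
      (hφ.continuous_fderiv (by simp)).clm_apply continuous_const
    have dψ : Continuous fun x => fderiv ℝ ψ x e :=
      (hψ.continuous_fderiv (by simp)).clm_apply continuous_const
    refine integral_mul_fderiv_eq_neg_fderiv_mul_of_integrable ?_ ?_ ?_
      (fun x _ => hφ.differentiable (by simp) x) (fun x _ => hψ.differentiable (by simp) x)
    · exact (dφ.mul cψ).integrable_of_hasCompactSupport (hcψ.mul_left)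
    · exact (cφ.mul dψ).integrable_of_hasCompactSupport (hc.mul_right)
    · exact (cφ.mul cψ).integrable_of_hasCompactSupport (hc.mul_right)
  refine (integral_congr_ae (g := fun x => φ x * fderiv ℝ ψ x e)
      (by filter_upwards [e1] with x hx; rw [hx])).trans (h1.trans ?_)
  rw [neg_inj]
  refine integral_congr_ae ?_
  filter_upwards [e2] with x hx
  rw [hx]
  simp)

theorem val_ofTest (φ : Euc N → ℝ) (hφ : ContDiff ℝ ∞ φ) (hc : HasCompactSupport φ) :
    (ofTest φ hφ hc).val =ᵐ[volume] φ :=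
  MemLp.coeFn_toLp (hφ.continuous.memLp_of_hasCompactSupport (p := 2) (μ := volume) hc)

theorem grad_ofTest (φ : Euc N → ℝ) (hφ : ContDiff ℝ ∞ φ) (hc : HasCompactSupport φ) :
    (ofTest φ hφ hc).grad =ᵐ[volume]
      fun x => (InnerProductSpace.toDual ℝ (Euc N)).symm (fderiv ℝ φ x) :=
  MemLp.coeFn_toLp (((InnerProductSpace.toDual ℝ (Euc N)).symm.continuous.comp
      (hφ.continuous_fderiv (by simp))).memLp_of_hasCompactSupport (p := 2) (μ := volume)
        ((hc.fderiv ℝ).comp_left (map_zero _)))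

/-! ### Translations -/

/-- Translation on `L²`: `(translateLp y u)(x) = u (x + y)`. -/
def translateLp {E : Type*} [NormedAddCommGroup E] (y : Euc N)
    (u : Lp E 2 (volume : Measure (Euc N))) : Lp E 2 (volume : Measure (Euc N)) :=
  Lp.compMeasurePreserving (fun x => x + y) (measurePreserving_add_right volume y) u

theorem coe_translateLp {E : Type*} [NormedAddCommGroup E] (y : Euc N)
    (u : Lp E 2 (volume : Measure (Euc N))) :
    translateLp y u =ᵐ[volume] fun x => u (x + y) :=
  Lp.coeFn_compMeasurePreserving u (measurePreserving_add_right volume y)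

theorem continuous_translateLp {E : Type*} [NormedAddCommGroup E]
    (u : Lp E 2 (volume : Measure (Euc N))) : Continuous fun y : Euc N => translateLp y u := by
  have : Continuous fun y : Euc N => (⟨fun x => x + y, by fun_prop⟩ : C(Euc N, Euc N)) :=
    ContinuousMap.continuous_of_continuous_uncurry _ (by
      simp only [Function.uncurry_def, ContinuousMap.coe_mk]; fun_prop)
  exact (continuous_const (y := u)).compMeasurePreservingLp this
    (fun y => measurePreserving_add_right volume y) (by norm_num)

theorem IsWeakGradient.translate {u : L2 N} {g : L2vec N} (h : IsWeakGradient u g) (y : Euc N) :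
    IsWeakGradient (translateLp y u) (translateLp y g) := by
  intro φ hφ hc e
  have hh := h (fun x => φ (x - y)) (hφ.comp (contDiff_id.sub contDiff_const))
    (hc.comp_homeomorph (Homeomorph.subRight y)) e
  rw [← integral_add_right_eq_self _ y, ← integral_add_right_eq_self (fun x => inner ℝ (g x) e * _) y]
    at hh
  have h1 : ∫ x, translateLp y u x * fderiv ℝ φ x e = ∫ x, u (x + y) * fderiv ℝ φ x e :=
    integral_congr_ae (by filter_upwards [coe_translateLp y u] with x hx; rw [hx])
  have h2 : ∫ x, inner ℝ (translateLp y g x) e * φ x = ∫ x, inner ℝ (g (x + y)) e * φ x :=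
    integral_congr_ae (by filter_upwards [coe_translateLp y g] with x hx; rw [hx])
  rw [h1, h2]
  simpa [fderiv_comp_sub] using hh

theorem translateLp_add {E : Type*} [NormedAddCommGroup E] (y : Euc N)
    (u v : Lp E 2 (volume : Measure (Euc N))) :
    translateLp y (u + v) = translateLp y u + translateLp y v := map_add _ _ _

theorem translateLp_smul {E : Type*} [NormedAddCommGroup E] [NormedSpace ℝ E] (y : Euc N) (c : ℝ)
    (u : Lp E 2 (volume : Measure (Euc N))) :
    translateLp y (c • u) = c • translateLp y u := by
  refine Lp.ext ?_
  filter_upwards [coe_translateLp y (c • u), Lp.coeFn_smul c (translateLp y u),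
    coe_translateLp y u, (measurePreserving_add_right volume
      y).quasiMeasurePreserving.ae (Lp.coeFn_smul c u)] with x h1 h2 h3 h4
  rw [h1, h2, h4, Pi.smul_apply, Pi.smul_apply, h3]

theorem norm_translateLp {E : Type*} [NormedAddCommGroup E] (y : Euc N)
    (u : Lp E 2 (volume : Measure (Euc N))) : ‖translateLp y u‖ = ‖u‖ :=
  Lp.norm_compMeasurePreserving _ _

/-- Translation on `H¹` as a linear map. -/
def translateₗ (y : Euc N) : H1 N →ₗ[ℝ] H1 N where
  toFun u := H1.mk (translateLp y (toL2L N u)) (translateLp y (gradL N u))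
    ((isWeakGradient u).translate y)
  map_add' u v := by
    refine H1.ext ?_ ?_
    · exact (congrArg (translateLp y) (map_add (toL2L N) u v)).trans
        (translateLp_add y _ _)
    · exact (congrArg (translateLp y) (map_add (gradL N) u v)).trans
        (translateLp_add y _ _)
  map_smul' c u := by
    refine H1.ext ?_ ?_
    · exact (congrArg (translateLp y) (map_smul (toL2L N) c u)).trans
        (translateLp_smul y c _)
    · exact (congrArg (translateLp y) (map_smul (gradL N) c u)).trans
        (translateLp_smul y c _)

/-- Translation on `H¹`: `(shift y u)(x) = u (x + y)`. -/
def shift (y : Euc N) : H1 N →ₗᵢ[ℝ] H1 N where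
  toLinearMap := translateₗ y
  norm_map' u := by
    change ‖translateₗ y u‖ = ‖u‖
    rw [← sq_eq_sq₀ (norm_nonneg _) (norm_nonneg _), H1.norm_sq, H1.norm_sq]
    have h1 : toL2L N (translateₗ y u) = translateLp y (toL2L N u) := rfl
    have h2 : gradL N (translateₗ y u) = translateLp y (gradL N u) := rfl
    rw [h1, h2, norm_translateLp, norm_translateLp]

theorem toL2L_shift (y : Euc N) (u : H1 N) :
    toL2L N (shift y u) = translateLp y (toL2L N u) := rfl

theorem val_shift (y : Euc N) (u : H1 N) :
    (shift y u).val =ᵐ[volume] fun x => u.val (x + y) := coe_translateLp y (toL2L N u)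

theorem grad_shift (y : Euc N) (u : H1 N) :
    (shift y u).grad =ᵐ[volume] fun x => u.grad (x + y) := coe_translateLp y (gradL N u)

theorem shift_shift (y z : Euc N) (u : H1 N) :
    shift y (shift z u) = shift (y + z) u := by
  refine H1.ext_val ?_
  filter_upwards [val_shift y (shift z u), val_shift (y + z) u,
    (measurePreserving_add_right volume y).quasiMeasurePreserving.ae (val_shift z u)]
    with x h1 h2 h3
  rw [h1, h2, h3, add_assoc]

theorem shift_zero (u : H1 N) : shift 0 u = u := by
  refine H1.ext_val ?_
  filter_upwards [val_shift 0 u] with x h1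
  simpa using h1

theorem continuous_shift (u : H1 N) : Continuous fun y : Euc N => shift y u := by
  refine Continuous.subtype_mk ?_ _
  exact (WithLp.prod_continuous_toLp 2 (L2 N) (L2vec N)).comp
    ((continuous_translateLp (toL2L N u)).prodMk (continuous_translateLp (gradL N u)))

end

section

variable {N : ℕ}

/-! ### Mollification -/

theorem lintegral_enorm_sq_coe {E : Type*} [NormedAddCommGroup E]
    (h : Lp E 2 (volume : Measure (Euc N))) :
    ∫⁻ x, ‖h x‖ₑ ^ 2 = ENNReal.ofReal (‖h‖ ^ 2) := by
  have h1 := eLpNorm_nnreal_pow_eq_lintegral (f := (h : Euc N → E)) (μ := volume) (p := 2)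
    (by norm_num)
  have h2 : ENNReal.ofReal ‖h‖ = eLpNorm (h : Euc N → E) 2 volume := by
    rw [Lp.norm_def, ENNReal.ofReal_toReal (Lp.eLpNorm_ne_top h)]
  rw [ENNReal.ofReal_pow (norm_nonneg _), h2]
  simpa using h1.symm

/-- Jensen's inequality for the square, read as monotonicity of `L^p` norms on a probability space.
-/
theorem sq_lintegral_le {α : Type*} [MeasurableSpace α] (ν : Measure α) [IsProbabilityMeasure ν]
    {g : α → ENNReal} (hg : AEMeasurable g ν) : (∫⁻ x, g x ∂ν) ^ 2 ≤ ∫⁻ x, g x ^ 2 ∂ν := by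
  have := eLpNorm_le_eLpNorm_of_exponent_le (p := 1) (q := 2) (μ := ν) (f := g) (by norm_num)
    hg.aestronglyMeasurable
  rw [eLpNorm_one_eq_lintegral_enorm] at this
  have h2 := eLpNorm_nnreal_pow_eq_lintegral (f := g) (μ := ν) (p := 2) (by norm_num)
  simp only [enorm_eq_self] at this h2
  calc (∫⁻ x, g x ∂ν) ^ 2 ≤ (eLpNorm g 2 ν) ^ 2 := by gcongr
    _ = ∫⁻ x, g x ^ 2 ∂ν := by simpa using h2

/-- Convolution with the normalised bump function `ρ`. -/
def mollify {E : Type*} [NormedAddCommGroup E] [NormedSpace ℝ E] (ρ : ContDiffBump (0 : Euc N))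
    (h : Euc N → E) : Euc N → E :=
  convolution (ρ.normed volume) h (ContinuousLinearMap.lsmul ℝ ℝ) volume

theorem mollify_eq {E : Type*} [NormedAddCommGroup E] [NormedSpace ℝ E]
    (ρ : ContDiffBump (0 : Euc N)) (h : Euc N → E) (x : Euc N) :
    mollify ρ h x = ∫ t, ρ.normed volume (x - t) • h t := by
  rw [mollify, convolution_lsmul_swap]

section Vector

variable {E : Type*} [NormedAddCommGroup E] [NormedSpace ℝ E]

theorem locallyIntegrable_coe {E : Type*} [NormedAddCommGroup E] (h : Lp E 2 (volume : Measure (Euc N))) :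
    LocallyIntegrable (h : Euc N → E) volume :=
  (Lp.memLp h).locallyIntegrable (by norm_num)

theorem integrable_normed_smul (ρ : ContDiffBump (0 : Euc N))
    (h : Lp E 2 (volume : Measure (Euc N))) (x : Euc N) :
    Integrable (fun t => ρ.normed volume t • h (x - t)) volume :=
  ρ.hasCompactSupport_normed.convolutionExists_left (ContinuousLinearMap.lsmul ℝ ℝ)
    (ρ.contDiff_normed (n := 0)).continuous (locallyIntegrable_coe h) x

/-- Regard the bump as the density of a probability measure: the error is then an average of `h(x-t)
- h(x)`. Jensen moves the square inside, Tonelli exchanges the integrals, and only translations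
shorter than `ρ.rOut` contribute. -/
theorem lintegral_mollify_sub_le [CompleteSpace E] (ρ : ContDiffBump (0 : Euc N))
    (h : Lp E 2 (volume : Measure (Euc N))) {δ : ℝ}
    (hδ : ∀ t : Euc N, ‖t‖ < ρ.rOut → ‖translateLp (-t) h - h‖ ≤ δ) :
    ∫⁻ x, ‖mollify ρ h x - h x‖ₑ ^ 2 ≤ ENNReal.ofReal (δ ^ 2) := by
  have hρm : Measurable fun t => ENNReal.ofReal (ρ.normed volume t) :=
    (ρ.contDiff_normed (n := 0)).continuous.measurable.ennreal_ofReal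
  set ν : Measure (Euc N) := volume.withDensity fun t => ENNReal.ofReal (ρ.normed volume t) with hν
  have hprob : IsProbabilityMeasure ν := by
    refine ⟨?_⟩
    rw [hν, withDensity_apply _ MeasurableSet.univ, Measure.restrict_univ,
      ← ofReal_integral_eq_lintegral_ofReal ρ.integrable_normed
        (Eventually.of_forall fun x => ρ.nonneg_normed x), ρ.integral_normed, ENNReal.ofReal_one]
  have hmeas : Measurable fun q : Euc N × Euc N => ‖h (q.1 - q.2) - h q.1‖ₑ := by
    have h1 : StronglyMeasurable fun q : Euc N × Euc N => h (q.1 - q.2) :=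
      (Lp.stronglyMeasurable h).comp_measurable (measurable_fst.sub measurable_snd)
    have h2 : StronglyMeasurable fun q : Euc N × Euc N => h q.1 :=
      (Lp.stronglyMeasurable h).comp_measurable measurable_fst
    exact (h1.sub h2).enorm
  have hpt : ∀ x, ‖mollify ρ h x - h x‖ₑ ^ 2 ≤ ∫⁻ t, ‖h (x - t) - h x‖ₑ ^ 2 ∂ν := by
    intro x
    have e1 : mollify ρ h x - h x = ∫ t, ρ.normed volume t • (h (x - t) - h x) := by
      simp only [smul_sub]
      rw [integral_sub (integrable_normed_smul ρ h x)
        (ρ.integrable_normed.smul_const _), integral_smul_const, ρ.integral_normed, one_smul]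
      rfl
    have e2 : ‖mollify ρ h x - h x‖ₑ ≤ ∫⁻ t, ‖h (x - t) - h x‖ₑ ∂ν := by
      have hm : Measurable fun t => ‖h (x - t) - h x‖ₑ := hmeas.comp measurable_prodMk_left
      rw [e1, hν, lintegral_withDensity_eq_lintegral_mul _ hρm hm]
      refine (enorm_integral_le_lintegral_enorm _).trans (le_of_eq ?_)
      refine lintegral_congr fun t => ?_
      rw [enorm_smul, Real.enorm_of_nonneg (ρ.nonneg_normed t)]
      rfl
    calc _ ≤ (∫⁻ t, ‖h (x - t) - h x‖ₑ ∂ν) ^ 2 := by gcongr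
      _ ≤ _ := sq_lintegral_le ν (hmeas.comp measurable_prodMk_left).aemeasurable
  calc ∫⁻ x, ‖mollify ρ h x - h x‖ₑ ^ 2 ≤ ∫⁻ x, ∫⁻ t, ‖h (x - t) - h x‖ₑ ^ 2 ∂ν :=
        lintegral_mono hpt
    _ = ∫⁻ t, (∫⁻ x, ‖h (x - t) - h x‖ₑ ^ 2) ∂ν :=
        lintegral_lintegral_swap (hmeas.pow_const 2).aemeasurable
    _ ≤ ∫⁻ _, ENNReal.ofReal (δ ^ 2) ∂ν := by
        refine lintegral_mono_ae ?_
        have hae : ∀ᵐ t ∂ν, t ∈ Metric.ball (0 : Euc N) ρ.rOut := by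
          rw [hν, ae_withDensity_iff hρm]
          refine Eventually.of_forall fun t ht => ?_
          rw [← ρ.support_normed_eq (μ := volume)]
          intro h0
          exact ht (by simp [h0])
        filter_upwards [hae] with t ht
        have h1 := hδ t (by simpa using ht)
        have h2 := lintegral_enorm_sq_coe (translateLp (-t) h - h)
        have h3 : ∫⁻ x, ‖h (x - t) - h x‖ₑ ^ 2 = ENNReal.ofReal (‖translateLp (-t) h - h‖ ^ 2) := by
          rw [← h2]
          refine lintegral_congr_ae ?_
          filter_upwards [Lp.coeFn_sub (translateLp (-t) h) h, coe_translateLp (-t) h] with x h4 h5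
          rw [h4, Pi.sub_apply, h5, sub_eq_add_neg x t]
        rw [h3]
        gcongr
    _ = ENNReal.ofReal (δ ^ 2) := by simp

end Vector

theorem contDiff_mollify (ρ : ContDiffBump (0 : Euc N)) (u : L2 N) :
    ContDiff ℝ ∞ (mollify ρ (u : Euc N → ℝ)) :=
  ρ.hasCompactSupport_normed.contDiff_convolution_left (n := ⊤) _ ρ.contDiff_normed
    (locallyIntegrable_coe u)

/-- Differentiate the kernel and use `t ↦ ρ(x-t)` as test function in the definition of the weak
gradient. The sign from the reflection cancels the one from the integration by parts. -/
theorem fderiv_mollify (ρ : ContDiffBump (0 : Euc N)) (u : H1 N) (x e : Euc N) :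
    fderiv ℝ (mollify ρ u.val) x e = inner ℝ (mollify ρ u.grad x) e := by
  have hc := ρ.hasCompactSupport_normed (μ := (volume : Measure (Euc N)))
  have hs : ContDiff ℝ ∞ (ρ.normed (volume : Measure (Euc N))) := ρ.contDiff_normed
  have hl := locallyIntegrable_coe (toL2L N u)
  have h1 := hc.hasFDerivAt_convolution_left (ContinuousLinearMap.lsmul ℝ ℝ)
    (hs.of_le (by exact_mod_cast le_top)) hl x
  have hex := (hc.fderiv ℝ).convolutionExists_left (ContinuousLinearMap.precompL (Euc N)
    (ContinuousLinearMap.lsmul ℝ ℝ)) (hs.continuous_fderiv (by simp)) hl x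
  have h2 : fderiv ℝ (mollify ρ u.val) x e =
      ∫ t, fderiv ℝ (ρ.normed volume) t e * u.val (x - t) := by
    rw [mollify, ← coe_toL2L, h1.fderiv, convolution_def, ContinuousLinearMap.integral_apply hex]
    rfl
  rw [h2, ← integral_sub_left_eq_self _ volume x]
  simp only [sub_sub_cancel]
  have h3 := isWeakGradient u (fun t => ρ.normed volume (x - t))
    (hs.comp (contDiff_const.sub contDiff_id)) (hc.comp_homeomorph (Homeomorph.subLeft x)) e
  have h4 : ∀ t, fderiv ℝ (fun t => ρ.normed volume (x - t)) t e =
      - fderiv ℝ (ρ.normed volume) (x - t) e := by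
    intro t
    have hd : HasFDerivAt (fun t => ρ.normed volume (x - t))
        ((fderiv ℝ (ρ.normed volume) (x - t)).comp (-ContinuousLinearMap.id ℝ (Euc N))) t :=
      ((hs.differentiable (by simp)) (x - t)).hasFDerivAt.comp t
        ((hasFDerivAt_id t).const_sub x)
    rw [hd.fderiv]
    simp
  simp only [h4, mul_neg, integral_neg, neg_inj, coe_toL2L, coe_gradL] at h3
  have h5 : Integrable (fun t => ρ.normed volume (x - t) • u.grad t) volume := by
    have := integrable_normed_smul ρ (gradL N u) x
    rw [← integrable_comp_sub_left _ x]
    simpa [coe_gradL] using this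
  rw [mollify_eq, real_inner_comm, ← integral_inner h5]
  simp only [real_inner_smul_right]
  calc _ = ∫ t, u.val t * fderiv ℝ (ρ.normed volume) (x - t) e := by simp only [mul_comm]
    _ = _ := h3.trans (integral_congr_ae (Eventually.of_forall fun t => by
      simp only [real_inner_comm e (u.grad t), mul_comm]))

/-- A mollified `L²` function is square integrable if the function is almost translation
invariant at the scale of the mollifier. -/
theorem mollify_close {E : Type*} [NormedAddCommGroup E] [NormedSpace ℝ E] [CompleteSpace E]
    (ρ : ContDiffBump (0 : Euc N))
    (h : Lp E 2 (volume : Measure (Euc N))) {δ : ℝ} (h0 : 0 ≤ δ)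
    (hδ : ∀ t : Euc N, ‖t‖ < ρ.rOut → ‖translateLp (-t) h - h‖ ≤ δ) :
    eLpNorm (fun x => mollify ρ h x - h x) 2 volume ≤ ENNReal.ofReal δ := by
  have h1 := lintegral_mollify_sub_le ρ h hδ
  have h2 := eLpNorm_nnreal_pow_eq_lintegral (f := fun x => mollify ρ h x - h x) (μ := volume)
    (p := 2) (by norm_num)
  have h3 : eLpNorm (fun x => mollify ρ h x - h x) 2 volume ^ 2 ≤ (ENNReal.ofReal δ) ^ 2 := by
    rw [← ENNReal.ofReal_pow h0]
    refine le_trans (le_of_eq ?_) h1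
    simpa using h2
  exact (ENNReal.pow_le_pow_left_iff two_ne_zero).1 h3

theorem continuous_mollify {E : Type*} [NormedAddCommGroup E] [NormedSpace ℝ E]
    (ρ : ContDiffBump (0 : Euc N)) (h : Lp E 2 (volume : Measure (Euc N))) :
    Continuous (mollify ρ (h : Euc N → E)) :=
  ρ.hasCompactSupport_normed.continuous_convolution_left _
    (ρ.contDiff_normed (n := 0)).continuous (locallyIntegrable_coe h)

end

section

variable {N : ℕ}

/-! ### Density of test functions -/

/-- Dominated convergence in `L²`, in the form met with cut-offs: at every point the error is
eventually exactly zero. -/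
theorem tendsto_eLpNorm_zero_of_dominated {α E : Type*} [MeasurableSpace α] {ν : Measure α}
    [NormedAddCommGroup E] {F : ℕ → α → E} {G : α → ℝ}
    (hF : ∀ n, AEStronglyMeasurable (F n) ν) (hG : MemLp G 2 ν) (hb : ∀ n x, ‖F n x‖ ≤ G x)
    (hz : ∀ x, ∀ᶠ n in atTop, F n x = 0) :
    Tendsto (fun n => eLpNorm (F n) 2 ν) atTop (𝓝 0) := by
  have h1 : Tendsto (fun n => ∫⁻ x, ‖F n x‖ₑ ^ 2 ∂ν) atTop (𝓝 (∫⁻ _, 0 ∂ν)) := by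
    refine tendsto_lintegral_of_dominated_convergence' (fun x => ‖G x‖ₑ ^ 2)
      (fun n => (hF n).enorm.pow_const 2) (fun n => Eventually.of_forall fun x => ?_) ?_ ?_
    · have : ‖F n x‖ₑ ≤ ‖G x‖ₑ := by
        rw [enorm_le_iff_norm_le]
        exact (hb n x).trans (le_abs_self _)
      dsimp only
      gcongr
    · have h2 := eLpNorm_nnreal_pow_eq_lintegral (f := G) (μ := ν) (p := 2) (by norm_num)
      have h3 : ∫⁻ x, ‖G x‖ₑ ^ 2 ∂ν = eLpNorm G 2 ν ^ 2 := by simpa using h2.symm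
      rw [h3]
      exact (ENNReal.pow_lt_top hG.2).ne
    · refine Eventually.of_forall fun x => tendsto_const_nhds.congr' ?_
      filter_upwards [hz x] with n hn
      simp [hn]
  have h4 : ∀ n, eLpNorm (F n) 2 ν = (∫⁻ x, ‖F n x‖ₑ ^ 2 ∂ν) ^ (1 / 2 : ℝ) := by
    intro n
    have h2 := eLpNorm_nnreal_pow_eq_lintegral (f := F n) (μ := ν) (p := 2) (by norm_num)
    have h3 : ∫⁻ x, ‖F n x‖ₑ ^ 2 ∂ν = eLpNorm (F n) 2 ν ^ (2 : ℝ) := by simpa using h2.symm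
    rw [h3, ← ENNReal.rpow_mul]
    norm_num
  simp only [h4]
  have h5 := h1.ennrpow_const (1 / 2 : ℝ)
  simpa using h5

/-- A smooth cut-off function equal to `1` on the ball of radius `n + 1`. -/
def cutoff (N : ℕ) (n : ℕ) (x : Euc N) : ℝ :=
  (⟨1, 2, one_pos, one_lt_two⟩ : ContDiffBump (0 : Euc N)) (((n : ℝ) + 1)⁻¹ • x)

theorem contDiff_cutoff (n : ℕ) : ContDiff ℝ ∞ (cutoff N n) :=
  (ContDiffBump.contDiff _).comp (contDiff_const_smul _)

theorem hasCompactSupport_cutoff (n : ℕ) : HasCompactSupport (cutoff N n) :=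
  (ContDiffBump.hasCompactSupport _).comp_homeomorph
    (Homeomorph.smulOfNeZero (((n : ℝ) + 1)⁻¹) (by positivity))

/-- Equality holds near `x` and not only at `x`, so that the derivative of the cut-off is eventually
zero at `x` as well. -/
theorem cutoff_eventually_one (x : Euc N) : ∀ᶠ n in atTop, cutoff N n =ᶠ[𝓝 x] 1 := by
  obtain ⟨m, hm⟩ := exists_nat_gt ‖x‖
  filter_upwards [eventually_ge_atTop m] with n hn
  have hx : x ∈ Metric.ball (0 : Euc N) ((n : ℝ) + 1) := by
    have : (m : ℝ) ≤ n := by exact_mod_cast hn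
    simp; linarith
  filter_upwards [Metric.isOpen_ball.mem_nhds hx] with y hy
  refine ContDiffBump.one_of_mem_closedBall _ ?_
  simp only [Metric.mem_closedBall, dist_zero_right, norm_smul, norm_inv] at hy ⊢
  have h1 : ‖(n : ℝ) + 1‖ = n + 1 := by rw [Real.norm_of_nonneg]; positivity
  rw [h1, inv_mul_le_iff₀ (by positivity)]
  simp at hy
  linarith

theorem cutoff_nonneg (n : ℕ) (x : Euc N) : 0 ≤ cutoff N n x := ContDiffBump.nonneg _

theorem cutoff_le_one (n : ℕ) (x : Euc N) : cutoff N n x ≤ 1 := ContDiffBump.le_one _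

/-- The dilation factor `1/(n+1)` is at most `1`, so stretching the bump never increases its
gradient. -/
theorem exists_norm_fderiv_cutoff_le (N : ℕ) :
    ∃ C : ℝ, 0 ≤ C ∧ ∀ n (x : Euc N), ‖fderiv ℝ (cutoff N n) x‖ ≤ C := by
  set χ : ContDiffBump (0 : Euc N) := ⟨1, 2, one_pos, one_lt_two⟩
  have hχ : ContDiff ℝ ∞ χ := χ.contDiff
  obtain ⟨C, hC⟩ := (χ.hasCompactSupport.fderiv ℝ).exists_bound_of_continuous
    (hχ.continuous_fderiv (by simp))
  refine ⟨C, (norm_nonneg _).trans (hC 0), fun n x => ?_⟩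
  have hd : HasFDerivAt (cutoff N n) ((fderiv ℝ χ (((n : ℝ) + 1)⁻¹ • x)).comp
      (((n : ℝ) + 1)⁻¹ • ContinuousLinearMap.id ℝ (Euc N))) x :=
    ((hχ.differentiable (by simp)) _).hasFDerivAt.comp x
      ((((n : ℝ) + 1)⁻¹ • ContinuousLinearMap.id ℝ (Euc N)).hasFDerivAt)
  rw [hd.fderiv, ContinuousLinearMap.comp_smul, ContinuousLinearMap.comp_id, norm_smul]
  have h1 : ‖((n : ℝ) + 1)⁻¹‖ ≤ 1 := by
    rw [norm_inv, Real.norm_of_nonneg (by positivity)]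
    exact inv_le_one_of_one_le₀ (by linarith [n.cast_nonneg (α := ℝ)])
  calc _ ≤ 1 * C := by gcongr; exact hC _
    _ = C := one_mul C

theorem exists_bump_radius {ε : ℝ} (hε : 0 < ε) :
    ∃ ρ : ContDiffBump (0 : Euc N), ρ.rOut = ε :=
  ⟨⟨ε / 2, ε, by positivity, by linarith⟩, rfl⟩

theorem norm_sub_le_of_eLpNorm {E : Type*} [NormedAddCommGroup E]
    {f g : Lp E 2 (volume : Measure (Euc N))} {δ : ℝ} (hδ : 0 ≤ δ)
    (h : eLpNorm (fun x => f x - g x) 2 volume ≤ ENNReal.ofReal δ) : ‖f - g‖ ≤ δ := by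
  rw [Lp.norm_def]
  refine ENNReal.toReal_le_of_le_ofReal hδ ?_
  rwa [eLpNorm_congr_ae (Lp.coeFn_sub f g)]

/-- Smooth compactly supported functions are dense in `H¹`. -/
theorem exists_test_close (u : H1 N) {η : ℝ} (hη : 0 < η) :
    ∃ (φ : Euc N → ℝ) (hφ : ContDiff ℝ ∞ φ) (hc : HasCompactSupport φ),
      ‖ofTest φ hφ hc - u‖ ≤ η := by
  -- Mollify, then cut off. Strong continuity of translations fixes a mollification radius for which
  -- both `u` and its gradient move by at most `η / 4`.
  have hct := (continuous_shift u).tendsto 0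
  rw [shift_zero, Metric.tendsto_nhds_nhds] at hct
  obtain ⟨ε, hε, hh⟩ := hct (η / 4) (by positivity)
  obtain ⟨ρ, hρ⟩ := exists_bump_radius (N := N) hε
  have hsh : ∀ t : Euc N, ‖t‖ < ρ.rOut → ‖shift (-t) u - u‖ ≤ η / 4 := fun t ht => by
    have := hh (x := -t) (by simpa [hρ] using ht)
    rw [dist_eq_norm] at this
    exact this.le
  have hη4 : 0 ≤ η / 4 := by positivity
  have c1 := mollify_close ρ (toL2L N u) hη4 fun t ht =>
    (norm_toL2L_le (shift (-t) u - u)).trans (hsh t ht)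
  have c2 := mollify_close ρ (gradL N u) hη4 fun t ht =>
    (norm_gradL_le (shift (-t) u - u)).trans (hsh t ht)
  rw [coe_toL2L] at c1
  rw [coe_gradL] at c2
  set m := mollify ρ u.val with hm
  set g := mollify ρ u.grad with hg
  have hmc : Continuous m := continuous_mollify ρ (toL2L N u)
  have hgc : Continuous g := continuous_mollify ρ (gradL N u)
  have hms : ContDiff ℝ ∞ m := contDiff_mollify ρ (toL2L N u)
  have hgrad : ∀ x, (InnerProductSpace.toDual ℝ (Euc N)).symm (fderiv ℝ m x) = g x := by
    intro x
    refine ext_inner_right ℝ fun e => ?_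
    rw [InnerProductSpace.toDual_symm_apply, hm, fderiv_mollify]
  have hm2 : MemLp m 2 volume := by
    have : MemLp (fun x => m x - u.val x) 2 volume :=
      ⟨hmc.aestronglyMeasurable.sub (aesm_val u), c1.trans_lt ENNReal.ofReal_lt_top⟩
    have h2 := this.add (memLp_val u)
    refine (memLp_congr_ae (Eventually.of_forall fun x => ?_)).1 h2
    simp
  have hg2 : MemLp g 2 volume := by
    have : MemLp (fun x => g x - u.grad x) 2 volume :=
      ⟨hgc.aestronglyMeasurable.sub (memLp_grad u).1, c2.trans_lt ENNReal.ofReal_lt_top⟩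
    have h2 := this.add (memLp_grad u)
    refine (memLp_congr_ae (Eventually.of_forall fun x => ?_)).1 h2
    simp
  obtain ⟨C, hC0, hC⟩ := exists_norm_fderiv_cutoff_le N
  have hφs : ∀ n, ContDiff ℝ ∞ fun x => cutoff N n x * m x := fun n => (contDiff_cutoff n).mul hms
  have hφc : ∀ n, HasCompactSupport fun x => cutoff N n x * m x := fun n =>
    (hasCompactSupport_cutoff n).mul_right
  have hDer : ∀ n x, (InnerProductSpace.toDual ℝ (Euc N)).symm
      (fderiv ℝ (fun x => cutoff N n x * m x) x) = cutoff N n x • g x +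
        m x • (InnerProductSpace.toDual ℝ (Euc N)).symm (fderiv ℝ (cutoff N n) x) := by
    intro n x
    rw [fderiv_fun_mul ((contDiff_cutoff n).differentiable (by simp) x)
      (hms.differentiable (by simp) x), map_add, map_smulₛₗ, map_smulₛₗ, hgrad]
    simp
  have t1 : Tendsto (fun n => eLpNorm (fun x => cutoff N n x * m x - m x) 2 volume)
      atTop (𝓝 0) := by
    refine tendsto_eLpNorm_zero_of_dominated (G := fun x => ‖m x‖)
      (fun n => (((hφs n).continuous.sub hmc)).aestronglyMeasurable) hm2.norm ?_ ?_
    · intro n x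
      have h1 := cutoff_nonneg n x
      have h2 := cutoff_le_one n x
      have h3 : cutoff N n x * m x - m x = (cutoff N n x - 1) * m x := by ring
      rw [h3, norm_mul]
      have : ‖cutoff N n x - 1‖ ≤ 1 := by rw [Real.norm_eq_abs, abs_le]; constructor <;> linarith
      exact mul_le_of_le_one_left (norm_nonneg _) this
    · intro x
      filter_upwards [cutoff_eventually_one x] with n hn
      rw [hn.eq_of_nhds]; simp
  have t2 : Tendsto (fun n => eLpNorm (fun x => (InnerProductSpace.toDual ℝ (Euc N)).symm
      (fderiv ℝ (fun x => cutoff N n x * m x) x) - g x) 2 volume) atTop (𝓝 0) := by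
    refine tendsto_eLpNorm_zero_of_dominated (G := fun x => ‖g x‖ + C * ‖m x‖)
      (fun n => ?_) (hg2.norm.add (hm2.norm.const_mul C)) ?_ ?_
    · exact (((InnerProductSpace.toDual ℝ (Euc N)).symm.continuous.comp
        ((hφs n).continuous_fderiv (by simp))).sub hgc).aestronglyMeasurable
    · intro n x
      rw [hDer]
      have h1 := cutoff_nonneg n x
      have h2 := cutoff_le_one n x
      have h3 : cutoff N n x • g x + m x • (InnerProductSpace.toDual ℝ (Euc N)).symm
          (fderiv ℝ (cutoff N n) x) - g x = (cutoff N n x - 1) • g x +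
          m x • (InnerProductSpace.toDual ℝ (Euc N)).symm (fderiv ℝ (cutoff N n) x) := by
        rw [sub_smul, one_smul]; abel
      rw [h3]
      refine (norm_add_le _ _).trans ?_
      rw [norm_smul, norm_smul, LinearIsometryEquiv.norm_map]
      have : ‖cutoff N n x - 1‖ ≤ 1 := by rw [Real.norm_eq_abs, abs_le]; constructor <;> linarith
      refine add_le_add (mul_le_of_le_one_left (norm_nonneg _) this) ?_
      rw [mul_comm]
      gcongr
      exact hC n x
    · intro x
      filter_upwards [cutoff_eventually_one x] with n hn
      rw [hDer, hn.eq_of_nhds, hn.fderiv_eq]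
      simp
  have hpos : (0 : ENNReal) < ENNReal.ofReal (η / 4) := by positivity
  obtain ⟨n, hn1, hn2⟩ := ((t1.eventually (gt_mem_nhds hpos)).and
    (t2.eventually (gt_mem_nhds hpos))).exists
  refine ⟨_, hφs n, hφc n, ?_⟩
  have b1 : ‖toL2L N (ofTest _ (hφs n) (hφc n)) - toL2L N u‖ ≤ η / 2 := by
    refine norm_sub_le_of_eLpNorm (by positivity) ?_
    have e : (fun x => toL2L N (ofTest _ (hφs n) (hφc n)) x - toL2L N u x) =ᵐ[volume]
        fun x => (cutoff N n x * m x - m x) + (m x - u.val x) := by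
      filter_upwards [val_ofTest _ (hφs n) (hφc n)] with x hx
      rw [coe_toL2L, coe_toL2L, hx]; ring
    rw [eLpNorm_congr_ae e]
    refine (eLpNorm_add_le ((hφs n).continuous.sub hmc).aestronglyMeasurable
      (hmc.aestronglyMeasurable.sub (aesm_val u)) (by norm_num)).trans ?_
    refine (add_le_add hn1.le c1).trans ?_
    rw [← ENNReal.ofReal_add hη4 hη4]
    exact le_of_eq (by ring_nf)
  have b2 : ‖gradL N (ofTest _ (hφs n) (hφc n)) - gradL N u‖ ≤ η / 2 := by
    refine norm_sub_le_of_eLpNorm (by positivity) ?_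
    have e : (fun x => gradL N (ofTest _ (hφs n) (hφc n)) x - gradL N u x) =ᵐ[volume]
        fun x => ((InnerProductSpace.toDual ℝ (Euc N)).symm
          (fderiv ℝ (fun x => cutoff N n x * m x) x) - g x) + (g x - u.grad x) := by
      filter_upwards [grad_ofTest _ (hφs n) (hφc n)] with x hx
      rw [coe_gradL, coe_gradL, hx]; abel
    rw [eLpNorm_congr_ae e]
    refine (eLpNorm_add_le (((InnerProductSpace.toDual ℝ (Euc N)).symm.continuous.comp
        ((hφs n).continuous_fderiv (by simp))).sub hgc).aestronglyMeasurable
      (hgc.aestronglyMeasurable.sub (memLp_grad u).1) (by norm_num)).trans ?_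
    refine (add_le_add hn2.le c2).trans ?_
    rw [← ENNReal.ofReal_add hη4 hη4]
    exact le_of_eq (by ring_nf)
  refine le_of_sq_le_sq ?_ hη.le
  rw [H1.norm_sq, map_sub, map_sub]
  nlinarith [norm_nonneg (toL2L N (ofTest _ (hφs n) (hφc n)) - toL2L N u),
    norm_nonneg (gradL N (ofTest _ (hφs n) (hφc n)) - gradL N u)]

/-- The set of test functions in `H¹`. -/
def testSet (N : ℕ) : Set (H1 N) :=
  {u | ∃ (φ : Euc N → ℝ) (hφ : ContDiff ℝ ∞ φ) (hc : HasCompactSupport φ), u = ofTest φ hφ hc}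

theorem dense_testSet : Dense (testSet N) := by
  intro u
  rw [Metric.mem_closure_iff]
  intro ε hε
  obtain ⟨φ, hφ, hc, h⟩ := exists_test_close u (half_pos hε)
  refine ⟨_, ⟨φ, hφ, hc, rfl⟩, ?_⟩
  rw [dist_comm, dist_eq_norm]
  linarith

end

section

variable {N : ℕ}

/-! ### Translation estimate, Sobolev and Hardy inequalities -/

theorem lintegral_fderiv_ofTest (φ : Euc N → ℝ) (hφ : ContDiff ℝ ∞ φ) (hc : HasCompactSupport φ) :
    ∫⁻ x, ‖fderiv ℝ φ x‖ₑ ^ 2 = ENNReal.ofReal (‖gradL N (ofTest φ hφ hc)‖ ^ 2) := by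
  rw [← lintegral_enorm_sq_coe]
  refine lintegral_congr_ae ?_
  filter_upwards [grad_ofTest φ hφ hc] with x hx
  rw [coe_gradL, hx]
  congr 1
  rw [← ofReal_norm, ← ofReal_norm, LinearIsometryEquiv.norm_map]

/-- For a test function, write the difference as an integral of the derivative along the segment
from `x` to `x + y`, apply Jensen in the segment parameter and use translation invariance. The
estimate is a closed condition, so density extends it. It makes mollification errors uniform on
bounded sets of `H¹`. -/
theorem norm_shift_sub_le (u : H1 N) (y : Euc N) :
    ‖toL2L N (shift y u - u)‖ ≤ ‖y‖ * ‖gradL N u‖ := by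
  have hclosed : IsClosed {u : H1 N | ‖toL2L N (shift y u - u)‖ ≤ ‖y‖ * ‖gradL N u‖} := by
    refine isClosed_le ?_ ?_
    · have := (shift (N := N) y).continuous
      fun_prop
    · fun_prop
  refine hclosed.closure_subset_iff.2 ?_ (dense_testSet u)
  rintro _ ⟨φ, hφ, hc, rfl⟩
  have hφc := hφ.continuous
  have hdc : Continuous (fderiv ℝ φ) := hφ.continuous_fderiv (by simp)
  refine le_of_sq_le_sq ?_ (mul_nonneg (norm_nonneg y) (norm_nonneg _))
  refine (ENNReal.ofReal_le_ofReal_iff (by positivity)).1 ?_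
  rw [← lintegral_enorm_sq_coe]
  set ν : Measure ℝ := volume.restrict (Ioc (0 : ℝ) 1)
  have hprob : IsProbabilityMeasure ν := ⟨by simp [ν]⟩
  have hpt : ∀ x, ‖φ (x + y) - φ x‖ₑ ^ 2 ≤ ∫⁻ t, ‖fderiv ℝ φ (x + t • y) y‖ₑ ^ 2 ∂ν := by
    intro x
    have hcc : Continuous fun t : ℝ => fderiv ℝ φ (x + t • y) y :=
      (hdc.comp (by fun_prop)).clm_apply continuous_const
    have h1 : ∫ t in (0 : ℝ)..1, fderiv ℝ φ (x + t • y) y = φ (x + y) - φ x := by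
      rw [intervalIntegral.integral_eq_sub_of_hasDerivAt (f := fun t => φ (x + t • y))]
      · simp
      · intro t _
        have hl : HasDerivAt (fun t : ℝ => x + t • y) y t := by
          simpa using ((hasDerivAt_id t).smul_const y).const_add x
        exact ((hφ.differentiable (by simp)) (x + t • y)).hasFDerivAt.comp_hasDerivAt t hl
      · exact hcc.intervalIntegrable _ _
    have h2 : ‖φ (x + y) - φ x‖ₑ ≤ ∫⁻ t, ‖fderiv ℝ φ (x + t • y) y‖ₑ ∂ν := by
      rw [← h1, intervalIntegral.integral_of_le zero_le_one]
      exact enorm_integral_le_lintegral_enorm _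
    calc _ ≤ (∫⁻ t, ‖fderiv ℝ φ (x + t • y) y‖ₑ ∂ν) ^ 2 := by gcongr
      _ ≤ _ := sq_lintegral_le ν hcc.enorm.aemeasurable
  calc ∫⁻ x, ‖toL2L N (shift y (ofTest φ hφ hc) - ofTest φ hφ hc) x‖ₑ ^ 2
      = ∫⁻ x, ‖φ (x + y) - φ x‖ₑ ^ 2 := by
        refine lintegral_congr_ae ?_
        filter_upwards [val_sub (shift y (ofTest φ hφ hc)) (ofTest φ hφ hc), val_ofTest φ hφ hc,
          val_shift y (ofTest φ hφ hc), (measurePreserving_add_right volume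
          y).quasiMeasurePreserving.ae (val_ofTest φ hφ hc)] with x h1 h2 h3 h4
        rw [coe_toL2L, h1, h3, h2, h4]
    _ ≤ ∫⁻ x, ∫⁻ t, ‖fderiv ℝ φ (x + t • y) y‖ₑ ^ 2 ∂ν := lintegral_mono hpt
    _ = ∫⁻ t, (∫⁻ x, ‖fderiv ℝ φ (x + t • y) y‖ₑ ^ 2) ∂ν := by
        refine lintegral_lintegral_swap ?_
        have : Continuous fun q : Euc N × ℝ => fderiv ℝ φ (q.1 + q.2 • y) y :=
          (hdc.comp (by fun_prop)).clm_apply continuous_const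
        exact (this.enorm.measurable.pow_const 2).aemeasurable
    _ ≤ ∫⁻ _, ENNReal.ofReal ((‖y‖ * ‖gradL N (ofTest φ hφ hc)‖) ^ 2) ∂ν := by
        refine lintegral_mono fun t => ?_
        dsimp only
        rw [lintegral_add_right_eq_self (fun x => ‖fderiv ℝ φ x y‖ₑ ^ 2) (t • y), mul_pow,
          ENNReal.ofReal_mul (by positivity), ← lintegral_fderiv_ofTest,
          ← lintegral_const_mul _ (hdc.enorm.measurable.pow_const 2)]
        refine lintegral_mono fun x => ?_
        dsimp only
        rw [ENNReal.ofReal_pow (norm_nonneg _), ← mul_pow, ofReal_norm]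
        gcongr
        rw [mul_comm]
        exact ContinuousLinearMap.le_opENorm _ _
    _ = _ := by simp

/-- The almost everywhere convergence allows integral inequalities to pass from test functions to
`H¹` by Fatou's lemma. -/
theorem exists_seq_test_tendsto (u : H1 N) : ∃ v : ℕ → H1 N, (∀ n, v n ∈ testSet N) ∧
    Tendsto v atTop (𝓝 u) ∧ ∀ᵐ x, Tendsto (fun n => (v n).val x) atTop (𝓝 (u.val x)) := by
  obtain ⟨v, hv, hlim⟩ := mem_closure_iff_seq_limit.1 (dense_testSet u)
  have h1 : Tendsto (fun n => toL2L N (v n)) atTop (𝓝 (toL2L N u)) :=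
    ((toL2L N).continuous.tendsto u).comp hlim
  obtain ⟨k, hk, hae⟩ := (tendstoInMeasure_of_tendsto_Lp h1).exists_seq_tendsto_ae
  exact ⟨v ∘ k, fun n => hv _, hlim.comp hk.tendsto_atTop, hae⟩

/-- The critical Sobolev exponent `2N/(N-2)`. -/
def critExp (N : ℕ) : ℝ := 2 * (N : ℝ) / ((N : ℝ) - 2)

theorem two_lt_critExp (hN : 3 ≤ N) : 2 < critExp N := by
  have : (3 : ℝ) ≤ N := by exact_mod_cast hN
  rw [critExp, lt_div_iff₀ (by linarith)]
  linarith

/-- Sobolev's inequality. -/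
theorem exists_sobolev (hN : 3 ≤ N) : ∃ C : ℝ, 0 ≤ C ∧ ∀ u : H1 N,
    ∫⁻ x, ‖u.val x‖ₑ ^ critExp N ≤ ENNReal.ofReal ((C * ‖u‖) ^ critExp N) := by
  have hs := two_lt_critExp hN
  have hs0 : 0 < critExp N := by linarith
  have hN3 : (3 : ℝ) ≤ N := by exact_mod_cast hN
  set p' : NNReal := ⟨critExp N, hs0.le⟩ with hp'
  have hp'0 : p' ≠ 0 := by
    intro h
    have : (p' : ℝ) = 0 := by rw [h]; rfl
    exact hs0.ne' this
  set K := SNormLESNormFDerivOfEqConst ℝ (volume : Measure (Euc N)) 2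
  refine ⟨K, K.2, ?_⟩
  have htest : ∀ v ∈ testSet N, ∫⁻ x, ‖v.val x‖ₑ ^ critExp N ≤
      ENNReal.ofReal ((K * ‖v‖) ^ critExp N) := by
    rintro _ ⟨φ, hφ, hc, rfl⟩
    have h1 := eLpNorm_le_eLpNorm_fderiv_of_eq (F := ℝ) (μ := (volume : Measure (Euc N)))
      (hφ.of_le (m := 1) (by exact_mod_cast le_top)) hc (p := 2) (p' := p') (by norm_num)
      (by simp; omega) (by
        have : (p' : ℝ) = critExp N := rfl
        rw [this, critExp, finrank_euclideanSpace_fin]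
        push_cast
        field_simp)
    have h2 : eLpNorm (fderiv ℝ φ) 2 volume ≤ ENNReal.ofReal ‖ofTest φ hφ hc‖ := by
      rw [← ENNReal.pow_le_pow_left_iff two_ne_zero]
      have h3 := eLpNorm_nnreal_pow_eq_lintegral (f := fderiv ℝ φ) (μ := volume) (p := 2)
        (by norm_num)
      have h4 : eLpNorm (fderiv ℝ φ) 2 volume ^ 2 = ∫⁻ x, ‖fderiv ℝ φ x‖ₑ ^ 2 := by simpa using h3
      rw [h4, lintegral_fderiv_ofTest φ hφ hc, ENNReal.ofReal_pow (norm_nonneg _)]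
      gcongr
      exact norm_gradL_le _
    have h5 : ∫⁻ x, ‖(ofTest φ hφ hc).val x‖ₑ ^ critExp N = eLpNorm φ p' volume ^ critExp N := by
      have := eLpNorm_nnreal_pow_eq_lintegral (f := φ) (μ := volume) hp'0
      refine Eq.trans ?_ this.symm
      refine lintegral_congr_ae ?_
      filter_upwards [val_ofTest φ hφ hc] with x hx
      rw [hx]
      rfl
    rw [h5, ← ENNReal.ofReal_rpow_of_nonneg (by positivity) hs0.le,
      ENNReal.ofReal_mul (NNReal.coe_nonneg K)]
    refine ENNReal.rpow_le_rpow (h1.trans ?_) hs0.le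
    rw [ENNReal.ofReal_coe_nnreal]
    exact mul_le_mul' le_rfl h2
  intro u
  obtain ⟨v, hv, hlim, hae⟩ := exists_seq_test_tendsto u
  calc ∫⁻ x, ‖u.val x‖ₑ ^ critExp N
      ≤ ∫⁻ x, liminf (fun n => ‖(v n).val x‖ₑ ^ critExp N) atTop := by
        refine lintegral_mono_ae ?_
        filter_upwards [hae] with x hx
        have : Tendsto (fun n => ‖(v n).val x‖ₑ ^ critExp N) atTop (𝓝 (‖u.val x‖ₑ ^ critExp N)) :=
          (hx.enorm).ennrpow_const _
        rw [this.liminf_eq]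
    _ ≤ liminf (fun n => ∫⁻ x, ‖(v n).val x‖ₑ ^ critExp N) atTop :=
        lintegral_liminf_le' fun n => (aesm_val (v n)).enorm.pow_const _
    _ ≤ liminf (fun n => ENNReal.ofReal ((K * ‖v n‖) ^ critExp N)) atTop :=
        liminf_le_liminf (Eventually.of_forall fun n => htest _ (hv n))
    _ = _ := by
        refine Tendsto.liminf_eq (ENNReal.tendsto_ofReal ?_)
        exact ((hlim.norm.const_mul (K : ℝ))).rpow_const (Or.inr hs0.le)

/-- Integrate by parts against the smooth vector field `x / (‖x‖² + ε)`. Its divergence is at least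
`(N-2) / (‖x‖² + ε)`, and Young's inequality absorbs the cross term `2 φ ∇φ · x / (‖x‖² + ε)` with
the sharp constant. The shift by `ε` removes the singularity. -/
theorem hardy_test (hN : 3 ≤ N) {φ : Euc N → ℝ} (hφ : ContDiff ℝ ∞ φ) (hc : HasCompactSupport φ)
    {ε : ℝ} (hε : 0 < ε) :
    ((N : ℝ) - 2) ^ 2 / 4 * ∫ x, φ x ^ 2 / (‖x‖ ^ 2 + ε) ≤ ∫ x, ‖fderiv ℝ φ x‖ ^ 2 := by
  have hN3 : (3 : ℝ) ≤ N := by exact_mod_cast hN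
  have hφc := hφ.continuous
  have hdc := hφ.continuous_fderiv (by simp)
  have hr : ∀ x : Euc N, 0 < ‖x‖ ^ 2 + ε := fun x => by positivity
  have hrc : Continuous fun x : Euc N => ‖x‖ ^ 2 + ε := by fun_prop
  have hrd : ∀ x : Euc N, HasFDerivAt (fun x : Euc N => ‖x‖ ^ 2 + ε)
      (2 • innerSL ℝ x) x := fun x => (hasStrictFDerivAt_norm_sq x).hasFDerivAt.add_const ε
  -- integration by parts in each coordinate direction
  have hibp : ∀ i : Fin N, ∫ x, φ x ^ 2 * (1 / (‖x‖ ^ 2 + ε) - 2 * x i ^ 2 / (‖x‖ ^ 2 + ε) ^ 2) =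
      - ∫ x, 2 * φ x * fderiv ℝ φ x (EuclideanSpace.single i 1) * (x i / (‖x‖ ^ 2 + ε)) := by
    intro i
    have hxi : ∀ x : Euc N, HasFDerivAt (fun x : Euc N => x i)
        (EuclideanSpace.proj i : Euc N →L[ℝ] ℝ) x := fun x =>
      (EuclideanSpace.proj i : Euc N →L[ℝ] ℝ).hasFDerivAt
    have hG : ∀ x : Euc N, HasFDerivAt (fun x : Euc N => x i / (‖x‖ ^ 2 + ε))
        ((((‖x‖ ^ 2 + ε) ^ 2)⁻¹) • ((‖x‖ ^ 2 + ε) • (EuclideanSpace.proj i : Euc N →L[ℝ] ℝ) -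
          x i • (2 • innerSL ℝ x))) x := by
      intro x
      have h1 : HasFDerivAt (fun x : Euc N => (‖x‖ ^ 2 + ε)⁻¹)
          ((-((‖x‖ ^ 2 + ε) ^ 2)⁻¹) • (2 • innerSL ℝ x)) x :=
        (hasDerivAt_inv (hr x).ne').comp_hasFDerivAt x (hrd x)
      simp only [div_eq_mul_inv]
      convert! (hxi x).mul h1 using 1
      ext v
      have := (hr x).ne'
      simp
      field_simp
      ring
    have hF : ∀ x, HasFDerivAt (fun x => φ x ^ 2) ((2 * φ x) • fderiv ℝ φ x) x := by
      intro x
      have := ((hφ.differentiable (by simp)) x).hasFDerivAt.pow 2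
      simpa using this
    have hval : ∀ x : Euc N, fderiv ℝ (fun x : Euc N => x i / (‖x‖ ^ 2 + ε)) x
        (EuclideanSpace.single i 1) = 1 / (‖x‖ ^ 2 + ε) - 2 * x i ^ 2 / (‖x‖ ^ 2 + ε) ^ 2 := by
      intro x
      rw [(hG x).fderiv]
      have := (hr x).ne'
      simp [EuclideanSpace.inner_single_right]
      field_simp
    have hxc : Continuous fun x : Euc N => x i := by fun_prop
    have e := integral_mul_fderiv_eq_neg_fderiv_mul_of_integrable (𝕜 := ℝ) (μ := volume)
      (f := fun x => φ x ^ 2) (g := fun x : Euc N => x i / (‖x‖ ^ 2 + ε))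
      (v := EuclideanSpace.single i 1) ?_ ?_ ?_
      (fun x _ => (hF x).differentiableAt) (fun x _ => (hG x).differentiableAt)
    · simp only [hval] at e
      rw [e]
      congr 1
      refine integral_congr_ae (Eventually.of_forall fun x => ?_)
      simp only
      rw [(hF x).fderiv]
      simp
    · simp only [(hF _).fderiv]
      refine Continuous.integrable_of_hasCompactSupport ?_ ?_
      · simp only [smul_apply, smul_eq_mul]
        exact ((continuous_const.mul hφc).mul (hdc.clm_apply continuous_const)).mul
          (hxc.div hrc fun x => (hr x).ne')
      · refine hc.mono fun x hx => ?_
        contrapose! hx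
        simp only [Function.mem_support, not_not] at hx ⊢
        simp [hx]
    · simp only [hval]
      refine Continuous.integrable_of_hasCompactSupport ?_ ?_
      · exact (hφc.pow 2).mul ((continuous_const.div hrc fun x => (hr x).ne').sub
          ((continuous_const.mul (hxc.pow 2)).div (hrc.pow 2) fun x => (pow_pos (hr x) 2).ne'))
      · refine hc.mono fun x hx => ?_
        contrapose! hx
        simp only [Function.mem_support, not_not] at hx ⊢
        simp [hx]
    · refine Continuous.integrable_of_hasCompactSupport ?_ ?_
      · exact (hφc.pow 2).mul (hxc.div hrc fun x => (hr x).ne')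
      · refine hc.mono fun x hx => ?_
        contrapose! hx
        simp only [Function.mem_support, not_not] at hx ⊢
        simp [hx]
  have hint : ∀ {w : Euc N → ℝ}, Continuous w → (∀ x, φ x = 0 → w x = 0) → Integrable w := by
    intro w hw h0
    refine hw.integrable_of_hasCompactSupport (hc.mono fun x hx => ?_)
    contrapose! hx
    simp only [Function.mem_support, not_not] at hx ⊢
    exact h0 x hx
  have hxc : ∀ i, Continuous fun x : Euc N => x i := fun i => by fun_prop
  have iA : Integrable (fun x => φ x ^ 2 / (‖x‖ ^ 2 + ε)) volume :=
    hint ((hφc.pow 2).div hrc fun x => (hr x).ne') fun x h => by simp [h]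
  have iD : Integrable (fun x => ‖fderiv ℝ φ x‖ ^ 2) volume := by
    refine (hdc.norm.pow 2).integrable_of_hasCompactSupport ((hc.fderiv ℝ).mono fun x hx => ?_)
    contrapose! hx
    simp only [Function.mem_support, not_not] at hx ⊢
    simp [hx]
  have hL : ∑ i, ∫ x, φ x ^ 2 * (1 / (‖x‖ ^ 2 + ε) - 2 * x i ^ 2 / (‖x‖ ^ 2 + ε) ^ 2) =
      ∫ x, φ x ^ 2 * ((N : ℝ) / (‖x‖ ^ 2 + ε) - 2 * ‖x‖ ^ 2 / (‖x‖ ^ 2 + ε) ^ 2) := by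
    rw [← integral_finsetSum]
    · refine integral_congr_ae (Eventually.of_forall fun x => ?_)
      simp only
      rw [← Finset.mul_sum, Finset.sum_sub_distrib, ← Finset.sum_div, ← Finset.sum_div,
        ← Finset.mul_sum, ← EuclideanSpace.real_norm_sq_eq]
      simp
    · intro i _
      exact hint ((hφc.pow 2).mul ((continuous_const.div hrc fun x => (hr x).ne').sub
          ((continuous_const.mul ((hxc i).pow 2)).div (hrc.pow 2) fun x => (pow_pos (hr x) 2).ne')))
        fun x h => by simp [h]
  have hR : ∑ i, ∫ x, 2 * φ x * fderiv ℝ φ x (EuclideanSpace.single i 1) * (x i / (‖x‖ ^ 2 + ε)) =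
      ∫ x, 2 * φ x * fderiv ℝ φ x x / (‖x‖ ^ 2 + ε) := by
    rw [← integral_finsetSum]
    · refine integral_congr_ae (Eventually.of_forall fun x => ?_)
      simp only
      have hx : x = ∑ i, x i • EuclideanSpace.single i (1 : ℝ) := by
        ext j
        simp [Finset.sum_apply, Pi.single_apply]
      have h2 : fderiv ℝ φ x x = ∑ i, x i * fderiv ℝ φ x (EuclideanSpace.single i 1) := by
        conv_lhs => rw [hx, map_sum]
        rw [← hx]
        simp
      rw [h2, Finset.mul_sum, Finset.sum_div]
      refine Finset.sum_congr rfl fun i _ => ?_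
      ring
    · intro i _
      exact hint (((continuous_const.mul hφc).mul (hdc.clm_apply continuous_const)).mul
          ((hxc i).div hrc fun x => (hr x).ne')) fun x h => by simp [h]
  have hmain : ∫ x, φ x ^ 2 * ((N : ℝ) / (‖x‖ ^ 2 + ε) - 2 * ‖x‖ ^ 2 / (‖x‖ ^ 2 + ε) ^ 2) =
      - ∫ x, 2 * φ x * fderiv ℝ φ x x / (‖x‖ ^ 2 + ε) := by
    rw [← hL, ← hR, ← Finset.sum_neg_distrib]
    exact Finset.sum_congr rfl fun i _ => hibp i
  have iL : Integrable (fun x => φ x ^ 2 * ((N : ℝ) / (‖x‖ ^ 2 + ε) -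
      2 * ‖x‖ ^ 2 / (‖x‖ ^ 2 + ε) ^ 2)) volume :=
    hint ((hφc.pow 2).mul ((continuous_const.div hrc fun x => (hr x).ne').sub
      ((continuous_const.mul (by fun_prop)).div (hrc.pow 2) fun x => (pow_pos (hr x) 2).ne')))
        fun x h => by simp [h]
  have iR : Integrable (fun x => 2 * φ x * fderiv ℝ φ x x / (‖x‖ ^ 2 + ε)) volume :=
    hint (((continuous_const.mul hφc).mul (hdc.clm_apply continuous_id)).div hrc
      fun x => (hr x).ne') fun x h => by simp [h]
  have hN2 : 0 < (N : ℝ) - 2 := by linarith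
  -- pointwise Young inequality
  have hpt : ∀ x, ((N : ℝ) - 2) / 2 * (φ x ^ 2 / (‖x‖ ^ 2 + ε)) ≤
      φ x ^ 2 * ((N : ℝ) / (‖x‖ ^ 2 + ε) - 2 * ‖x‖ ^ 2 / (‖x‖ ^ 2 + ε) ^ 2) +
      2 * φ x * fderiv ℝ φ x x / (‖x‖ ^ 2 + ε) + 2 / ((N : ℝ) - 2) * ‖fderiv ℝ φ x‖ ^ 2 := by
    intro x
    have hrx := hr x
    have h1 : |fderiv ℝ φ x x| ≤ ‖fderiv ℝ φ x‖ * ‖x‖ := (fderiv ℝ φ x).le_opNorm x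
    generalize fderiv ℝ φ x x = d at *
    generalize ‖fderiv ℝ φ x‖ = D at *
    have hs : ‖x‖ ^ 2 ≤ ‖x‖ ^ 2 + ε := by linarith
    generalize ‖x‖ = s at *
    generalize φ x = w at *
    set r := s ^ 2 + ε with hrdef
    have e1 : w ^ 2 * ((N : ℝ) / r - 2 * s ^ 2 / r ^ 2) + 2 * w * d / r +
        2 / ((N : ℝ) - 2) * D ^ 2 - ((N : ℝ) - 2) / 2 * (w ^ 2 / r) =
        2 * w ^ 2 * (r - s ^ 2) / r ^ 2 + ((N : ℝ) - 2) / 2 * (w ^ 2 * (r - s ^ 2) / r ^ 2) +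
        (((N : ℝ) - 2) / 2 * (w ^ 2 * s ^ 2 / r ^ 2) + 2 * w * d / r + 2 / ((N : ℝ) - 2) * D ^ 2) := by
      field_simp
      ring
    have e2 : 0 ≤ ((N : ℝ) - 2) / 2 * (w ^ 2 * s ^ 2 / r ^ 2) + 2 * w * d / r +
        2 / ((N : ℝ) - 2) * D ^ 2 := by
      have e3 : - (2 * |w| * (D * s) / r) ≤ 2 * w * d / r := by
        rw [← neg_div]
        refine div_le_div_of_nonneg_right ?_ hrx.le
        have : |w * d| ≤ |w| * (D * s) := by rw [abs_mul]; gcongr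
        have := neg_abs_le (w * d)
        nlinarith
      have e4 : ((N : ℝ) - 2) / 2 * (w ^ 2 * s ^ 2 / r ^ 2) - (2 * |w| * (D * s) / r) +
          2 / ((N : ℝ) - 2) * D ^ 2 = 2 / ((N : ℝ) - 2) * (((N : ℝ) - 2) / 2 * (|w| * s / r) - D) ^ 2 := by
        rw [← sq_abs w]
        field_simp
        ring
      have e5 : 0 ≤ 2 / ((N : ℝ) - 2) * (((N : ℝ) - 2) / 2 * (|w| * s / r) - D) ^ 2 := by positivity
      linarith
    have e6 : 0 ≤ w ^ 2 * (r - s ^ 2) / r ^ 2 :=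
      div_nonneg (mul_nonneg (sq_nonneg w) (by linarith)) (by positivity)
    have e7 : 0 ≤ ((N : ℝ) - 2) / 2 * (w ^ 2 * (r - s ^ 2) / r ^ 2) := by positivity
    have e8 : 2 * w ^ 2 * (r - s ^ 2) / r ^ 2 = 2 * (w ^ 2 * (r - s ^ 2) / r ^ 2) := by ring
    linarith
  have hfin := integral_mono (iA.const_mul (((N : ℝ) - 2) / 2))
    ((iL.add iR).add (iD.const_mul (2 / ((N : ℝ) - 2)))) hpt
  rw [integral_add' (iL.add iR) (iD.const_mul _), integral_add' iL iR, hmain, neg_add_cancel,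
    zero_add, integral_const_mul, integral_const_mul] at hfin
  have : ((N : ℝ) - 2) / 2 * (((N : ℝ) - 2) / 2 * ∫ x, φ x ^ 2 / (‖x‖ ^ 2 + ε)) ≤
      ((N : ℝ) - 2) / 2 * (2 / ((N : ℝ) - 2) * ∫ x, ‖fderiv ℝ φ x‖ ^ 2) := by gcongr
  have e1 : ((N : ℝ) - 2) / 2 * (2 / ((N : ℝ) - 2) * ∫ x, ‖fderiv ℝ φ x‖ ^ 2) =
      ∫ x, ‖fderiv ℝ φ x‖ ^ 2 := by field_simp
  linarith

/-- Hardy's inequality. -/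
theorem lintegral_hardy (hN : 3 ≤ N) (u : H1 N) :
    ∫⁻ x, ENNReal.ofReal (u.val x ^ 2 / ‖x‖ ^ 2) ≤
      ENNReal.ofReal (4 / ((N : ℝ) - 2) ^ 2 * ‖gradL N u‖ ^ 2) := by
  have hN3 : (3 : ℝ) ≤ N := by exact_mod_cast hN
  have hN2 : 0 < (N : ℝ) - 2 := by linarith
  obtain ⟨v, hv, hlim, hae⟩ := exists_seq_test_tendsto u
  -- The regularisation is tied to the index of the approximating sequence, so one application of
  -- Fatou handles both limits.
  have htest : ∀ n, ∫⁻ x, ENNReal.ofReal ((v n).val x ^ 2 / (‖x‖ ^ 2 + 1 / ((n : ℝ) + 1))) ≤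
      ENNReal.ofReal (4 / ((N : ℝ) - 2) ^ 2 * ‖gradL N (v n)‖ ^ 2) := by
    intro n
    have hε : 0 < 1 / ((n : ℝ) + 1) := by positivity
    obtain ⟨φ, hφ, hc, hvn⟩ := hv n
    have h1 := hardy_test hN hφ hc hε
    have h2 : ∫ x, ‖fderiv ℝ φ x‖ ^ 2 = ‖gradL N (v n)‖ ^ 2 := by
      rw [hvn, ← integral_grad_sq]
      refine integral_congr_ae ?_
      filter_upwards [grad_ofTest φ hφ hc] with x hx
      rw [hx, LinearIsometryEquiv.norm_map]
    have h3 : Integrable (fun x => φ x ^ 2 / (‖x‖ ^ 2 + 1 / ((n : ℝ) + 1))) volume := by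
      refine Continuous.integrable_of_hasCompactSupport ?_ (hc.mono fun x hx => ?_)
      · exact (hφ.continuous.pow 2).div (by fun_prop) fun x => by positivity
      · contrapose! hx
        simp only [Function.mem_support, not_not] at hx ⊢
        simp [hx]
    have h4 : ∫⁻ x, ENNReal.ofReal ((v n).val x ^ 2 / (‖x‖ ^ 2 + 1 / ((n : ℝ) + 1))) =
        ENNReal.ofReal (∫ x, φ x ^ 2 / (‖x‖ ^ 2 + 1 / ((n : ℝ) + 1))) := by
      rw [ofReal_integral_eq_lintegral_ofReal h3 (Eventually.of_forall fun x => by positivity)]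
      refine lintegral_congr_ae ?_
      filter_upwards [val_ofTest φ hφ hc] with x hx
      rw [hvn, hx]
    rw [h4]
    refine ENNReal.ofReal_le_ofReal ?_
    rw [h2] at h1
    have h5 : 4 / ((N : ℝ) - 2) ^ 2 * (((N : ℝ) - 2) ^ 2 / 4 *
      ∫ x, φ x ^ 2 / (‖x‖ ^ 2 + 1 / ((n : ℝ) + 1))) ≤
        4 / ((N : ℝ) - 2) ^ 2 * ‖gradL N (v n)‖ ^ 2 := by gcongr
    have h6 : 4 / ((N : ℝ) - 2) ^ 2 * (((N : ℝ) - 2) ^ 2 / 4 *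
      ∫ x, φ x ^ 2 / (‖x‖ ^ 2 + 1 / ((n : ℝ) + 1))) =
        ∫ x, φ x ^ 2 / (‖x‖ ^ 2 + 1 / ((n : ℝ) + 1)) := by
      generalize ∫ x, φ x ^ 2 / (‖x‖ ^ 2 + 1 / ((n : ℝ) + 1)) = I
      field_simp
    linarith
  have h0 : ∀ᵐ x : Euc N, x ≠ 0 := by
    have : Nonempty (Fin N) := ⟨⟨0, by omega⟩⟩
    exact Measure.ae_ne volume 0
  calc ∫⁻ x, ENNReal.ofReal (u.val x ^ 2 / ‖x‖ ^ 2)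
      ≤ ∫⁻ x, liminf (fun n : ℕ => ENNReal.ofReal
          ((v n).val x ^ 2 / (‖x‖ ^ 2 + 1 / ((n : ℝ) + 1)))) atTop := by
        refine lintegral_mono_ae ?_
        filter_upwards [hae, h0] with x hx hx0
        have h1 : Tendsto (fun n : ℕ => ‖x‖ ^ 2 + 1 / ((n : ℝ) + 1)) atTop (𝓝 (‖x‖ ^ 2)) := by
          simpa using tendsto_one_div_add_atTop_nhds_zero_nat.const_add (‖x‖ ^ 2)
        have h2 := ENNReal.tendsto_ofReal ((hx.pow 2).div h1 (by positivity))
        exact h2.liminf_eq.ge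
    _ ≤ liminf (fun n : ℕ => ∫⁻ x, ENNReal.ofReal
          ((v n).val x ^ 2 / (‖x‖ ^ 2 + 1 / ((n : ℝ) + 1)))) atTop := by
        refine lintegral_liminf_le' fun n => AEMeasurable.ennreal_ofReal ?_
        exact ((aesm_val (v n)).aemeasurable.pow_const 2).div (by fun_prop)
    _ ≤ liminf (fun n => ENNReal.ofReal (4 / ((N : ℝ) - 2) ^ 2 * ‖gradL N (v n)‖ ^ 2)) atTop :=
        liminf_le_liminf (Eventually.of_forall htest)
    _ = _ := by
        refine Tendsto.liminf_eq (ENNReal.tendsto_ofReal ?_)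
        have : Tendsto (fun n => gradL N (v n)) atTop (𝓝 (gradL N u)) :=
          ((gradL N).continuous.tendsto u).comp hlim
        exact (this.norm.pow 2).const_mul _

theorem integrable_hardy (hN : 3 ≤ N) (u : H1 N) :
    Integrable (fun x => u.val x ^ 2 / ‖x‖ ^ 2) volume := by
  refine ⟨(((aesm_val u).aemeasurable.pow_const 2).div (by fun_prop)).aestronglyMeasurable, ?_⟩
  rw [hasFiniteIntegral_iff_ofReal (Eventually.of_forall fun x => by positivity)]
  exact (lintegral_hardy hN u).trans_lt ENNReal.ofReal_lt_top

theorem integral_hardy_le (hN : 3 ≤ N) (u : H1 N) :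
    ∫ x, u.val x ^ 2 / ‖x‖ ^ 2 ≤ 4 / ((N : ℝ) - 2) ^ 2 * ‖gradL N u‖ ^ 2 := by
  rw [integral_eq_lintegral_of_nonneg_ae (Eventually.of_forall fun x => by positivity)
    (integrable_hardy hN u).1]
  exact ENNReal.toReal_le_of_le_ofReal (by positivity) (lintegral_hardy hN u)

end

section

variable {N : ℕ}

/-! ### The quadratic forms -/

theorem exists_bound_of_memLp_top {V : Euc N → ℝ} (hV : MemLp V ⊤ volume) :
    ∃ C : ℝ, 0 ≤ C ∧ ∀ᵐ x, |V x| ≤ C := by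
  refine ⟨(eLpNormEssSup V volume).toReal, ENNReal.toReal_nonneg, ?_⟩
  have h := hV.2
  rw [eLpNorm_exponent_top] at h
  filter_upwards [ae_le_eLpNormEssSup (f := V) (μ := (volume : Measure (Euc N)))] with x hx
  rw [← Real.norm_eq_abs, ← toReal_enorm]
  exact ENNReal.toReal_mono h.ne hx

theorem integrable_pot {V : Euc N → ℝ} (hV : MemLp V ⊤ volume) (u v : H1 N) :
    Integrable (fun x => V x * (u.val x * v.val x)) volume :=
  (integrable_val_mul u v).mul_of_top_right hV

theorem memLp_hardy (hN : 3 ≤ N) (u : H1 N) : MemLp (fun x => u.val x / ‖x‖) 2 volume := by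
  rw [memLp_two_iff_integrable_sq]
  · simpa only [div_pow] using integrable_hardy hN u
  · exact ((aesm_val u).aemeasurable.div (by fun_prop)).aestronglyMeasurable

theorem integrable_hardy_mul (hN : 3 ≤ N) (u v : H1 N) :
    Integrable (fun x => u.val x * v.val x / ‖x‖ ^ 2) volume := by
  refine ((memLp_hardy hN u).integrable_mul (memLp_hardy hN v)).congr
    (Eventually.of_forall fun x => ?_)
  simp only [Pi.mul_apply]
  rw [div_mul_div_comm, sq]

theorem abs_integral_mul_le {α : Type*} [MeasurableSpace α] {ν : Measure α} {f g : α → ℝ}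
    (hf : MemLp f 2 ν) (hg : MemLp g 2 ν) :
    ∫ x, |f x| * |g x| ∂ν ≤ √(∫ x, f x ^ 2 ∂ν) * √(∫ x, g x ^ 2 ∂ν) := by
  have h := real_inner_le_norm (hf.abs.toLp _) (hg.abs.toLp _)
  have e : ∀ {k : α → ℝ} (hk : MemLp k 2 ν), ‖hk.abs.toLp _‖ = √(∫ x, k x ^ 2 ∂ν) := by
    intro k hk
    rw [← Real.sqrt_sq (norm_nonneg _), ← real_inner_self_eq_norm_sq, L2.inner_def]
    congr 1
    refine integral_congr_ae ?_
    filter_upwards [hk.abs.coeFn_toLp] with x hx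
    rw [hx]
    simp
  rw [e hf, e hg, L2.inner_def] at h
  refine le_trans (le_of_eq (integral_congr_ae ?_)) h
  filter_upwards [hf.abs.coeFn_toLp, hg.abs.coeFn_toLp] with x hx hy
  rw [hx, hy]
  simp [mul_comm]

/-- `∫ u v / |x|²` as a bounded bilinear form on `H¹`. -/
def hardyL (hN : 3 ≤ N) : H1 N →L[ℝ] H1 N →L[ℝ] ℝ :=
  LinearMap.mkContinuous₂ (LinearMap.mk₂ ℝ (fun u v : H1 N => ∫ x, u.val x * v.val x / ‖x‖ ^ 2)
    (fun u v w => by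
      rw [← integral_add (integrable_hardy_mul hN u w) (integrable_hardy_mul hN v w)]
      refine integral_congr_ae ?_
      filter_upwards [val_add u v] with x hx
      rw [hx]; ring)
    (fun c u v => by
      rw [smul_eq_mul, ← integral_const_mul]
      refine integral_congr_ae ?_
      filter_upwards [val_smul c u] with x hx
      rw [hx]; ring)
    (fun u v w => by
      rw [← integral_add (integrable_hardy_mul hN u v) (integrable_hardy_mul hN u w)]
      refine integral_congr_ae ?_
      filter_upwards [val_add v w] with x hx
      rw [hx]; ring)
    (fun c u v => by
      rw [smul_eq_mul, ← integral_const_mul]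
      refine integral_congr_ae ?_
      filter_upwards [val_smul c v] with x hx
      rw [hx]; ring))
    (4 / ((N : ℝ) - 2) ^ 2) (fun u v => by
      have hle : ∀ w : H1 N, √(∫ x, (w.val x / ‖x‖) ^ 2) ≤ √(4 / ((N : ℝ) - 2) ^ 2) * ‖w‖ := by
        intro w
        simp only [div_pow]
        rw [← Real.sqrt_sq (norm_nonneg w), ← Real.sqrt_mul (by positivity)]
        refine Real.sqrt_le_sqrt ((integral_hardy_le hN w).trans ?_)
        gcongr
        exact norm_gradL_le w
      have h1 := abs_integral_mul_le (memLp_hardy hN u) (memLp_hardy hN v)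
      have h2 : |∫ x, u.val x * v.val x / ‖x‖ ^ 2| ≤ ∫ x, |u.val x / ‖x‖| * |v.val x / ‖x‖| := by
        refine (abs_integral_le_integral_abs).trans (le_of_eq ?_)
        refine integral_congr_ae (Eventually.of_forall fun x => ?_)
        simp only
        rw [← abs_mul, div_mul_div_comm, sq]
      calc _ ≤ _ := h2.trans h1
        _ ≤ (√(4 / ((N : ℝ) - 2) ^ 2) * ‖u‖) * (√(4 / ((N : ℝ) - 2) ^ 2) * ‖v‖) :=
          mul_le_mul (hle u) (hle v) (Real.sqrt_nonneg _) (by positivity)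
        _ = (√(4 / ((N : ℝ) - 2) ^ 2) * √(4 / ((N : ℝ) - 2) ^ 2)) * ‖u‖ * ‖v‖ := by ring
        _ = _ := by rw [Real.mul_self_sqrt (by positivity)])

theorem hardyL_apply (hN : 3 ≤ N) (u v : H1 N) :
    hardyL hN u v = ∫ x, u.val x * v.val x / ‖x‖ ^ 2 := rfl

theorem hardyL_self (hN : 3 ≤ N) (u : H1 N) : hardyL hN u u = ∫ x, u.val x ^ 2 / ‖x‖ ^ 2 := by
  simp only [hardyL_apply, sq]

theorem hardyL_self_nonneg (hN : 3 ≤ N) (u : H1 N) : 0 ≤ hardyL hN u u := by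
  rw [hardyL_self]
  exact integral_nonneg fun x => by positivity

theorem hardyL_self_le (hN : 3 ≤ N) (u : H1 N) :
    hardyL hN u u ≤ 4 / ((N : ℝ) - 2) ^ 2 * ‖gradL N u‖ ^ 2 := by
  rw [hardyL_self]
  exact integral_hardy_le hN u

/-- Strictness is what separates the levels for `μ < 0` from the level for `μ = 0` in the
nonexistence proof. -/
theorem hardyL_self_pos (hN : 3 ≤ N) {u : H1 N} (hu : u ≠ 0) : 0 < hardyL hN u u := by
  refine lt_of_le_of_ne (hardyL_self_nonneg hN u) fun h => hu ?_
  rw [hardyL_self, eq_comm, integral_eq_zero_iff_of_nonneg (fun x => by positivity)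
    (integrable_hardy hN u)] at h
  refine H1.ext_val (EventuallyEq.trans ?_ val_zero.symm)
  have h0 : ∀ᵐ x : Euc N, x ≠ 0 := by
    have : Nonempty (Fin N) := ⟨⟨0, by omega⟩⟩
    exact Measure.ae_ne volume 0
  filter_upwards [h, h0] with x hx hx0
  have : ‖x‖ ≠ 0 := norm_ne_zero_iff.2 hx0
  simpa [this] using hx

theorem hardyTerm_eq (hN : 3 ≤ N) (μ : ℝ) (u : H1 N) : hardyTerm μ u = μ * hardyL hN u u := by
  rw [hardyL_self, ← integral_const_mul, hardyTerm]
  refine integral_congr_ae (Eventually.of_forall fun x => ?_)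
  simp only [sq_abs]
  ring

theorem bform_zero_apply {V : Euc N → ℝ} (hV : MemLp V ⊤ volume) (u v : H1 N) :
    bform V 0 u v = inner ℝ (gradL N u) (gradL N v) + ∫ x, V x * (u.val x * v.val x) := by
  rw [inner_gradL, ← integral_add (integrable_grad_inner u v) (integrable_pot hV u v), bform]
  simp

theorem bform_eq_sub {V : Euc N → ℝ} (hN : 3 ≤ N) (hV : MemLp V ⊤ volume) (μ : ℝ) (u v : H1 N) :
    bform V μ u v = bform V 0 u v - μ * hardyL hN u v := by
  rw [bform_zero_apply hV, inner_gradL,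
    ← integral_add' (integrable_grad_inner u v) (integrable_pot hV u v), hardyL_apply,
    ← integral_const_mul, ← integral_sub ((integrable_grad_inner u v).add (integrable_pot hV u v))
      ((integrable_hardy_mul hN u v).const_mul μ), bform]
  refine integral_congr_ae (Eventually.of_forall fun x => ?_)
  simp only [Pi.add_apply]
  ring

theorem bform_comm (V : Euc N → ℝ) (μ : ℝ) (u v : H1 N) : bform V μ u v = bform V μ v u := by
  simp only [bform]
  refine integral_congr_ae (Eventually.of_forall fun x => ?_)
  simp only
  rw [real_inner_comm]
  ring

theorem bform_zero_add_left {V : Euc N → ℝ} (hV : MemLp V ⊤ volume) (u v w : H1 N) :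
    bform V 0 (u + v) w = bform V 0 u w + bform V 0 v w := by
  have : ∫ x, V x * ((u + v).val x * w.val x) =
      (∫ x, V x * (u.val x * w.val x)) + ∫ x, V x * (v.val x * w.val x) := by
    rw [← integral_add (integrable_pot hV u w) (integrable_pot hV v w)]
    refine integral_congr_ae ?_
    filter_upwards [val_add u v] with x hx
    rw [hx]; ring
  rw [bform_zero_apply hV, bform_zero_apply hV, bform_zero_apply hV, this, map_add, inner_add_left]
  ring

theorem bform_zero_smul_left {V : Euc N → ℝ} (hV : MemLp V ⊤ volume) (c : ℝ) (u v : H1 N) :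
    bform V 0 (c • u) v = c * bform V 0 u v := by
  have : ∫ x, V x * ((c • u).val x * v.val x) = c * ∫ x, V x * (u.val x * v.val x) := by
    rw [← integral_const_mul]
    refine integral_congr_ae ?_
    filter_upwards [val_smul c u] with x hx
    rw [hx]; ring
  rw [bform_zero_apply hV, bform_zero_apply hV, this, map_smul, real_inner_smul_left]
  ring

theorem exists_abs_bform_le {V : Euc N → ℝ} (hV : MemLp V ⊤ volume) :
    ∃ C : ℝ, ∀ u v : H1 N, ‖bform V 0 u v‖ ≤ C * ‖u‖ * ‖v‖ := by
  obtain ⟨C, hC0, hC⟩ := exists_bound_of_memLp_top hV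
  refine ⟨1 + C, fun u v => ?_⟩
  have h1 : |inner ℝ (gradL N u) (gradL N v)| ≤ ‖u‖ * ‖v‖ :=
    (abs_real_inner_le_norm _ _).trans (mul_le_mul (norm_gradL_le u) (norm_gradL_le v)
      (norm_nonneg _) (norm_nonneg _))
  have h2 : |∫ x, V x * (u.val x * v.val x)| ≤ C * (‖u‖ * ‖v‖) := by
    have h3 := abs_integral_mul_le (memLp_val u) (memLp_val v)
    rw [integral_val_sq, integral_val_sq, Real.sqrt_sq (norm_nonneg _),
      Real.sqrt_sq (norm_nonneg _)] at h3
    calc _ ≤ ∫ x, |V x * (u.val x * v.val x)| := abs_integral_le_integral_abs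
      _ ≤ ∫ x, C * (|u.val x| * |v.val x|) := by
        refine integral_mono_ae (integrable_pot hV u v).abs
          ((((memLp_val u).abs).integrable_mul ((memLp_val v).abs)).const_mul C) ?_
        filter_upwards [hC] with x hx
        rw [abs_mul, abs_mul]
        exact mul_le_mul_of_nonneg_right hx (by positivity)
      _ ≤ C * (‖u‖ * ‖v‖) := by
        rw [integral_const_mul]
        refine mul_le_mul_of_nonneg_left (h3.trans ?_) hC0
        exact mul_le_mul (norm_toL2L_le u) (norm_toL2L_le v) (norm_nonneg _) (norm_nonneg _)
  rw [bform_zero_apply hV, Real.norm_eq_abs]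
  refine (abs_add_le _ _).trans ?_
  linarith

/-- `B_0` as a bounded bilinear form on `H¹`. -/
def schrL {V : Euc N → ℝ} (hV : MemLp V ⊤ volume) : H1 N →L[ℝ] H1 N →L[ℝ] ℝ :=
  LinearMap.mkContinuous₂ (LinearMap.mk₂ ℝ (fun u v : H1 N => bform V 0 u v)
    (fun u v w => bform_zero_add_left hV u v w)
    (fun c u v => bform_zero_smul_left hV c u v)
    (fun u v w => by
      rw [bform_comm V 0 u, bform_zero_add_left hV, bform_comm V 0 v, bform_comm V 0 w])
    (fun c u v => by
      rw [bform_comm V 0 u, bform_zero_smul_left hV, bform_comm V 0 v, smul_eq_mul]))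
    (exists_abs_bform_le hV).choose (exists_abs_bform_le hV).choose_spec

theorem schrL_apply {V : Euc N → ℝ} (hV : MemLp V ⊤ volume) (u v : H1 N) :
    schrL hV u v = bform V 0 u v := rfl

/-- `B_μ` as a bounded bilinear form on `H¹`. -/
def formL {V : Euc N → ℝ} (hN : 3 ≤ N) (hV : MemLp V ⊤ volume) (μ : ℝ) :
    H1 N →L[ℝ] H1 N →L[ℝ] ℝ := schrL hV - μ • hardyL hN

theorem formL_apply {V : Euc N → ℝ} (hN : 3 ≤ N) (hV : MemLp V ⊤ volume) (μ : ℝ) (u v : H1 N) :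
    formL hN hV μ u v = bform V μ u v := by
  rw [bform_eq_sub hN hV]
  rfl

theorem formL_comm {V : Euc N → ℝ} (hN : 3 ≤ N) (hV : MemLp V ⊤ volume) (μ : ℝ) (u v : H1 N) :
    formL hN hV μ u v = formL hN hV μ v u := by
  rw [formL_apply, formL_apply, bform_comm]

theorem energy_eq_form (V : Euc N → ℝ) (f : Euc N → ℝ → ℝ) (μ : ℝ) (u : H1 N) :
    energy V f μ u = 1 / 2 * bform V μ u u - ∫ x, primitive f x (u.val x) := by
  rw [energy, bform]
  congr 2
  refine integral_congr_ae (Eventually.of_forall fun x => ?_)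
  simp only [real_inner_self_eq_norm_sq, sq_abs]
  ring

/-- Gårding's inequality. -/
theorem exists_garding {V : Euc N → ℝ} (hV : MemLp V ⊤ volume) :
    ∃ Λ : ℝ, 0 < Λ ∧ ∀ u : H1 N, ‖u‖ ^ 2 ≤ bform V 0 u u + Λ * ‖toL2L N u‖ ^ 2 := by
  obtain ⟨C, hC0, hC⟩ := exists_bound_of_memLp_top hV
  refine ⟨C + 1, by positivity, fun u => ?_⟩
  rw [bform_zero_apply hV, H1.norm_sq, real_inner_self_eq_norm_sq, ← integral_val_sq]
  have h : - (C * ∫ x, u.val x ^ 2) ≤ ∫ x, V x * (u.val x * u.val x) := by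
    rw [← integral_const_mul, ← integral_neg]
    refine integral_mono_ae ((integrable_val_sq u).const_mul C).neg (integrable_pot hV u u) ?_
    filter_upwards [hC] with x hx
    have := neg_abs_le (V x)
    nlinarith [mul_self_nonneg (u.val x)]
  linarith

theorem bform_shift {V : Euc N → ℝ} {z : Fin N → ℤ}
    (hp : ∀ᵐ x, V (x + latticePoint z) = V x) (u v : H1 N) :
    bform V 0 (shift (latticePoint z) u) (shift (latticePoint z) v) = bform V 0 u v := by
  rw [bform, bform]
  simp only [zero_div, sub_zero]
  rw [← integral_add_right_eq_self (fun x => inner ℝ (u.grad x) (v.grad x) + _) (latticePoint z)]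
  refine integral_congr_ae ?_
  filter_upwards [hp, val_shift (latticePoint z) u, val_shift (latticePoint z) v,
    grad_shift (latticePoint z) u, grad_shift (latticePoint z) v] with x h1 h2 h3 h4 h5
  rw [h1, h2, h3, h4, h5]

theorem inner_toL2L_shift (y : Euc N) (u v : H1 N) :
    inner ℝ (toL2L N (shift y u)) (toL2L N (shift y v)) =
      inner ℝ (toL2L N u) (toL2L N v) := by
  rw [inner_toL2L, inner_toL2L, ← integral_add_right_eq_self (fun x => u.val x * v.val x) y]
  refine integral_congr_ae ?_
  filter_upwards [val_shift y u, val_shift y v] with x h1 h2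
  rw [h1, h2]

end

section

/-! ### Square roots and the spectral splitting of an invertible symmetric operator -/

section Abstract

variable {F : Type*} [NormedAddCommGroup F] [InnerProductSpace ℝ F] [CompleteSpace F]

/-- A solution `Y` of `2 Y = K + Y²`, so that `1 - Y` is a square root of `1 - K`. -/
theorem exists_sqrt_aux {K : F →L[ℝ] F} (hK : ∀ x y, inner ℝ (K x) y = inner ℝ x (K y)) {r : ℝ}
    (hr1 : r < 1) (hKr : ‖K‖ ≤ r) :
    ∃ Y : F →L[ℝ] F, ‖Y‖ ≤ r ∧ (∀ x y, inner ℝ (Y x) y = inner ℝ x (Y y)) ∧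
      (2 : ℝ) • Y = K + Y * Y ∧ (∀ A : F →L[ℝ] F, A * K = K * A → A * Y = Y * A) ∧
      ∀ S : Submodule ℝ F, IsClosed (S : Set F) → (∀ x ∈ S, K x ∈ S) → ∀ x ∈ S, Y x ∈ S := by
  have hr0 : 0 ≤ r := (norm_nonneg K).trans hKr
  -- The fixed point of `Y ↦ (K + Y²)/2` is sought inside a closed set that encodes every property
  -- needed later: symmetry, commutation with the commutant of `K`, and preservation of closed
  -- `K`-invariant subspaces. The map preserves these, and on the ball of radius `r < 1` it is a
  -- contraction with constant `r`.
  set s : Set (F →L[ℝ] F) := {Y | ‖Y‖ ≤ r} ∩ ({Y | ∀ x y, inner ℝ (Y x) y = inner ℝ x (Y y)} ∩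
    ({Y | ∀ A : F →L[ℝ] F, A * K = K * A → A * Y = Y * A} ∩
      {Y | ∀ S : Submodule ℝ F, IsClosed (S : Set F) → (∀ x ∈ S, K x ∈ S) → ∀ x ∈ S, Y x ∈ S}))
    with hs
  have ev : ∀ x : F, Continuous fun Y : F →L[ℝ] F => Y x := fun x =>
    (ContinuousLinearMap.apply ℝ F x).continuous
  have hclosed : IsClosed s := by
    refine (isClosed_le continuous_norm continuous_const).inter (IsClosed.inter ?_
      (IsClosed.inter ?_ ?_))
    · simp only [ofPred_forall]
      exact isClosed_iInter fun x => isClosed_iInter fun y =>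
        isClosed_eq ((ev x).inner continuous_const) (continuous_const.inner (ev y))
    · simp only [ofPred_forall]
      exact isClosed_iInter fun A => isClosed_iInter fun _ =>
        isClosed_eq (continuous_const.mul continuous_id) (continuous_id.mul continuous_const)
    · simp only [ofPred_forall]
      exact isClosed_iInter fun S => isClosed_iInter fun hS => isClosed_iInter fun _ =>
        isClosed_iInter fun x => isClosed_iInter fun _ => hS.preimage (ev x)
  let g : (F →L[ℝ] F) → (F →L[ℝ] F) := fun Y => (1 / 2 : ℝ) • (K + Y * Y)
  have hmaps : MapsTo g s s := by
    rintro Y ⟨h1, h2, h3, h4⟩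
    simp only [mem_ofPred_eq] at h1 h2 h3 h4
    refine ⟨?_, ?_, ?_, ?_⟩
    · have h5 : ‖Y * Y‖ ≤ r * r := (norm_mul_le _ _).trans (by gcongr)
      have h6 : ‖K + Y * Y‖ ≤ r + r * r := (norm_add_le _ _).trans (add_le_add hKr h5)
      simp only [mem_ofPred_eq, g]
      rw [norm_smul]
      norm_num
      nlinarith
    · intro x y
      simp only [g, smul_apply, add_apply, mul_apply_eq_comp, real_inner_smul_left,
        real_inner_smul_right, inner_add_left, inner_add_right, hK, h2]
    · intro A hA
      simp only [g, mul_smul_comm, smul_mul_assoc, mul_add, add_mul]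
      rw [hA, ← mul_assoc, h3 A hA, mul_assoc, h3 A hA, mul_assoc]
    · intro S hS hKS x hx
      simp only [g, smul_apply, add_apply, mul_apply_eq_comp]
      exact S.smul_mem _ (S.add_mem (hKS x hx) (h4 S hS hKS _ (h4 S hS hKS x hx)))
  have hcontr : ContractingWith ⟨r, hr0⟩ (hmaps.restrict g s s) := by
    refine ⟨by exact_mod_cast hr1, LipschitzWith.of_dist_le_mul ?_⟩
    rintro ⟨Y, hY⟩ ⟨Z, hZ⟩
    have h1 : ‖Y‖ ≤ r := hY.1
    have h2 : ‖Z‖ ≤ r := hZ.1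
    change dist (g Y) (g Z) ≤ r * dist Y Z
    rw [dist_eq_norm, dist_eq_norm]
    have e : g Y - g Z = (1 / 2 : ℝ) • (Y * (Y - Z) + (Y - Z) * Z) := by
      simp only [g, ← smul_sub]
      congr 1
      noncomm_ring
    rw [e, norm_smul]
    have h3 : ‖Y * (Y - Z) + (Y - Z) * Z‖ ≤ r * ‖Y - Z‖ + ‖Y - Z‖ * r :=
      (norm_add_le _ _).trans (add_le_add ((norm_mul_le _ _).trans (by gcongr))
        ((norm_mul_le _ _).trans (by gcongr)))
    norm_num
    nlinarith
  have h0 : (0 : F →L[ℝ] F) ∈ s := by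
    refine ⟨by simpa using hr0, by simp, by simp, ?_⟩
    intro S _ _ x _
    simp
  obtain ⟨Y, hYs, hY, -⟩ := hcontr.exists_fixedPoint' hclosed.isComplete hmaps h0 (edist_ne_top _ _)
  refine ⟨Y, hYs.1, hYs.2.1, ?_, hYs.2.2.1, hYs.2.2.2⟩
  have hYg : (1 / 2 : ℝ) • (K + Y * Y) = Y := hY
  nth_rw 1 [← hYg]
  rw [smul_smul]
  norm_num

/-- Square root of a symmetric positive definite bounded operator. -/
theorem exists_sqrt {A : F →L[ℝ] F} (hA : ∀ x y, inner ℝ (A x) y = inner ℝ x (A y)) {c : ℝ}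
    (hc : 0 < c) (hpos : ∀ x, c * ‖x‖ ^ 2 ≤ inner ℝ (A x) x) :
    ∃ (P P' : F →L[ℝ] F) (κ : ℝ), 0 < κ ∧ (∀ x y, inner ℝ (P x) y = inner ℝ x (P y)) ∧
      P * P = A ∧ P * P' = 1 ∧ P' * P = 1 ∧ (∀ x, κ * ‖x‖ ^ 2 ≤ inner ℝ (P x) x) ∧
      (∀ D : F →L[ℝ] F, D * A = A * D → D * P = P * D) ∧
      ∀ S : Submodule ℝ F, IsClosed (S : Set F) → (∀ x ∈ S, A x ∈ S) → ∀ x ∈ S, P x ∈ S := by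
  -- Scaling by `M` places the Rayleigh quotients of `K = 1 - A/M` in `[0, 1 - c/M]`, hence `‖K‖ <
  -- 1`; the square root of `A` is then `√M (1 - Y)`.
  set M : ℝ := ‖A‖ + c with hM
  have hM0 : 0 < M := by positivity
  set K : F →L[ℝ] F := 1 - M⁻¹ • A with hKdef
  have hK : ∀ x y, inner ℝ (K x) y = inner ℝ x (K y) := by
    intro x y
    simp only [hKdef, sub_apply, one_apply_eq_self, smul_apply, inner_sub_left,
      inner_sub_right, real_inner_smul_left, real_inner_smul_right, hA]
  have hKq : ∀ x, inner ℝ (K x) x = ‖x‖ ^ 2 - M⁻¹ * inner ℝ (A x) x := by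
    intro x
    simp only [hKdef, sub_apply, one_apply_eq_self, smul_apply, inner_sub_left,
      real_inner_smul_left, real_inner_self_eq_norm_sq]
  set r : ℝ := 1 - M⁻¹ * c with hr
  have hMc : M⁻¹ * c ≤ 1 := by
    rw [inv_mul_le_iff₀ hM0]
    linarith [norm_nonneg A]
  have hr0 : 0 ≤ r := by linarith
  have hr1 : r < 1 := by have : 0 < M⁻¹ * c := by positivity
                         linarith
  have hKr : ‖K‖ ≤ r := by
    have hsym : (K : F →ₗ[ℝ] F).IsSymmetric := hK
    rw [ContinuousLinearMap.norm_eq_iSup_rayleighQuotient K hsym]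
    refine Real.iSup_le (fun x => ?_) hr0
    rcases eq_or_ne x 0 with rfl | hx
    · simp [ContinuousLinearMap.rayleighQuotient, ContinuousLinearMap.reApplyInnerSelf, hr0]
    · have hx2 : 0 < ‖x‖ ^ 2 := by positivity
      rw [ContinuousLinearMap.rayleighQuotient, ContinuousLinearMap.reApplyInnerSelf, abs_div,
        abs_of_pos hx2, div_le_iff₀ hx2]
      simp only [RCLike.re_to_real]
      rw [hKq, abs_le]
      have h1 := hpos x
      have h2 : inner ℝ (A x) x ≤ M * ‖x‖ ^ 2 := by
        have := (real_inner_le_norm (A x) x).trans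
          (mul_le_mul_of_nonneg_right (A.le_opNorm x) (norm_nonneg x))
        nlinarith
      have h3 : M⁻¹ * (c * ‖x‖ ^ 2) ≤ M⁻¹ * inner ℝ (A x) x := by gcongr
      have h4 : M⁻¹ * inner ℝ (A x) x ≤ M⁻¹ * (M * ‖x‖ ^ 2) := by gcongr
      have h5 : M⁻¹ * (M * ‖x‖ ^ 2) = ‖x‖ ^ 2 := by field_simp
      constructor
      · nlinarith
      · rw [hr]; nlinarith
  obtain ⟨Y, hYr, hYs, hYe, hYc, hYi⟩ := exists_sqrt_aux hK hr1 hKr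
  set m : ℝ := √M with hm
  have hm0 : 0 < m := Real.sqrt_pos.2 hM0
  have hmm : m * m = M := Real.mul_self_sqrt hM0.le
  let U := Units.oneSub Y (hYr.trans_lt hr1)
  have hU : (U : F →L[ℝ] F) = 1 - Y := rfl
  have hU1 : (1 - Y) * (↑U⁻¹ : F →L[ℝ] F) = 1 := by rw [← hU]; exact U.mul_inv
  have hU2 : (↑U⁻¹ : F →L[ℝ] F) * (1 - Y) = 1 := by rw [← hU]; exact U.inv_mul
  refine ⟨m • (1 - Y), m⁻¹ • (↑U⁻¹ : F →L[ℝ] F), m * (1 - r), by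
    have : 0 < 1 - r := by linarith
    positivity, ?_, ?_, ?_, ?_, ?_, ?_, ?_⟩
  · intro x y
    simp only [sub_apply, one_apply_eq_self, smul_apply, inner_sub_left,
      inner_sub_right, real_inner_smul_left, real_inner_smul_right, hYs]
  · have e : (1 - Y) * (1 - Y) = M⁻¹ • A := by
      have : (1 - Y) * (1 - Y) = 1 - ((2 : ℝ) • Y - Y * Y) := by
        rw [two_smul]; noncomm_ring
      rw [this, hYe, hKdef]
      abel
    rw [smul_mul_smul_comm, e, hmm, smul_smul, mul_inv_cancel₀ hM0.ne', one_smul]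
  · rw [smul_mul_smul_comm, mul_inv_cancel₀ hm0.ne', one_smul, hU1]
  · rw [smul_mul_smul_comm, inv_mul_cancel₀ hm0.ne', one_smul, hU2]
  · intro x
    simp only [sub_apply, one_apply_eq_self, smul_apply, inner_sub_left,
      real_inner_smul_left, real_inner_self_eq_norm_sq]
    have h1 : inner ℝ (Y x) x ≤ r * ‖x‖ ^ 2 := by
      have h2 := (real_inner_le_norm (Y x) x).trans
          (mul_le_mul_of_nonneg_right (Y.le_opNorm x) (norm_nonneg x))
      have h3 : ‖Y‖ * ‖x‖ * ‖x‖ ≤ r * ‖x‖ * ‖x‖ := by gcongr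
      nlinarith
    rw [mul_assoc]
    refine mul_le_mul_of_nonneg_left ?_ hm0.le
    linarith
  · intro D hD
    have : D * K = K * D := by
      simp only [hKdef, mul_sub, sub_mul, mul_one, one_mul, mul_smul_comm, smul_mul_assoc, hD]
    rw [mul_smul_comm, smul_mul_assoc, mul_sub, sub_mul, hYc D this, mul_one, one_mul]
  · intro S hS hAS x hx
    have hKS : ∀ x ∈ S, K x ∈ S := by
      intro x hx
      simp only [hKdef, sub_apply, one_apply_eq_self, smul_apply]
      exact S.sub_mem hx (S.smul_mem _ (hAS x hx))
    simp only [sub_apply, one_apply_eq_self, smul_apply]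
    exact S.smul_mem _ (S.sub_mem hx (hYi S hS hKS x hx))

/-- Splitting of an invertible symmetric operator into its positive and negative part. -/
theorem exists_spectral_splitting {T : F →L[ℝ] F}
    (hT : ∀ x y, inner ℝ (T x) y = inner ℝ x (T y)) {c : ℝ} (hc : 0 < c)
    (hbelow : ∀ x, c * ‖x‖ ≤ ‖T x‖) :
    ∃ (S₁ S₂ : Submodule ℝ F) (κ : ℝ), 0 < κ ∧ IsCompl S₁ S₂ ∧
      (∀ x ∈ S₁, ∀ y ∈ S₂, inner ℝ x y = 0 ∧ inner ℝ (T x) y = 0) ∧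
      (∀ x ∈ S₁, κ * ‖x‖ ^ 2 ≤ inner ℝ (T x) x) ∧ (∀ x ∈ S₂, inner ℝ (T x) x ≤ - (κ * ‖x‖ ^ 2)) ∧
      ∀ S : Submodule ℝ F, IsClosed (S : Set F) → (∀ x ∈ S, T x ∈ S) →
        ((∀ x ∈ S, 0 ≤ inner ℝ (T x) x) → S ≤ S₁) ∧
        ((∀ x ∈ S, inner ℝ (T x) x ≤ 0) → S ≤ S₂) := by
  -- `P` is the absolute value of `T`. The summands are the sets where `T = P` and where `T = -P`,
  -- with projections `P⁻¹(P ± T)/2`.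
  obtain ⟨P, P', κ, hκ, hPs, hPP, hP1, hP2, hPpos, hPc, hPi⟩ :=
    exists_sqrt (A := T * T) (fun x y => by simp only [mul_apply_eq_comp, hT])
      (c := c ^ 2) (by positivity) (fun x => by
        rw [mul_apply_eq_comp, hT, real_inner_self_eq_norm_sq, ← mul_pow]
        gcongr
        exact hbelow x)
  have hTP : T * P = P * T := hPc T (mul_assoc _ _ _).symm
  have hTP' : ∀ x, T (P x) = P (T x) := fun x => congrArg (fun D : F →L[ℝ] F => D x) hTP
  have hPPx : ∀ x, P (P x) = T (T x) := fun x => congrArg (fun D : F →L[ℝ] F => D x) hPP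
  have hP1x : ∀ x, P (P' x) = x := fun x => congrArg (fun D : F →L[ℝ] F => D x) hP1
  have hP2x : ∀ x, P' (P x) = x := fun x => congrArg (fun D : F →L[ℝ] F => D x) hP2
  have hinj : ∀ x, P x = 0 → x = 0 := fun x hx => by rw [← hP2x x, hx, map_zero]
  have hTP'x : ∀ x, T (P' x) = P' (T x) := fun x => by
    rw [← hP2x (T (P' x)), ← hTP', hP1x]
  refine ⟨LinearMap.ker ((P - T : F →L[ℝ] F) : F →ₗ[ℝ] F),
    LinearMap.ker ((P + T : F →L[ℝ] F) : F →ₗ[ℝ] F), κ, hκ, ?_, ?_, ?_, ?_, ?_⟩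
  · constructor
    · rw [Submodule.disjoint_def]
      intro x h1 h2
      simp only [LinearMap.mem_ker, ContinuousLinearMap.coe_coe, sub_apply, add_apply] at h1 h2
      refine hinj x ?_
      have h3 : (2 : ℝ) • P x = (P x - T x) + (P x + T x) := by rw [two_smul]; abel
      rw [h1, h2, add_zero] at h3
      simpa using h3
    · rw [codisjoint_iff, Submodule.eq_top_iff']
      intro x
      rw [Submodule.mem_sup]
      refine ⟨(1 / 2 : ℝ) • P' (P x + T x), ?_, (1 / 2 : ℝ) • P' (P x - T x), ?_, ?_⟩
      · simp only [LinearMap.mem_ker, ContinuousLinearMap.coe_coe, sub_apply, map_smul]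
        rw [hP1x, hTP'x, map_add, hTP', ← hPPx, ← map_add, hP2x]
        simp [add_comm]
      · simp only [LinearMap.mem_ker, ContinuousLinearMap.coe_coe, add_apply, map_smul]
        rw [hP1x, hTP'x, map_sub, hTP', ← hPPx, ← map_sub, hP2x]
        simp
      · rw [← smul_add, ← map_add]
        have : P x + T x + (P x - T x) = (2 : ℝ) • P x := by rw [two_smul]; abel
        rw [this, map_smul, hP2x, smul_smul]
        norm_num
  · intro x h1 y h2
    simp only [LinearMap.mem_ker, ContinuousLinearMap.coe_coe, sub_apply, add_apply] at h1 h2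
    have key : ∀ x', P x' = T x' → inner ℝ (P x') y = 0 := by
      intro x' hx'
      have e1 : inner ℝ (P x') y = - inner ℝ (P x') y := by
        nth_rw 1 [hx']
        rw [hT, eq_neg_of_add_eq_zero_right h2, inner_neg_right, hPs]
      linarith
    have hx := sub_eq_zero.1 h1
    refine ⟨?_, by rw [← hx]; exact key x hx⟩
    have := key (P' x) (by rw [hTP'x, ← hx, hP1x, hP2x])
    rwa [hP1x] at this
  · intro x h1
    simp only [LinearMap.mem_ker, ContinuousLinearMap.coe_coe, sub_apply] at h1
    rw [← sub_eq_zero.1 h1]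
    exact hPpos x
  · intro x h1
    simp only [LinearMap.mem_ker, ContinuousLinearMap.coe_coe, add_apply] at h1
    rw [eq_neg_of_add_eq_zero_right h1, inner_neg_left]
    exact neg_le_neg (hPpos x)
  · intro S hS hTS
    have hPS : ∀ x ∈ S, P x ∈ S := hPi S hS fun x hx => hTS _ (hTS x hx)
    constructor
    · intro hpos x hx
      simp only [LinearMap.mem_ker, ContinuousLinearMap.coe_coe, sub_apply]
      -- The component of `x` on the wrong side, up to the factor `P`. It stays in `S` and satisfies
      -- `T w = -P w`, so nonnegativity of `T` on `S` and positivity of `P` force `w = 0`.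
      set w := P x - T x with hw
      have hwS : w ∈ S := S.sub_mem (hPS x hx) (hTS x hx)
      have hTw : T w = - P w := by
        rw [hw, map_sub, map_sub, hTP', hPPx]; abel
      have h1 := hpos w hwS
      rw [hTw, inner_neg_left] at h1
      have h2 := hPpos w
      have h3 : κ * ‖w‖ ^ 2 ≤ 0 := by linarith
      have h4 : ‖w‖ ^ 2 ≤ 0 := by
        by_contra h
        push Not at h
        nlinarith
      exact norm_eq_zero.1 (pow_eq_zero_iff two_ne_zero |>.1 (le_antisymm h4 (sq_nonneg _)))
    · intro hneg x hx
      simp only [LinearMap.mem_ker, ContinuousLinearMap.coe_coe, add_apply]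
      set w := P x + T x with hw
      have hwS : w ∈ S := S.add_mem (hPS x hx) (hTS x hx)
      have hTw : T w = P w := by
        rw [hw, map_add, map_add, hTP', hPPx]; abel
      have h1 := hneg w hwS
      rw [hTw] at h1
      have h2 := hPpos w
      have h3 : κ * ‖w‖ ^ 2 ≤ 0 := by linarith
      have h4 : ‖w‖ ^ 2 ≤ 0 := by
        by_contra h
        push Not at h
        nlinarith
      exact norm_eq_zero.1 (pow_eq_zero_iff two_ne_zero |>.1 (le_antisymm h4 (sq_nonneg _)))

theorem exists_bounded_below_of_bijective {T : F →L[ℝ] F} (hT : Function.Bijective T) :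
    ∃ c : ℝ, 0 < c ∧ ∀ x, c * ‖x‖ ≤ ‖T x‖ := by
  let e := ContinuousLinearEquiv.ofBijective T (LinearMap.ker_eq_bot.2 hT.1)
    (LinearMap.range_eq_top.2 hT.2)
  refine ⟨(‖(e.symm : F →L[ℝ] F)‖ + 1)⁻¹, by positivity, fun x => ?_⟩
  rw [inv_mul_le_iff₀ (by positivity)]
  have h1 : ‖x‖ ≤ ‖(e.symm : F →L[ℝ] F)‖ * ‖T x‖ := by
    have := (e.symm : F →L[ℝ] F).le_opNorm (T x)
    have h2 : e.symm (T x) = x := e.symm_apply_apply x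
    rwa [ContinuousLinearEquiv.coe_coe, h2] at this
  nlinarith [norm_nonneg (T x)]

end Abstract

end

section

variable {N : ℕ}

/-! ### The spectral decomposition of `H¹` -/

theorem isReducing_symm {V : Euc N → ℝ} {S T : Submodule ℝ (H1 N)} (h : IsCompl S T)
    (ho : ∀ u ∈ S, ∀ v ∈ T, inner ℝ u.toL2 v.toL2 = 0 ∧ bform V 0 u v = 0) : IsReducing V T :=
  ⟨S, h.symm, fun u hu v hv => by
    rw [real_inner_comm, bform_comm]; exact ho v hv u hu⟩

/-- Simultaneous splitting of two symmetric forms: `L` is invertible and `L + Λ K` is positive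
definite. -/
theorem exists_form_splitting {F : Type*} [NormedAddCommGroup F] [InnerProductSpace ℝ F]
    [CompleteSpace F] {L K : F →L[ℝ] F} (hLs : ∀ x y, inner ℝ (L x) y = inner ℝ x (L y))
    (hKs : ∀ x y, inner ℝ (K x) y = inner ℝ x (K y)) (hLbij : Function.Bijective L)
    {Λ : ℝ} (hΛ : 0 < Λ) (hgard : ∀ x, ‖x‖ ^ 2 ≤ inner ℝ (L x) x + Λ * inner ℝ (K x) x) :
    ∃ (Y₁ Y₂ : Submodule ℝ F) (κ : ℝ), 0 < κ ∧ IsCompl Y₁ Y₂ ∧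
      (∀ x ∈ Y₁, ∀ y ∈ Y₂, inner ℝ (K x) y = 0 ∧ inner ℝ (L x) y = 0) ∧
      (∀ x ∈ Y₁, κ * ‖x‖ ^ 2 ≤ inner ℝ (L x) x) ∧ (∀ x ∈ Y₂, inner ℝ (L x) x ≤ - (κ * ‖x‖ ^ 2)) ∧
      ∀ S S' : Submodule ℝ F, IsCompl S S' →
        (∀ x ∈ S, ∀ y ∈ S', inner ℝ (K x) y = 0 ∧ inner ℝ (L x) y = 0) →
        ((∀ x ∈ S, 0 ≤ inner ℝ (L x) x) → S ≤ Y₁) ∧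
        ((∀ x ∈ S, inner ℝ (L x) x ≤ 0) → S ≤ Y₂) := by
  set A : F →L[ℝ] F := L + Λ • K with hAdef
  have hA : ∀ u v, inner ℝ (A u) v = inner ℝ (L u) v + Λ * inner ℝ (K u) v := by
    intro u v
    rw [hAdef, add_apply, smul_apply, inner_add_left, real_inner_smul_left]
  have hAs : ∀ u v, inner ℝ (A u) v = inner ℝ u (A v) := by
    intro u v
    rw [hA, real_inner_comm (A v), hA, hLs, hKs, real_inner_comm u, real_inner_comm u]
  -- The substitution `x = Q u` with `Q² = L + ΛK` turns the form of `L + ΛK` into the inner product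
  -- and `L` into the bounded symmetric `T = Q⁻¹ L Q⁻¹`. Orthogonality for both `L` and `K` then
  -- becomes ordinary orthogonality together with `T`-orthogonality.
  obtain ⟨Q, Q', -, -, hQs, hQQ, hQ1, hQ2, -, -, -⟩ := exists_sqrt hAs one_pos (fun u => by
    rw [hA, one_mul]; exact hgard u)
  have hQ1x : ∀ x, Q (Q' x) = x := fun x => congrArg (fun D : F →L[ℝ] F => D x) hQ1
  have hQ2x : ∀ x, Q' (Q x) = x := fun x => congrArg (fun D : F →L[ℝ] F => D x) hQ2
  have hQQx : ∀ x, Q (Q x) = A x := fun x => congrArg (fun D : F →L[ℝ] F => D x) hQQ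
  have hQ's : ∀ x y, inner ℝ (Q' x) y = inner ℝ x (Q' y) := by
    intro x y
    rw [← hQ1x y, ← hQs, hQ1x, hQ2x]
  have hQinner : ∀ u v, inner ℝ (Q u) (Q v) = inner ℝ (L u) v + Λ * inner ℝ (K u) v := by
    intro u v
    rw [← hQs, hQQx, hA]
  set T : F →L[ℝ] F := Q' * L * Q' with hT
  have hTx : ∀ x, T x = Q' (L (Q' x)) := fun x => rfl
  have hTinner : ∀ x y, inner ℝ (T x) y = inner ℝ (L (Q' x)) (Q' y) := by
    intro x y
    rw [hTx, hQ's]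
  have hQ'bij : Function.Bijective Q' :=
    ⟨Function.LeftInverse.injective hQ1x, Function.RightInverse.surjective hQ2x⟩
  have hTbij : Function.Bijective T := (hQ'bij.comp hLbij).comp hQ'bij
  obtain ⟨c, hc, hbelow⟩ := exists_bounded_below_of_bijective hTbij
  obtain ⟨S₁, S₂, κ, hκ, hcompl, horth, hp, hn, hmax⟩ := exists_spectral_splitting (T := T)
    (fun x y => by rw [hTinner, hLs, real_inner_comm, ← hTinner, real_inner_comm]) hc hbelow
  let e : F ≃ₗ[ℝ] F := LinearEquiv.ofLinearMap (Q' : F →ₗ[ℝ] F) (Q : F →ₗ[ℝ] F)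
    (LinearMap.ext hQ2x) (LinearMap.ext hQ1x)
  have hmem : ∀ (S : Submodule ℝ F) u, u ∈ S.map (e : F →ₗ[ℝ] F) ↔ Q u ∈ S := by
    intro S u
    constructor
    · rintro ⟨x, hx, rfl⟩
      change Q (Q' x) ∈ S
      rwa [hQ1x]
    · intro h
      exact ⟨Q u, h, hQ2x u⟩
  have hQn : ∀ u, ‖u‖ ^ 2 ≤ ‖Q u‖ ^ 2 := by
    intro u
    rw [← real_inner_self_eq_norm_sq (Q u), hQinner]
    exact hgard u
  refine ⟨S₁.map (e : F →ₗ[ℝ] F), S₂.map (e : F →ₗ[ℝ] F), κ, hκ,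
    hcompl.map (Submodule.orderIsoMapComap e), ?_, ?_, ?_, ?_⟩
  · intro u hu v hv
    rw [hmem] at hu hv
    obtain ⟨h1, h2⟩ := horth _ hu _ hv
    rw [hTinner, hQ2x, hQ2x] at h2
    rw [hQinner, h2, zero_add] at h1
    exact ⟨(mul_eq_zero.1 h1).resolve_left hΛ.ne', h2⟩
  · intro u hu
    rw [hmem] at hu
    have h1 := hp _ hu
    rw [hTinner, hQ2x] at h1
    refine le_trans ?_ h1
    nlinarith [hQn u]
  · intro u hu
    rw [hmem] at hu
    have h1 := hn _ hu
    rw [hTinner, hQ2x] at h1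
    refine h1.trans (neg_le_neg ?_)
    nlinarith [hQn u]
  · intro S S' hSS' ho
    set W := S.comap (e : F →ₗ[ℝ] F) with hW
    have hWmem : ∀ x, x ∈ W ↔ Q' x ∈ S := fun x => Iff.rfl
    -- In the new variable a reducing subspace is exactly the orthogonal complement of the image of
    -- its partner. Hence it is automatically closed and `T`-invariant, as the maximality statement
    -- requires.
    have hWorth : ∀ x, x ∈ W ↔ ∀ v ∈ S', inner ℝ x (Q v) = 0 := by
      intro x
      constructor
      · intro hx v hv
        rw [hWmem] at hx
        obtain ⟨h1, h2⟩ := ho _ hx v hv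
        rw [← hQ1x x, hQinner, h1, h2]; simp
      · intro h
        rw [hWmem]
        obtain ⟨a, ha, b, hb, hab⟩ := Submodule.mem_sup.1
          ((codisjoint_iff.1 hSS'.codisjoint).ge (Submodule.mem_top (x := Q' x)))
        have h1 := h b hb
        obtain ⟨h2, h3⟩ := ho a ha b hb
        rw [← hQ1x x, hQinner, ← hab, map_add, map_add, inner_add_left, inner_add_left, h2, h3,
          zero_add, zero_add] at h1
        have h4 := hgard b
        rw [h1] at h4
        have h5 : b = 0 :=
          norm_eq_zero.1 (pow_eq_zero_iff two_ne_zero |>.1 (le_antisymm h4 (sq_nonneg _)))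
        rw [← hab, h5, add_zero]
        exact ha
    have hWc : IsClosed (W : Set F) := by
      have : (W : Set F) = ⋂ v ∈ S', {x | inner ℝ x (Q v) = 0} := by
        ext x
        simp only [SetLike.mem_coe, mem_iInter]
        exact hWorth x
      rw [this]
      exact isClosed_biInter fun v _ => isClosed_eq (by fun_prop) continuous_const
    have hWT : ∀ x ∈ W, T x ∈ W := by
      intro x hx
      rw [hWorth]
      intro v hv
      rw [hTinner, hQ2x]
      exact (ho _ ((hWmem x).1 hx) v hv).2
    obtain ⟨m1, m2⟩ := hmax W hWc hWT
    constructor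
    · intro h u hu
      rw [hmem]
      refine m1 (fun x hx => ?_) ?_
      · rw [hTinner]; exact h _ hx
      · rw [hWmem, hQ2x]; exact hu
    · intro h u hu
      rw [hmem]
      refine m2 (fun x hx => ?_) ?_
      · rw [hTinner]; exact h _ hx
      · rw [hWmem, hQ2x]; exact hu

theorem exists_schrodinger_operator {V : Euc N → ℝ} (hVb : MemLp V ⊤ volume) :
    ∃ L : H1 N →L[ℝ] H1 N, ∀ u v, inner ℝ (L u) v = bform V 0 u v :=
  ⟨InnerProductSpace.continuousLinearMapOfBilin (𝕜 := ℝ) (schrL hVb), fun u v =>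
    InnerProductSpace.continuousLinearMapOfBilin_apply (schrL hVb) u v⟩

theorem exists_gram_of_map {F G : Type*} [NormedAddCommGroup F] [InnerProductSpace ℝ F]
    [CompleteSpace F] [NormedAddCommGroup G] [InnerProductSpace ℝ G] [CompleteSpace G]
    (T : F →L[ℝ] G) : ∃ K : F →L[ℝ] F, ∀ u v, inner ℝ (K u) v = inner ℝ (T u) (T v) :=
  ⟨(ContinuousLinearMap.adjoint T).comp T, fun u v =>
    ContinuousLinearMap.adjoint_inner_left T v (T u)⟩

theorem exists_gram_operator (N : ℕ) : ∃ K : H1 N →L[ℝ] H1 N, ∀ u v,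
    inner ℝ (K u) v = inner ℝ (toL2L N u) (toL2L N v) :=
  exists_gram_of_map (toL2L N)

theorem exists_resolvent_zero {V : Euc N → ℝ} (hV : CondV V) : ∃ R : L2 N →L[ℝ] L2 N,
    ∀ u h : L2 N, IsSchrodingerImage V u h ↔ R h = u := by
  have h0 := hV.gap
  rw [schrodingerSpectrum, mem_ofPred_eq, not_not] at h0
  obtain ⟨R, hR⟩ := h0
  refine ⟨R, fun u h => ?_⟩
  rw [← hR, zero_smul, add_zero]

/-- A bounded positive definite symmetric operator is onto. -/
theorem surjective_of_coercive {F : Type*} [NormedAddCommGroup F] [InnerProductSpace ℝ F]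
    [CompleteSpace F] {A : F →L[ℝ] F} (hs : ∀ x y, inner ℝ (A x) y = inner ℝ x (A y))
    (hc : ∀ x, ‖x‖ ^ 2 ≤ inner ℝ (A x) x) (w : F) : ∃ x, A x = w := by
  obtain ⟨Q, Q', -, -, -, hQQ, hQ1, -, -, -, -⟩ := exists_sqrt hs one_pos (fun u => by
    rw [one_mul]; exact hc u)
  have hQ1x : ∀ x, Q (Q' x) = x := fun x => congrArg (fun D : F →L[ℝ] F => D x) hQ1
  refine ⟨Q' (Q' w), ?_⟩
  rw [← hQQ, mul_apply_eq_comp, hQ1x, hQ1x]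

/-- The spectral gap gives an inverse on `L²` only. To reach an arbitrary right-hand side `w` in
`H¹`, solve the coercive problem `(L + ΛK) y = w` and correct `y` by the solution `ζ` of `(-Δ+V) ζ =
Λ y`, whose datum lies in `L²`. -/
theorem bijective_schrodinger_operator {V : Euc N → ℝ} (hV : CondV V) {L : H1 N →L[ℝ] H1 N}
    (hL : ∀ u v, inner ℝ (L u) v = bform V 0 u v) : Function.Bijective L := by
  obtain ⟨R, hR⟩ := exists_resolvent_zero hV
  constructor
  · rw [injective_iff_map_eq_zero]
    intro u hu
    have h1 : IsSchrodingerImage V (toL2L N u) 0 := by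
      refine ⟨u, rfl, fun φ => ?_⟩
      rw [integral_mul_toL2L, inner_zero_left, ← hL, hu, inner_zero_left]
    rw [hR, map_zero] at h1
    exact toL2L_injective (by rw [← h1, map_zero])
  · intro w
    obtain ⟨Λ, hΛ, hgard⟩ := exists_garding hV.bounded
    obtain ⟨K, hK⟩ := exists_gram_operator N
    have hA : ∀ u v, inner ℝ ((L + Λ • K) u) v =
        bform V 0 u v + Λ * inner ℝ (toL2L N u) (toL2L N v) := fun u v => by
      rw [add_apply, smul_apply, inner_add_left, real_inner_smul_left, hL, hK]
    obtain ⟨y, hy⟩ := surjective_of_coercive (A := L + Λ • K)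
      (fun u v => by
        rw [hA, real_inner_comm ((L + Λ • K) v), hA, bform_comm, real_inner_comm (toL2L N v)])
      (fun u => by
        rw [hA, real_inner_self_eq_norm_sq]; exact hgard u) w
    obtain ⟨ζ, -, hζ⟩ := (hR (R (Λ • toL2L N y)) (Λ • toL2L N y)).2 rfl
    refine ⟨y + ζ, ext_inner_right ℝ fun φ => ?_⟩
    rw [map_add, inner_add_left, hL ζ, hζ, integral_mul_toL2L, real_inner_smul_left, ← hy, hA, hL]

/-- `H¹ = X⁺ ⊕ X⁻`, orthogonally in `L²` and for `B_0`, and `B_0` is coercive on both summands. -/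
theorem spectral_split {V : Euc N → ℝ} (hV : CondV V) :
    IsCompl (Xplus V) (Xminus V) ∧
    (∀ u ∈ Xplus V, ∀ v ∈ Xminus V,
      inner ℝ (toL2L N u) (toL2L N v) = 0 ∧ bform V 0 u v = 0) ∧
    ∃ c : ℝ, 0 < c ∧ (∀ u ∈ Xplus V, c * ‖u‖ ^ 2 ≤ bform V 0 u u) ∧
      ∀ u ∈ Xminus V, bform V 0 u u ≤ - (c * ‖u‖ ^ 2) := by
  obtain ⟨Λ, hΛ, hgard⟩ := exists_garding hV.bounded
  obtain ⟨L, hL⟩ := exists_schrodinger_operator hV.bounded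
  obtain ⟨K, hK⟩ := exists_gram_operator N
  have hgardA : ∀ x, ‖x‖ ^ 2 ≤ inner ℝ (L x) x + Λ * inner ℝ (K x) x := fun x => by
    rw [hL, hK, real_inner_self_eq_norm_sq]
    exact hgard x
  have hLs : ∀ x y, inner ℝ (L x) y = inner ℝ x (L y) := fun x y => by
    rw [hL, real_inner_comm (L y), hL, bform_comm]
  have hKs : ∀ x y, inner ℝ (K x) y = inner ℝ x (K y) := fun x y => by
    rw [hK, real_inner_comm (K y), hK, real_inner_comm (toL2L N y)]
  obtain ⟨Y₁, Y₂, κ, hκ, hYc, hYo, hpos, hneg, hmax⟩ :=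
    exists_form_splitting hLs hKs (bijective_schrodinger_operator hV hL) hΛ hgardA
  have hYo' : ∀ u ∈ Y₁, ∀ v ∈ Y₂, inner ℝ u.toL2 v.toL2 = 0 ∧ bform V 0 u v = 0 :=
    fun u hu v hv => by
      have := hYo u hu v hv
      rwa [hL, hK] at this
  have hpos' : ∀ u ∈ Y₁, κ * ‖u‖ ^ 2 ≤ bform V 0 u u := fun u hu => by
    have := hpos u hu
    rwa [hL] at this
  have hneg' : ∀ u ∈ Y₂, bform V 0 u u ≤ - (κ * ‖u‖ ^ 2) := fun u hu => by
    have := hneg u hu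
    rwa [hL] at this
  have hmax' : ∀ S S' : Submodule ℝ (H1 N), IsCompl S S' →
      (∀ u ∈ S, ∀ v ∈ S', inner ℝ u.toL2 v.toL2 = 0 ∧ bform V 0 u v = 0) →
      ((∀ u ∈ S, 0 ≤ bform V 0 u u) → S ≤ Y₁) ∧ ((∀ u ∈ S, bform V 0 u u ≤ 0) → S ≤ Y₂) := by
    intro S S' h1 h2
    obtain ⟨h3, h4⟩ := hmax S S' h1 fun x hx y hy => by
      rw [hL, hK]; exact h2 x hx y hy
    exact ⟨fun h => h3 fun x hx => by rw [hL]; exact h x hx,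
      fun h => h4 fun x hx => by rw [hL]; exact h x hx⟩
  -- `Y₁` is itself one of the subspaces in the supremum, and by maximality it contains all the
  -- others.
  have hXp : Xplus V = Y₁ := by
    refine le_antisymm (sSup_le ?_) (le_sSup ⟨⟨Y₂, hYc, hYo'⟩, fun u hu => ?_⟩)
    · rintro S ⟨⟨S', hS1, hS2⟩, hS3⟩
      exact (hmax' S S' hS1 hS2).1 hS3
    · exact le_trans (by positivity) (hpos' u hu)
  have hXm : Xminus V = Y₂ := by
    refine le_antisymm (sSup_le ?_) (le_sSup ⟨isReducing_symm hYc hYo', fun u hu => ?_⟩)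
    · rintro S ⟨⟨S', hS1, hS2⟩, hS3⟩
      exact (hmax' S S' hS1 hS2).2 hS3
    · exact (hneg' u hu).trans (neg_nonpos.2 (by positivity))
  rw [hXp, hXm]
  exact ⟨hYc, hYo', κ, hκ, hpos', hneg'⟩

/-- Lattice translations as linear automorphisms of `H¹`. -/
def shiftEquiv (y : Euc N) : H1 N ≃ₗ[ℝ] H1 N :=
  LinearEquiv.ofLinearMap (shift y).toLinearMap (shift (-y)).toLinearMap
    (LinearMap.ext fun u => by
      change shift y (shift (-y) u) = u
      rw [shift_shift, add_neg_cancel, shift_zero])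
    (LinearMap.ext fun u => by
      change shift (-y) (shift y u) = u
      rw [shift_shift, neg_add_cancel, shift_zero])

theorem isReducing_map_shift {V : Euc N → ℝ} {z : Fin N → ℤ}
    (hp : ∀ᵐ x, V (x + latticePoint z) = V x) {S : Submodule ℝ (H1 N)} (hS : IsReducing V S) :
    IsReducing V (S.map (shiftEquiv (latticePoint z) : H1 N →ₗ[ℝ] H1 N)) := by
  obtain ⟨T, hST, ho⟩ := hS
  refine ⟨T.map (shiftEquiv (latticePoint z) : H1 N →ₗ[ℝ] H1 N),
    hST.map (Submodule.orderIsoMapComap (shiftEquiv (latticePoint z))), ?_⟩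
  rintro _ ⟨u, hu, rfl⟩ _ ⟨v, hv, rfl⟩
  have h1 := inner_toL2L_shift (latticePoint z) u v
  have h2 := bform_shift hp u v
  obtain ⟨h3, h4⟩ := ho u hu v hv
  exact ⟨h1.trans h3, h2.trans h4⟩

/-- A lattice translation permutes the subspaces over which the supremum is taken, because it
preserves the `L²` product and `B_0`. -/
theorem shift_mem_Xplus {V : Euc N → ℝ} (hV : CondV V) (z : Fin N → ℤ) {u : H1 N}
    (hu : u ∈ Xplus V) : shift (latticePoint z) u ∈ Xplus V := by
  have : (Xplus V).map (shiftEquiv (latticePoint z) : H1 N →ₗ[ℝ] H1 N) ≤ Xplus V := by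
    rw [Xplus, sSup_eq_iSup, Submodule.map_iSup]
    refine iSup_le fun S => ?_
    rw [Submodule.map_iSup]
    refine iSup_le fun hS => ?_
    rw [← sSup_eq_iSup]
    refine le_sSup ⟨isReducing_map_shift (hV.periodic z) hS.1, ?_⟩
    rintro _ ⟨v, hv, rfl⟩
    exact (bform_shift (hV.periodic z) v v).ge.trans' (hS.2 v hv)
  exact this ⟨u, hu, rfl⟩

theorem shift_mem_Xminus {V : Euc N → ℝ} (hV : CondV V) (z : Fin N → ℤ) {u : H1 N}
    (hu : u ∈ Xminus V) : shift (latticePoint z) u ∈ Xminus V := by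
  have : (Xminus V).map (shiftEquiv (latticePoint z) : H1 N →ₗ[ℝ] H1 N) ≤ Xminus V := by
    rw [Xminus, sSup_eq_iSup, Submodule.map_iSup]
    refine iSup_le fun S => ?_
    rw [Submodule.map_iSup]
    refine iSup_le fun hS => ?_
    rw [← sSup_eq_iSup]
    refine le_sSup ⟨isReducing_map_shift (hV.periodic z) hS.1, ?_⟩
    rintro _ ⟨v, hv, rfl⟩
    exact (bform_shift (hV.periodic z) v v).le.trans (hS.2 v hv)
  exact this ⟨u, hu, rfl⟩

/-- If the spectrum is positive, so is the form `B_0`. -/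
theorem Xminus_eq_bot {V : Euc N → ℝ} (hV : CondV V) (hpos : 0 < sInf (schrodingerSpectrum V)) :
    Xminus V = ⊥ := by
  have hVb := hV.bounded
  obtain ⟨-, -, c, hc, -, hneg⟩ := spectral_split hV
  obtain ⟨Λ, hΛ, hgard⟩ := exists_garding hVb
  rw [Submodule.eq_bot_iff]
  intro w hw
  by_contra hw0
  -- The real infimum of a set unbounded below is `0` by convention, so the assumption `0 < sInf`
  -- already gives boundedness from below.
  have hbdd : BddBelow (schrodingerSpectrum V) := by
    by_contra h
    rw [Real.sInf_of_not_bddBelow h] at hpos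
    exact lt_irrefl _ hpos
  have hn0 : ∀ u : H1 N, u ≠ 0 → 0 < ‖toL2L N u‖ ^ 2 := fun u hu => by
    have : toL2L N u ≠ 0 := fun h => hu (toL2L_injective (by rw [h, map_zero]))
    positivity
  set Q : Set ℝ := (fun u : H1 N => bform V 0 u u / ‖toL2L N u‖ ^ 2) '' {u | u ≠ 0} with hQ
  have hQne : Q.Nonempty := ⟨_, w, hw0, rfl⟩
  have hQb : BddBelow Q := by
    refine ⟨-Λ, ?_⟩
    rintro _ ⟨u, hu, rfl⟩
    simp only
    rw [le_div_iff₀ (hn0 u hu)]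
    nlinarith [hgard u, sq_nonneg ‖u‖]
  -- The bottom of the Rayleigh quotients. A nonzero element of `X⁻` makes it negative, and it is
  -- shown to lie in the spectrum, against the positivity of the infimum.
  set l := sInf Q with hl
  have hlb : ∀ u : H1 N, l * ‖toL2L N u‖ ^ 2 ≤ bform V 0 u u := by
    intro u
    rcases eq_or_ne u 0 with rfl | hu
    · rw [← schrL_apply hVb]; simp
    · rw [← le_div_iff₀ (hn0 u hu)]
      exact csInf_le hQb ⟨u, hu, rfl⟩
  have hlneg : l < 0 := by
    refine (csInf_le hQb ⟨w, hw0, rfl⟩).trans_lt ?_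
    refine div_neg_of_neg_of_pos ((hneg w hw).trans_lt ?_) (hn0 w hw0)
    have : 0 < ‖w‖ ^ 2 := by have := norm_pos_iff.2 hw0; positivity
    nlinarith
  have hmem : l ∈ schrodingerSpectrum V := by
    rw [schrodingerSpectrum, mem_ofPred_eq]
    rintro ⟨R, hR⟩
    -- the form `B_0 - l` is bounded below by a positive multiple of the norm
    have key : ∀ φ : H1 N, ‖toL2L N φ‖ ^ 2 ≤ ‖R‖ * (bform V 0 φ φ - l * ‖toL2L N φ‖ ^ 2) := by
      intro φ
      set h := toL2L N φ with hh
      obtain ⟨ζ, hζ1, hζ⟩ := (hR (R h) h).2 rfl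
      have hb : ∀ ψ, bform V 0 ζ ψ - l * inner ℝ (toL2L N ζ) (toL2L N ψ) =
          inner ℝ h (toL2L N ψ) := by
        intro ψ
        rw [hζ ψ, integral_mul_toL2L, inner_add_left, real_inner_smul_left, ← hζ1]
        simp only [toL2L_apply]
        ring
      -- Cauchy–Schwarz for the nonnegative form `B_0 - l⟨·,·⟩`, obtained from the discriminant
      -- along `ζ - tφ`. Here `ζ = R h` represents the pairing with `h`, so the mixed term is `‖h‖²`
      -- and the remaining one is at most `‖R‖ ‖h‖²`.
      have hq : ∀ t : ℝ, 0 ≤ (bform V 0 φ φ - l * ‖h‖ ^ 2) * (t * t) +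
          (-2 * ‖h‖ ^ 2) * t + inner ℝ h (toL2L N ζ) := by
        intro t
        have h1 := hlb (ζ - t • φ)
        rw [← schrL_apply hVb, ← real_inner_self_eq_norm_sq] at h1
        simp only [map_sub, map_smul, sub_apply, smul_apply, inner_sub_left, inner_sub_right,
          real_inner_smul_left, real_inner_smul_right, smul_eq_mul, schrL_apply] at h1
        have h2 := hb ζ
        have h3 := hb φ
        rw [real_inner_self_eq_norm_sq, bform_comm V 0 φ ζ,
          real_inner_comm (toL2L N ζ) (toL2L N φ)] at h1
        rw [real_inner_self_eq_norm_sq] at h2 h3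
        rw [← hh, real_inner_self_eq_norm_sq] at h1
        have h3' : bform V 0 ζ φ = l * inner ℝ (toL2L N ζ) h + ‖h‖ ^ 2 := by linarith
        rw [h3'] at h1
        rw [← h2]
        linarith
      have hd := discrim_le_zero hq
      rw [discrim] at hd
      have hζ2 : inner ℝ h (toL2L N ζ) ≤ ‖R‖ * ‖h‖ ^ 2 := by
        rw [toL2L_apply, hζ1]
        refine (real_inner_le_norm _ _).trans ?_
        nlinarith [R.le_opNorm h, norm_nonneg h]
      have hb0 : 0 ≤ bform V 0 φ φ - l * ‖h‖ ^ 2 := sub_nonneg.2 (hlb φ)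
      by_cases hz : ‖h‖ ^ 2 = 0
      · rw [hz]; rw [hz] at hb0; exact mul_nonneg (norm_nonneg _) hb0
      · have hz' : 0 < ‖h‖ ^ 2 := lt_of_le_of_ne (sq_nonneg _) (Ne.symm hz)
        have h4 : ‖h‖ ^ 2 * ‖h‖ ^ 2 ≤ (bform V 0 φ φ - l * ‖h‖ ^ 2) * (‖R‖ * ‖h‖ ^ 2) := by
          have := mul_le_mul_of_nonneg_left hζ2 hb0
          nlinarith
        refine le_of_mul_le_mul_right ?_ hz'
        linarith
    -- The estimate `key` leaves a gap of order `‖R‖⁻¹` above `l`, which contradicts that `l` is an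
    -- infimum. Adding `1` covers `R = 0`.
    have hlt : l < l + (‖R‖ + 1)⁻¹ := by
      have : 0 < (‖R‖ + 1)⁻¹ := by positivity
      linarith
    obtain ⟨_, ⟨u, hu, rfl⟩, hq⟩ := exists_lt_of_csInf_lt hQne hlt
    simp only at hq
    have hu0 := hn0 u hu
    rw [div_lt_iff₀ hu0] at hq
    have h1 := key u
    have h2 : bform V 0 u u - l * ‖toL2L N u‖ ^ 2 < (‖R‖ + 1)⁻¹ * ‖toL2L N u‖ ^ 2 := by linarith
    have h3 : ‖R‖ * (bform V 0 u u - l * ‖toL2L N u‖ ^ 2) ≤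
        ‖R‖ * ((‖R‖ + 1)⁻¹ * ‖toL2L N u‖ ^ 2) := by gcongr
    have h4 : ‖R‖ * ((‖R‖ + 1)⁻¹ * ‖toL2L N u‖ ^ 2) < ‖toL2L N u‖ ^ 2 := by
      rw [← mul_assoc, ← div_eq_mul_inv]
      refine mul_lt_of_lt_one_left hu0 ?_
      rw [div_lt_one (by positivity)]
      linarith
    linarith
  have := csInf_le hbdd hmem
  linarith

end

section

variable {N : ℕ}

/-! ### Superposition of Carathéodory functions -/

/-- For simple `u` the composition is a finite sum of indicators; continuity in the second variable
passes to the limit of simple approximations. -/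
theorem aemeasurable_caratheodory {α : Type*} [MeasurableSpace α] {ν : Measure α}
    {f : α → ℝ → ℝ} (hm : ∀ s, AEMeasurable (fun x => f x s) ν)
    (hc : ∀ᵐ x ∂ν, Continuous (f x)) {u : α → ℝ} (hu : AEMeasurable u ν) :
    AEMeasurable (fun x => f x (u x)) ν := by
  set w := hu.mk u with hw
  have hwm : StronglyMeasurable w := hu.measurable_mk.stronglyMeasurable
  have hsimple : ∀ φ : SimpleFunc α ℝ, AEMeasurable (fun x => f x (φ x)) ν := by
    intro φ
    have : (fun x => f x (φ x)) =
        fun x => ∑ c ∈ φ.range, (φ ⁻¹' {c}).indicator (fun y => f y c) x := by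
      funext x
      rw [Finset.sum_eq_single (φ x)]
      · simp
      · intro c _ hcx
        rw [indicator_of_notMem]
        exact fun h => hcx h.symm
      · intro h
        exact absurd (φ.mem_range_self x) h
    rw [this]
    exact Finset.aemeasurable_fun_sum _ fun c _ => (hm c).indicator (φ.measurableSet_preimage _)
  have hlim : AEMeasurable (fun x => f x (w x)) ν := by
    refine aemeasurable_of_tendsto_metrizable_ae atTop (fun n => hsimple (hwm.approx n)) ?_
    filter_upwards [hc] with x hx
    exact (hx.tendsto _).comp (hwm.tendsto_approx x)
  refine hlim.congr ?_
  filter_upwards [hu.ae_eq_mk] with x hx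
  rw [hx]

/-- Treating the pair `(x,t)` as the parameter gives joint measurability of `f`, and Fubini then
gives measurability of the partial integral. -/
theorem aemeasurable_primitive {f : Euc N → ℝ → ℝ} (hf : CondF1 f) (s : ℝ) :
    AEMeasurable (fun x => primitive f x s) volume := by
  have key : ∀ S : Set ℝ, AEMeasurable (fun x => ∫ t in S, f x t) volume := by
    intro S
    have h1 : AEMeasurable (fun q : Euc N × ℝ => f q.1 q.2)
        ((volume : Measure (Euc N)).prod (volume.restrict S)) :=
      aemeasurable_caratheodory (f := fun (q : Euc N × ℝ) s => f q.1 s)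
        (fun s => (hf.measurable s).comp_fst)
        (Measure.quasiMeasurePreserving_fst.ae hf.continuous) measurable_snd.aemeasurable
    exact h1.aestronglyMeasurable.integral_prod_right'.aemeasurable
  simp only [primitive, intervalIntegral]
  exact (key _).sub (key _)

/-! ### Scalar nonlinearities -/

/-- A continuous scalar nonlinearity `g` with `g(s) = o(s)` at `0` and `g(s)/|s|` non-decreasing
on both half lines. -/
structure ScalarNonlin (g : ℝ → ℝ) : Prop where
  cont : Continuous g
  small : ∀ ε > 0, ∃ δ > 0, ∀ s : ℝ, |s| < δ → |g s| ≤ ε * |s|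
  mono : MonotoneOn (fun s => g s / |s|) (Iio 0) ∧ MonotoneOn (fun s => g s / |s|) (Ioi 0)

namespace ScalarNonlin

variable {g : ℝ → ℝ}

/-- The assumptions are invariant under this reflection, so statements on the negative half line
reduce to the positive one. -/
theorem reflect (hg : ScalarNonlin g) : ScalarNonlin (fun s => - g (-s)) := by
  refine ⟨by have := hg.cont; fun_prop, fun ε hε => ?_, ?_, ?_⟩
  · obtain ⟨δ, hδ, h⟩ := hg.small ε hε
    refine ⟨δ, hδ, fun s hs => ?_⟩
    have := h (-s) (by rwa [abs_neg])
    rwa [abs_neg s, ← abs_neg (g (-s))] at this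
  · intro s hs t ht hst
    have := hg.mono.2 (mem_Ioi.2 (neg_pos.2 (mem_Iio.1 ht))) (mem_Ioi.2 (neg_pos.2 (mem_Iio.1 hs)))
      (neg_le_neg hst)
    simp only [abs_neg, neg_div] at this ⊢
    exact neg_le_neg this
  · intro s hs t ht hst
    have := hg.mono.1 (mem_Iio.2 (neg_lt_zero.2 (mem_Ioi.1 ht)))
      (mem_Iio.2 (neg_lt_zero.2 (mem_Ioi.1 hs))) (neg_le_neg hst)
    simp only [abs_neg, neg_div] at this ⊢
    exact neg_le_neg this

theorem map_zero (hg : ScalarNonlin g) : g 0 = 0 := by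
  obtain ⟨δ, hδ, h⟩ := hg.small 1 one_pos
  have := h 0 (by simpa using hδ)
  simpa using this

/-- A negative value at `s` would, by monotonicity of `g(t)/t`, keep `g(t)/t` below a negative
constant down to `t = 0`, against `g(t) = o(t)`. -/
theorem nonneg (hg : ScalarNonlin g) {s : ℝ} (hs : 0 ≤ s) : 0 ≤ g s := by
  rcases hs.eq_or_lt with rfl | hs
  · exact hg.map_zero.ge
  by_contra hneg
  push Not at hneg
  set ε := - g s / (2 * s) with hε
  have hεpos : 0 < ε := by
    rw [hε]; exact div_pos (by linarith) (by linarith)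
  obtain ⟨δ, hδ, h⟩ := hg.small ε hεpos
  set t := min s (δ / 2) with ht
  have ht0 : 0 < t := lt_min hs (by linarith)
  have h1 := hg.mono.2 (show t ∈ Ioi (0 : ℝ) from ht0) (show s ∈ Ioi (0 : ℝ) from hs)
    (min_le_left _ _)
  have h2 := h t (by rw [abs_of_pos ht0]; exact (min_le_right _ _).trans_lt (by linarith))
  simp only [abs_of_pos ht0, abs_of_pos hs] at h1 h2
  have h3 : -ε ≤ g t / t := by
    rw [le_div_iff₀ ht0]; linarith [neg_abs_le (g t)]
  have h4 : g s / s = -2 * ε := by rw [hε]; field_simp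
  linarith

theorem nonpos (hg : ScalarNonlin g) {s : ℝ} (hs : s ≤ 0) : g s ≤ 0 := by
  have := hg.reflect.nonneg (neg_nonneg.2 hs)
  rw [neg_neg] at this
  linarith

theorem mul_self_nonneg (hg : ScalarNonlin g) (s : ℝ) : 0 ≤ g s * s := by
  rcases le_total 0 s with h | h
  · exact mul_nonneg (hg.nonneg h) h
  · exact mul_nonneg_of_nonpos_of_nonpos (hg.nonpos h) h

theorem slope_le (hg : ScalarNonlin g) {s t : ℝ} (hs : 0 ≤ s) (hst : s ≤ t) :
    g s * t ≤ g t * s := by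
  rcases hs.eq_or_lt with rfl | hs
  · rw [hg.map_zero]; simp
  have ht := hs.trans_le hst
  have h1 := hg.mono.2 (show s ∈ Ioi (0 : ℝ) from hs) (show t ∈ Ioi (0 : ℝ) from ht) hst
  simp only [abs_of_pos hs, abs_of_pos ht] at h1
  rwa [div_le_div_iff₀ hs ht] at h1

theorem monotoneOn_nonneg (hg : ScalarNonlin g) {s t : ℝ} (hs : 0 ≤ s) (hst : s ≤ t) :
    g s ≤ g t := by
  rcases (hs.trans hst).eq_or_lt with h | h
  · have : s = t := le_antisymm hst (h ▸ hs)
    rw [this]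
  · have h1 := hg.slope_le hs hst
    have h2 := hg.nonneg (hs.trans hst)
    refine le_of_mul_le_mul_right ?_ h
    nlinarith

/-- On the positive half line `g` is the product of `t` and the nonnegative non-decreasing slope
`g(t)/t`; the negative half line follows by reflection. This makes the primitive convex. -/
theorem monotone (hg : ScalarNonlin g) : Monotone g := by
  intro s t hst
  rcases le_total 0 s with hs | hs
  · exact hg.monotoneOn_nonneg hs hst
  rcases le_total 0 t with ht | ht
  · exact (hg.nonpos hs).trans (hg.nonneg ht)
  · have := hg.reflect.monotoneOn_nonneg (neg_nonneg.2 ht) (neg_le_neg hst)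
    simp only [neg_neg] at this
    linarith

theorem intervalIntegrable (hg : ScalarNonlin g) (a b : ℝ) : IntervalIntegrable g volume a b :=
  hg.cont.intervalIntegrable a b

theorem primitive_sub (hg : ScalarNonlin g) (a b : ℝ) :
    (∫ t in (0 : ℝ)..b, g t) - ∫ t in (0 : ℝ)..a, g t = ∫ t in a..b, g t :=
  intervalIntegral.integral_interval_sub_left (hg.intervalIntegrable _ _)
    (hg.intervalIntegrable _ _)

theorem primitive_reflect (s : ℝ) :
    ∫ t in (0 : ℝ)..s, (fun s => - g (-s)) t = ∫ t in (0 : ℝ)..(-s), g t := by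
  simp only [intervalIntegral.integral_neg]
  rw [intervalIntegral.integral_comp_neg, neg_zero, ← intervalIntegral.integral_symm]

/-- The tangent inequality for the convex primitive. -/
theorem tangent_le (hg : ScalarNonlin g) (a b : ℝ) :
    g a * (b - a) ≤ (∫ t in (0 : ℝ)..b, g t) - ∫ t in (0 : ℝ)..a, g t := by
  rw [hg.primitive_sub]
  have hc : ∫ _ in a..b, g a = g a * (b - a) := by
    rw [intervalIntegral.integral_const, smul_eq_mul, mul_comm]
  rw [← hc]
  rcases le_total a b with h | h
  · exact intervalIntegral.integral_mono_on h (intervalIntegrable_const) (hg.intervalIntegrable _ _)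
      fun t ht => hg.monotone ht.1
  · rw [intervalIntegral.integral_symm b a, intervalIntegral.integral_symm b a]
    exact neg_le_neg (intervalIntegral.integral_mono_on h (hg.intervalIntegrable _ _)
      intervalIntegrable_const fun t ht => hg.monotone ht.2)

theorem primitive_nonneg (hg : ScalarNonlin g) (s : ℝ) : 0 ≤ ∫ t in (0 : ℝ)..s, g t := by
  have := hg.tangent_le 0 s
  rw [hg.map_zero] at this
  simpa using this

/-- The function `g(t)` lies above the line `t g(u)/u` for `t ≥ u` and below it for `t ≤ u`;
integrate the comparison from `u` to `s`. -/
theorem quadratic_le_of_pos (hg : ScalarNonlin g) {u s : ℝ} (hu : 0 < u) (hs : 0 ≤ s) :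
    g u / (2 * u) * (s ^ 2 - u ^ 2) ≤
      (∫ t in (0 : ℝ)..s, g t) - ∫ t in (0 : ℝ)..u, g t := by
  rw [hg.primitive_sub]
  have hc : ∫ t in u..s, g u / u * t = g u / (2 * u) * (s ^ 2 - u ^ 2) := by
    rw [intervalIntegral.integral_const_mul, integral_id]
    field_simp
  have hi : ∀ a b : ℝ, IntervalIntegrable (fun t => g u / u * t) volume a b := fun a b =>
    (by fun_prop : Continuous fun t => g u / u * t).intervalIntegrable a b
  rw [← hc]
  rcases le_total u s with h | h
  · refine intervalIntegral.integral_mono_on h (hi _ _) (hg.intervalIntegrable _ _) fun t ht => ?_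
    rw [div_mul_eq_mul_div, div_le_iff₀ hu]
    exact hg.slope_le hu.le ht.1
  · rw [intervalIntegral.integral_symm s u, intervalIntegral.integral_symm s u]
    refine neg_le_neg (intervalIntegral.integral_mono_on h (hg.intervalIntegrable _ _) (hi _ _)
      fun t ht => ?_)
    rw [div_mul_eq_mul_div, le_div_iff₀ hu]
    exact hg.slope_le (hs.trans ht.1) ht.2

/-- The primitive minus the parabola tangent at `u` is minimal at `u` on the half line of `u`. -/
theorem quadratic_le (hg : ScalarNonlin g) {u s : ℝ} (hu : u ≠ 0) (hs : 0 ≤ s * u) :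
    g u / (2 * u) * (s ^ 2 - u ^ 2) ≤
      (∫ t in (0 : ℝ)..s, g t) - ∫ t in (0 : ℝ)..u, g t := by
  rcases hu.lt_or_gt with h | h
  · have hs' : s ≤ 0 := by
      by_contra hs'
      push Not at hs'
      nlinarith
    have h1 := hg.reflect.quadratic_le_of_pos (neg_pos.2 h) (neg_nonneg.2 hs')
    rw [primitive_reflect, primitive_reflect] at h1
    simp only [neg_neg, neg_sq] at h1
    have h2 : -g u / (2 * -u) = g u / (2 * u) := by
      rw [mul_neg, neg_div_neg_eq]
    rwa [h2] at h1
  · refine hg.quadratic_le_of_pos h ?_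
    by_contra hs'
    push Not at hs'
    nlinarith

theorem two_mul_primitive_le (hg : ScalarNonlin g) (u : ℝ) :
    2 * ∫ t in (0 : ℝ)..u, g t ≤ g u * u := by
  rcases eq_or_ne u 0 with rfl | hu
  · simp
  have h := hg.quadratic_le (s := 0) hu (by simp)
  rw [intervalIntegral.integral_same] at h
  have h2 : g u / (2 * u) * (0 ^ 2 - u ^ 2) = - (g u * u / 2) := by field_simp; ring
  rw [h2] at h
  linarith

/-- The quadratic comparison at `r u` combined with `2 G(u) ≤ g(u) u` for the primitive `G` of `g`;
it says that `G(ru)/r²` grows with `r`. -/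
theorem sq_mul_primitive_le (hg : ScalarNonlin g) (u : ℝ) {r : ℝ} (hr : 1 ≤ r) :
    r ^ 2 * ∫ t in (0 : ℝ)..u, g t ≤ ∫ t in (0 : ℝ)..(r * u), g t := by
  rcases eq_or_ne u 0 with rfl | hu
  · simp
  have h := hg.quadratic_le (s := r * u) hu (by nlinarith [sq_nonneg u])
  have h2 : g u / (2 * u) * ((r * u) ^ 2 - u ^ 2) = g u * u / 2 * (r ^ 2 - 1) := by
    field_simp
  rw [h2] at h
  have h3 := hg.two_mul_primitive_le u
  have h4 : 0 ≤ r ^ 2 - 1 := by nlinarith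
  nlinarith

/-- The pointwise inequality behind the maximality of points of the Nehari–Pankov manifold. -/
theorem nehari_le (hg : ScalarNonlin g) (u v : ℝ) {t : ℝ} (ht : 0 ≤ t) :
    g u * ((t ^ 2 - 1) / 2 * u + t * v) + (∫ τ in (0 : ℝ)..u, g τ) ≤
      ∫ τ in (0 : ℝ)..(t * u + v), g τ := by
  set s := t * u + v with hs
  have hv : v = s - t * u := by rw [hs]; ring
  rcases eq_or_ne u 0 with rfl | hu
  · rw [hg.map_zero]; simpa using hg.primitive_nonneg s
  set q := g u / u with hq
  have hq0 : 0 ≤ q := by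
    have := hg.mul_self_nonneg u
    have h2 : q = g u * u / u ^ 2 := by rw [hq]; field_simp
    rw [h2]; positivity
  have hgu : g u = q * u := by rw [hq]; field_simp
  have h0 := hg.two_mul_primitive_le u
  rw [hgu] at h0
  rw [hv, hgu]
  -- If `s` and `u` have opposite signs, the left side is nonpositive and the primitive at `s` is
  -- nonnegative. Otherwise the quadratic comparison applies, and the difference of the two sides is
  -- at least `q (s - t u)² / 2`.
  rcases le_total (s * u) 0 with h | h
  · have h1 := hg.primitive_nonneg s
    have h2 : q * (t * (s * u)) ≤ 0 := mul_nonpos_of_nonneg_of_nonpos hq0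
      (mul_nonpos_of_nonneg_of_nonpos ht h)
    have h3 : 0 ≤ q * (t ^ 2 * u ^ 2) := by positivity
    nlinarith
  · have h1 := hg.quadratic_le hu h
    have h2 : g u / (2 * u) * (s ^ 2 - u ^ 2) = q / 2 * (s ^ 2 - u ^ 2) := by
      rw [hq]; field_simp
    rw [h2] at h1
    have h3 : 0 ≤ q * (s - t * u) ^ 2 := by positivity
    nlinarith

end ScalarNonlin

/-! ### The assumptions on the nonlinearity, bundled -/

/-- Assumptions (F1)–(F5). -/
structure CondF (f : Euc N → ℝ → ℝ) (p : ℝ) : Prop where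
  F1 : CondF1 f
  F2 : CondF2 f p
  F3 : CondF3 f
  F4 : CondF4 f
  F5 : CondF5 f

namespace CondF

variable {f : Euc N → ℝ → ℝ} {p : ℝ}

theorem scalar (hf : CondF f p) : ∀ᵐ x, ScalarNonlin (f x) := by
  filter_upwards [hf.F1.continuous] with x hx
  exact ⟨hx, fun ε hε => by
    obtain ⟨δ, hδ, h⟩ := hf.F3 ε hε
    exact ⟨δ, hδ, h x⟩, hf.F5 x⟩

/-- (F3) handles `|s| < δ`; for `|s| ≥ δ` the constant term in (F2) is absorbed into `|s|^(p-1)` at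
the cost of a factor `δ^(1-p)`. -/
theorem growth (hf : CondF f p) {ε : ℝ} (hε : 0 < ε) :
    ∃ C : ℝ, 0 ≤ C ∧ ∀ (x : Euc N) (s : ℝ), |f x s| ≤ ε * |s| + C * |s| ^ (p - 1) := by
  obtain ⟨a, ha, hgr⟩ := hf.F2.growth
  obtain ⟨δ, hδ, h⟩ := hf.F3 ε hε
  have hp : 0 < p - 1 := by linarith [hf.F2.two_lt]
  refine ⟨a * ((δ ^ (p - 1))⁻¹ + 1), by positivity, fun x s => ?_⟩
  rcases lt_or_ge |s| δ with hs | hs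
  · exact (h x s hs).trans (le_add_of_nonneg_right (by positivity))
  · refine (hgr x s).trans ?_
    have h1 : δ ^ (p - 1) ≤ |s| ^ (p - 1) := Real.rpow_le_rpow hδ.le hs hp.le
    have hδp : 0 < δ ^ (p - 1) := by positivity
    have h2 : 1 ≤ (δ ^ (p - 1))⁻¹ * |s| ^ (p - 1) := by
      rw [inv_mul_eq_div, one_le_div hδp]; exact h1
    have h3 : 0 ≤ ε * |s| := by positivity
    nlinarith

theorem aemeasurable (hf : CondF f p) {u : Euc N → ℝ} (hu : AEMeasurable u volume) :
    AEMeasurable (fun x => f x (u x)) volume :=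
  aemeasurable_caratheodory hf.F1.measurable hf.F1.continuous hu

theorem aemeasurable_primitive (hf : CondF f p) {u : Euc N → ℝ} (hu : AEMeasurable u volume) :
    AEMeasurable (fun x => primitive f x (u x)) volume := by
  refine aemeasurable_caratheodory (HardySchrodinger.aemeasurable_primitive hf.F1) ?_ hu
  filter_upwards [hf.F1.continuous] with x hx
  exact intervalIntegral.continuous_primitive (fun a b => hx.intervalIntegrable a b) 0

theorem primitive_le (hf : CondF f p) {ε : ℝ} (hε : 0 < ε) :
    ∃ C : ℝ, 0 ≤ C ∧ ∀ᵐ x, ∀ s : ℝ, primitive f x s ≤ ε * s ^ 2 + C * |s| ^ p := by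
  obtain ⟨C, hC, h⟩ := hf.growth hε
  refine ⟨C, hC, ?_⟩
  filter_upwards [hf.scalar] with x hx s
  have h1 := hx.two_mul_primitive_le s
  have h2 := h x s
  have h0 := hx.primitive_nonneg s
  have h3 : f x s * s ≤ |f x s| * |s| := by rw [← abs_mul]; exact le_abs_self _
  have h4 : |s| ^ (p - 1) * |s| = |s| ^ p := by
    rw [← Real.rpow_add_one' (abs_nonneg s) (by linarith [hf.F2.two_lt]), sub_add_cancel]
  have h5 : |f x s| * |s| ≤ (ε * |s| + C * |s| ^ (p - 1)) * |s| :=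
    mul_le_mul_of_nonneg_right h2 (abs_nonneg s)
  have h6 : (ε * |s| + C * |s| ^ (p - 1)) * |s| = ε * s ^ 2 + C * |s| ^ p := by
    rw [add_mul, mul_assoc, mul_assoc, h4, ← sq, sq_abs]
  change primitive f x s ≤ _
  have h7 : 2 * primitive f x s ≤ f x s * s := h1
  have h8 : 0 ≤ primitive f x s := h0
  linarith

end CondF

end

section

variable {N : ℕ}

/-! ### Power functions of `H¹` functions -/

/-- Split at the threshold `s = K`. The threshold stays free: `K = ‖u‖` yields homogeneous
estimates, and large `K` makes the last term small when `p < r`. -/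
theorem rpow_le_interpolate {q p r K s : ℝ} (hqp : q ≤ p) (hpr : p ≤ r) (hK : 0 < K)
    (hs : 0 ≤ s) (hp : 0 < p) : s ^ p ≤ K ^ (p - q) * s ^ q + K ^ (p - r) * s ^ r := by
  rcases hs.eq_or_lt with rfl | hs
  · rw [Real.zero_rpow hp.ne']
    have h1 : (0 : ℝ) ≤ 0 ^ q := Real.rpow_nonneg le_rfl _
    have h2 : (0 : ℝ) ≤ 0 ^ r := Real.rpow_nonneg le_rfl _
    positivity
  rcases le_total s K with h | h
  · have h1 : s ^ p = s ^ (p - q) * s ^ q := by rw [← Real.rpow_add hs]; ring_nf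
    have h2 : s ^ (p - q) ≤ K ^ (p - q) := Real.rpow_le_rpow hs.le h (by linarith)
    rw [h1]
    have h3 : s ^ (p - q) * s ^ q ≤ K ^ (p - q) * s ^ q := by gcongr
    have h4 : 0 ≤ K ^ (p - r) * s ^ r := by positivity
    linarith
  · have h1 : s ^ p = s ^ (p - r) * s ^ r := by rw [← Real.rpow_add hs]; ring_nf
    have h2 : s ^ (p - r) ≤ K ^ (p - r) := Real.rpow_le_rpow_of_nonpos hK h (by linarith)
    rw [h1]
    have h3 : s ^ (p - r) * s ^ r ≤ K ^ (p - r) * s ^ r := by gcongr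
    have h4 : 0 ≤ K ^ (p - q) * s ^ q := by positivity
    linarith

theorem add_rpow_le_two {a b r : ℝ} (ha : 0 ≤ a) (hb : 0 ≤ b) (hr : 0 ≤ r) :
    (a + b) ^ r ≤ 2 ^ r * (a ^ r + b ^ r) := by
  have ha' : 0 ≤ a ^ r := Real.rpow_nonneg ha _
  have hb' : 0 ≤ b ^ r := Real.rpow_nonneg hb _
  rcases le_total a b with h | h
  · calc (a + b) ^ r ≤ (2 * b) ^ r := Real.rpow_le_rpow (by positivity) (by linarith) hr
      _ = 2 ^ r * b ^ r := Real.mul_rpow (by norm_num) hb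
      _ ≤ _ := by gcongr; linarith
  · calc (a + b) ^ r ≤ (2 * a) ^ r := Real.rpow_le_rpow (by positivity) (by linarith) hr
      _ = 2 ^ r * a ^ r := Real.mul_rpow (by norm_num) ha
      _ ≤ _ := by gcongr; linarith

theorem aemeasurable_val (u : H1 N) : AEMeasurable u.val volume :=
  (aesm_val u).aemeasurable

theorem integrable_rpow_critExp (hN : 3 ≤ N) (u : H1 N) :
    Integrable (fun x => |u.val x| ^ critExp N) := by
  obtain ⟨C, hC, h⟩ := exists_sobolev hN
  refine ⟨((aemeasurable_val u).abs.pow_const _).aestronglyMeasurable, ?_⟩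
  rw [hasFiniteIntegral_iff_enorm]
  refine lt_of_le_of_lt (le_trans (le_of_eq ?_) (h u)) ENNReal.ofReal_lt_top
  refine lintegral_congr fun x => ?_
  rw [Real.enorm_rpow_of_nonneg (abs_nonneg _) (by linarith [two_lt_critExp hN]),
    ← Real.norm_eq_abs, enorm_norm]

theorem integral_rpow_critExp_le (hN : 3 ≤ N) : ∃ C : ℝ, 0 ≤ C ∧ ∀ u : H1 N,
    ∫ x, |u.val x| ^ critExp N ≤ (C * ‖u‖) ^ critExp N := by
  obtain ⟨C, hC, h⟩ := exists_sobolev hN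
  refine ⟨C, hC, fun u => ?_⟩
  rw [← ENNReal.ofReal_le_ofReal_iff (by positivity), ofReal_integral_eq_lintegral_ofReal
    (integrable_rpow_critExp hN u) (ae_of_all _ fun x => by positivity)]
  refine le_trans (le_of_eq ?_) (h u)
  refine lintegral_congr fun x => ?_
  rw [← ENNReal.ofReal_rpow_of_nonneg (abs_nonneg _) (by linarith [two_lt_critExp hN]),
    ← Real.norm_eq_abs, ofReal_norm]

theorem integrable_rpow (hN : 3 ≤ N) {p : ℝ} (hp : 2 ≤ p) (hp' : p ≤ critExp N) (u : H1 N) :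
    Integrable (fun x => |u.val x| ^ p) := by
  refine ((integrable_val_sq u).add (integrable_rpow_critExp hN u)).mono'
    ((aemeasurable_val u).abs.pow_const _).aestronglyMeasurable (ae_of_all _ fun x => ?_)
  rw [Real.norm_of_nonneg (by positivity)]
  have := rpow_le_interpolate hp hp' one_pos (abs_nonneg (u.val x)) (by linarith)
  simpa using this

theorem exists_integral_rpow_le (hN : 3 ≤ N) {p : ℝ} (hp : 2 ≤ p) (hp' : p ≤ critExp N) :
    ∃ S : ℝ, 0 ≤ S ∧ ∀ u : H1 N, ∫ x, |u.val x| ^ p ≤ S * ‖u‖ ^ p := by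
  obtain ⟨C, hC, h⟩ := integral_rpow_critExp_le hN
  have hp0 : 0 < p := by linarith
  refine ⟨1 + C ^ critExp N, by positivity, fun u => ?_⟩
  rcases eq_or_ne u 0 with rfl | hu
  · rw [norm_zero, Real.zero_rpow hp0.ne', mul_zero]
    refine le_of_eq ?_
    rw [← integral_zero (Euc N) ℝ]
    refine integral_congr_ae ?_
    filter_upwards [val_zero (N := N)] with x hx
    rw [hx, abs_zero, Real.zero_rpow hp0.ne']
  have hn : 0 < ‖u‖ := norm_pos_iff.2 hu
  -- With threshold `‖u‖` both terms of the interpolation scale like `‖u‖ ^ p`.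
  have h1 : ∫ x, |u.val x| ^ p ≤
      ‖u‖ ^ (p - 2) * ‖u‖ ^ (2 : ℝ) + ‖u‖ ^ (p - critExp N) * (C * ‖u‖) ^ critExp N := by
    calc ∫ x, |u.val x| ^ p
        ≤ ∫ x, (‖u‖ ^ (p - 2) * |u.val x| ^ (2 : ℝ) +
            ‖u‖ ^ (p - critExp N) * |u.val x| ^ critExp N) := by
          refine integral_mono (integrable_rpow hN hp hp' u) (Integrable.add
            ((integrable_rpow hN le_rfl (two_lt_critExp hN).le u).const_mul _)
            ((integrable_rpow_critExp hN u).const_mul _)) fun x => ?_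
          exact rpow_le_interpolate hp hp' hn (abs_nonneg _) hp0
      _ = ‖u‖ ^ (p - 2) * (∫ x, |u.val x| ^ (2 : ℝ)) +
            ‖u‖ ^ (p - critExp N) * ∫ x, |u.val x| ^ critExp N := by
          rw [integral_add ((integrable_rpow hN le_rfl (two_lt_critExp hN).le u).const_mul _)
            ((integrable_rpow_critExp hN u).const_mul _), integral_const_mul, integral_const_mul]
      _ ≤ _ := by
          gcongr
          · simp only [Real.rpow_two, sq_abs]
            rw [integral_val_sq]
            gcongr
            exact norm_toL2L_le u
          · exact h u
  refine h1.trans (le_of_eq ?_)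
  rw [← Real.rpow_add hn, Real.mul_rpow hC hn.le, mul_left_comm, ← Real.rpow_add hn]
  ring_nf

theorem memLp_of_integrable_rpow {α : Type*} [MeasurableSpace α] {ν : Measure α} {g : α → ℝ}
    {r : ℝ} (hr : 0 < r) (hg : AEMeasurable g ν) (hi : Integrable (fun x => |g x| ^ r) ν) :
    MemLp g (ENNReal.ofReal r) ν := by
  rw [← integrable_norm_rpow_iff hg.aestronglyMeasurable (by simpa using hr) ENNReal.ofReal_ne_top,
    ENNReal.toReal_ofReal hr.le]
  exact hi

/-- Hölder's inequality for a function in `L^{p'}` against an `H¹` function. -/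
theorem exists_holder_le (hN : 3 ≤ N) {p : ℝ} (hp : 2 ≤ p) (hp' : p ≤ critExp N) :
    ∃ S : ℝ, 0 ≤ S ∧ ∀ (g : Euc N → ℝ), AEMeasurable g volume → (∀ x, 0 ≤ g x) →
      Integrable (fun x => g x ^ p.conjExponent) → ∀ ψ : H1 N,
      Integrable (fun x => g x * |ψ.val x|) ∧
      ∫ x, g x * |ψ.val x| ≤ (∫ x, g x ^ p.conjExponent) ^ (1 / p.conjExponent) * (S * ‖ψ‖) := by
  obtain ⟨S, hS, h⟩ := exists_integral_rpow_le hN hp hp'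
  have hpq := (Real.HolderConjugate.conjExponent (show 1 < p by linarith)).symm
  refine ⟨S ^ (1 / p), by positivity, fun g hg hg0 hgi ψ => ?_⟩
  have hm1 : MemLp g (ENNReal.ofReal p.conjExponent) volume := memLp_of_integrable_rpow hpq.pos hg
    (by simpa only [abs_of_nonneg (hg0 _)] using hgi)
  have hm2 : MemLp (fun x => |ψ.val x|) (ENNReal.ofReal p) volume :=
    memLp_of_integrable_rpow (by linarith) (aemeasurable_val ψ).abs
      (by simpa only [abs_abs] using integrable_rpow hN hp hp' ψ)
  have hm3 : (ENNReal.ofReal p.conjExponent).HolderTriple (ENNReal.ofReal p) 1 := by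
    have := hpq.ennrealOfReal
    exact this
  refine ⟨hm1.integrable_mul hm2, ?_⟩
  refine (integral_mul_le_Lp_mul_Lq_of_nonneg hpq (ae_of_all _ hg0)
    (ae_of_all _ fun x => abs_nonneg _) hm1 hm2).trans ?_
  have hI : 0 ≤ ∫ x, g x ^ p.conjExponent :=
    integral_nonneg fun x => Real.rpow_nonneg (hg0 x) _
  refine mul_le_mul_of_nonneg_left ?_ (Real.rpow_nonneg hI _)
  calc (∫ x, |ψ.val x| ^ p) ^ (1 / p) ≤ (S * ‖ψ‖ ^ p) ^ (1 / p) :=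
        Real.rpow_le_rpow (integral_nonneg fun x => by positivity) (h ψ) (by positivity)
    _ = S ^ (1 / p) * ‖ψ‖ := by
        rw [Real.mul_rpow hS (by positivity), ← Real.rpow_mul (norm_nonneg _),
          mul_one_div_cancel (by linarith), Real.rpow_one]

/-! ### Convergence lemmas -/

/-- Dominated convergence with a majorant that is only asymptotically fixed. -/
theorem tendsto_integral_zero_of_le_add {α : Type*} [MeasurableSpace α] {ν : Measure α}
    {g E : ℕ → α → ℝ} {H : α → ℝ} (hgm : ∀ n, AEMeasurable (g n) ν)
    (hg0 : ∀ n x, 0 ≤ g n x) (hH : Integrable H ν) (hE : ∀ n, Integrable (E n) ν)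
    (hE0 : ∀ n x, 0 ≤ E n x)
    (hle : ∀ n, ∀ᵐ x ∂ν, g n x ≤ H x + E n x)
    (hlim : ∀ᵐ x ∂ν, Tendsto (fun n => g n x) atTop (𝓝 0))
    (hElim : Tendsto (fun n => ∫ x, E n x ∂ν) atTop (𝓝 0)) :
    Tendsto (fun n => ∫ x, g n x ∂ν) atTop (𝓝 0) := by
  have hmm : ∀ n, AEStronglyMeasurable (fun x => min (g n x) |H x|) ν := fun n =>
    ((hgm n).min hH.aemeasurable.abs).aestronglyMeasurable
  have hb : ∀ n, ∀ᵐ x ∂ν, ‖min (g n x) |H x|‖ ≤ |H x| := fun n => ae_of_all _ fun x => by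
    rw [Real.norm_of_nonneg (le_min (hg0 n x) (abs_nonneg _))]
    exact min_le_right _ _
  have hmi : ∀ n, Integrable (fun x => min (g n x) |H x|) ν := fun n =>
    hH.abs.mono' (hmm n) (hb n)
  have h1 : Tendsto (fun n => ∫ x, min (g n x) |H x| ∂ν) atTop (𝓝 (∫ _, (0 : ℝ) ∂ν)) := by
    refine tendsto_integral_of_dominated_convergence (fun x => |H x|) hmm hH.abs hb ?_
    filter_upwards [hlim] with x hx
    refine squeeze_zero (fun n => le_min (hg0 n x) (abs_nonneg _)) (fun n => min_le_left _ _) hx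
  rw [integral_zero] at h1
  have h2 := h1.add hElim
  rw [add_zero] at h2
  refine squeeze_zero (fun n => integral_nonneg (hg0 n)) (fun n => ?_) h2
  rw [← integral_add (hmi n) (hE n)]
  refine integral_mono_of_nonneg (ae_of_all _ (hg0 n)) ((hmi n).add (hE n)) ?_
  filter_upwards [hle n] with x hx
  rcases le_total (g n x) |H x| with h | h
  · simp only [min_eq_left h]; linarith [hE0 n x]
  · simp only [min_eq_right h]; linarith [le_abs_self (H x)]

theorem exists_subseq_ae_tendsto_zero {α : Type*} [MeasurableSpace α] {ν : Measure α}
    {k : ℕ → α → ℝ} (hk : ∀ n, Integrable (k n) ν) (hk0 : ∀ n x, 0 ≤ k n x)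
    (hlim : Tendsto (fun n => ∫ x, k n x ∂ν) atTop (𝓝 0)) :
    ∃ ns : ℕ → ℕ, StrictMono ns ∧ ∀ᵐ x ∂ν, Tendsto (fun i => k (ns i) x) atTop (𝓝 0) := by
  have h1 : Tendsto (fun n => eLpNorm (k n - fun _ => (0 : ℝ)) 1 ν) atTop (𝓝 0) := by
    have h2 : ∀ n, eLpNorm (k n - fun _ => (0 : ℝ)) 1 ν = ENNReal.ofReal (∫ x, k n x ∂ν) := by
      intro n
      rw [ofReal_integral_eq_lintegral_ofReal (hk n) (ae_of_all _ (hk0 n)),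
        eLpNorm_one_eq_lintegral_enorm]
      refine lintegral_congr fun x => ?_
      rw [Pi.sub_apply, sub_zero, Real.enorm_of_nonneg (hk0 n x)]
    simp only [h2]
    simpa using ENNReal.tendsto_ofReal hlim
  exact (tendstoInMeasure_of_tendsto_eLpNorm one_ne_zero (fun n => (hk n).aestronglyMeasurable)
    aestronglyMeasurable_const h1).exists_seq_tendsto_ae

theorem tendsto_zero_of_rpow {p : ℝ} (hp : 0 < p) {a : ℕ → ℝ} (ha : ∀ n, 0 ≤ a n)
    (h : Tendsto (fun n => a n ^ p) atTop (𝓝 0)) : Tendsto a atTop (𝓝 0) := by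
  have h1 := h.rpow_const (p := 1 / p) (Or.inr (by positivity))
  rw [Real.zero_rpow (by positivity)] at h1
  refine h1.congr fun n => ?_
  rw [← Real.rpow_mul (ha n), mul_one_div_cancel hp.ne', Real.rpow_one]

theorem tendsto_rpow_zero {p : ℝ} (hp : 0 < p) {a : ℕ → ℝ}
    (h : Tendsto a atTop (𝓝 0)) : Tendsto (fun n => a n ^ p) atTop (𝓝 0) := by
  have h1 := h.rpow_const (p := p) (Or.inr hp.le)
  rwa [Real.zero_rpow hp.ne'] at h1

/-- A subsequence of an `L^p`-convergent sequence converges almost everywhere. -/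
theorem exists_subseq_ae_of_rpow (hN : 3 ≤ N) {p : ℝ} (hp : 2 ≤ p) (hp' : p ≤ critExp N)
    {w : ℕ → H1 N} {u : H1 N}
    (h : Tendsto (fun n => ∫ x, |(w n - u).val x| ^ p) atTop (𝓝 0)) :
    ∃ ns : ℕ → ℕ, StrictMono ns ∧
      ∀ᵐ x, Tendsto (fun i => (w (ns i)).val x) atTop (𝓝 (u.val x)) := by
  obtain ⟨ns, hns, hae⟩ := exists_subseq_ae_tendsto_zero
    (fun n => integrable_rpow hN hp hp' (w n - u)) (fun n x => by positivity) h
  refine ⟨ns, hns, ?_⟩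
  have hsub : ∀ᵐ x, ∀ n, (w n - u).val x = (w n).val x - u.val x :=
    ae_all_iff.2 fun n => val_sub (w n) u
  filter_upwards [hae, hsub] with x hx hs
  have h1 := tendsto_zero_of_rpow (show 0 < p by linarith) (fun n => abs_nonneg _) hx
  rw [tendsto_iff_norm_sub_tendsto_zero]
  simpa only [hs, Real.norm_eq_abs] using h1

end

/-! ### The potential `∫ F(x,u)` and the superposition operator as a map into the dual of `H¹`. -/

section

variable {N : ℕ}

namespace CondF

variable {f : Euc N → ℝ → ℝ} {p : ℝ}

theorem two_le (hf : CondF f p) : 2 ≤ p := hf.F2.two_lt.le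

theorem le_critExp (hf : CondF f p) : p ≤ critExp N := hf.F2.lt_critical.le

end CondF

/-- The potential part `∫ F(x,u)` of the energy. -/
def potential (f : Euc N → ℝ → ℝ) (u : H1 N) : ℝ := ∫ x, primitive f x (u.val x)

theorem energy_eq_potential {V : Euc N → ℝ} {f : Euc N → ℝ → ℝ} (μ : ℝ) (u : H1 N) :
    energy V f μ u = 1 / 2 * bform V μ u u - potential f u := energy_eq_form V f μ u

variable {f : Euc N → ℝ → ℝ} {p : ℝ}

theorem primitive_nonneg_ae (hf : CondF f p) : ∀ᵐ x, ∀ s, 0 ≤ primitive f x s := by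
  filter_upwards [hf.scalar] with x hx s using hx.primitive_nonneg s

theorem integrable_primitive (hN : 3 ≤ N) (hf : CondF f p) (u : H1 N) :
    Integrable (fun x => primitive f x (u.val x)) := by
  obtain ⟨C, hC, h⟩ := hf.primitive_le one_pos
  refine (((integrable_val_sq u).const_mul 1).add
    ((integrable_rpow hN hf.two_le hf.le_critExp u).const_mul C)).mono'
    (hf.aemeasurable_primitive (aemeasurable_val u)).aestronglyMeasurable ?_
  filter_upwards [h, primitive_nonneg_ae hf] with x hx h0
  rw [Real.norm_of_nonneg (h0 _)]
  exact hx _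

theorem potential_nonneg (hf : CondF f p) (u : H1 N) : 0 ≤ potential f u := by
  refine integral_nonneg_of_ae ?_
  filter_upwards [primitive_nonneg_ae hf] with x hx using hx _

theorem potential_le (hN : 3 ≤ N) (hf : CondF f p) {ε : ℝ} (hε : 0 < ε) :
    ∃ C : ℝ, 0 ≤ C ∧ ∀ u : H1 N,
      potential f u ≤ ε * ‖toL2L N u‖ ^ 2 + C * ∫ x, |u.val x| ^ p := by
  obtain ⟨C, hC, h⟩ := hf.primitive_le hε
  refine ⟨C, hC, fun u => ?_⟩
  have hi1 := (integrable_val_sq u).const_mul ε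
  have hi2 := (integrable_rpow hN hf.two_le hf.le_critExp u).const_mul C
  rw [← integral_val_sq, ← integral_const_mul, ← integral_const_mul, ← integral_add hi1 hi2]
  refine integral_mono_ae (integrable_primitive hN hf u) (hi1.add hi2) ?_
  filter_upwards [h] with x hx using hx _

theorem potential_bounded (hN : 3 ≤ N) (hf : CondF f p) (R : ℝ) :
    ∃ M : ℝ, ∀ u : H1 N, ‖u‖ ≤ R → potential f u ≤ M := by
  obtain ⟨C, hC, h⟩ := potential_le hN hf one_pos
  obtain ⟨S, hS, hSo⟩ := exists_integral_rpow_le hN hf.two_le hf.le_critExp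
  refine ⟨1 * R ^ 2 + C * (S * R ^ p), fun u hu => (h u).trans ?_⟩
  have h1 : ‖u‖ ^ p ≤ R ^ p := Real.rpow_le_rpow (norm_nonneg _) hu (by linarith [hf.two_le])
  have h2 : ‖toL2L N u‖ ^ 2 ≤ R ^ 2 :=
    pow_le_pow_left₀ (norm_nonneg _) ((norm_toL2L_le u).trans hu) 2
  have h3 : ∫ x, |u.val x| ^ p ≤ S * R ^ p :=
    (hSo u).trans (mul_le_mul_of_nonneg_left h1 hS)
  gcongr

theorem rpow_conjExponent {p : ℝ} (hp : 2 ≤ p) {s : ℝ} (hs : 0 ≤ s) :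
    (s ^ (p - 1)) ^ p.conjExponent = s ^ p := by
  rw [← Real.rpow_mul hs, Real.conjExponent, mul_div_cancel₀ _ (by linarith)]

/-- The dual norm of a function dominated by an `L²` and an `L^{p'}` part. -/
theorem exists_dual_bound (hN : 3 ≤ N) {p : ℝ} (hp : 2 ≤ p) (hp' : p ≤ critExp N) :
    ∃ S : ℝ, 0 ≤ S ∧ ∀ (h m g : Euc N → ℝ), AEMeasurable h volume → MemLp m 2 volume →
      AEMeasurable g volume → (∀ x, 0 ≤ g x) → Integrable (fun x => g x ^ p.conjExponent) →
      (∀ᵐ x, |h x| ≤ |m x| + g x) → ∀ ψ : H1 N,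
      Integrable (fun x => |h x| * |ψ.val x|) ∧ ∫ x, |h x| * |ψ.val x| ≤
        (√(∫ x, m x ^ 2) + S * (∫ x, g x ^ p.conjExponent) ^ (1 / p.conjExponent)) * ‖ψ‖ := by
  obtain ⟨S, hS, hhol⟩ := exists_holder_le hN hp hp'
  refine ⟨S, hS, fun h m g hh hm hg hg0 hgi hle ψ => ?_⟩
  obtain ⟨hi2, h2⟩ := hhol g hg hg0 hgi ψ
  have hψ := memLp_val ψ
  have hi1 : Integrable (fun x => |m x| * |ψ.val x|) :=
    (hm.integrable_mul hψ).abs.congr (ae_of_all _ fun x => abs_mul _ _)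
  have h1 := abs_integral_mul_le hm hψ
  have hb : ∀ᵐ x, |h x| * |ψ.val x| ≤ |m x| * |ψ.val x| + g x * |ψ.val x| := by
    filter_upwards [hle] with x hx
    rw [← add_mul]
    exact mul_le_mul_of_nonneg_right hx (abs_nonneg _)
  have hi : Integrable (fun x => |h x| * |ψ.val x|) := by
    refine (hi1.add hi2).mono' (hh.abs.mul (aemeasurable_val ψ).abs).aestronglyMeasurable ?_
    filter_upwards [hb] with x hx
    rwa [Real.norm_of_nonneg (by positivity)]
  refine ⟨hi, ?_⟩
  have h3 : ∫ x, |h x| * |ψ.val x| ≤ (∫ x, |m x| * |ψ.val x|) + ∫ x, g x * |ψ.val x| := by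
    rw [← integral_add hi1 hi2]
    exact integral_mono_ae hi (hi1.add hi2) hb
  rw [integral_val_sq, Real.sqrt_sq (norm_nonneg _)] at h1
  have h4 : √(∫ x, m x ^ 2) * ‖toL2L N ψ‖ ≤ √(∫ x, m x ^ 2) * ‖ψ‖ :=
    mul_le_mul_of_nonneg_left (norm_toL2L_le ψ) (Real.sqrt_nonneg _)
  linarith

theorem nonlin_mul_bound (hN : 3 ≤ N) (hf : CondF f p) (u : H1 N) : ∃ M : ℝ, ∀ ψ : H1 N,
    Integrable (fun x => f x (u.val x) * ψ.val x) ∧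
      |∫ x, f x (u.val x) * ψ.val x| ≤ M * ‖ψ‖ := by
  obtain ⟨S, hS, h⟩ := exists_dual_bound hN hf.two_le hf.le_critExp
  obtain ⟨C, hC, hgr⟩ := hf.growth one_pos
  have hm := (hf.aemeasurable (aemeasurable_val u))
  have key := h (fun x => f x (u.val x)) u.val (fun x => C * |u.val x| ^ (p - 1)) hm
    (memLp_val u) (((aemeasurable_val u).abs.pow_const _).const_mul C) (fun x => by positivity)
    (by
      refine ((integrable_rpow hN hf.two_le hf.le_critExp u).const_mul
        (C ^ p.conjExponent)).congr (ae_of_all _ fun x => ?_)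
      simp only
      rw [Real.mul_rpow hC (by positivity), rpow_conjExponent hf.two_le (abs_nonneg _)])
    (ae_of_all _ fun x => by simpa using hgr x (u.val x))
  refine ⟨√(∫ x, u.val x ^ 2) + S * (∫ x, (C * |u.val x| ^ (p - 1)) ^ p.conjExponent) ^
    (1 / p.conjExponent), fun ψ => ⟨?_, ?_⟩⟩
  rotate_left
  · refine abs_integral_le_integral_abs.trans ?_
    simp only [abs_mul]
    exact (key ψ).2
  · refine (key ψ).1.mono' (hm.mul (aemeasurable_val ψ)).aestronglyMeasurable
      (ae_of_all _ fun x => ?_)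
    rw [norm_mul]; rfl

theorem integrable_nonlin_mul (hN : 3 ≤ N) (hf : CondF f p) (u ψ : H1 N) :
    Integrable (fun x => f x (u.val x) * ψ.val x) :=
  (nonlin_mul_bound hN hf u).choose_spec ψ |>.1

/-- The functional `ψ ↦ ∫ f(x,u) ψ`. -/
def nonlinL (hN : 3 ≤ N) (hf : CondF f p) (u : H1 N) : H1 N →L[ℝ] ℝ :=
  LinearMap.mkContinuous
    { toFun := fun ψ => ∫ x, f x (u.val x) * ψ.val x
      map_add' := fun ψ χ => by
        rw [← integral_add (integrable_nonlin_mul hN hf u ψ) (integrable_nonlin_mul hN hf u χ)]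
        refine integral_congr_ae ?_
        filter_upwards [val_add ψ χ] with x hx
        rw [hx]; ring
      map_smul' := fun c ψ => by
        rw [RingHom.id_apply, smul_eq_mul, ← integral_const_mul]
        refine integral_congr_ae ?_
        filter_upwards [val_smul c ψ] with x hx
        rw [hx]; ring }
    (nonlin_mul_bound hN hf u).choose
    (fun ψ => ((nonlin_mul_bound hN hf u).choose_spec ψ).2)

theorem nonlinL_apply (hN : 3 ≤ N) (hf : CondF f p) (u ψ : H1 N) :
    nonlinL hN hf u ψ = ∫ x, f x (u.val x) * ψ.val x := rfl

/-- Continuity of the superposition operator from `L^p` (on bounded sets) to the dual of `H¹`. -/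
theorem nonlin_tendsto (hN : 3 ≤ N) (hf : CondF f p) {w : ℕ → H1 N} {u : H1 N} {R : ℝ}
    (hR : ∀ n, ‖toL2L N (w n)‖ ≤ R)
    (hw : Tendsto (fun n => ∫ x, |(w n - u).val x| ^ p) atTop (𝓝 0)) {ε : ℝ} (hε : 0 < ε) :
    ∀ᶠ n in atTop, ∀ ψ : H1 N,
      ∫ x, |f x ((w n).val x) - f x (u.val x)| * |ψ.val x| ≤ ε * ‖ψ‖ := by
  -- Arguing by contradiction leaves freedom to pass to a subsequence that converges almost
  -- everywhere.
  by_contra hcon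
  obtain ⟨k, hk, hbad⟩ := extraction_of_frequently_atTop (not_eventually.1 hcon)
  obtain ⟨ns, hns, hae⟩ := exists_subseq_ae_of_rpow hN hf.two_le hf.le_critExp
    (hw.comp hk.tendsto_atTop)
  set v : ℕ → H1 N := fun i => w (k (ns i)) with hv
  have hvlim : Tendsto (fun i => ∫ x, |(v i - u).val x| ^ p) atTop (𝓝 0) :=
    (hw.comp hk.tendsto_atTop).comp hns.tendsto_atTop
  have hR0 : 0 ≤ R := (norm_nonneg _).trans (hR 0)
  -- Chosen so that the linear part of the growth bound contributes at most `ε / 2` in `L²`. This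
  -- part need not be small pointwise, since only convergence in `L^p` is assumed.
  set η : ℝ := ε / (2 * (R + ‖u‖ + 1)) with hη
  have hη0 : 0 < η := by positivity
  obtain ⟨S, hS, hdual⟩ := exists_dual_bound hN hf.two_le hf.le_critExp
  obtain ⟨C, hC, hgr⟩ := hf.growth hη0
  have hp1 : 0 < p.conjExponent :=
    (Real.HolderConjugate.conjExponent (show 1 < p by linarith [hf.two_le])).symm.pos
  have hpp : 0 < p := by linarith [hf.two_le]
  set d : ℕ → Euc N → ℝ := fun i x => f x ((v i).val x) - f x (u.val x) with hd
  have hdm : ∀ i, AEMeasurable (d i) volume := fun i =>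
    (hf.aemeasurable (aemeasurable_val (v i))).sub (hf.aemeasurable (aemeasurable_val u))
  set m : ℕ → Euc N → ℝ := fun i x => η * (|(v i).val x| + |u.val x|) with hm
  have hmm : ∀ i, MemLp (m i) 2 volume := fun i =>
    ((memLp_val (v i)).norm.add (memLp_val u).norm).const_mul η
  -- The excess over the linear part. It tends to zero almost everywhere and is bounded by `p - 1`
  -- powers, hence tends to zero in the dual exponent.
  set g : ℕ → Euc N → ℝ := fun i x => max (|d i x| - m i x) 0 with hg
  have hg0 : ∀ i x, 0 ≤ g i x := fun i x => le_max_right _ _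
  have hgm : ∀ i, AEMeasurable (g i) volume := fun i =>
    ((hdm i).abs.sub (hmm i).aestronglyMeasurable.aemeasurable).max aemeasurable_const
  have hgle : ∀ i x, g i x ≤ C * (|(v i).val x| ^ (p - 1) + |u.val x| ^ (p - 1)) := by
    intro i x
    refine max_le ?_ (by positivity)
    have h1 := hgr x ((v i).val x)
    have h2 := hgr x (u.val x)
    have h3 : |d i x| ≤ |f x ((v i).val x)| + |f x (u.val x)| := abs_sub _ _
    simp only [hm]
    nlinarith
  set D : ℝ := (2 * C) ^ p.conjExponent with hD
  have hgp : ∀ i, ∀ᵐ x, g i x ^ p.conjExponent ≤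
      D * (2 ^ p + 1) * |u.val x| ^ p + D * 2 ^ p * |(v i - u).val x| ^ p := by
    intro i
    filter_upwards [val_sub (v i) u] with x hx
    have h1 : g i x ^ p.conjExponent ≤
        (C * (|(v i).val x| ^ (p - 1) + |u.val x| ^ (p - 1))) ^ p.conjExponent :=
      Real.rpow_le_rpow (hg0 i x) (hgle i x) hp1.le
    have h2 : (C * (|(v i).val x| ^ (p - 1) + |u.val x| ^ (p - 1))) ^ p.conjExponent ≤
        D * (|(v i).val x| ^ p + |u.val x| ^ p) := by
      rw [Real.mul_rpow hC (by positivity), hD, Real.mul_rpow (by norm_num) hC]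
      have h3 := add_rpow_le_two (a := |(v i).val x| ^ (p - 1)) (b := |u.val x| ^ (p - 1))
        (by positivity) (by positivity) hp1.le
      rw [rpow_conjExponent hf.two_le (abs_nonneg _),
        rpow_conjExponent hf.two_le (abs_nonneg _)] at h3
      have := mul_le_mul_of_nonneg_left h3 (Real.rpow_nonneg hC p.conjExponent)
      linarith
    have h4 : |(v i).val x| ^ p ≤ 2 ^ p * (|(v i - u).val x| ^ p + |u.val x| ^ p) := by
      refine le_trans (Real.rpow_le_rpow (abs_nonneg _) ?_ hpp.le)
        (add_rpow_le_two (abs_nonneg _) (abs_nonneg _) hpp.le)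
      rw [hx]
      have := abs_add_le ((v i).val x - u.val x) (u.val x)
      rwa [sub_add_cancel] at this
    have hD0 : 0 ≤ D := by positivity
    have h5 := mul_le_mul_of_nonneg_left h4 hD0
    nlinarith
  have hiu := integrable_rpow hN hf.two_le hf.le_critExp u
  have hiv : ∀ i, Integrable (fun x => |(v i - u).val x| ^ p) := fun i =>
    integrable_rpow hN hf.two_le hf.le_critExp (v i - u)
  have hgi : ∀ i, Integrable (fun x => g i x ^ p.conjExponent) := by
    intro i
    refine ((hiu.const_mul (D * (2 ^ p + 1))).add ((hiv i).const_mul (D * 2 ^ p))).mono'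
      ((hgm i).pow_const _).aestronglyMeasurable ?_
    filter_upwards [hgp i] with x hx
    rwa [Real.norm_of_nonneg (Real.rpow_nonneg (hg0 i x) _)]
  have hglim : Tendsto (fun i => ∫ x, g i x ^ p.conjExponent) atTop (𝓝 0) := by
    refine tendsto_integral_zero_of_le_add (fun i => (hgm i).pow_const _)
      (fun i x => Real.rpow_nonneg (hg0 i x) _) (hiu.const_mul (D * (2 ^ p + 1)))
      (fun i => (hiv i).const_mul (D * 2 ^ p)) (fun i x => by positivity) hgp ?_ ?_
    · filter_upwards [hae, hf.F1.continuous] with x hx hc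
      refine tendsto_rpow_zero hp1 ?_
      have h1 : Tendsto (fun i => |d i x|) atTop (𝓝 0) := by
        have := ((hc.tendsto _).comp hx).sub_const (f x (u.val x))
        rw [sub_self] at this
        simpa using this.abs
      refine squeeze_zero (fun i => hg0 i x) (fun i => max_le ?_ (abs_nonneg _)) h1
      have : 0 ≤ m i x := by positivity
      linarith
    · simp only [integral_const_mul]
      simpa using hvlim.const_mul (D * 2 ^ p)
  have hlast : Tendsto (fun i => S * (∫ x, g i x ^ p.conjExponent) ^ (1 / p.conjExponent))
      atTop (𝓝 0) := by
    simpa using (tendsto_rpow_zero (p := 1 / p.conjExponent) (by positivity) hglim).const_mul S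
  obtain ⟨i, hi⟩ := (hlast.eventually (gt_mem_nhds (half_pos hε))).exists
  refine hbad (ns i) fun ψ => ?_
  refine ((hdual (d i) (m i) (g i) (hdm i) (hmm i) (hgm i) (hg0 i) (hgi i)
    (ae_of_all _ fun x => ?_) ψ).2).trans ?_
  · have h1 : |d i x| - m i x ≤ g i x := le_max_left _ _
    have h2 := le_abs_self (m i x)
    linarith
  · refine mul_le_mul_of_nonneg_right ?_ (norm_nonneg _)
    have h1 : √(∫ x, m i x ^ 2) ≤ η * (R + ‖u‖) := by
      set a : L2 N := η • (|toL2L N (v i)| + |toL2L N u|) with ha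
      have h2 : ∫ x, m i x ^ 2 = ‖a‖ ^ 2 := by
        rw [← real_inner_self_eq_norm_sq, L2.inner_def]
        refine integral_congr_ae ?_
        filter_upwards [Lp.coeFn_smul η (|toL2L N (v i)| + |toL2L N u|),
          Lp.coeFn_add |toL2L N (v i)| |toL2L N u|, Lp.coeFn_abs (toL2L N (v i)),
          Lp.coeFn_abs (toL2L N u)] with x h1 h2 h3 h4
        rw [ha, h1, Pi.smul_apply, h2, Pi.add_apply, h3, h4, real_inner_self_eq_norm_sq,
          Real.norm_eq_abs, sq_abs, smul_eq_mul]
        rfl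
      rw [h2, Real.sqrt_sq (norm_nonneg _), ha, norm_smul, Real.norm_of_nonneg hη0.le]
      refine mul_le_mul_of_nonneg_left ((norm_add_le _ _).trans ?_) hη0.le
      rw [norm_abs_eq_norm, norm_abs_eq_norm]
      exact add_le_add (hR _) (norm_toL2L_le u)
    have h2 : η * (R + ‖u‖) ≤ ε / 2 := by
      rw [hη, div_mul_eq_mul_div, div_le_div_iff₀ (by positivity) two_pos]
      nlinarith [norm_nonneg u]
    linarith

end

section

variable {N : ℕ} {f : Euc N → ℝ → ℝ} {p : ℝ}

/-! ### The potential: differentiability and convexity -/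

/-- The tangent inequality of the convex functional `∫ F(x,u)`. -/
theorem potential_tangent (hN : 3 ≤ N) (hf : CondF f p) (u w : H1 N) :
    potential f u + nonlinL hN hf u (w - u) ≤ potential f w := by
  rw [nonlinL_apply, potential, potential,
    ← integral_add (integrable_primitive hN hf u) (integrable_nonlin_mul hN hf u (w - u))]
  refine integral_mono_ae ((integrable_primitive hN hf u).add
    (integrable_nonlin_mul hN hf u (w - u))) (integrable_primitive hN hf w) ?_
  filter_upwards [hf.scalar, val_sub w u] with x hx hs
  have := hx.tangent_le (u.val x) (w.val x)
  simp only [hs]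
  change primitive f x _ + _ ≤ primitive f x _
  simp only [primitive]
  linarith

/-- By convexity the remainder at `u + h` lies between `0` and the pairing of `f(·,u+h) - f(·,u)`
with `h`. Continuity of the superposition operator makes this `o(‖h‖)`. -/
theorem hasFDerivAt_potential (hN : 3 ≤ N) (hf : CondF f p) (u : H1 N) :
    HasFDerivAt (potential f) (nonlinL hN hf u) u := by
  rw [hasFDerivAt_iff_isLittleO_nhds_zero, Asymptotics.isLittleO_iff]
  intro ε hε
  have hkey : ∀ h : H1 N, ‖potential f (u + h) - potential f u - nonlinL hN hf u h‖ ≤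
      ∫ x, |f x ((u + h).val x) - f x (u.val x)| * |h.val x| := by
    intro h
    have h1 := potential_tangent hN hf u (u + h)
    have h2 := potential_tangent hN hf (u + h) u
    rw [add_sub_cancel_left] at h1
    rw [show u - (u + h) = -h by abel, map_neg] at h2
    have h3 : nonlinL hN hf (u + h) h - nonlinL hN hf u h ≤
        ∫ x, |f x ((u + h).val x) - f x (u.val x)| * |h.val x| := by
      rw [nonlinL_apply, nonlinL_apply, ← integral_sub (integrable_nonlin_mul hN hf _ _)
        (integrable_nonlin_mul hN hf _ _)]
      refine (le_abs_self _).trans (abs_integral_le_integral_abs.trans (le_of_eq ?_))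
      refine integral_congr_ae (ae_of_all _ fun x => ?_)
      simp only
      rw [← sub_mul, abs_mul]
    rw [Real.norm_of_nonneg (by linarith)]
    linarith
  by_contra hcon
  have hfr : ∃ᶠ h in 𝓝 (0 : H1 N),
      ¬ ‖potential f (u + h) - potential f u - nonlinL hN hf u h‖ ≤ ε * ‖h‖ := not_eventually.1 hcon
  obtain ⟨h, hlim, hbad⟩ := exists_seq_forall_of_frequently hfr
  obtain ⟨S, hS, hSo⟩ := exists_integral_rpow_le hN hf.two_le hf.le_critExp
  obtain ⟨B, hB⟩ := (Metric.isBounded_range_of_tendsto _ hlim).exists_norm_le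
  have hn : Tendsto (fun n => ‖h n‖) atTop (𝓝 0) := by simpa using hlim.norm
  have hw : Tendsto (fun n => ∫ x, |((u + h n) - u).val x| ^ p) atTop (𝓝 0) := by
    have h1 := (tendsto_rpow_zero (p := p) (by linarith [hf.two_le]) hn).const_mul S
    rw [mul_zero] at h1
    refine squeeze_zero (fun n => integral_nonneg fun x => by positivity) (fun n => ?_) h1
    rw [add_sub_cancel_left]
    exact hSo (h n)
  obtain ⟨n, hn⟩ := (nonlin_tendsto hN hf (w := fun n => u + h n) (R := ‖u‖ + B) (fun n =>
    (norm_toL2L_le _).trans ((norm_add_le _ _).trans (by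
      have := hB (h n) (mem_range_self n); linarith))) hw hε).exists
  exact hbad n ((hkey (h n)).trans (hn (h n)))

theorem continuous_potential (hN : 3 ≤ N) (hf : CondF f p) : Continuous (potential f) :=
  continuous_iff_continuousAt.2 fun u => (hasFDerivAt_potential hN hf u).continuousAt

theorem potential_zero (f : Euc N → ℝ → ℝ) : potential f 0 = 0 := by
  rw [potential, ← integral_zero (Euc N) ℝ]
  refine integral_congr_ae ?_
  filter_upwards [val_zero (N := N)] with x hx
  rw [hx]
  simp [primitive]

/-- Average the tangent inequalities at the convex combination; the linear terms cancel. -/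
theorem potential_convex (hN : 3 ≤ N) (hf : CondF f p) (u w : H1 N) {a b : ℝ} (ha : 0 ≤ a)
    (hb : 0 ≤ b) (hab : a + b = 1) :
    potential f (a • u + b • w) ≤ a * potential f u + b * potential f w := by
  set m := a • u + b • w with hm
  have h1 := potential_tangent hN hf m u
  have h2 := potential_tangent hN hf m w
  have h3 : a * nonlinL hN hf m (u - m) + b * nonlinL hN hf m (w - m) = 0 := by
    rw [← smul_eq_mul, ← smul_eq_mul, ← map_smul, ← map_smul, ← map_add]
    have : a • (u - m) + b • (w - m) = 0 := by
      rw [smul_sub, smul_sub]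
      have : a • u - a • m + (b • w - b • m) = m - (a + b) • m := by
        rw [hm, add_smul a b]; abel
      rw [this, hab, one_smul, sub_self]
    rw [this, map_zero]
  have h4 := mul_le_mul_of_nonneg_left h1 ha
  have h5 := mul_le_mul_of_nonneg_left h2 hb
  have h6 : a * potential f m + b * potential f m = potential f m := by
    rw [← add_mul, hab, one_mul]
  linarith

theorem sq_mul_potential_le (hN : 3 ≤ N) (hf : CondF f p) (u : H1 N) {r : ℝ} (hr : 1 ≤ r) :
    r ^ 2 * potential f u ≤ potential f (r • u) := by
  rw [potential, potential, ← integral_const_mul]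
  refine integral_mono_ae ((integrable_primitive hN hf u).const_mul _)
    (integrable_primitive hN hf (r • u)) ?_
  filter_upwards [hf.scalar, val_smul r u] with x hx hs
  simp only [hs]
  exact hx.sq_mul_primitive_le (u.val x) hr

theorem two_mul_potential_le (hN : 3 ≤ N) (hf : CondF f p) (u : H1 N) :
    2 * potential f u ≤ nonlinL hN hf u u := by
  rw [potential, nonlinL_apply, ← integral_const_mul]
  refine integral_mono_ae ((integrable_primitive hN hf u).const_mul _)
    (integrable_nonlin_mul hN hf u u) ?_
  filter_upwards [hf.scalar] with x hx
  exact hx.two_mul_primitive_le (u.val x)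

theorem potential_nehari_le (hN : 3 ≤ N) (hf : CondF f p) (u v : H1 N) {t : ℝ} (ht : 0 ≤ t) :
    nonlinL hN hf u (((t ^ 2 - 1) / 2) • u + t • v) + potential f u ≤ potential f (t • u + v) := by
  rw [potential, potential, nonlinL_apply, ← integral_add (integrable_nonlin_mul hN hf _ _)
    (integrable_primitive hN hf u)]
  refine integral_mono_ae ((integrable_nonlin_mul hN hf _ _).add (integrable_primitive hN hf u))
    (integrable_primitive hN hf _) ?_
  filter_upwards [hf.scalar, val_add (((t ^ 2 - 1) / 2) • u) (t • v), val_smul ((t ^ 2 - 1) / 2) u,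
    val_smul t v, val_add (t • u) v, val_smul t u] with x hx h1 h2 h3 h4 h5
  simp only [h1, h2, h3, h4, h5]
  exact hx.nehari_le (u.val x) (v.val x) ht

/-! ### Superquadratic growth and lattice invariance of the potential. -/

/-- `s²` on `|s| ≥ δ` and `0` elsewhere. -/
def largeSq (δ s : ℝ) : ℝ := if δ ≤ |s| then s ^ 2 else 0

theorem measurable_largeSq (δ : ℝ) : Measurable (largeSq δ) :=
  Measurable.ite (measurableSet_le measurable_const measurable_norm) (by fun_prop)
    measurable_const

theorem largeSq_nonneg (δ s : ℝ) : 0 ≤ largeSq δ s := by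
  rw [largeSq]; split_ifs <;> positivity

theorem largeSq_le (δ s : ℝ) : largeSq δ s ≤ s ^ 2 := by
  rw [largeSq]; split_ifs; exacts [le_rfl, sq_nonneg s]

theorem integrable_largeSq (δ : ℝ) (u : H1 N) : Integrable (fun x => largeSq δ (u.val x)) := by
  refine (integrable_val_sq u).mono'
    ((measurable_largeSq δ).comp_aemeasurable (aemeasurable_val u)).aestronglyMeasurable
    (ae_of_all _ fun x => ?_)
  rw [Real.norm_of_nonneg (largeSq_nonneg _ _)]
  exact largeSq_le _ _

/-- Use (F4) where `|t w| ≥ R` and `F ≥ 0` elsewhere. The radius does not depend on `w`, so the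
bound applies along sequences and not only along a fixed ray. -/
theorem potential_ge (hN : 3 ≤ N) (hf : CondF f p) (M : ℝ) :
    ∃ R : ℝ, 0 < R ∧ ∀ (w : H1 N) (δ t : ℝ), 0 < t → R ≤ t * δ →
      M * t ^ 2 * ∫ x, largeSq δ (w.val x) ≤ potential f (t • w) := by
  obtain ⟨R, hR, h⟩ := hf.F4 M
  refine ⟨R, hR, fun w δ t ht hRt => ?_⟩
  rw [potential, ← integral_const_mul]
  refine integral_mono_ae ((integrable_largeSq δ w).const_mul _)
    (integrable_primitive hN hf _) ?_
  filter_upwards [primitive_nonneg_ae hf, val_smul t w] with x hx hs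
  simp only [hs, largeSq]
  split_ifs with hδ
  · have h1 : R ≤ |t * w.val x| := by
      rw [abs_mul, abs_of_pos ht]
      exact hRt.trans (mul_le_mul_of_nonneg_left hδ ht.le)
    have h2 := h x _ h1
    have h3 : 0 < (t * w.val x) ^ 2 := by
      have : 0 < |t * w.val x| := hR.trans_le h1
      rw [← sq_abs]; positivity
    rw [le_div_iff₀ h3] at h2
    linarith
  · rw [mul_zero]; exact hx _

/-- Otherwise `w` would vanish almost everywhere on every set `{|w| ≥ 1/(n+1)}`. -/
theorem exists_largeSq_pos {w : H1 N} (hw : w ≠ 0) :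
    ∃ δ : ℝ, 0 < δ ∧ 0 < ∫ x, largeSq δ (w.val x) := by
  by_contra hcon
  push Not at hcon
  have h1 : ∀ n : ℕ, ∀ᵐ x, largeSq (1 / ((n : ℝ) + 1)) (w.val x) = 0 := by
    intro n
    have h2 := le_antisymm (hcon (1 / ((n : ℝ) + 1)) (by positivity))
      (integral_nonneg fun x => largeSq_nonneg _ _)
    rw [integral_eq_zero_iff_of_nonneg (fun x => largeSq_nonneg _ _) (integrable_largeSq _ w)] at h2
    exact h2
  refine hw (H1.ext_val ?_)
  filter_upwards [ae_all_iff.2 h1, val_zero (N := N)] with x hx h0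
  rw [h0]
  by_contra hne
  obtain ⟨n, hn⟩ := exists_nat_one_div_lt (abs_pos.2 hne)
  have := hx n
  rw [largeSq, if_pos hn.le] at this
  exact hne (pow_eq_zero_iff two_ne_zero |>.1 this)

/-- Superquadratic growth of the potential along rays. -/
theorem potential_superquadratic (hN : 3 ≤ N) (hf : CondF f p) {w : H1 N} (hw : w ≠ 0) (M : ℝ) :
    ∃ T : ℝ, 0 < T ∧ ∀ t, T ≤ t → M * t ^ 2 ≤ potential f (t • w) := by
  obtain ⟨δ, hδ, hm⟩ := exists_largeSq_pos hw
  set m := ∫ x, largeSq δ (w.val x) with hmdef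
  obtain ⟨R, hR, h⟩ := potential_ge hN hf (|M| / m)
  refine ⟨R / δ, by positivity, fun t ht => ?_⟩
  have ht0 : 0 < t := lt_of_lt_of_le (by positivity) ht
  have h1 := h w δ t ht0 (by rwa [div_le_iff₀ hδ] at ht)
  rw [← hmdef] at h1
  have h2 : |M| / m * t ^ 2 * m = |M| * t ^ 2 := by field_simp
  rw [h2] at h1
  refine le_trans ?_ h1
  gcongr
  exact le_abs_self M

theorem primitive_periodic (hf : CondF f p) (z : Fin N → ℤ) (x : Euc N) (s : ℝ) :
    primitive f (x + latticePoint z) s = primitive f x s := by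
  simp only [primitive, hf.F1.periodic]

theorem potential_shift (hf : CondF f p) (z : Fin N → ℤ) (u : H1 N) :
    potential f (shift (latticePoint z) u) = potential f u := by
  rw [potential, potential,
    ← integral_add_right_eq_self (fun x => primitive f x (u.val x)) (latticePoint z)]
  refine integral_congr_ae ?_
  filter_upwards [val_shift (latticePoint z) u] with x hx
  rw [hx, primitive_periodic hf]

theorem nonlinL_shift (hN : 3 ≤ N) (hf : CondF f p) (z : Fin N → ℤ) (u ψ : H1 N) :
    nonlinL hN hf (shift (latticePoint z) u) (shift (latticePoint z) ψ) = nonlinL hN hf u ψ := by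
  rw [nonlinL_apply, nonlinL_apply,
    ← integral_add_right_eq_self (fun x => f x (u.val x) * ψ.val x) (latticePoint z)]
  refine integral_congr_ae ?_
  filter_upwards [val_shift (latticePoint z) u, val_shift (latticePoint z) ψ] with x hx hy
  rw [hx, hy, hf.F1.periodic]

/-! ### The energy and its derivative -/

theorem hasFDerivAt_quadratic {F : Type*} [NormedAddCommGroup F] [NormedSpace ℝ F]
    (B : F →L[ℝ] F →L[ℝ] ℝ) (u : F) : HasFDerivAt (fun w => B w w) (B u + B.flip u) u := by
  refine (B.hasFDerivAt_of_bilinear (hasFDerivAt_id u) (hasFDerivAt_id u)).congr_fderiv ?_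
  ext ψ
  simp

theorem hasFDerivAt_energy (hN : 3 ≤ N) {V : Euc N → ℝ} (hV : MemLp V ⊤ volume)
    (hf : CondF f p) (μ : ℝ) (u : H1 N) :
    HasFDerivAt (energy V f μ) (formL hN hV μ u - nonlinL hN hf u) u := by
  have h1 : HasFDerivAt (fun w => formL hN hV μ w w)
      ((formL hN hV μ u) + (formL hN hV μ).flip u) u := hasFDerivAt_quadratic _ u
  have h2 := (h1.const_mul (1 / 2)).sub (hasFDerivAt_potential hN hf u)
  have h3 : energy V f μ = fun w => 1 / 2 * formL hN hV μ w w - potential f w := by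
    funext w
    rw [energy_eq_potential, formL_apply]
  rw [h3]
  refine h2.congr_fderiv ?_
  ext ψ
  simp only [sub_apply, smul_apply, add_apply, ContinuousLinearMap.flip_apply, smul_eq_mul]
  rw [formL_comm hN hV μ ψ u]
  ring

theorem mem_nehariPankov_iff (hN : 3 ≤ N) {V : Euc N → ℝ} (hV : MemLp V ⊤ volume)
    (hf : CondF f p) {μ : ℝ} {u : H1 N} : u ∈ nehariPankov V f μ ↔
      u ∉ Xminus V ∧ bform V μ u u = nonlinL hN hf u u ∧
        ∀ v ∈ Xminus V, bform V μ u v = nonlinL hN hf u v := by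
  have hd := hasFDerivAt_energy hN hV hf μ u
  constructor
  · rintro ⟨h1, L, hL, h2, h3⟩
    obtain rfl := hL.unique hd
    refine ⟨h1, ?_, fun v hv => ?_⟩
    · rw [sub_apply, formL_apply] at h2; linarith
    · have := h3 v hv
      rw [sub_apply, formL_apply] at this; linarith
  · rintro ⟨h1, h2, h3⟩
    refine ⟨h1, _, hd, ?_, fun v hv => ?_⟩
    · rw [sub_apply, formL_apply, h2, sub_self]
    · rw [sub_apply, formL_apply, h3 v hv, sub_self]

theorem critical_iff (hN : 3 ≤ N) {V : Euc N → ℝ} (hV : MemLp V ⊤ volume)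
    (hf : CondF f p) {μ : ℝ} {u : H1 N} : HasFDerivAt (energy V f μ) (0 : H1 N →L[ℝ] ℝ) u ↔
      ∀ v, bform V μ u v = nonlinL hN hf u v := by
  have hd := hasFDerivAt_energy hN hV hf μ u
  constructor
  · intro h v
    have h1 := h.unique hd
    have h2 := congrArg (fun L : H1 N →L[ℝ] ℝ => L v) h1
    simp only [zero_apply, sub_apply, formL_apply] at h2
    linarith
  · intro h
    refine hd.congr_fderiv ?_
    ext v
    rw [sub_apply, formL_apply, h v, sub_self, zero_apply]

/-- Points satisfying the Nehari–Pankov equations maximise the energy on their half space. -/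
theorem energy_le_of_nehari (hN : 3 ≤ N) {V : Euc N → ℝ} (hV : MemLp V ⊤ volume)
    (hf : CondF f p) {μ : ℝ} {u : H1 N} (hu : bform V μ u u = nonlinL hN hf u u)
    {v : H1 N} (huv : bform V μ u v = nonlinL hN hf u v) (hv : bform V μ v v ≤ 0) {t : ℝ}
    (ht : 0 ≤ t) : energy V f μ (t • u + v) ≤ energy V f μ u := by
  have h1 := potential_nehari_le hN hf u v ht
  rw [map_add, map_smul, map_smul, ← hu, ← huv, smul_eq_mul, smul_eq_mul] at h1
  have h2 : bform V μ (t • u + v) (t • u + v) =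
      t ^ 2 * bform V μ u u + 2 * t * bform V μ u v + bform V μ v v := by
    simp only [← formL_apply hN hV, map_add, map_smul, add_apply, smul_apply, smul_eq_mul]
    rw [formL_comm hN hV μ v u]
    ring
  rw [energy_eq_potential, energy_eq_potential, h2]
  nlinarith

end

section

/-! ### Maximisation over half spaces -/

section Maximization

variable {F : Type*} [NormedAddCommGroup F] [InnerProductSpace ℝ F]

/-- Continuous, nonnegative, convex, superquadratic functionals, bounded on bounded sets. -/
structure IsSuperquadratic (Φ : F → ℝ) : Prop where
  continuous : Continuous Φ
  nonneg : ∀ u, 0 ≤ Φ u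
  convex : ∀ u w (a b : ℝ), 0 ≤ a → 0 ≤ b → a + b = 1 → Φ (a • u + b • w) ≤ a * Φ u + b * Φ w
  bounded : ∀ R : ℝ, ∃ M : ℝ, ∀ u, ‖u‖ ≤ R → Φ u ≤ M
  sq_mul_le : ∀ u (r : ℝ), 1 ≤ r → r ^ 2 * Φ u ≤ Φ (r • u)
  superquadratic : ∀ w, w ≠ 0 → ∀ M : ℝ, ∃ T : ℝ, 0 < T ∧ ∀ t, T ≤ t → M * t ^ 2 ≤ Φ (t • w)

/-- Almost maximisers of a decreasing sequence of uniformly concave functionals converge. -/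
theorem cauchySeq_of_concave {Y : Submodule ℝ F} {c : ℝ} (hc : 0 < c) {G : ℕ → F → ℝ}
    (hG : ∀ n m, n ≤ m → ∀ z, G m z ≤ G n z)
    (hconc : ∀ n, ∀ x ∈ Y, ∀ y ∈ Y, 1 / 2 * (G n x + G n y) + c * ‖x - y‖ ^ 2 ≤
      G n ((1 / 2 : ℝ) • (x + y)))
    {a b : ℕ → ℝ} {l : ℝ} (ha : Tendsto a atTop (𝓝 l)) (hb : Tendsto b atTop (𝓝 l))
    (hle : ∀ n, ∀ z ∈ Y, G n z ≤ a n) {z : ℕ → F} (hz : ∀ n, z n ∈ Y)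
    (hbz : ∀ n, b n ≤ G n (z n)) : CauchySeq z := by
  -- Compare at the midpoint using the functional with the smaller index: since the sequence
  -- decreases, `z m` is also a good competitor for `G n`.
  have key : ∀ n m, n ≤ m → c * ‖z n - z m‖ ^ 2 ≤ a n - 1 / 2 * (b n + b m) := by
    intro n m hnm
    have h1 := hconc n _ (hz n) _ (hz m)
    have h2 := hle n _ (Y.smul_mem (1 / 2) (Y.add_mem (hz n) (hz m)))
    have h3 := hbz n
    have h4 := (hbz m).trans (hG n m hnm (z m))
    linarith
  rw [Metric.cauchySeq_iff']
  intro ε hε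
  have hcε : 0 < c * ε ^ 2 / 2 := by positivity
  obtain ⟨n₀, hn₀⟩ := eventually_atTop.1
    ((ha.eventually_lt_const (show l < l + c * ε ^ 2 / 2 by linarith)).and
      (hb.eventually_const_lt (show l - c * ε ^ 2 / 2 < l by linarith)))
  refine ⟨n₀, fun n hn => ?_⟩
  have h1 := key n₀ n hn
  obtain ⟨h2, h3⟩ := hn₀ n₀ le_rfl
  obtain ⟨-, h4⟩ := hn₀ n hn
  have h5 : ‖z n₀ - z n‖ ^ 2 < ε ^ 2 := by
    have : c * ‖z n₀ - z n‖ ^ 2 < c * ε ^ 2 := by linarith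
    exact lt_of_mul_lt_mul_left this hc.le
  rw [dist_comm, dist_eq_norm]
  exact lt_of_pow_lt_pow_left₀ 2 hε.le h5

variable {B : F →L[ℝ] F →L[ℝ] ℝ} {Y : Submodule ℝ F} {c : ℝ}

/-- By the parallelogram identity the quadratic part exceeds its average at the midpoint by
`-B(x-y,x-y)/8`, and the convex part helps. -/
theorem energy_midpoint (hB : ∀ u v, B u v = B v u)
    (hneg : ∀ y ∈ Y, B y y ≤ - (c * ‖y‖ ^ 2)) {Φ : F → ℝ}
    (hconv : ∀ u w (a b : ℝ), 0 ≤ a → 0 ≤ b → a + b = 1 →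
      Φ (a • u + b • w) ≤ a * Φ u + b * Φ w) (e x y : F) (hx : x ∈ Y) (hy : y ∈ Y) :
    1 / 2 * ((1 / 2 * B (e + x) (e + x) - Φ (e + x)) + (1 / 2 * B (e + y) (e + y) - Φ (e + y))) +
      c / 8 * ‖x - y‖ ^ 2 ≤
      1 / 2 * B (e + (1 / 2 : ℝ) • (x + y)) (e + (1 / 2 : ℝ) • (x + y)) -
        Φ (e + (1 / 2 : ℝ) • (x + y)) := by
  have h1 := hneg _ (Y.sub_mem hx hy)
  have h2 := hconv (e + x) (e + y) (1 / 2) (1 / 2) (by norm_num) (by norm_num) (by norm_num)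
  have h3 : (1 / 2 : ℝ) • (e + x) + (1 / 2 : ℝ) • (e + y) = e + (1 / 2 : ℝ) • (x + y) := by
    module
  rw [h3] at h2
  simp only [map_add, map_sub, map_smul, add_apply, sub_apply, smul_apply, smul_eq_mul] at h1 ⊢
  rw [hB y x] at h1
  rw [hB x e, hB y e, hB y x]
  linarith

/-- Young's inequality absorbs the mixed term and leaves a quarter of the negative definiteness, so
the energy tends to `-∞` along `Y`. -/
theorem quadratic_upper (hc : 0 < c) (hneg : ∀ y ∈ Y, B y y ≤ - (c * ‖y‖ ^ 2))
    (hB : ∀ u v, B u v = B v u) (e z : F) (hz : z ∈ Y) :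
    1 / 2 * B (e + z) (e + z) + c / 4 * ‖z‖ ^ 2 ≤ (‖B‖ + ‖B‖ ^ 2 / c) * ‖e‖ ^ 2 := by
  have h1 := hneg z hz
  have h2 : B e e ≤ ‖B‖ * ‖e‖ ^ 2 := by
    refine (le_abs_self _).trans ((B.le_opNorm₂ e e).trans (le_of_eq (by ring)))
  have h3 : B e z ≤ ‖B‖ * ‖e‖ * ‖z‖ := (le_abs_self _).trans (B.le_opNorm₂ e z)
  have h4 : ‖B‖ * ‖e‖ * ‖z‖ ≤ ‖B‖ ^ 2 / c * ‖e‖ ^ 2 + c / 4 * ‖z‖ ^ 2 := by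
    have h5 : 0 ≤ (‖B‖ * ‖e‖ - c / 2 * ‖z‖) ^ 2 / c := by positivity
    have h6 : (‖B‖ * ‖e‖ - c / 2 * ‖z‖) ^ 2 / c =
        ‖B‖ ^ 2 / c * ‖e‖ ^ 2 - ‖B‖ * ‖e‖ * ‖z‖ + c / 4 * ‖z‖ ^ 2 := by
      field_simp; ring
    linarith
  have h0 : 0 ≤ ‖B‖ * ‖e‖ ^ 2 := by positivity
  simp only [map_add, add_apply]
  rw [hB z e]
  nlinarith

/-- The supremum over an affine copy of `Y` is attained. -/
theorem exists_max_affine [CompleteSpace F] (hY : IsClosed (Y : Set F)) (hc : 0 < c)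
    (hB : ∀ u v, B u v = B v u) (hneg : ∀ y ∈ Y, B y y ≤ - (c * ‖y‖ ^ 2)) {Φ : F → ℝ}
    (hcont : Continuous Φ) (h0 : ∀ u, 0 ≤ Φ u)
    (hconv : ∀ u w (a b : ℝ), 0 ≤ a → 0 ≤ b → a + b = 1 →
      Φ (a • u + b • w) ≤ a * Φ u + b * Φ w) (e : F) :
    ∃ z ∈ Y, ∀ y ∈ Y, 1 / 2 * B (e + y) (e + y) - Φ (e + y) ≤
      1 / 2 * B (e + z) (e + z) - Φ (e + z) := by
  set G : F → ℝ := fun y => 1 / 2 * B (e + y) (e + y) - Φ (e + y) with hG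
  have hGc : Continuous G := by
    have : Continuous fun y => B (e + y) (e + y) :=
      (B.continuous.comp (continuous_const.add continuous_id)).clm_apply
        (continuous_const.add continuous_id)
    exact (this.const_mul _).sub (hcont.comp (continuous_const.add continuous_id))
  have hbdd : BddAbove (G '' (Y : Set F)) := by
    refine ⟨(‖B‖ + ‖B‖ ^ 2 / c) * ‖e‖ ^ 2, ?_⟩
    rintro _ ⟨y, hy, rfl⟩
    have h1 := quadratic_upper hc hneg hB e y hy
    have h2 := h0 (e + y)
    have h3 : 0 ≤ c / 4 * ‖y‖ ^ 2 := by positivity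
    simp only [hG]
    linarith
  have hne : (G '' (Y : Set F)).Nonempty := ⟨_, 0, Y.zero_mem, rfl⟩
  set l := sSup (G '' (Y : Set F)) with hl
  have hex : ∀ n : ℕ, ∃ z ∈ Y, l - 1 / ((n : ℝ) + 1) ≤ G z := by
    intro n
    obtain ⟨_, ⟨z, hz, rfl⟩, h⟩ := exists_lt_of_lt_csSup hne
      (show l - 1 / ((n : ℝ) + 1) < l by
        have : 0 < 1 / ((n : ℝ) + 1) := by positivity
        linarith)
    exact ⟨z, hz, h.le⟩
  choose z hzY hz using hex
  have hb : Tendsto (fun n : ℕ => l - 1 / ((n : ℝ) + 1)) atTop (𝓝 l) := by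
    simpa using tendsto_one_div_add_atTop_nhds_zero_nat.const_sub l
  -- Uniform concavity makes any maximising sequence converge in norm; no weak compactness is
  -- involved.
  have hcau : CauchySeq z := cauchySeq_of_concave (c := c / 8) (by positivity) (G := fun _ => G)
    (fun _ _ _ _ => le_rfl) (fun _ x hx y hy => energy_midpoint hB hneg hconv e x y hx hy)
    (a := fun _ => l) tendsto_const_nhds hb (fun _ y hy => le_csSup hbdd ⟨y, hy, rfl⟩) hzY hz
  obtain ⟨zs, hzs⟩ := cauchySeq_tendsto_of_complete hcau
  refine ⟨zs, hY.mem_of_tendsto hzs (Eventually.of_forall hzY), fun y hy => ?_⟩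
  exact (le_csSup hbdd ⟨y, hy, rfl⟩).trans
    (le_of_tendsto_of_tendsto' hb ((hGc.tendsto zs).comp hzs) hz)

/-- The energy is negative on the half space far away from `Y`. -/
theorem exists_energy_neg [CompleteSpace F] (hY : IsClosed (Y : Set F)) (hc : 0 < c)
    (hB : ∀ u v, B u v = B v u) (hneg : ∀ y ∈ Y, B y y ≤ - (c * ‖y‖ ^ 2)) {Φ : F → ℝ}
    (hΦ : IsSuperquadratic Φ) {e : F} (he : e ∉ Y) :
    ∃ T : ℝ, 0 < T ∧ ∀ t, T ≤ t → ∀ z ∈ Y,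
      1 / 2 * B (t • e + z) (t • e + z) - Φ (t • e + z) < 0 := by
  -- After division by `t²` the energy at `t(e + y)` becomes `B(e+y,e+y)/2 - Ψ t (e+y)`, which is
  -- non-increasing in `t`. The question is whether its maximum over `Y` becomes negative.
  set Ψ : ℝ → F → ℝ := fun t w => Φ (t • w) / t ^ 2 with hΨ
  have hΨmono : ∀ s t : ℝ, 0 < s → s ≤ t → ∀ w, Ψ s w ≤ Ψ t w := by
    intro s t hs hst w
    have ht := hs.trans_le hst
    have h1 := hΦ.sq_mul_le (s • w) (t / s) ((one_le_div hs).2 hst)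
    rw [smul_smul, div_mul_cancel₀ _ hs.ne'] at h1
    simp only [hΨ]
    rw [div_le_div_iff₀ (by positivity) (by positivity)]
    rw [div_pow, div_mul_eq_mul_div, div_le_iff₀ (by positivity)] at h1
    linarith
  have hΨc : ∀ t : ℝ, Continuous (Ψ t) := fun t =>
    (hΦ.continuous.comp (continuous_const_smul t)).div_const _
  have hΨ0 : ∀ t w, 0 ≤ Ψ t w := fun t w => div_nonneg (hΦ.nonneg _) (sq_nonneg t)
  have hΨconv : ∀ t u w (a b : ℝ), 0 ≤ a → 0 ≤ b → a + b = 1 →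
      Ψ t (a • u + b • w) ≤ a * Ψ t u + b * Ψ t w := by
    intro t u w a b ha hb hab
    simp only [hΨ]
    have h1 := hΦ.convex (t • u) (t • w) a b ha hb hab
    rw [← mul_div_assoc, ← mul_div_assoc, ← add_div]
    refine div_le_div_of_nonneg_right ?_ (sq_nonneg t)
    rwa [show t • (a • u + b • w) = a • t • u + b • t • w by module]
  set G : ℕ → F → ℝ := fun n y => 1 / 2 * B (e + y) (e + y) - Ψ ((n : ℝ) + 1) (e + y) with hG
  have hGanti : ∀ n m, n ≤ m → ∀ z, G m z ≤ G n z := by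
    intro n m hnm z
    have := hΨmono ((n : ℝ) + 1) ((m : ℝ) + 1) (by positivity)
      (by have : (n : ℝ) ≤ m := by exact_mod_cast hnm
          linarith) (e + z)
    simp only [hG]
    linarith
  have hmax : ∀ n, ∃ z ∈ Y, ∀ y ∈ Y, G n y ≤ G n z := fun n =>
    exists_max_affine hY hc hB hneg (hΨc _) (hΨ0 _) (hΨconv _) e
  choose z hzY hz using hmax
  -- If all the maxima are nonnegative, the maximisers converge to some `zs`, and `e + zs ≠ 0`
  -- contradicts superquadratic growth. Otherwise the first negative maximum supplies `T`.
  by_cases hall : ∀ n, 0 ≤ G n (z n)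
  · exfalso
    have hanti : Antitone fun n => G n (z n) := by
      refine antitone_nat_of_succ_le fun n => ?_
      exact (hGanti n (n + 1) (Nat.le_succ n) _).trans (hz n _ (hzY (n + 1)))
    have hlim := tendsto_atTop_ciInf hanti ⟨0, by rintro _ ⟨n, rfl⟩; exact hall n⟩
    have hcau : CauchySeq z := cauchySeq_of_concave (c := c / 8) (by positivity) hGanti
      (fun n x hx y hy => energy_midpoint hB hneg (hΨconv _) e x y hx hy) hlim hlim hz hzY
      (fun n => le_rfl)
    obtain ⟨zs, hzs⟩ := cauchySeq_tendsto_of_complete hcau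
    have hzsY : zs ∈ Y := hY.mem_of_tendsto hzs (Eventually.of_forall hzY)
    have hGc : ∀ n, Continuous (G n) := fun n => by
      have : Continuous fun y => B (e + y) (e + y) :=
        (B.continuous.comp (continuous_const.add continuous_id)).clm_apply
          (continuous_const.add continuous_id)
      exact (this.const_mul _).sub ((hΨc _).comp (continuous_const.add continuous_id))
    have hGs : ∀ n, 0 ≤ G n zs := fun n =>
      ge_of_tendsto (((hGc n).tendsto zs).comp hzs) (eventually_atTop.2 ⟨n, fun m hm =>
        (hall m).trans (hGanti n m hm (z m))⟩)
    have hne : e + zs ≠ 0 := fun h => he (by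
      rw [eq_neg_of_add_eq_zero_left h]; exact Y.neg_mem hzsY)
    obtain ⟨T, hT, hsup⟩ := hΦ.superquadratic _ hne (1 / 2 * B (e + zs) (e + zs) + 1)
    obtain ⟨n, hn⟩ := exists_nat_ge T
    have h1 := hsup ((n : ℝ) + 1) (by linarith)
    have h2 := hGs n
    simp only [hG, hΨ] at h2
    rw [sub_nonneg, div_le_iff₀ (by positivity)] at h2
    have h3 : 0 < ((n : ℝ) + 1) ^ 2 := by positivity
    nlinarith
  · push Not at hall
    obtain ⟨n, hn⟩ := hall
    refine ⟨(n : ℝ) + 1, by positivity, fun t ht y hy => ?_⟩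
    have hn0 : (0 : ℝ) < (n : ℝ) + 1 := by positivity
    have ht0 : 0 < t := hn0.trans_le ht
    have h1 := hz n (t⁻¹ • y) (Y.smul_mem _ hy)
    have h2 := hΨmono _ _ hn0 ht (e + t⁻¹ • y)
    have h3 : t • (e + t⁻¹ • y) = t • e + y := by
      rw [smul_add, smul_smul, mul_inv_cancel₀ ht0.ne', one_smul]
    have h4 : 1 / 2 * B (e + t⁻¹ • y) (e + t⁻¹ • y) - Ψ t (e + t⁻¹ • y) < 0 := by
      simp only [hG] at h1 hn
      linarith
    have h5 : B (t • e + y) (t • e + y) = t ^ 2 * B (e + t⁻¹ • y) (e + t⁻¹ • y) := by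
      rw [← h3, map_smul, map_smul, smul_apply, smul_eq_mul, smul_eq_mul]; ring
    simp only [hΨ, h3] at h4
    rw [h5]
    have h6 : 0 < t ^ 2 := by positivity
    have h7 : t ^ 2 * (1 / 2 * B (e + t⁻¹ • y) (e + t⁻¹ • y) - Φ (t • e + y) / t ^ 2) < 0 :=
      mul_neg_of_pos_of_neg h6 h4
    rw [mul_sub, mul_div_cancel₀ _ h6.ne'] at h7
    linarith

/-- A convex function bounded above on a ball is Lipschitz inside it: write `w + s e` as a convex
combination of `w` and `w ± T e`. -/
theorem convex_shift_le {Φ : F → ℝ} (hΦ : IsSuperquadratic Φ) {M R T : ℝ} {e w : F} (hT : 0 < T)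
    (hM : ∀ u, ‖u‖ ≤ R → Φ u ≤ M) (hw : ‖w‖ + T * ‖e‖ ≤ R) {s : ℝ} (hs : |s| ≤ T) :
    Φ (w + s • e) ≤ Φ w + |s| / T * M := by
  have h1 : 0 ≤ |s| / T := by positivity
  have h2 : |s| / T ≤ 1 := (div_le_one hT).2 hs
  obtain ⟨σ, hσ1, hσ2⟩ : ∃ σ : ℝ, |σ| ≤ 1 ∧ s = |s| / T * (σ * T) := by
    rcases le_total 0 s with h | h
    · exact ⟨1, by simp, by rw [abs_of_nonneg h]; field_simp⟩
    · exact ⟨-1, by simp, by rw [abs_of_nonpos h]; field_simp⟩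
  have h3 := hΦ.convex w (w + (σ * T) • e) (1 - |s| / T) (|s| / T) (by linarith) h1 (by ring)
  have h4 : (1 - |s| / T) • w + (|s| / T) • (w + (σ * T) • e) = w + s • e := by
    rw [smul_add, smul_smul, ← hσ2]; module
  rw [h4] at h3
  have h5 : Φ (w + (σ * T) • e) ≤ M := by
    refine hM _ ((norm_add_le _ _).trans (le_trans ?_ hw))
    rw [norm_smul, norm_mul, Real.norm_eq_abs, Real.norm_of_nonneg hT.le]
    gcongr
    nlinarith
  have h6 := hΦ.nonneg w
  nlinarith

/-- The energy has a maximum on the half space `ℝ₊ e ⊕ Y`, attained away from `Y`. -/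
theorem exists_max_halfspace [CompleteSpace F] (hY : IsClosed (Y : Set F)) (hc : 0 < c)
    (hB : ∀ u v, B u v = B v u) (hneg : ∀ y ∈ Y, B y y ≤ - (c * ‖y‖ ^ 2)) {Φ : F → ℝ}
    (hΦ : IsSuperquadratic Φ) {e : F} (he : e ∉ Y) {t₀ : ℝ} (ht₀ : 0 < t₀)
    (hpos : 0 < 1 / 2 * B (t₀ • e) (t₀ • e) - Φ (t₀ • e)) :
    ∃ t : ℝ, 0 < t ∧ ∃ y ∈ Y, ∀ s : ℝ, 0 ≤ s → ∀ z ∈ Y,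
      1 / 2 * B (s • e + z) (s • e + z) - Φ (s • e + z) ≤
        1 / 2 * B (t • e + y) (t • e + y) - Φ (t • e + y) := by
  set J : F → ℝ := fun u => 1 / 2 * B u u - Φ u with hJ
  change ∃ t : ℝ, 0 < t ∧ ∃ y ∈ Y, ∀ s : ℝ, 0 ≤ s → ∀ z ∈ Y, J (s • e + z) ≤ J (t • e + y)
  obtain ⟨T, hT, hTneg⟩ := exists_energy_neg hY hc hB hneg hΦ he
  have hmax : ∀ t : ℝ, ∃ z ∈ Y, ∀ y ∈ Y, J (t • e + y) ≤ J (t • e + z) := fun t =>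
    exists_max_affine hY hc hB hneg hΦ.continuous hΦ.nonneg hΦ.convex (t • e)
  choose z hzY hz using hmax
  -- the maximisers are bounded for `t ∈ [0, T]`
  obtain ⟨M₀, hM₀⟩ := hΦ.bounded (T * ‖e‖)
  obtain ⟨K, hK⟩ : ∃ K : ℝ, ∀ t ∈ Icc 0 T, ‖z t‖ ≤ K := by
    set Q := (‖B‖ + ‖B‖ ^ 2 / c) * (T * ‖e‖) ^ 2 + ‖B‖ * (T * ‖e‖) ^ 2 + M₀ with hQ
    refine ⟨4 * Q / c + 1, fun t ht => ?_⟩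
    have h1 := hz t 0 Y.zero_mem
    rw [add_zero] at h1
    have h2 := quadratic_upper hc hneg hB (t • e) (z t) (hzY t)
    have hte : ‖t • e‖ ≤ T * ‖e‖ := by
      rw [norm_smul, Real.norm_of_nonneg ht.1]
      exact mul_le_mul_of_nonneg_right ht.2 (norm_nonneg _)
    have hte2 : ‖t • e‖ ^ 2 ≤ (T * ‖e‖) ^ 2 := pow_le_pow_left₀ (norm_nonneg _) hte 2
    have h3 := hM₀ _ hte
    have h4 : -(‖B‖ * (T * ‖e‖) ^ 2) ≤ 1 / 2 * B (t • e) (t • e) := by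
      have h5 : |B (t • e) (t • e)| ≤ ‖B‖ * ‖t • e‖ * ‖t • e‖ := B.le_opNorm₂ _ _
      have h6 := neg_abs_le (B (t • e) (t • e))
      have h7 : ‖B‖ * ‖t • e‖ ^ 2 ≤ ‖B‖ * (T * ‖e‖) ^ 2 := by gcongr
      nlinarith [norm_nonneg B, sq_nonneg ‖t • e‖]
    have h5 : (‖B‖ + ‖B‖ ^ 2 / c) * ‖t • e‖ ^ 2 ≤ (‖B‖ + ‖B‖ ^ 2 / c) * (T * ‖e‖) ^ 2 := by
      gcongr
    have h6 := hΦ.nonneg (t • e + z t)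
    simp only [hJ] at h1
    have h7 : c / 4 * ‖z t‖ ^ 2 ≤ Q := by linarith
    have h8 : ‖z t‖ ^ 2 ≤ 4 * Q / c := by
      rw [le_div_iff₀ hc]; linarith
    nlinarith [norm_nonneg (z t)]
  -- The maximum over the slice at height `t`. It is Lipschitz on `[0, T]`, because the maximiser of
  -- one slice, moved along `e`, is a competitor in the other.
  set φ : ℝ → ℝ := fun t => J (t • e + z t) with hφ
  set R := T * ‖e‖ + K + T * ‖e‖ with hR
  obtain ⟨M, hM⟩ := hΦ.bounded R
  have hK0 : 0 ≤ K := (norm_nonneg _).trans (hK 0 ⟨le_rfl, hT.le⟩)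
  have hM0 : 0 ≤ M := (hΦ.nonneg 0).trans (hM 0 (by rw [norm_zero]; positivity))
  set D := ‖B‖ * ‖e‖ * R + M / T with hD
  have hlip : ∀ s ∈ Icc 0 T, ∀ t ∈ Icc 0 T, φ t - φ s ≤ D * |s - t| := by
    intro s hs t ht
    have h1 := hz s (z t) (hzY t)
    have hst : |s - t| ≤ T := by
      rw [abs_le]; constructor <;> linarith [hs.1, hs.2, ht.1, ht.2]
    set w := t • e + z t with hw
    have hwn : ‖w‖ ≤ T * ‖e‖ + K := by
      refine (norm_add_le _ _).trans (add_le_add ?_ (hK t ht))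
      rw [norm_smul, Real.norm_of_nonneg ht.1]
      exact mul_le_mul_of_nonneg_right ht.2 (norm_nonneg _)
    have h2 : s • e + z t = w + (s - t) • e := by rw [hw]; module
    rw [h2] at h1
    have h3 := convex_shift_le hΦ hT hM (w := w) (e := e) (by rw [hR]; linarith) hst
    have h4 : B (w + (s - t) • e) (w + (s - t) • e) =
        B w w + (s - t) * (B e (w + (1 / 2 * (s - t)) • e) * 2) := by
      simp only [map_add, map_smul, add_apply, smul_apply, smul_eq_mul]
      rw [hB w e]; ring
    have h5 : |B e (w + (1 / 2 * (s - t)) • e)| ≤ ‖B‖ * ‖e‖ * R := by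
      refine (B.le_opNorm₂ _ _).trans (mul_le_mul_of_nonneg_left ?_ (by positivity))
      refine (norm_add_le _ _).trans ?_
      rw [hR, norm_smul, Real.norm_eq_abs, abs_mul, abs_of_pos (by norm_num : (0 : ℝ) < 1 / 2)]
      refine add_le_add hwn (mul_le_mul_of_nonneg_right ?_ (norm_nonneg _))
      linarith [abs_nonneg (s - t)]
    have h6 : -(|s - t| * (‖B‖ * ‖e‖ * R)) ≤ (s - t) * B e (w + (1 / 2 * (s - t)) • e) := by
      refine (neg_le_neg ?_).trans (neg_abs_le _)
      rw [abs_mul]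
      exact mul_le_mul_of_nonneg_left h5 (abs_nonneg _)
    have h7 : φ t = 1 / 2 * B w w - Φ w := rfl
    have h8 : φ s = J (s • e + z s) := rfl
    have h9 : J (w + (s - t) • e) = 1 / 2 * B (w + (s - t) • e) (w + (s - t) • e) -
      Φ (w + (s - t) • e) := rfl
    rw [h9, h4] at h1
    rw [h7, h8, hD]
    have h10 : |s - t| / T * M = M / T * |s - t| := by ring
    rw [h10] at h3
    linarith
  have hφc : ContinuousOn φ (Icc 0 T) := by
    have hD0 : 0 ≤ D := by positivity
    refine (LipschitzOnWith.of_dist_le_mul (K := ⟨D, hD0⟩) fun s hs t ht => ?_).continuousOn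
    rw [Real.dist_eq, Real.dist_eq, abs_le]
    change -(D * |s - t|) ≤ _ ∧ _ ≤ D * |s - t|
    have h1 := hlip s hs t ht
    have h2 := hlip t ht s hs
    rw [abs_sub_comm t s] at h2
    exact ⟨by linarith, h2⟩
  obtain ⟨t, ht, htmax⟩ := isCompact_Icc.exists_isMaxOn ⟨0, le_rfl, hT.le⟩ hφc
  have ht₀T : t₀ < T := by
    by_contra h
    push Not at h
    have := hTneg t₀ h 0 Y.zero_mem
    rw [add_zero] at this
    linarith
  have hφt : 0 < φ t := by
    refine lt_of_lt_of_le ?_ (htmax ⟨ht₀.le, ht₀T.le⟩)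
    have := hz t₀ 0 Y.zero_mem
    rw [add_zero] at this
    exact lt_of_lt_of_le hpos this
  -- Height zero is excluded because the energy is nonpositive on `Y`, while the maximum is at least
  -- the positive value at `t₀ • e`.
  refine ⟨t, lt_of_le_of_ne ht.1 fun h => ?_, z t, hzY t, fun s hs y hy => ?_⟩
  · have h1 : φ t = 1 / 2 * B (t • e + z t) (t • e + z t) - Φ (t • e + z t) := rfl
    rw [← h, zero_smul, zero_add] at h1
    have h2 := hneg _ (hzY 0)
    have h3 := hΦ.nonneg (z 0)
    have h4 : 0 ≤ c * ‖z 0‖ ^ 2 := by positivity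
    rw [h] at hφt h1
    rw [h1] at hφt
    rw [← h] at hφt
    linarith
  · rcases le_total T s with h | h
    · exact ((hTneg s h y hy).trans hφt).le
    · exact (hz s y hy).trans (htmax ⟨hs, h⟩)

end Maximization

end

section

variable {N : ℕ} {V : Euc N → ℝ} {f : Euc N → ℝ → ℝ} {p : ℝ}

/-! ### The projection onto the positive spectral subspace -/

/-- For the `X⁺` part `a` of `u`, orthogonality gives `c‖a‖² ≤ B_0(a,a) = B_0(a,u) ≤ C‖a‖‖u‖`. -/
theorem projection_bound (hV : CondV V) : ∃ C : ℝ, ∀ u,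
    ‖(Xplus V).projection (Xminus V) (spectral_split hV).1 u‖ ≤ C * ‖u‖ := by
  obtain ⟨hc, ho, c, hc0, hp, hn⟩ := spectral_split hV
  obtain ⟨C, hC⟩ := exists_abs_bform_le hV.bounded
  refine ⟨C / c, fun u => ?_⟩
  set a := (Xplus V).projection (Xminus V) hc u with ha
  have ham : a ∈ Xplus V := Submodule.projection_apply_mem hc u
  have hb : u - a ∈ Xminus V := Submodule.sub_projection_mem hc u
  have h1 := hp a ham
  have h2 : bform V 0 a u = bform V 0 a a := by
    have h3 := (ho a ham _ hb).2
    rw [← schrL_apply hV.bounded, map_sub, schrL_apply, schrL_apply] at h3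
    linarith
  have h3 := (le_abs_self _).trans (hC a u)
  rw [h2] at h3
  rcases eq_or_ne a 0 with h | h
  · rw [h, norm_zero]
    have h4 := (norm_nonneg _).trans (hC u u)
    rcases eq_or_ne u 0 with h5 | h5
    · rw [h5, norm_zero, mul_zero]
    · have hu : 0 < ‖u‖ := norm_pos_iff.2 h5
      rw [mul_assoc] at h4
      have : 0 ≤ C := nonneg_of_mul_nonneg_left h4 (by positivity)
      positivity
  · have hn : 0 < ‖a‖ := norm_pos_iff.2 h
    rw [div_mul_eq_mul_div, le_div_iff₀ hc0]
    refine le_of_mul_le_mul_right ?_ hn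
    nlinarith

/-- The projection of `H¹ = X⁺ ⊕ X⁻` onto `X⁺`. -/
def projPlus (hV : CondV V) : H1 N →L[ℝ] H1 N :=
  LinearMap.mkContinuousOfExistsBound ((Xplus V).projection (Xminus V) (spectral_split hV).1)
    (projection_bound hV)

theorem projPlus_mem (hV : CondV V) (u : H1 N) : projPlus hV u ∈ Xplus V :=
  Submodule.projection_apply_mem (spectral_split hV).1 u

theorem sub_projPlus_mem (hV : CondV V) (u : H1 N) : u - projPlus hV u ∈ Xminus V :=
  Submodule.sub_projection_mem (spectral_split hV).1 u

theorem projPlus_eq_zero_iff (hV : CondV V) {u : H1 N} : projPlus hV u = 0 ↔ u ∈ Xminus V :=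
  Submodule.projection_apply_eq_zero_iff (spectral_split hV).1

theorem projPlus_of_mem (hV : CondV V) {u : H1 N} (hu : u ∈ Xplus V) : projPlus hV u = u :=
  Submodule.projection_apply_left (spectral_split hV).1 ⟨u, hu⟩

theorem projPlus_eq_of (hV : CondV V) {u a : H1 N} (ha : a ∈ Xplus V) (hb : u - a ∈ Xminus V) :
    projPlus hV u = a := by
  have h1 := (projPlus_eq_zero_iff hV).2 hb
  rw [map_sub, projPlus_of_mem hV ha, sub_eq_zero] at h1
  exact h1

theorem inner_projPlus_comm (hV : CondV V) (u v : H1 N) :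
    inner ℝ (toL2L N (projPlus hV u)) (toL2L N v) =
      inner ℝ (toL2L N u) (toL2L N (projPlus hV v)) := by
  obtain ⟨-, ho, -⟩ := spectral_split hV
  have h1 := (ho _ (projPlus_mem hV u) _ (sub_projPlus_mem hV v)).1
  have h2 := (ho _ (projPlus_mem hV v) _ (sub_projPlus_mem hV u)).1
  rw [map_sub, inner_sub_right] at h1 h2
  rw [real_inner_comm (toL2L N u), real_inner_comm (toL2L N (projPlus hV u))] at h2
  linarith

theorem projPlus_shift (hV : CondV V) (z : Fin N → ℤ) (u : H1 N) :
    projPlus hV (shift (latticePoint z) u) = shift (latticePoint z) (projPlus hV u) := by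
  refine projPlus_eq_of hV (shift_mem_Xplus hV z (projPlus_mem hV u)) ?_
  rw [← map_sub]
  exact shift_mem_Xminus hV z (sub_projPlus_mem hV u)

/-- Describes `X⁻` as an `L²`-orthogonal complement, which shows that it is closed. -/
theorem mem_Xminus_iff (hV : CondV V) {u : H1 N} :
    u ∈ Xminus V ↔ ∀ v ∈ Xplus V, inner ℝ (toL2L N v) (toL2L N u) = 0 := by
  obtain ⟨-, ho, -⟩ := spectral_split hV
  refine ⟨fun hu v hv => (ho v hv u hu).1, fun h => ?_⟩
  rw [← projPlus_eq_zero_iff hV]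
  have h1 := h _ (projPlus_mem hV u)
  have h2 := (ho _ (projPlus_mem hV u) _ (sub_projPlus_mem hV u)).1
  rw [map_sub, inner_sub_right, h1, zero_sub, neg_eq_zero, inner_self_eq_zero] at h2
  exact toL2L_injective (by rw [h2, map_zero])

theorem isClosed_Xminus (hV : CondV V) : IsClosed (Xminus V : Set (H1 N)) := by
  have : (Xminus V : Set (H1 N)) =
      ⋂ v ∈ Xplus V, {u | inner ℝ (toL2L N v) (toL2L N u) = 0} := by
    ext u
    simp only [SetLike.mem_coe, mem_iInter]
    exact mem_Xminus_iff hV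
  rw [this]
  exact isClosed_biInter fun v _ => isClosed_eq
    (continuous_const.inner (toL2L N).continuous) continuous_const

/-! ### Points of the Nehari–Pankov manifold -/

theorem isSuperquadratic_potential (hN : 3 ≤ N) (hf : CondF f p) :
    IsSuperquadratic (potential f) where
  continuous := continuous_potential hN hf
  nonneg := potential_nonneg hf
  convex := fun u w _ _ ha hb hab => potential_convex hN hf u w ha hb hab
  bounded := potential_bounded hN hf
  sq_mul_le := fun u _ hr => sq_mul_potential_le hN hf u hr
  superquadratic := fun _ hw M => potential_superquadratic hN hf hw M

/-- Near the origin the potential is dominated by any positive quadratic form. -/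
theorem exists_small_ray (hN : 3 ≤ N) (hf : CondF f p) (e : H1 N) {b : ℝ} (hb : 0 < b) :
    ∃ t : ℝ, 0 < t ∧ potential f (t • e) < b * t ^ 2 := by
  set ε := b / (2 * (‖e‖ ^ 2 + 1)) with hε
  have hε0 : 0 < ε := by positivity
  obtain ⟨C, hC, h⟩ := potential_le hN hf hε0
  obtain ⟨S, hS, hSo⟩ := exists_integral_rpow_le hN hf.two_le hf.le_critExp
  have hp2 : 0 < p - 2 := by linarith [hf.F2.two_lt]
  have hlim : Tendsto (fun t : ℝ => C * S * ‖e‖ ^ p * t ^ (p - 2)) (𝓝[>] 0) (𝓝 0) := by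
    have h1 : Tendsto (fun t : ℝ => t ^ (p - 2)) (𝓝 0) (𝓝 0) := by
      have := (Real.continuousAt_rpow_const 0 (p - 2) (Or.inr hp2.le)).tendsto
      rwa [Real.zero_rpow hp2.ne'] at this
    simpa using (h1.mono_left nhdsWithin_le_nhds).const_mul (C * S * ‖e‖ ^ p)
  obtain ⟨t, ht, ht0⟩ := ((hlim.eventually_lt_const (half_pos hb)).and
    self_mem_nhdsWithin).exists
  have ht0 : 0 < t := ht0
  refine ⟨t, ht0, (h (t • e)).trans_lt ?_⟩
  have h1 : ‖toL2L N (t • e)‖ ^ 2 ≤ t ^ 2 * ‖e‖ ^ 2 := by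
    rw [← mul_pow]
    refine pow_le_pow_left₀ (norm_nonneg _) ((norm_toL2L_le _).trans (le_of_eq ?_)) 2
    rw [norm_smul, Real.norm_of_nonneg ht0.le]
  have h2 : ∫ x, |(t • e).val x| ^ p ≤ S * (t ^ p * ‖e‖ ^ p) := by
    refine (hSo _).trans (le_of_eq ?_)
    rw [norm_smul, Real.norm_of_nonneg ht0.le, Real.mul_rpow ht0.le (norm_nonneg _)]
  have h3 : t ^ p = t ^ (p - 2) * t ^ 2 := by
    rw [← Real.rpow_natCast, ← Real.rpow_add ht0]; norm_num
  have h4 : ε * ‖e‖ ^ 2 ≤ b / 2 := by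
    rw [hε, div_mul_eq_mul_div, div_le_div_iff₀ (by positivity) two_pos]
    nlinarith [sq_nonneg ‖e‖]
  have ht2 : 0 < t ^ 2 := by positivity
  calc ε * ‖toL2L N (t • e)‖ ^ 2 + C * ∫ x, |(t • e).val x| ^ p
      ≤ ε * (t ^ 2 * ‖e‖ ^ 2) + C * (S * (t ^ p * ‖e‖ ^ p)) := by gcongr
    _ = (ε * ‖e‖ ^ 2) * t ^ 2 + (C * S * ‖e‖ ^ p * t ^ (p - 2)) * t ^ 2 := by rw [h3]; ring
    _ < b * t ^ 2 := by nlinarith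

/-- Replacing `u` by its `X⁺` part leaves the half space unchanged and makes the energy positive for
small multiples. At the resulting maximum the derivative vanishes in the directions `e` and `X⁻`,
since small moves in them stay in the half space. -/
theorem exists_mem_nehariPankov (hN : 3 ≤ N) (hV : CondV V) (hf : CondF f p) {μ c : ℝ}
    (hc : 0 < c) (hp : ∀ u ∈ Xplus V, c * ‖u‖ ^ 2 ≤ bform V μ u u)
    (hn : ∀ u ∈ Xminus V, bform V μ u u ≤ - (c * ‖u‖ ^ 2)) {u : H1 N} (hu : u ∉ Xminus V) :
    ∃ t : ℝ, 0 < t ∧ ∃ v ∈ Xminus V, t • u + v ∈ nehariPankov V f μ := by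
  set e := projPlus hV u with he
  have he0 : e ≠ 0 := fun h => hu ((projPlus_eq_zero_iff hV).1 h)
  have heX : e ∈ Xplus V := projPlus_mem hV u
  have heY : e ∉ Xminus V := fun h => he0 (by
    rw [← projPlus_of_mem hV heX]; exact (projPlus_eq_zero_iff hV).2 h)
  have hb : 0 < 1 / 2 * bform V μ e e := by
    have := hp e heX
    have h2 : 0 < ‖e‖ := norm_pos_iff.2 he0
    have h3 : 0 < c * ‖e‖ ^ 2 := by positivity
    linarith
  obtain ⟨t₀, ht₀, hsmall⟩ := exists_small_ray hN hf e hb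
  obtain ⟨t, ht, y, hy, hmax⟩ := exists_max_halfspace (B := formL hN hV.bounded μ)
    (isClosed_Xminus hV) hc (formL_comm hN hV.bounded μ) (fun y hy => by
      rw [formL_apply]; exact hn y hy)
    (isSuperquadratic_potential hN hf) heY ht₀ (by
      rw [map_smul, map_smul, smul_apply, formL_apply, smul_eq_mul, smul_eq_mul]
      nlinarith)
  have hE : ∀ w, energy V f μ w = 1 / 2 * formL hN hV.bounded μ w w - potential f w := fun w => by
    rw [energy_eq_potential, formL_apply]
  simp only [← hE] at hmax
  set m := t • e + y with hm
  have hd := hasFDerivAt_energy hN hV.bounded hf μ m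
  set L := formL hN hV.bounded μ m - nonlinL hN hf m with hL
  have hcrit : ∀ d : H1 N, (∀ᶠ s : ℝ in 𝓝 0, energy V f μ (m + s • d) ≤ energy V f μ m) →
      L d = 0 := by
    intro d hmaxd
    have h1 : HasDerivAt (fun s : ℝ => energy V f μ (m + s • d)) (L d) 0 := by
      have h2 : HasDerivAt (fun s : ℝ => m + s • d) d 0 := by
        have h3 := ((hasDerivAt_id (0 : ℝ)).smul_const d).const_add m
        rwa [one_smul] at h3
      have h4 : HasFDerivAt (energy V f μ) L (m + (0 : ℝ) • d) := by
        rw [zero_smul, add_zero]; exact hd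
      exact h4.comp_hasDerivAt (0 : ℝ) h2
    have hloc : IsLocalMax (fun s : ℝ => energy V f μ (m + s • d)) 0 := by
      filter_upwards [hmaxd] with s hs
      simpa using hs
    exact hloc.hasDerivAt_eq_zero h1
  have hLe : L e = 0 := by
    refine hcrit e ?_
    filter_upwards [lt_mem_nhds (show -t < (0 : ℝ) by linarith)] with s hs
    have : m + s • e = (t + s) • e + y := by rw [hm]; module
    rw [this]
    exact hmax (t + s) (by linarith) y hy
  have hLv : ∀ v ∈ Xminus V, L v = 0 := by
    intro v hv
    refine hcrit v (Eventually.of_forall fun s => ?_)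
    have : m + s • v = t • e + (y + s • v) := by rw [hm]; module
    rw [this]
    exact hmax t ht.le _ ((Xminus V).add_mem hy ((Xminus V).smul_mem s hv))
  refine ⟨t, ht, y - t • (u - e), (Xminus V).sub_mem hy
    ((Xminus V).smul_mem t (sub_projPlus_mem hV u)), ?_⟩
  have hmeq : t • u + (y - t • (u - e)) = m := by rw [hm]; module
  rw [hmeq]
  refine ⟨fun h => heY ?_, L, hd, ?_, hLv⟩
  · have h1 : t • e ∈ Xminus V := by
      have := (Xminus V).sub_mem h hy
      rwa [hm, add_sub_cancel_right] at this
    have := (Xminus V).smul_mem t⁻¹ h1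
    rwa [smul_smul, inv_mul_cancel₀ ht.ne', one_smul] at this
  · rw [hm, map_add, map_smul, hLe, hLv y hy, smul_zero, add_zero]

theorem energy_zero_eq (hN : 3 ≤ N) (hV : CondV V) (μ : ℝ) (u : H1 N) :
    energy V f 0 u = energy V f μ u + 1 / 2 * (μ * hardyL hN u u) := by
  rw [energy_eq_potential, energy_eq_potential, bform_eq_sub hN hV.bounded μ]
  ring

theorem level_le {μ : ℝ} {u : H1 N} (hu : u ∈ nehariPankov V f μ) :
    level V f μ ≤ (energy V f μ u : EReal) := iInf₂_le u hu

theorem energy_le_of_mem_nehariPankov (hN : 3 ≤ N) (hV : CondV V) (hf : CondF f p) {μ : ℝ}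
    (hn : ∀ u ∈ Xminus V, bform V μ u u ≤ 0) {u : H1 N} (hu : u ∈ nehariPankov V f μ) {t : ℝ}
    (ht : 0 ≤ t) {v : H1 N} (hv : v ∈ Xminus V) :
    energy V f μ (t • u + v) ≤ energy V f μ u := by
  obtain ⟨-, h1, h2⟩ := (mem_nehariPankov_iff hN hV.bounded hf).1 hu
  exact energy_le_of_nehari hN hV.bounded hf h1 (h2 v hv) (hn v hv) ht

theorem IsGroundState.energy_pos {μ : ℝ} {u : H1 N} (hu : IsGroundState V f μ u) :
    0 < energy V f μ u := by
  have := hu.level_pos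
  rw [← hu.energy_eq] at this
  exact_mod_cast this

theorem notMem_Xminus_of_energy_pos (hf : CondF f p) {μ : ℝ}
    (hn : ∀ u ∈ Xminus V, bform V μ u u ≤ 0) {u : H1 N} (hu : 0 < energy V f μ u) :
    u ∉ Xminus V := by
  intro h
  rw [energy_eq_potential] at hu
  linarith [hn u h, potential_nonneg hf u]

theorem IsGroundState.mem_nehariPankov (hf : CondF f p) {μ : ℝ}
    (hn : ∀ u ∈ Xminus V, bform V μ u u ≤ 0) {u : H1 N} (hu : IsGroundState V f μ u) :
    u ∈ nehariPankov V f μ :=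
  ⟨notMem_Xminus_of_energy_pos hf hn hu.energy_pos, 0, hu.critical, rfl, fun _ _ => rfl⟩

/-! ### Admissible parameters -/

theorem hardy_const_pos (hN : 3 ≤ N) : 0 < ((N : ℝ) - 2) ^ 2 / 4 := by
  have : (3 : ℝ) ≤ N := by exact_mod_cast hN
  have : 0 < (N : ℝ) - 2 := by linarith
  positivity

/-- Extracts a real constant from an extended supremum, treating finite and infinite values of
`μ(V)^±` alike. -/
theorem exists_lt_of_lt_mul_sSup {k μ : ℝ} (hk : 0 < k) {S : Set ℝ}
    (h : (μ : EReal) < (k : EReal) * sSup ((fun M : ℝ => (M : EReal)) '' S)) :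
    ∃ M ∈ S, μ < k * M := by
  by_contra hcon
  push Not at hcon
  have h1 : sSup ((fun M : ℝ => (M : EReal)) '' S) ≤ ((μ / k : ℝ) : EReal) := by
    refine sSup_le ?_
    rintro _ ⟨M, hM, rfl⟩
    have := hcon M hM
    rw [EReal.coe_le_coe_iff, le_div_iff₀ hk]
    linarith
  have h2 : (k : EReal) * sSup ((fun M : ℝ => (M : EReal)) '' S) ≤
      (k : EReal) * ((μ / k : ℝ) : EReal) :=
    mul_le_mul_of_nonneg_left h1 (by exact_mod_cast hk.le)
  rw [← EReal.coe_mul, mul_div_cancel₀ _ hk.ne'] at h2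
  exact absurd h (not_lt.2 h2)

theorem hardyL_le_div (hN : 3 ≤ N) (u : H1 N) :
    ((N : ℝ) - 2) ^ 2 / 4 * hardyL hN u u ≤ ‖gradL N u‖ ^ 2 := by
  have h1 := hardyL_self_le hN u
  have h2 := hardy_const_pos hN
  have h3 : 4 / ((N : ℝ) - 2) ^ 2 = (((N : ℝ) - 2) ^ 2 / 4)⁻¹ := by rw [inv_div]
  rw [h3, inv_mul_eq_div, le_div_iff₀ h2] at h1
  linarith

/-- For admissible `μ ≥ 0` the form `B_μ` is coercive on `X⁺`. -/
theorem Admissible.pos (hN : 3 ≤ N) (hV : CondV V) {μ : ℝ} (h : Admissible V μ) (hμ : 0 ≤ μ) :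
    ∃ c : ℝ, 0 < c ∧ ∀ u ∈ Xplus V, c * ‖u‖ ^ 2 ≤ bform V μ u u := by
  have hk := hardy_const_pos hN
  set k := ((N : ℝ) - 2) ^ 2 / 4 with hkdef
  obtain ⟨M, ⟨hM, hMu⟩, hlt⟩ := exists_lt_of_lt_mul_sSup hk h.2
  obtain ⟨-, -, c, hc, hp, -⟩ := spectral_split hV
  -- On `X⁺`, Hardy's inequality and the choice of `M` give `B_μ ≥ (1 - μ/(kM)) B_0`.
  have hθ : 0 < 1 - μ / (k * M) := by
    rw [sub_pos, div_lt_one (by positivity)]; exact hlt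
  refine ⟨(1 - μ / (k * M)) * c, by positivity, fun u hu => ?_⟩
  have h1 := hMu u hu
  rw [integral_grad_sq] at h1
  have h2 := hardyL_le_div hN u
  rw [← hkdef] at h2
  have h3 : μ * hardyL hN u u ≤ μ / (k * M) * bform V 0 u u := by
    rw [div_mul_eq_mul_div, le_div_iff₀ (by positivity)]
    have h5 := mul_le_mul_of_nonneg_left ((mul_le_mul_of_nonneg_left h2 hM.le).trans h1) hμ
    linarith
  rw [bform_eq_sub hN hV.bounded μ]
  have h4 := mul_le_mul_of_nonneg_left (hp u hu) hθ.le
  linarith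

/-- For admissible `μ` the form `B_μ` is nonpositive on `X⁻`. -/
theorem Admissible.nonpos (hN : 3 ≤ N) (hV : CondV V) {μ : ℝ} (h : Admissible V μ) :
    ∀ u ∈ Xminus V, bform V μ u u ≤ 0 := by
  have hk := hardy_const_pos hN
  have h' : ((-μ : ℝ) : EReal) < ((((N : ℝ) - 2) ^ 2 / 4 : ℝ) : EReal) * muMinus V := by
    rw [EReal.coe_neg]
    exact EReal.neg_lt_comm.1 h.1
  obtain ⟨M, ⟨hM, hMu⟩, hlt⟩ := exists_lt_of_lt_mul_sSup hk h'
  set k := ((N : ℝ) - 2) ^ 2 / 4 with hkdef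
  intro u hu
  have h1 := hMu u hu
  rw [integral_grad_sq] at h1
  have h2 := hardyL_le_div hN u
  rw [← hkdef] at h2
  have h0 := hardyL_self_nonneg hN u
  rw [bform_eq_sub hN hV.bounded μ]
  nlinarith

theorem bform_le_of_nonneg (hN : 3 ≤ N) (hV : CondV V) {μ : ℝ} (hμ : 0 ≤ μ) (u : H1 N) :
    bform V μ u u ≤ bform V 0 u u := by
  rw [bform_eq_sub hN hV.bounded μ]
  nlinarith [hardyL_self_nonneg hN u]

theorem bform_zero_nonpos (hV : CondV V) : ∀ u ∈ Xminus V, bform V 0 u u ≤ 0 := by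
  obtain ⟨-, -, c, hc, -, hn⟩ := spectral_split hV
  intro u hu
  have : 0 ≤ c * ‖u‖ ^ 2 := by positivity
  linarith [hn u hu]

/-! ### Comparison of the levels -/

theorem exists_mem_nehariPankov_zero (hN : 3 ≤ N) (hV : CondV V) (hf : CondF f p) {u : H1 N}
    (hu : u ∉ Xminus V) :
    ∃ t : ℝ, 0 < t ∧ ∃ v ∈ Xminus V, t • u + v ∈ nehariPankov V f 0 := by
  obtain ⟨-, -, c, hc, hp, hn⟩ := spectral_split hV
  exact exists_mem_nehariPankov hN hV hf hc hp hn hu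

/-- For `μ ≥ 0` only coercivity on `X⁺` is at stake: subtracting the Hardy term preserves negative
definiteness on `X⁻`. -/
theorem exists_mem_nehariPankov_of_pos (hN : 3 ≤ N) (hV : CondV V) (hf : CondF f p) {μ c' : ℝ}
    (hμ : 0 ≤ μ) (hc' : 0 < c') (hp' : ∀ u ∈ Xplus V, c' * ‖u‖ ^ 2 ≤ bform V μ u u) {u : H1 N}
    (hu : u ∉ Xminus V) :
    ∃ t : ℝ, 0 < t ∧ ∃ v ∈ Xminus V, t • u + v ∈ nehariPankov V f μ := by
  obtain ⟨-, -, c, hc, -, hn⟩ := spectral_split hV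
  refine exists_mem_nehariPankov hN hV hf (lt_min hc hc') (fun u hu => le_trans ?_ (hp' u hu))
    (fun u hu => (bform_le_of_nonneg hN hV hμ u).trans ((hn u hu).trans (neg_le_neg ?_))) hu
  · exact mul_le_mul_of_nonneg_right (min_le_right _ _) (sq_nonneg _)
  · exact mul_le_mul_of_nonneg_right (min_le_left _ _) (sq_nonneg _)

/-- The level of `J_0` is at most `J_0(tu+v) = J_μ(tu+v) + ½ Hardy`, and `J_μ(tu+v) ≤ J_μ(u)` by
maximality of `u` on its half space. -/
theorem level_zero_le_of_groundState (hN : 3 ≤ N) (hV : CondV V) (hf : CondF f p) {μ : ℝ}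
    (hadm : Admissible V μ) {u : H1 N} (hu : IsGroundState V f μ u) :
    ∃ t : ℝ, 0 < t ∧ ∃ v ∈ Xminus V, t • u + v ∈ nehariPankov V f 0 ∧
      level V f 0 ≤ level V f μ + ((1 / 2 * hardyTerm μ (t • u + v) : ℝ) : EReal) := by
  have hn := hadm.nonpos hN hV
  have hmem := hu.mem_nehariPankov hf hn
  obtain ⟨t, ht, v, hv, hm⟩ := exists_mem_nehariPankov_zero hN hV hf hmem.1
  refine ⟨t, ht, v, hv, hm, (level_le hm).trans ?_⟩
  rw [← hu.energy_eq, ← EReal.coe_add, EReal.coe_le_coe_iff, energy_zero_eq hN hV μ, hardyTerm_eq hN]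
  have := energy_le_of_mem_nehariPankov hN hV hf hn hmem ht.le hv
  linarith

theorem level_le_of_groundState_zero (hN : 3 ≤ N) (hV : CondV V) (hf : CondF f p) {μ : ℝ}
    (hadm : Admissible V μ) (hμ : 0 ≤ μ) {u : H1 N} (hu : IsGroundState V f 0 u) :
    ∃ t : ℝ, 0 < t ∧ ∃ v ∈ Xminus V, t • u + v ∈ nehariPankov V f μ ∧
      level V f μ ≤ level V f 0 - ((1 / 2 * hardyTerm μ (t • u + v) : ℝ) : EReal) := by
  have hn := bform_zero_nonpos hV
  have hmem := hu.mem_nehariPankov hf hn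
  obtain ⟨c, hc, hp⟩ := hadm.pos hN hV hμ
  obtain ⟨t, ht, v, hv, hm⟩ := exists_mem_nehariPankov_of_pos hN hV hf hμ hc hp hmem.1
  refine ⟨t, ht, v, hv, hm, (level_le hm).trans ?_⟩
  rw [← hu.energy_eq, ← EReal.coe_sub, EReal.coe_le_coe_iff, hardyTerm_eq hN]
  have h1 := energy_le_of_mem_nehariPankov hN hV hf hn hmem ht.le hv
  have h2 := energy_zero_eq (f := f) hN hV μ (t • u + v)
  linarith

end

section

variable {N : ℕ} {V : Euc N → ℝ} {f : Euc N → ℝ → ℝ} {p : ℝ}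

/-! ### Nonexistence for negative `μ` -/

theorem hardyL_add_le (hN : 3 ≤ N) (a b : H1 N) :
    hardyL hN (a + b) (a + b) ≤ 2 * hardyL hN a a + 2 * hardyL hN b b := by
  have h := hardyL_self_nonneg hN (a - b)
  simp only [map_add, map_sub, add_apply, sub_apply] at h ⊢
  linarith

theorem hardyL_le_norm (hN : 3 ≤ N) : ∃ C : ℝ, 0 < C ∧ ∀ u : H1 N, hardyL hN u u ≤ C * ‖u‖ ^ 2 := by
  have : (3 : ℝ) ≤ N := by exact_mod_cast hN
  have h2 : 0 < (N : ℝ) - 2 := by linarith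
  refine ⟨4 / ((N : ℝ) - 2) ^ 2, by positivity, fun u => (hardyL_self_le hN u).trans ?_⟩
  refine mul_le_mul_of_nonneg_left ?_ (by positivity)
  exact pow_le_pow_left₀ (norm_nonneg _) (norm_gradL_le u) 2

/-- After the translation the support lies at distance at least `r` from the origin, where the
weight is at most `r⁻²`. -/
theorem hardyL_shift_test_le (hN : 3 ≤ N) {φ : Euc N → ℝ} (hφ : ContDiff ℝ ∞ φ)
    (hc : HasCompactSupport φ) {R r : ℝ} (hr : 0 < r) (hR : ∀ x, φ x ≠ 0 → ‖x‖ ≤ R) {y : Euc N}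
    (hy : R + r ≤ ‖y‖) : hardyL hN (shift y (ofTest φ hφ hc)) (shift y (ofTest φ hφ hc)) ≤
      (r ^ 2)⁻¹ * ‖ofTest φ hφ hc‖ ^ 2 := by
  set w := ofTest φ hφ hc with hw
  rw [hardyL_self]
  have h1 : ∫ x, (shift y w).val x ^ 2 / ‖x‖ ^ 2 ≤ ∫ x, (r ^ 2)⁻¹ * (shift y w).val x ^ 2 := by
    refine integral_mono_ae (integrable_hardy hN (shift y w))
      ((integrable_val_sq (shift y w)).const_mul _) ?_
    have hq : ∀ᵐ x, w.val (x + y) = φ (x + y) :=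
      (measurePreserving_add_right volume y).quasiMeasurePreserving.ae (val_ofTest φ hφ hc)
    filter_upwards [val_shift y w, hq] with x hx hx'
    simp only [hx, hx']
    by_cases h0 : φ (x + y) = 0
    · rw [h0]; simp
    · have h2 := hR _ h0
      have h3 : r ≤ ‖x‖ := by
        have h4 : ‖y‖ ≤ ‖x + y‖ + ‖x‖ := by
          have := norm_sub_le (x + y) x
          rwa [add_sub_cancel_left] at this
        linarith
      rw [div_eq_inv_mul]
      gcongr
  refine h1.trans ?_
  rw [integral_const_mul, integral_val_sq]
  refine mul_le_mul_of_nonneg_left (pow_le_pow_left₀ (norm_nonneg _) ?_ 2) (by positivity)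
  refine (norm_toL2L_le _).trans (le_of_eq ?_)
  exact (shift y).norm_map w

theorem exists_latticePoint_norm_ge (hN : 3 ≤ N) (R : ℝ) :
    ∃ z : Fin N → ℤ, R ≤ ‖latticePoint z‖ := by
  obtain ⟨n, hn⟩ := exists_nat_ge R
  refine ⟨fun _ => (n : ℤ), hn.trans ?_⟩
  have h := EuclideanSpace.norm_eq (latticePoint (N := N) fun _ => (n : ℤ))
  rw [h]
  refine Real.le_sqrt_of_sq_le ?_
  have h2 : ∀ i, ‖(latticePoint (N := N) fun _ => (n : ℤ)) i‖ ^ 2 = (n : ℝ) ^ 2 := by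
    intro i
    simp [latticePoint]
  rw [Finset.sum_congr rfl fun i _ => h2 i, Finset.sum_const, Finset.card_univ, Fintype.card_fin,
    nsmul_eq_mul]
  have : (1 : ℝ) ≤ N := by exact_mod_cast (by omega : 1 ≤ N)
  nlinarith [sq_nonneg (n : ℝ)]

/-- The Hardy term of lattice translates can be made arbitrarily small. -/
theorem exists_shift_hardyL_le (hN : 3 ≤ N) (w : H1 N) {ε : ℝ} (hε : 0 < ε) :
    ∃ z : Fin N → ℤ,
      hardyL hN (shift (latticePoint z) w) (shift (latticePoint z) w) ≤ ε := by
  obtain ⟨C, hC, hCle⟩ := hardyL_le_norm hN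
  obtain ⟨φ, hφ, hc, hclose⟩ := exists_test_close w (show 0 < √(ε / (4 * C)) by positivity)
  set a := ofTest φ hφ hc with ha
  obtain ⟨R, hR⟩ := hc.isBounded.exists_norm_le
  set r := √(4 * (‖a‖ ^ 2 + 1) / ε) with hr
  have hr0 : 0 < r := by positivity
  have hr2 : r ^ 2 = 4 * (‖a‖ ^ 2 + 1) / ε := Real.sq_sqrt (by positivity)
  obtain ⟨z, hz⟩ := exists_latticePoint_norm_ge hN (R + r)
  refine ⟨z, ?_⟩
  have h1 := hardyL_shift_test_le hN hφ hc hr0 (fun x hx => hR x (subset_tsupport _ hx)) hz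
  have h2 : hardyL hN (shift (latticePoint z) (w - a)) (shift (latticePoint z) (w - a)) ≤
      ε / 4 := by
    refine (hCle _).trans ?_
    rw [(shift (latticePoint z)).norm_map]
    have h3 : ‖w - a‖ ^ 2 ≤ ε / (4 * C) := by
      have h4 : ‖w - a‖ ≤ √(ε / (4 * C)) := by
        rw [norm_sub_rev]; exact hclose
      calc ‖w - a‖ ^ 2 ≤ √(ε / (4 * C)) ^ 2 := pow_le_pow_left₀ (norm_nonneg _) h4 2
        _ = _ := Real.sq_sqrt (by positivity)
    calc C * ‖w - a‖ ^ 2 ≤ C * (ε / (4 * C)) := by gcongr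
      _ = ε / 4 := by field_simp
  have h3 : (r ^ 2)⁻¹ * ‖a‖ ^ 2 ≤ ε / 4 := by
    rw [hr2, inv_div, div_mul_eq_mul_div, div_le_div_iff₀ (by positivity) (by norm_num)]
    nlinarith [sq_nonneg ‖a‖]
  have h4 := hardyL_add_le hN (shift (latticePoint z) a) (shift (latticePoint z) (w - a))
  rw [← map_add, add_sub_cancel] at h4
  linarith

theorem energy_zero_shift (hV : CondV V) (hf : CondF f p) (z : Fin N → ℤ) (u : H1 N) :
    energy V f 0 (shift (latticePoint z) u) = energy V f 0 u := by
  rw [energy_eq_potential, energy_eq_potential, bform_shift (hV.periodic z), potential_shift hf]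

-- A ground state `u` would yield a Nehari point `w` of `J_0` with `J_0(w)` below `J_μ(u)` by some
-- `d > 0`. Far lattice translates of `w` have the same `J_0` energy on their rays and an almost
-- zero Hardy term, so the Nehari point of `J_μ` on such a ray has energy at most `J_0(w) + d/2`,
-- below the level.
set_option maxHeartbeats 1000000 in
theorem not_groundState_of_neg (hN : 3 ≤ N) (hV : CondV V) (hf : CondF f p) {μ : ℝ} (hμ : μ < 0)
    (hpos : 0 < sInf (schrodingerSpectrum V)) (u : H1 N) : ¬ IsGroundState V f μ u := by
  intro hu
  have hbot := Xminus_eq_bot hV hpos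
  have hn : ∀ ν : ℝ, ∀ u ∈ Xminus V, bform V ν u u ≤ 0 := by
    intro ν v hv
    rw [hbot, Submodule.mem_bot] at hv
    rw [hv, ← formL_apply hN hV.bounded]
    simp
  have hX : ∀ v ∈ Xminus V, v = 0 := fun v hv => by rwa [hbot, Submodule.mem_bot] at hv
  obtain ⟨hcompl, -, c, hc, hp, -⟩ := spectral_split hV
  have hpμ : ∀ u ∈ Xplus V, c * ‖u‖ ^ 2 ≤ bform V μ u u := by
    intro u hu
    rw [bform_eq_sub hN hV.bounded μ]
    nlinarith [hp u hu, hardyL_self_nonneg hN u]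
  have hnμ : ∀ u ∈ Xminus V, bform V μ u u ≤ - (c * ‖u‖ ^ 2) := by
    intro v hv
    rw [hX v hv, ← formL_apply hN hV.bounded]
    simp
  have hEpos := hu.energy_pos
  have hmem := hu.mem_nehariPankov hf (hn μ)
  -- the level of `J_0` lies strictly below the level of `J_μ`
  obtain ⟨t, ht, v, hv, hm⟩ := exists_mem_nehariPankov_zero hN hV hf hmem.1
  have h1 := energy_le_of_mem_nehariPankov hN hV hf (hn μ) hmem ht.le hv
  have hne : t • u + v ≠ 0 := fun h => hm.1 (by rw [h]; exact (Xminus V).zero_mem)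
  have h2 := hardyL_self_pos hN hne
  have h3 := energy_zero_eq (f := f) hN hV μ (t • u + v)
  have hlt : energy V f 0 (t • u + v) < energy V f μ u := by nlinarith
  set w := t • u + v with hw
  set d := energy V f μ u - energy V f 0 w with hd
  have hd0 : 0 < d := by rw [hd]; linarith
  obtain ⟨C, hC, hCle⟩ := hardyL_le_norm hN
  -- `T` is fixed before the translation: since the Hardy term of every translate is at most
  -- `C‖w‖²`, the energy `J_μ` is nonpositive beyond `T` on the ray of each translate. So the Nehari
  -- parameter `s` stays below `T`.
  obtain ⟨T, hT, hTle⟩ := potential_superquadratic hN hf hne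
    (1 / 2 * (bform V 0 w w - μ * (C * ‖w‖ ^ 2)))
  obtain ⟨η, hη0, hη⟩ : ∃ η : ℝ, 0 < η ∧ -μ * (T ^ 2 * η) = d := by
    have hT2 : 0 < T ^ 2 := by positivity
    have hμ' : 0 < -μ := by linarith
    refine ⟨d / (-μ * T ^ 2), by positivity, ?_⟩
    rw [← mul_assoc, mul_div_cancel₀ _ (by positivity)]
  obtain ⟨z, hz⟩ := exists_shift_hardyL_le hN w hη0
  set wz := shift (latticePoint z) w with hwz
  have hwz0 : wz ∉ Xminus V := fun h => hne (by
    have h4 := hX _ h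
    have h5 : ‖w‖ = 0 := by rw [← (shift (latticePoint z)).norm_map w, ← hwz, h4, norm_zero]
    exact norm_eq_zero.1 h5)
  obtain ⟨s, hs, v', hv', hm'⟩ := exists_mem_nehariPankov hN hV hf hc hpμ hnμ hwz0
  rw [hX v' hv', add_zero] at hm'
  have hle : energy V f μ u ≤ energy V f μ (s • wz) := by
    have := level_le hm'
    rw [← hu.energy_eq] at this
    exact_mod_cast this
  have hsw : s • wz = shift (latticePoint z) (s • w) := by rw [hwz, map_smul]
  have hE0 : energy V f 0 (s • wz) = energy V f 0 (s • w) := by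
    rw [hsw, energy_zero_shift hV hf]
  have hhs : hardyL hN (s • wz) (s • wz) = s ^ 2 * hardyL hN wz wz := by
    rw [map_smul, map_smul, smul_apply, smul_eq_mul, smul_eq_mul]; ring
  have h4 := energy_zero_eq (f := f) hN hV μ (s • wz)
  rw [hE0, hhs] at h4
  have hsT : s < T := by
    by_contra hcon
    push Not at hcon
    have h5 := hTle s hcon
    have h6 : energy V f 0 (s • w) = 1 / 2 * (s ^ 2 * bform V 0 w w) - potential f (s • w) := by
      rw [energy_eq_potential, ← schrL_apply hV.bounded, map_smul, map_smul, smul_apply,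
        smul_eq_mul, smul_eq_mul, schrL_apply]
      ring
    have h7 := hCle wz
    rw [hwz, (shift (latticePoint z)).norm_map, ← hwz] at h7
    have h8 : s ^ 2 * (-μ * hardyL hN wz wz) ≤ s ^ 2 * (-μ * (C * ‖w‖ ^ 2)) := by
      have : 0 ≤ -μ := by linarith
      gcongr
    nlinarith
  have h5 : energy V f 0 (s • w) ≤ energy V f 0 w := by
    have := energy_le_of_mem_nehariPankov hN hV hf (hn 0) hm hs.le (Xminus V).zero_mem
    rwa [add_zero] at this
  have h6 : -μ * (s ^ 2 * hardyL hN wz wz) ≤ d := by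
    have h8 := hardyL_self_nonneg hN wz
    have hμ' : 0 ≤ -μ := by linarith
    rw [← hη]
    gcongr
  linarith

end

section

variable {N : ℕ}

/-! ### Vanishing sequences -/

/-- The mollification estimate with modulus of continuity supplied by the gradient; the error is
uniform on bounded sets of `H¹`. -/
theorem mollify_error (ρ : ContDiffBump (0 : Euc N)) (u : H1 N) :
    Integrable (fun x => (mollify ρ u.val x - u.val x) ^ 2) ∧
      ∫ x, (mollify ρ u.val x - u.val x) ^ 2 ≤ (ρ.rOut * ‖gradL N u‖) ^ 2 := by
  have h1 := lintegral_mollify_sub_le ρ (toL2L N u) (δ := ρ.rOut * ‖gradL N u‖) (fun t ht => by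
    rw [← toL2L_shift, ← map_sub]
    refine (norm_shift_sub_le u (-t)).trans (mul_le_mul_of_nonneg_right ?_ (norm_nonneg _))
    rw [norm_neg]; exact ht.le)
  have hm : AEStronglyMeasurable (fun x => (mollify ρ u.val x - u.val x) ^ 2) volume :=
    (((continuous_mollify ρ (toL2L N u)).aestronglyMeasurable).sub (aesm_val u)).pow 2
  have h2 : ∫⁻ x, ENNReal.ofReal ((mollify ρ u.val x - u.val x) ^ 2) ≤
      ENNReal.ofReal ((ρ.rOut * ‖gradL N u‖) ^ 2) := by
    refine le_trans (le_of_eq (lintegral_congr fun x => ?_)) h1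
    rw [← sq_abs, ENNReal.ofReal_pow (abs_nonneg _), ← Real.norm_eq_abs, ofReal_norm]
    rfl
  have hi : Integrable (fun x => (mollify ρ u.val x - u.val x) ^ 2) := by
    refine ⟨hm, ?_⟩
    rw [hasFiniteIntegral_iff_ofReal (ae_of_all _ fun x => sq_nonneg _)]
    exact h2.trans_lt ENNReal.ofReal_lt_top
  refine ⟨hi, ?_⟩
  rw [← ENNReal.ofReal_le_ofReal_iff (by positivity),
    ofReal_integral_eq_lintegral_ofReal hi (ae_of_all _ fun x => sq_nonneg _)]
  exact h2

/-- A mollifier as an element of `H¹`. -/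
def bumpH1 (ρ : ContDiffBump (0 : Euc N)) : H1 N :=
  ofTest (fun t => ρ.normed volume (-t)) (ρ.contDiff_normed.comp contDiff_neg)
    (ρ.hasCompactSupport_normed.comp_homeomorph (Homeomorph.neg (Euc N)))

theorem mollify_eq_inner (ρ : ContDiffBump (0 : Euc N)) (u : H1 N) (y : Euc N) :
    mollify ρ u.val y = inner ℝ (toL2L N (shift y u)) (toL2L N (bumpH1 ρ)) := by
  rw [mollify_eq, inner_toL2L,
    ← integral_add_right_eq_self (fun t => ρ.normed volume (y - t) • u.val t) y]
  refine integral_congr_ae ?_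
  filter_upwards [val_shift y u, val_ofTest (fun t => ρ.normed volume (-t))
    (ρ.contDiff_normed.comp contDiff_neg)
    (ρ.hasCompactSupport_normed.comp_homeomorph (Homeomorph.neg (Euc N)))] with t h1 h2
  rw [h1, bumpH1, h2, smul_eq_mul, mul_comm, sub_add_cancel_right]

/-- All lattice translates of the sequence tend weakly to zero in `L²`, uniformly. -/
def LatticeVanishing (g : ℕ → H1 N) : Prop :=
  ∀ b : H1 N, ∀ ε > 0, ∀ᶠ n in atTop, ∀ z : Fin N → ℤ,
    |inner ℝ (toL2L N (shift (latticePoint z) (g n))) (toL2L N b)| ≤ ε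

theorem abs_inner_shift_le (y : Euc N) (u b : H1 N) :
    |inner ℝ (toL2L N (shift y u)) (toL2L N b)| ≤ ‖u‖ * ‖b‖ := by
  refine (abs_real_inner_le_norm _ _).trans (mul_le_mul ?_ (norm_toL2L_le b) (norm_nonneg _)
    (norm_nonneg _))
  refine (norm_toL2L_le _).trans (le_of_eq ?_)
  exact (shift y).norm_map u

theorem exists_lattice_add (y : Euc N) : ∃ (z : Fin N → ℤ) (ξ : Euc N),
    y = ξ + latticePoint z ∧ ‖ξ‖ ≤ √N := by
  refine ⟨fun i => ⌊y i⌋, y - latticePoint fun i => ⌊y i⌋, by abel, ?_⟩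
  rw [EuclideanSpace.norm_eq]
  refine Real.sqrt_le_sqrt ?_
  have h : ∀ i : Fin N, ‖(y - latticePoint fun i => ⌊y i⌋) i‖ ^ 2 ≤ 1 := by
    intro i
    have h1 : (y - latticePoint fun i => ⌊y i⌋) i = Int.fract (y i) := by
      simp [latticePoint]
    rw [h1, Real.norm_of_nonneg (Int.fract_nonneg _)]
    exact pow_le_one₀ (Int.fract_nonneg _) (Int.fract_lt_one _).le
  refine (Finset.sum_le_sum fun i _ => h i).trans (le_of_eq ?_)
  simp

/-- Every `y` is a lattice point plus a vector of length at most `√N`. The corresponding translates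
of `b` form a compact set, so finitely many test elements suffice. -/
theorem LatticeVanishing.uniform {g : ℕ → H1 N} (hg : LatticeVanishing g) {M : ℝ}
    (hM : ∀ n, ‖g n‖ ≤ M) (b : H1 N) {ε : ℝ} (hε : 0 < ε) :
    ∀ᶠ n in atTop, ∀ y : Euc N, |inner ℝ (toL2L N (shift y (g n))) (toL2L N b)| ≤ ε := by
  have hM0 : 0 ≤ M := (norm_nonneg _).trans (hM 0)
  set K : Set (H1 N) := (fun ξ : Euc N => shift (-ξ) b) '' Metric.closedBall 0 (√N) with hK
  have hKc : IsCompact K := (isCompact_closedBall 0 _).image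
    ((continuous_shift b).comp continuous_neg)
  set η := ε / (2 * (M + 1)) with hη
  have hη0 : 0 < η := by positivity
  obtain ⟨t, -, htfin, hcover⟩ := hKc.finite_cover_balls hη0
  have hev : ∀ᶠ n in atTop, ∀ b' ∈ t, ∀ z : Fin N → ℤ,
      |inner ℝ (toL2L N (shift (latticePoint z) (g n))) (toL2L N b')| ≤ ε / 2 :=
    (eventually_all_finite htfin).2 fun b' _ => hg b' (ε / 2) (half_pos hε)
  filter_upwards [hev] with n hn y
  obtain ⟨z, ξ, hy, hξ⟩ := exists_lattice_add y
  have h1 : shift (-ξ) b ∈ K := ⟨ξ, by simpa using hξ, rfl⟩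
  obtain ⟨b', hb', hball⟩ := mem_iUnion₂.1 (hcover h1)
  have h2 := hn b' hb' z
  have h3 : inner ℝ (toL2L N (shift y (g n))) (toL2L N b) =
      inner ℝ (toL2L N (shift (latticePoint z) (g n))) (toL2L N (shift (-ξ) b)) := by
    rw [← inner_toL2L_shift ξ (shift (latticePoint z) (g n)), shift_shift, shift_shift,
      add_neg_cancel, shift_zero, hy]
  have h4 : inner ℝ (toL2L N (shift (latticePoint z) (g n))) (toL2L N (shift (-ξ) b)) =
      inner ℝ (toL2L N (shift (latticePoint z) (g n))) (toL2L N b') +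
      inner ℝ (toL2L N (shift (latticePoint z) (g n))) (toL2L N (shift (-ξ) b - b')) := by
    rw [map_sub, inner_sub_right]; ring
  have h5 := abs_inner_shift_le (latticePoint z) (g n) (shift (-ξ) b - b')
  have h6 : ‖g n‖ * ‖shift (-ξ) b - b'‖ ≤ M * η := by
    refine mul_le_mul (hM n) ?_ (norm_nonneg _) hM0
    rw [← dist_eq_norm]; exact (Metric.mem_ball.1 hball).le
  have h7 : M * η ≤ ε / 2 := by
    rw [hη, mul_div_assoc', div_le_div_iff₀ (by positivity) two_pos]
    nlinarith
  rw [h3, h4]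
  refine (abs_add_le _ _).trans ?_
  linarith

/-- If `|s| ≤ 2η`, the surplus power `p - 2` is small. Otherwise the mollified value `m` accounts
for at most half of `s`, so `s²` is bounded by the mollification error; `m` stands for the
mollification of `s` at the same point. -/
theorem rpow_le_of_mollified {p r s m η K : ℝ} (hp : 2 < p) (hpr : p ≤ r) (hη : 0 < η)
    (hK : 0 < K) (hm : |m| ≤ η) :
    |s| ^ p ≤ (2 * η) ^ (p - 2) * s ^ 2 + K ^ (p - 2) * (4 * (m - s) ^ 2) +
      K ^ (p - r) * |s| ^ r := by
  have h0 : 0 ≤ K ^ (p - r) * |s| ^ r := by positivity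
  rcases le_total |s| (2 * η) with h | h
  · have h1 : |s| ^ p ≤ (2 * η) ^ (p - 2) * s ^ 2 := by
      rcases (abs_nonneg s).eq_or_lt with h2 | h2
      · rw [← h2, Real.zero_rpow (by linarith)]; positivity
      · have h3 : |s| ^ p = |s| ^ (p - 2) * s ^ 2 := by
          rw [← sq_abs, ← Real.rpow_natCast, ← Real.rpow_add h2]; norm_num
        rw [h3]
        have := Real.rpow_le_rpow h2.le h (by linarith : 0 ≤ p - 2)
        gcongr
    have h2 : 0 ≤ K ^ (p - 2) * (4 * (m - s) ^ 2) := by positivity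
    linarith
  · have h1 := rpow_le_interpolate hp.le hpr hK (abs_nonneg s) (by linarith)
    rw [Real.rpow_two, sq_abs] at h1
    have h2 : s ^ 2 ≤ 4 * (m - s) ^ 2 := by
      have h3 : |s| ≤ 2 * |m - s| := by
        have := abs_sub_abs_le_abs_sub s m
        rw [abs_sub_comm m s]
        linarith
      have := pow_le_pow_left₀ (abs_nonneg s) h3 2
      rw [mul_pow, sq_abs, sq_abs] at this
      linarith
    have h3 : K ^ (p - 2) * s ^ 2 ≤ K ^ (p - 2) * (4 * (m - s) ^ 2) := by gcongr
    have h4 : 0 ≤ (2 * η) ^ (p - 2) * s ^ 2 := by positivity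
    linarith

/-- Bounded sequences whose mollifications tend to zero uniformly tend to zero in `L^p`. -/
theorem LatticeVanishing.tendsto_rpow (hN : 3 ≤ N) {p : ℝ} (hp : 2 < p) (hp' : p < critExp N)
    {g : ℕ → H1 N} (hg : LatticeVanishing g) {M : ℝ} (hM : ∀ n, ‖g n‖ ≤ M) :
    Tendsto (fun n => ∫ x, |(g n).val x| ^ p) atTop (𝓝 0) := by
  have hM0 : 0 ≤ M := (norm_nonneg _).trans (hM 0)
  obtain ⟨C, hC, hCle⟩ := integral_rpow_critExp_le hN
  have hcr := two_lt_critExp hN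
  rw [Metric.tendsto_atTop']
  intro ε hε
  -- choice of the parameters
  obtain ⟨K, hK0, hK⟩ : ∃ K : ℝ, 0 < K ∧ K ^ (p - critExp N) * (C * M) ^ critExp N < ε / 3 := by
    have h1 : Tendsto (fun K : ℝ => K ^ (p - critExp N) * (C * M) ^ critExp N) atTop (𝓝 0) := by
      have h2 := (tendsto_rpow_neg_atTop (y := critExp N - p) (by linarith)).mul_const
        ((C * M) ^ critExp N)
      rw [zero_mul] at h2
      simpa only [neg_sub] using h2
    obtain ⟨K, hK, hK0⟩ := ((h1.eventually_lt_const (show (0 : ℝ) < ε / 3 by positivity)).and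
      (eventually_gt_atTop 0)).exists
    exact ⟨K, hK0, hK⟩
  -- The mollification radius depends on `K`, which multiplies the mollification error; only after
  -- it is fixed does the vanishing hypothesis determine `n₀`.
  obtain ⟨r, hr0, hr⟩ : ∃ r : ℝ, 0 < r ∧ K ^ (p - 2) * (4 * (r * M) ^ 2) < ε / 3 := by
    have h1 : Tendsto (fun r : ℝ => K ^ (p - 2) * (4 * (r * M) ^ 2)) (𝓝[>] 0) (𝓝 0) := by
      have : Continuous fun r : ℝ => K ^ (p - 2) * (4 * (r * M) ^ 2) := by fun_prop
      have h2 := this.tendsto 0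
      simp only [zero_mul, ne_eq, OfNat.ofNat_ne_zero, not_false_eq_true, zero_pow, mul_zero] at h2
      exact h2.mono_left nhdsWithin_le_nhds
    obtain ⟨r, hr, hr0⟩ := ((h1.eventually_lt_const (show (0 : ℝ) < ε / 3 by positivity)).and
      self_mem_nhdsWithin).exists
    exact ⟨r, hr0, hr⟩
  obtain ⟨η, hη0, hη⟩ : ∃ η : ℝ, 0 < η ∧ (2 * η) ^ (p - 2) * M ^ 2 < ε / 3 := by
    have h1 : Tendsto (fun η : ℝ => (2 * η) ^ (p - 2) * M ^ 2) (𝓝[>] 0) (𝓝 0) := by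
      have h2 : Continuous fun η : ℝ => (2 * η) ^ (p - 2) * M ^ 2 :=
        ((continuous_const.mul continuous_id).rpow_const fun _ => Or.inr (by linarith)).mul
          continuous_const
      have h3 := h2.tendsto 0
      rw [mul_zero, Real.zero_rpow (by linarith), zero_mul] at h3
      exact h3.mono_left nhdsWithin_le_nhds
    obtain ⟨r, hr, hr0⟩ := ((h1.eventually_lt_const (show (0 : ℝ) < ε / 3 by positivity)).and
      self_mem_nhdsWithin).exists
    exact ⟨r, hr0, hr⟩
  obtain ⟨ρ, hρ⟩ := exists_bump_radius (N := N) hr0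
  obtain ⟨n₀, hn₀⟩ := eventually_atTop.1 (hg.uniform hM (bumpH1 ρ) hη0)
  refine ⟨n₀, fun n hn => ?_⟩
  set u := g n with hu
  have hmol : ∀ x, |mollify ρ u.val x| ≤ η := fun x => by
    rw [mollify_eq_inner]; exact hn₀ n hn.le x
  obtain ⟨hi2, hint2⟩ := mollify_error ρ u
  have hi1 := (integrable_val_sq u).const_mul ((2 * η) ^ (p - 2))
  have hi2' := (hi2.const_mul 4).const_mul (K ^ (p - 2))
  have hi3 := (integrable_rpow_critExp hN u).const_mul (K ^ (p - critExp N))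
  have h1 : ∫ x, |u.val x| ^ p ≤ (2 * η) ^ (p - 2) * ‖toL2L N u‖ ^ 2 +
      K ^ (p - 2) * (4 * ∫ x, (mollify ρ u.val x - u.val x) ^ 2) +
      K ^ (p - critExp N) * ∫ x, |u.val x| ^ critExp N := by
    rw [← integral_val_sq, ← integral_const_mul, ← integral_const_mul, ← integral_const_mul,
      ← integral_const_mul, ← integral_add' hi1 hi2', ← integral_add (hi1.add hi2') hi3]
    refine integral_mono (integrable_rpow hN hp.le hp'.le u) ((hi1.add hi2').add hi3) fun x => ?_
    exact rpow_le_of_mollified hp hp'.le hη0 hK0 (hmol x)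
  have h2 : ‖toL2L N u‖ ^ 2 ≤ M ^ 2 :=
    pow_le_pow_left₀ (norm_nonneg _) ((norm_toL2L_le u).trans (hM n)) 2
  have h3 : ∫ x, (mollify ρ u.val x - u.val x) ^ 2 ≤ (r * M) ^ 2 := by
    refine hint2.trans (pow_le_pow_left₀ (by have := ρ.rOut_pos; positivity) ?_ 2)
    rw [hρ]
    exact mul_le_mul_of_nonneg_left ((norm_gradL_le u).trans (hM n)) hr0.le
  have h4 : ∫ x, |u.val x| ^ critExp N ≤ (C * M) ^ critExp N :=
    (hCle u).trans (Real.rpow_le_rpow (by positivity)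
      (mul_le_mul_of_nonneg_left (hM n) hC) (by linarith))
  have h5 : (2 * η) ^ (p - 2) * ‖toL2L N u‖ ^ 2 ≤ (2 * η) ^ (p - 2) * M ^ 2 := by gcongr
  have h6 : K ^ (p - 2) * (4 * ∫ x, (mollify ρ u.val x - u.val x) ^ 2) ≤
      K ^ (p - 2) * (4 * (r * M) ^ 2) := by gcongr
  have h7 : K ^ (p - critExp N) * ∫ x, |u.val x| ^ critExp N ≤
      K ^ (p - critExp N) * (C * M) ^ critExp N := by gcongr
  rw [Real.dist_eq, sub_zero, abs_of_nonneg (integral_nonneg fun x => by positivity)]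
  linarith

end

section

variable {N : ℕ} {V : Euc N → ℝ} {f : Euc N → ℝ → ℝ} {p : ℝ}

/-! ### Boundedness of almost minimisers -/

theorem integral_largeSq_shift (δ : ℝ) (y : Euc N) (u : H1 N) :
    ∫ x, largeSq δ ((shift y u).val x) = ∫ x, largeSq δ (u.val x) := by
  rw [← integral_add_right_eq_self (fun x => largeSq δ (u.val x)) y]
  refine integral_congr_ae ?_
  filter_upwards [val_shift y u] with x hx
  rw [hx]

/-- Where `|u| < δ`, integrability of `φ` suffices; where `|u| ≥ δ`, Young's inequality with
parameter `θ` brings in the mass of large values. -/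
theorem abs_inner_test_le {φ : Euc N → ℝ} (hφ : ContDiff ℝ ∞ φ) (hc : HasCompactSupport φ)
    (u : H1 N) {δ θ : ℝ} (hδ : 0 < δ) (hθ : 0 < θ) :
    |inner ℝ (toL2L N u) (toL2L N (ofTest φ hφ hc))| ≤
      δ * (∫ x, |φ x|) + 1 / (4 * θ) * (∫ x, largeSq δ (u.val x)) +
        θ * ‖ofTest φ hφ hc‖ ^ 2 := by
  have hi1 : Integrable (fun x => δ * |φ x|) :=
    ((hφ.continuous.integrable_of_hasCompactSupport hc).abs).const_mul δ
  have hi2 := (integrable_largeSq δ u).const_mul (1 / (4 * θ))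
  have hi3 := (integrable_val_sq (ofTest φ hφ hc)).const_mul θ
  have h1 : |inner ℝ (toL2L N u) (toL2L N (ofTest φ hφ hc))| ≤
      δ * (∫ x, |φ x|) + 1 / (4 * θ) * (∫ x, largeSq δ (u.val x)) +
        θ * ‖toL2L N (ofTest φ hφ hc)‖ ^ 2 := by
    rw [inner_toL2L, ← integral_val_sq, ← integral_const_mul, ← integral_const_mul,
      ← integral_const_mul, ← integral_add' hi1 hi2, ← integral_add (hi1.add hi2) hi3]
    refine abs_integral_le_integral_abs.trans ?_
    refine integral_mono_ae (integrable_val_mul u _).abs ((hi1.add hi2).add hi3) ?_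
    filter_upwards [val_ofTest φ hφ hc] with x hx
    simp only [hx, Pi.add_apply, abs_mul]
    rcases lt_or_ge |u.val x| δ with h | h
    · have h2 : |u.val x| * |φ x| ≤ δ * |φ x| := mul_le_mul_of_nonneg_right h.le (abs_nonneg _)
      have h3 : 0 ≤ 1 / (4 * θ) * largeSq δ (u.val x) :=
        mul_nonneg (by positivity) (largeSq_nonneg _ _)
      have h4 : 0 ≤ θ * φ x ^ 2 := by positivity
      linarith
    · rw [largeSq, if_pos h]
      have h2 : 0 ≤ (|u.val x| - 2 * θ * |φ x|) ^ 2 / (4 * θ) := by positivity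
      have h3 : (|u.val x| - 2 * θ * |φ x|) ^ 2 / (4 * θ) =
          1 / (4 * θ) * u.val x ^ 2 - |u.val x| * |φ x| + θ * φ x ^ 2 := by
        rw [← sq_abs (u.val x), ← sq_abs (φ x)]
        field_simp
        ring
      have h4 : 0 ≤ δ * |φ x| := by positivity
      linarith
  have h2 : θ * ‖toL2L N (ofTest φ hφ hc)‖ ^ 2 ≤ θ * ‖ofTest φ hφ hc‖ ^ 2 := by
    gcongr
    exact norm_toL2L_le _
  linarith

/-- The mass of large values is translation invariant, which gives uniformity in the translation.
Replace `b` by a test function, then choose `δ` and `θ`, and finally let the mass tend to zero. -/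
theorem latticeVanishing_of_largeSq {w : ℕ → H1 N} {M : ℝ} (hM : ∀ n, ‖w n‖ ≤ M)
    (h : ∀ δ > 0, Tendsto (fun n => ∫ x, largeSq δ ((w n).val x)) atTop (𝓝 0)) :
    LatticeVanishing w := by
  have hM0 : 0 ≤ M := (norm_nonneg _).trans (hM 0)
  intro b ε hε
  obtain ⟨φ, hφ, hc, hclose⟩ := exists_test_close b (show 0 < ε / (4 * (M + 1)) by positivity)
  set a := ofTest φ hφ hc with ha
  set A := ∫ x, |φ x| with hA
  have hA0 : 0 ≤ A := integral_nonneg fun x => abs_nonneg _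
  set δ := ε / (4 * (A + 1)) with hδ
  have hδ0 : 0 < δ := by positivity
  set θ := ε / (4 * (‖a‖ ^ 2 + 1)) with hθ
  have hθ0 : 0 < θ := by positivity
  have hlim := (h δ hδ0).const_mul (1 / (4 * θ))
  rw [mul_zero] at hlim
  filter_upwards [hlim.eventually_lt_const (show (0 : ℝ) < ε / 4 by positivity)] with n hn z
  have h1 := abs_inner_test_le hφ hc (shift (latticePoint z) (w n)) hδ0 hθ0
  rw [integral_largeSq_shift] at h1
  have h2 : inner ℝ (toL2L N (shift (latticePoint z) (w n))) (toL2L N b) =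
      inner ℝ (toL2L N (shift (latticePoint z) (w n))) (toL2L N a) -
      inner ℝ (toL2L N (shift (latticePoint z) (w n))) (toL2L N (a - b)) := by
    rw [map_sub, inner_sub_right]; ring
  have h3 := abs_inner_shift_le (latticePoint z) (w n) (a - b)
  have h4 : ‖w n‖ * ‖a - b‖ ≤ M * (ε / (4 * (M + 1))) :=
    mul_le_mul (hM n) hclose (norm_nonneg _) hM0
  have h5 : M * (ε / (4 * (M + 1))) ≤ ε / 4 := by
    rw [mul_div_assoc', div_le_div_iff₀ (by positivity) (by norm_num)]
    nlinarith
  have h6 : δ * A ≤ ε / 4 := by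
    rw [hδ, div_mul_eq_mul_div, div_le_div_iff₀ (by positivity) (by norm_num)]
    nlinarith
  have h7 : θ * ‖a‖ ^ 2 ≤ ε / 4 := by
    rw [hθ, div_mul_eq_mul_div, div_le_div_iff₀ (by positivity) (by norm_num)]
    nlinarith [sq_nonneg ‖a‖]
  rw [h2]
  refine (abs_sub _ _).trans ?_
  linarith

/-- The projection commutes with lattice translations and is symmetric for the `L²` product, so it
can be moved onto the test element. -/
theorem LatticeVanishing.projPlus (hV : CondV V) {w : ℕ → H1 N} (hw : LatticeVanishing w) :
    LatticeVanishing fun n => projPlus hV (w n) := by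
  intro b ε hε
  filter_upwards [hw (HardySchrodinger.projPlus hV b) ε hε] with n hn z
  rw [← projPlus_shift, inner_projPlus_comm]
  exact hn z

theorem bform_smul_self (hN : 3 ≤ N) (hV : CondV V) (μ s : ℝ) (u : H1 N) :
    bform V μ (s • u) (s • u) = s ^ 2 * bform V μ u u := by
  rw [← formL_apply hN hV.bounded, map_smul, map_smul, smul_apply, smul_eq_mul, smul_eq_mul,
    formL_apply]
  ring

theorem bform_split (hV : CondV V) (u : H1 N) :
    bform V 0 u u = bform V 0 (projPlus hV u) (projPlus hV u) +
      bform V 0 (u - projPlus hV u) (u - projPlus hV u) := by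
  obtain ⟨-, ho, -⟩ := spectral_split hV
  have h1 := (ho _ (projPlus_mem hV u) _ (sub_projPlus_mem hV u)).2
  have h2 : u = projPlus hV u + (u - projPlus hV u) := by abel
  set a := projPlus hV u
  set b := u - a
  rw [h2]
  simp only [← schrL_apply hV.bounded, map_add, add_apply] at h1 ⊢
  have h3 : schrL hV.bounded b a = 0 := by
    rw [schrL_apply, bform_comm, ← schrL_apply hV.bounded, h1]
  rw [h1, h3]
  ring

theorem exists_bform_pos_small (hN : 3 ≤ N) (hV : CondV V) : ∃ c μ₀ : ℝ, 0 < c ∧ 0 < μ₀ ∧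
    (∀ u ∈ Xminus V, bform V 0 u u ≤ - (c * ‖u‖ ^ 2)) ∧
    ∀ μ, μ ≤ μ₀ → ∀ u ∈ Xplus V, c * ‖u‖ ^ 2 ≤ bform V μ u u := by
  obtain ⟨-, -, c, hc, hp, hn⟩ := spectral_split hV
  obtain ⟨C, hC, hCle⟩ := hardyL_le_norm hN
  refine ⟨c / 2, c / (2 * C), by positivity, by positivity, fun u hu => (hn u hu).trans ?_,
    fun μ hμ u hu => ?_⟩
  · have : 0 ≤ c * ‖u‖ ^ 2 := by positivity
    linarith
  · rw [bform_eq_sub hN hV.bounded μ]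
    have h1 := hp u hu
    have h2 := hCle u
    have h3 := hardyL_self_nonneg hN u
    have h4 : μ * hardyL hN u u ≤ c / (2 * C) * (C * ‖u‖ ^ 2) :=
      (mul_le_mul_of_nonneg_right hμ h3).trans (mul_le_mul_of_nonneg_left h2 (by positivity))
    have h5 : c / (2 * C) * (C * ‖u‖ ^ 2) = c / 2 * ‖u‖ ^ 2 := by field_simp
    linarith

/-- A normalised sequence with superlinearly scaled nonnegative energies vanishes. -/
theorem latticeVanishing_of_energy_nonneg (hN : 3 ≤ N) (hV : CondV V) (hf : CondF f p)
    {w : ℕ → H1 N} (hw : ∀ n, ‖w n‖ ≤ 1) {t : ℕ → ℝ} (ht : Tendsto t atTop atTop)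
    (hE : ∀ n, 0 ≤ energy V f 0 (t n • w n)) : LatticeVanishing w := by
  refine latticeVanishing_of_largeSq hw fun δ hδ => ?_
  obtain ⟨C, hC⟩ := exists_abs_bform_le hV.bounded
  rw [Metric.tendsto_atTop']
  intro ε hε
  -- Nonnegative energy bounds the potential by `t²|C|/2`. With this constant in the lower bound,
  -- the mass of large values is below `ε`.
  obtain ⟨R, hR, hge⟩ := potential_ge hN hf ((|C| + 1) / ε)
  obtain ⟨n₀, hn₀⟩ := eventually_atTop.1 ((ht.eventually_ge_atTop (R / δ)).and
    (ht.eventually_gt_atTop 0))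
  refine ⟨n₀, fun n hn => ?_⟩
  obtain ⟨h1, ht0⟩ := hn₀ n hn.le
  have h2 := hge (w n) δ (t n) ht0 (by rwa [div_le_iff₀ hδ] at h1)
  have h3 := hE n
  rw [energy_eq_potential, bform_smul_self hN hV] at h3
  have h4 : bform V 0 (w n) (w n) ≤ |C| := by
    refine (le_abs_self _).trans ((hC _ _).trans ?_)
    have h5 := hw n
    have h6 := norm_nonneg (w n)
    calc C * ‖w n‖ * ‖w n‖ ≤ |C| * ‖w n‖ * ‖w n‖ := by gcongr; exact le_abs_self C
      _ ≤ |C| * 1 * 1 := by gcongr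
      _ = |C| := by ring
  set I := ∫ x, largeSq δ ((w n).val x) with hI
  have hI0 : 0 ≤ I := integral_nonneg fun x => largeSq_nonneg _ _
  rw [Real.dist_eq, sub_zero, abs_of_nonneg hI0]
  have ht2 : 0 < t n ^ 2 := by positivity
  have h5 : (|C| + 1) / ε * I ≤ 1 / 2 * |C| := by
    refine le_of_mul_le_mul_left ?_ ht2
    nlinarith
  rw [div_mul_eq_mul_div, div_le_iff₀ hε] at h5
  nlinarith [abs_nonneg C]

/-- Otherwise normalise an unbounded sequence. Nonnegative energy makes it vanish, so its positive
parts tend to zero in `L^p`; nonnegativity of `B_0` keeps these parts away from zero in `H¹`. Along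
their rays the potential is then negligible and the energy exceeds `d`. -/
theorem exists_norm_le_of_energy (hN : 3 ≤ N) (hV : CondV V) (hf : CondF f p) (d : ℝ) :
    ∃ μ₀ : ℝ, 0 < μ₀ ∧ ∃ R : ℝ, ∀ μ, 0 ≤ μ → μ ≤ μ₀ → ∀ m : H1 N, 0 ≤ energy V f 0 m →
      (∀ s : ℝ, 0 ≤ s → energy V f μ (s • projPlus hV m) ≤ d) → ‖m‖ ≤ R := by
  obtain ⟨c, μ₁, hc, hμ₁, hn, hp⟩ := exists_bform_pos_small hN hV
  by_contra hcon
  push Not at hcon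
  have hex : ∀ n : ℕ, ∃ (μ : ℝ) (m : H1 N), μ ≤ μ₁ ∧ 0 ≤ energy V f 0 m ∧
      (∀ s : ℝ, 0 ≤ s → energy V f μ (s • projPlus hV m) ≤ d) ∧ (n : ℝ) + 1 < ‖m‖ := by
    intro n
    obtain ⟨μ, -, h2, m, h3, h4, h5⟩ := hcon μ₁ hμ₁ ((n : ℝ) + 1)
    exact ⟨μ, m, h2, h3, h4, h5⟩
  choose μ m hμ hE hs hm using hex
  have hm0 : ∀ n, 0 < ‖m n‖ := fun n => lt_trans (by positivity) (hm n)
  set w : ℕ → H1 N := fun n => ‖m n‖⁻¹ • m n with hw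
  have hw1 : ∀ n, ‖w n‖ = 1 := fun n => by
    simp only [hw]
    rw [norm_smul, norm_inv, norm_norm, inv_mul_cancel₀ (hm0 n).ne']
  have hmw : ∀ n, ‖m n‖ • w n = m n := fun n => by
    simp only [hw]
    rw [smul_smul, mul_inv_cancel₀ (hm0 n).ne', one_smul]
  have htend : Tendsto (fun n => ‖m n‖) atTop atTop :=
    tendsto_atTop_mono (fun n => (by linarith [hm n] : (n : ℝ) ≤ ‖m n‖))
      tendsto_natCast_atTop_atTop
  have hvan : LatticeVanishing w := latticeVanishing_of_energy_nonneg hN hV hf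
    (fun n => (hw1 n).le) htend (fun n => by rw [hmw]; exact hE n)
  set e : ℕ → H1 N := fun n => projPlus hV (w n) with he
  have hvanp := hvan.projPlus hV
  have heb : ∀ n, ‖e n‖ ≤ ‖projPlus hV‖ := fun n => by
    have := (projPlus hV).le_opNorm (w n)
    rwa [hw1, mul_one] at this
  have hlp := hvanp.tendsto_rpow hN hf.F2.two_lt hf.F2.lt_critical heb
  -- lower bound for the positive parts
  obtain ⟨C, hC⟩ := exists_abs_bform_le hV.bounded
  have hlow : ∀ n, c ≤ (2 * |C| + 2 * c) * ‖e n‖ ^ 2 := by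
    intro n
    have h1 : 0 ≤ bform V 0 (w n) (w n) := by
      have h2 := hE n
      rw [← hmw, energy_eq_potential, bform_smul_self hN hV] at h2
      have h3 := potential_nonneg hf (‖m n‖ • w n)
      have h4 : 0 < ‖m n‖ ^ 2 := pow_pos (hm0 n) 2
      have h5 : 0 ≤ ‖m n‖ ^ 2 * bform V 0 (w n) (w n) := by linarith
      exact nonneg_of_mul_nonneg_right h5 h4
    rw [bform_split hV] at h1
    have h2 := hn _ (sub_projPlus_mem hV (w n))
    have h3 : bform V 0 (e n) (e n) ≤ |C| * ‖e n‖ ^ 2 := by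
      refine (le_abs_self _).trans ((hC _ _).trans ?_)
      rw [mul_assoc, ← sq]
      gcongr
      exact le_abs_self C
    set r := w n - projPlus hV (w n) with hr
    have h4 : 1 ≤ ‖e n‖ + ‖r‖ := by
      have h5 : w n = e n + r := by rw [hr]; simp only [he]; abel
      rw [← hw1 n, h5]
      exact norm_add_le _ _
    have h5 : 1 ≤ 2 * ‖e n‖ ^ 2 + 2 * ‖r‖ ^ 2 := by
      nlinarith [sq_nonneg (‖e n‖ - ‖r‖), norm_nonneg (e n), norm_nonneg r]
    have h6 : bform V 0 (projPlus hV (w n)) (projPlus hV (w n)) = bform V 0 (e n) (e n) := rfl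
    nlinarith
  set κ := c / (2 * |C| + 2 * c) with hκ
  have hκ0 : 0 < κ := by positivity
  have hlow' : ∀ n, κ ≤ ‖e n‖ ^ 2 := fun n => by
    rw [hκ, div_le_iff₀ (by positivity)]; linarith [hlow n]
  -- the energy along the rays is too large
  obtain ⟨D, hD, hpot⟩ := potential_le hN hf (show 0 < c / 4 by positivity)
  -- Half of the quadratic part survives the `L²` share of the potential bound and is at least `|d|
  -- + 2`; the `L^p` share is below `1`, so the energy is above `d`.
  set s := √(4 * (|d| + 2) / (c * κ)) with hs'
  have hs0 : 0 ≤ s := Real.sqrt_nonneg _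
  have hs2 : c * κ * s ^ 2 = 4 * (|d| + 2) := by
    rw [hs', Real.sq_sqrt (by positivity)]; field_simp
  have hlim : Tendsto (fun n => D * (s ^ p * ∫ x, |(e n).val x| ^ p)) atTop (𝓝 0) := by
    simpa using (hlp.const_mul (s ^ p)).const_mul D
  obtain ⟨n, hn1⟩ := (hlim.eventually_lt_const one_pos).exists
  have h1 := hs n (s / ‖m n‖) (by positivity)
  have h2 : (s / ‖m n‖) • projPlus hV (m n) = s • e n := by
    simp only [he, hw, map_smul, smul_smul]
    rw [div_eq_mul_inv]
  rw [h2, energy_eq_potential, bform_smul_self hN hV] at h1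
  have h3 := hp (μ n) (hμ n) (e n) (projPlus_mem hV (w n))
  have h4 := hpot (s • e n)
  have h5 : ∫ x, |(s • e n).val x| ^ p = s ^ p * ∫ x, |(e n).val x| ^ p := by
    rw [← integral_const_mul]
    refine integral_congr_ae ?_
    filter_upwards [val_smul s (e n)] with x hx
    simp only [hx]
    rw [abs_mul, abs_of_nonneg hs0, Real.mul_rpow hs0 (abs_nonneg _)]
  have h6 : ‖toL2L N (s • e n)‖ ^ 2 ≤ s ^ 2 * ‖e n‖ ^ 2 := by
    rw [← mul_pow]
    refine pow_le_pow_left₀ (norm_nonneg _) ((norm_toL2L_le _).trans (le_of_eq ?_)) 2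
    rw [norm_smul, Real.norm_of_nonneg hs0]
  rw [h5] at h4
  have h7 := hlow' n
  have h8 : s ^ 2 * (c * ‖e n‖ ^ 2) ≤ s ^ 2 * bform V (μ n) (e n) (e n) := by gcongr
  have h9 : c * κ * s ^ 2 ≤ s ^ 2 * (c * ‖e n‖ ^ 2) := by
    have : c * s ^ 2 * κ ≤ c * s ^ 2 * ‖e n‖ ^ 2 := by gcongr
    linarith
  have h10 : c / 4 * ‖toL2L N (s • e n)‖ ^ 2 ≤ c / 4 * (s ^ 2 * ‖e n‖ ^ 2) := by gcongr
  have h11 := le_abs_self d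
  have h12 : 0 ≤ |d| := abs_nonneg d
  linarith

end

section

variable {N : ℕ} {V : Euc N → ℝ} {f : Euc N → ℝ → ℝ} {p : ℝ}

/-! ### Continuity of the level at `μ = 0` -/

theorem bform_nonpos_of_nonneg (hN : 3 ≤ N) (hV : CondV V) {μ : ℝ} (hμ : 0 ≤ μ) :
    ∀ u ∈ Xminus V, bform V μ u u ≤ 0 := fun u hu =>
  (bform_le_of_nonneg hN hV hμ u).trans (bform_zero_nonpos hV u hu)

theorem energy_le_energy_zero (hN : 3 ≤ N) (hV : CondV V) {μ : ℝ} (hμ : 0 ≤ μ) (u : H1 N) :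
    energy V f μ u ≤ energy V f 0 u := by
  rw [energy_zero_eq hN hV μ]
  have := mul_nonneg hμ (hardyL_self_nonneg hN u)
  linarith

/-- Each Nehari–Pankov point for `0` shares its half space with one for `μ`, and lowering the energy
by the Hardy term only helps. -/
theorem level_le_level_zero (hN : 3 ≤ N) (hV : CondV V) (hf : CondF f p) :
    ∃ μ₀ : ℝ, 0 < μ₀ ∧ ∀ μ, 0 ≤ μ → μ ≤ μ₀ → level V f μ ≤ level V f 0 := by
  obtain ⟨c, μ₀, hc, hμ₀, -, hp⟩ := exists_bform_pos_small hN hV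
  refine ⟨μ₀, hμ₀, fun μ hμ0 hμ => le_iInf₂ fun u hu => ?_⟩
  obtain ⟨t, ht, v, hv, hm⟩ := exists_mem_nehariPankov_of_pos hN hV hf hμ0 hc (hp μ hμ) hu.1
  refine (level_le hm).trans ?_
  rw [EReal.coe_le_coe_iff]
  exact (energy_le_energy_zero hN hV hμ0 _).trans
    (energy_le_of_mem_nehariPankov hN hV hf (bform_zero_nonpos hV) hu ht.le hv)

/-- On the ray through the positive part the energy stays below that of a Nehari point. -/
theorem energy_ray_le (hN : 3 ≤ N) (hV : CondV V) (hf : CondF f p) {μ : ℝ} (hμ : 0 ≤ μ)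
    {u : H1 N} (hu : u ∈ nehariPankov V f μ) {t : ℝ} (ht : 0 ≤ t) {v : H1 N} (hv : v ∈ Xminus V)
    {s : ℝ} (hs : 0 ≤ s) : energy V f μ (s • projPlus hV (t • u + v)) ≤ energy V f μ u := by
  have h1 : s • projPlus hV (t • u + v) =
      (s * t) • u + (s • v - s • ((t • u + v) - projPlus hV (t • u + v))) := by
    module
  rw [h1]
  exact energy_le_of_mem_nehariPankov hN hV hf (bform_nonpos_of_nonneg hN hV hμ) hu
    (mul_nonneg hs ht) ((Xminus V).sub_mem ((Xminus V).smul_mem s hv)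
      ((Xminus V).smul_mem s (sub_projPlus_mem hV _)))

theorem energy_nonneg_of_mem (hN : 3 ≤ N) (hV : CondV V) (hf : CondF f p) {μ : ℝ} (hμ : 0 ≤ μ)
    {u : H1 N} (hu : u ∈ nehariPankov V f μ) : 0 ≤ energy V f μ u := by
  have h1 := energy_le_of_mem_nehariPankov hN hV hf (bform_nonpos_of_nonneg hN hV hμ) hu le_rfl
    (Xminus V).zero_mem
  rw [zero_smul, zero_add, energy_eq_potential, potential_zero, ← formL_apply hN hV.bounded] at h1
  simpa using h1

/-- The upper bound is monotonicity in `μ`. For the lower bound, a point `u` of `N_μ` with energy at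
most `l + 1` is moved inside its half space to `N_0`; the moved point has norm at most `R` uniformly
in `μ`, so the Hardy correction is `O(μ)`. No ground states are used. -/
theorem tendsto_level (hN : 3 ≤ N) (hV : CondV V) (hf : CondF f p) :
    Tendsto (fun μ : ℝ => level V f μ) (𝓝[>] 0) (𝓝 (level V f 0)) := by
  -- An infinite level means an empty Nehari–Pankov set, hence `X⁻` is everything, and then all the
  -- levels are infimums over the empty set.
  by_cases htop : level V f 0 = ⊤
  · have hX : ∀ u : H1 N, u ∈ Xminus V := by
      intro u
      by_contra hu
      obtain ⟨t, -, v, -, hm⟩ := exists_mem_nehariPankov_zero hN hV hf hu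
      have := level_le hm
      rw [htop, top_le_iff] at this
      exact EReal.coe_ne_top _ this
    have : ∀ μ, level V f μ = level V f 0 := by
      intro μ
      rw [htop, level]
      exact iInf₂_eq_top.2 fun u hu => absurd (hX u) hu.1
    simp only [this]
    exact tendsto_const_nhds
  have hbot : level V f 0 ≠ ⊥ := by
    have : (0 : EReal) ≤ level V f 0 := le_iInf₂ fun u hu => by
      exact_mod_cast energy_nonneg_of_mem hN hV hf le_rfl hu
    intro h
    rw [h] at this
    exact absurd this (by simp)
  obtain ⟨l, hl⟩ : ∃ l : ℝ, level V f 0 = (l : EReal) :=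
    ⟨_, (EReal.coe_toReal htop hbot).symm⟩
  obtain ⟨μ₁, hμ₁, hup⟩ := level_le_level_zero hN hV hf
  obtain ⟨μ₂, hμ₂, R, hR⟩ := exists_norm_le_of_energy hN hV hf (l + 1)
  obtain ⟨C, hC, hCle⟩ := hardyL_le_norm hN
  have hlow : ∀ μ, 0 ≤ μ → μ ≤ μ₂ → ((l - 1 / 2 * (μ * (C * R ^ 2)) : ℝ) : EReal) ≤ level V f μ := by
    intro μ hμ0 hμ
    refine le_iInf₂ fun u hu => ?_
    rw [EReal.coe_le_coe_iff]
    have h0 : 0 ≤ μ * (C * R ^ 2) := by positivity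
    rcases le_total (energy V f μ u) (l + 1) with h | h
    · obtain ⟨t, ht, v, hv, hm⟩ := exists_mem_nehariPankov_zero hN hV hf hu.1
      have h1 := hR μ hμ0 hμ _ (energy_nonneg_of_mem hN hV hf le_rfl hm) fun s hs =>
        (energy_ray_le hN hV hf hμ0 hu ht.le hv hs).trans h
      have h2 := level_le hm
      rw [hl, EReal.coe_le_coe_iff, energy_zero_eq hN hV μ] at h2
      have h3 := energy_le_of_mem_nehariPankov hN hV hf (bform_nonpos_of_nonneg hN hV hμ0) hu
        ht.le hv
      have h4 : μ * hardyL hN (t • u + v) (t • u + v) ≤ μ * (C * R ^ 2) := by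
        refine mul_le_mul_of_nonneg_left ((hCle _).trans ?_) hμ0
        gcongr
      linarith
    · linarith
  rw [hl]
  have hlim : Tendsto (fun μ : ℝ => ((l - 1 / 2 * (μ * (C * R ^ 2)) : ℝ) : EReal)) (𝓝[>] 0)
      (𝓝 (l : EReal)) := by
    have h1 : Continuous fun μ : ℝ => l - 1 / 2 * (μ * (C * R ^ 2)) := by fun_prop
    have h2 := h1.tendsto 0
    rw [zero_mul, mul_zero, sub_zero] at h2
    exact (continuous_coe_real_ereal.tendsto l).comp (h2.mono_left nhdsWithin_le_nhds)
  refine tendsto_of_tendsto_of_tendsto_of_le_of_le' hlim tendsto_const_nhds ?_ ?_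
  · filter_upwards [Ioo_mem_nhdsGT hμ₂] with μ hμ using hlow μ hμ.1.le hμ.2.le
  · filter_upwards [Ioo_mem_nhdsGT hμ₁] with μ hμ
    rw [← hl]
    exact hup μ hμ.1.le hμ.2.le

end

section

variable {N : ℕ} {V : Euc N → ℝ} {f : Euc N → ℝ → ℝ} {p : ℝ}

/-! ### Weak convergence -/

/-- Sequential Banach–Alaoglu, transported through the Riesz isomorphism; separability gives
sequential compactness. -/
theorem exists_weak_subseq {F : Type*} [NormedAddCommGroup F] [InnerProductSpace ℝ F]
    [CompleteSpace F] [TopologicalSpace.SeparableSpace F] {w : ℕ → F} {R : ℝ}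
    (hR : ∀ n, ‖w n‖ ≤ R) :
    ∃ (k : ℕ → ℕ) (u : F), StrictMono k ∧
      ∀ L : F →L[ℝ] ℝ, Tendsto (fun n => L (w (k n))) atTop (𝓝 (L u)) := by
  set g : ℕ → WeakDual ℝ F := fun n =>
    StrongDual.toWeakDual (InnerProductSpace.toDual ℝ F (w n)) with hg
  have hmem : ∀ n, g n ∈ WeakDual.toStrongDual ⁻¹'
      Metric.closedBall (0 : StrongDual ℝ F) R := by
    intro n
    rw [mem_preimage, mem_closedBall_zero_iff]
    change ‖InnerProductSpace.toDual ℝ F (w n)‖ ≤ R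
    rw [LinearIsometryEquiv.norm_map]
    exact hR n
  obtain ⟨φ, -, k, hk, hlim⟩ := WeakDual.isSeqCompact_closedBall ℝ F 0 R hmem
  refine ⟨k, (InnerProductSpace.toDual ℝ F).symm (WeakDual.toStrongDual φ), hk, fun L => ?_⟩
  set v := (InnerProductSpace.toDual ℝ F).symm L with hv
  have hL : ∀ x, L x = inner ℝ v x := fun x => by
    rw [hv, InnerProductSpace.toDual_symm_apply]
  have h1 : Tendsto (fun n => (g (k n)) v) atTop (𝓝 (φ v)) :=
    ((WeakDual.eval_continuous v).tendsto φ).comp hlim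
  have h2 : φ v = L ((InnerProductSpace.toDual ℝ F).symm (WeakDual.toStrongDual φ)) := by
    rw [hL, real_inner_comm, InnerProductSpace.toDual_symm_apply]
    rfl
  rw [← h2]
  refine h1.congr fun n => ?_
  rw [hL, real_inner_comm]
  rfl

instance separableSpace_H1 : TopologicalSpace.SeparableSpace (H1 N) := by
  have : Fact ((2 : ENNReal) ≠ ⊤) := ⟨by simp⟩
  have h1 : SecondCountableTopology (L2 N) := inferInstance
  have h2 : SecondCountableTopology (L2vec N) := inferInstance
  have h3 : SecondCountableTopology (WithLp 2 (L2 N × L2vec N)) :=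
    (WithLp.prodContinuousLinearEquiv 2 ℝ (L2 N) (L2vec N)).toHomeomorph.secondCountableTopology
  have h4 : SecondCountableTopology (H1 N) :=
    TopologicalSpace.Subtype.secondCountableTopology (sobolev N : Set (WithLp 2 (L2 N × L2vec N)))
  exact TopologicalSpace.SecondCountableTopology.to_separableSpace

/-- The decay exponent only has to exceed the dimension. One integrable weight replaces an
exhaustion by balls, so one subsequence gives almost everywhere convergence without a diagonal
argument. -/
theorem integrable_weight (N : ℕ) :
    Integrable (fun x : Euc N => (1 + ‖x‖) ^ (-((N : ℝ) + 1))) := by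
  refine integrable_one_add_norm ?_
  rw [finrank_euclideanSpace_fin]
  linarith

/-- Weakly null sequences in `H¹` tend to zero in a weighted `L²` space. -/
theorem tendsto_weighted_of_weak {h : ℕ → H1 N} {R : ℝ} (hR : ∀ n, ‖h n‖ ≤ R)
    (hw : ∀ L : H1 N →L[ℝ] ℝ, Tendsto (fun n => L (h n)) atTop (𝓝 0)) :
    Tendsto (fun n => ∫ x, (h n).val x ^ 2 * (1 + ‖x‖) ^ (-((N : ℝ) + 1))) atTop (𝓝 0) := by
  have hR0 : 0 ≤ R := (norm_nonneg _).trans (hR 0)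
  set g : Euc N → ℝ := fun x => (1 + ‖x‖) ^ (-((N : ℝ) + 1)) with hg
  have hgi : Integrable g := integrable_weight N
  have hg0 : ∀ x, 0 ≤ g x := fun x => by positivity
  have hg1 : ∀ x, g x ≤ 1 := fun x =>
    Real.rpow_le_one_of_one_le_of_nonpos (by linarith [norm_nonneg x]) (by
      have : (0 : ℝ) ≤ N := Nat.cast_nonneg N
      linarith)
  have hsq : ∀ u : H1 N, Integrable (fun x => u.val x ^ 2 * g x) := fun u =>
    (integrable_val_sq u).mono' ((integrable_val_sq u).aestronglyMeasurable.mul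
      hgi.aestronglyMeasurable) (ae_of_all _ fun x => by
        rw [Real.norm_of_nonneg (mul_nonneg (sq_nonneg _) (hg0 x))]
        exact mul_le_of_le_one_right (sq_nonneg _) (hg1 x))
  rw [Metric.tendsto_atTop']
  intro ε hε
  obtain ⟨r, hr0, hr⟩ : ∃ r : ℝ, 0 < r ∧ 2 * (r * R) ^ 2 < ε / 2 := by
    have h1 : Tendsto (fun r : ℝ => 2 * (r * R) ^ 2) (𝓝[>] 0) (𝓝 0) := by
      have : Continuous fun r : ℝ => 2 * (r * R) ^ 2 := by fun_prop
      have h2 := this.tendsto 0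
      simp only [zero_mul, ne_eq, OfNat.ofNat_ne_zero, not_false_eq_true, zero_pow, mul_zero] at h2
      exact h2.mono_left nhdsWithin_le_nhds
    obtain ⟨r, hr, hr0⟩ := ((h1.eventually_lt_const (half_pos hε)).and
      self_mem_nhdsWithin).exists
    exact ⟨r, hr0, hr⟩
  obtain ⟨ρ, hρ⟩ := exists_bump_radius (N := N) hr0
  -- Each mollified value is a continuous linear functional of `h n`, so it tends to zero pointwise
  -- under a uniform bound; dominated convergence applies, and the mollification error is small
  -- uniformly in `n`.
  set m : ℕ → Euc N → ℝ := fun n => mollify ρ (h n).val with hm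
  have hmc : ∀ n, Continuous (m n) := fun n => continuous_mollify ρ (toL2L N (h n))
  set D := (R * ‖bumpH1 ρ‖) ^ 2 with hD
  have hmD : ∀ n x, m n x ^ 2 ≤ D := by
    intro n x
    rw [← sq_abs]
    refine pow_le_pow_left₀ (abs_nonneg _) ?_ 2
    simp only [hm]
    rw [mollify_eq_inner]
    refine (abs_inner_shift_le x (h n) (bumpH1 ρ)).trans ?_
    exact mul_le_mul_of_nonneg_right (hR n) (norm_nonneg _)
  have hmi : ∀ n, Integrable (fun x => m n x ^ 2 * g x) := fun n =>
    (hgi.const_mul D).mono' (((hmc n).pow 2).aestronglyMeasurable.mul hgi.aestronglyMeasurable)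
      (ae_of_all _ fun x => by
        rw [Real.norm_of_nonneg (mul_nonneg (sq_nonneg _) (hg0 x))]
        exact mul_le_mul_of_nonneg_right (hmD n x) (hg0 x))
  have hmlim : Tendsto (fun n => ∫ x, m n x ^ 2 * g x) atTop (𝓝 0) := by
    have h1 := tendsto_integral_of_dominated_convergence (F := fun n x => m n x ^ 2 * g x)
      (f := fun _ => (0 : ℝ)) (fun x => D * g x) (fun n => (hmi n).aestronglyMeasurable)
      (hgi.const_mul D) (fun n => ae_of_all _ fun x => by
        rw [Real.norm_of_nonneg (mul_nonneg (sq_nonneg _) (hg0 x))]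
        exact mul_le_mul_of_nonneg_right (hmD n x) (hg0 x)) (ae_of_all _ fun x => ?_)
    · rwa [integral_zero] at h1
    · have h2 := hw (((innerSL ℝ (toL2L N (bumpH1 ρ))).comp (toL2L N)).comp
        (shift x).toContinuousLinearMap)
      have h3 : Tendsto (fun n => m n x) atTop (𝓝 0) := by
        refine h2.congr fun n => ?_
        simp only [hm]
        rw [mollify_eq_inner, real_inner_comm]
        rfl
      simpa using (h3.pow 2).mul_const (g x)
  obtain ⟨n₀, hn₀⟩ := eventually_atTop.1
    (hmlim.eventually_lt_const (show (0 : ℝ) < ε / 4 by positivity))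
  refine ⟨n₀, fun n hn => ?_⟩
  obtain ⟨hei, he⟩ := mollify_error ρ (h n)
  have h1 : ∫ x, (h n).val x ^ 2 * g x ≤
      2 * (∫ x, (mollify ρ (h n).val x - (h n).val x) ^ 2) + 2 * ∫ x, m n x ^ 2 * g x := by
    rw [← integral_const_mul, ← integral_const_mul,
      ← integral_add (hei.const_mul 2) ((hmi n).const_mul 2)]
    refine integral_mono (hsq (h n)) ((hei.const_mul 2).add ((hmi n).const_mul 2)) fun x => ?_
    have h2 : (h n).val x ^ 2 ≤ 2 * (mollify ρ (h n).val x - (h n).val x) ^ 2 + 2 * m n x ^ 2 := by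
      simp only [hm]
      nlinarith [sq_nonneg (2 * mollify ρ (h n).val x - (h n).val x)]
    have h3 := mul_le_mul_of_nonneg_right h2 (hg0 x)
    have h4 : (mollify ρ (h n).val x - (h n).val x) ^ 2 * g x ≤
        (mollify ρ (h n).val x - (h n).val x) ^ 2 := mul_le_of_le_one_right (sq_nonneg _) (hg1 x)
    simp only
    linarith
  have h2 : (ρ.rOut * ‖gradL N (h n)‖) ^ 2 ≤ (r * R) ^ 2 := by
    rw [hρ]
    refine pow_le_pow_left₀ (by positivity) ?_ 2
    exact mul_le_mul_of_nonneg_left ((norm_gradL_le _).trans (hR n)) hr0.le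
  have h3 := hn₀ n hn.le
  rw [Real.dist_eq, sub_zero, abs_of_nonneg
    (integral_nonneg fun x => mul_nonneg (sq_nonneg _) (hg0 x))]
  linarith

/-- A bounded sequence in `H¹` has a subsequence that converges weakly and almost everywhere. -/
theorem exists_weak_ae_subseq {w : ℕ → H1 N} {R : ℝ} (hR : ∀ n, ‖w n‖ ≤ R) :
    ∃ (k : ℕ → ℕ) (u : H1 N), StrictMono k ∧
      (∀ L : H1 N →L[ℝ] ℝ, Tendsto (fun n => L (w (k n))) atTop (𝓝 (L u))) ∧
      ∀ᵐ x, Tendsto (fun n => (w (k n)).val x) atTop (𝓝 (u.val x)) := by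
  obtain ⟨k, u, hk, hlim⟩ := exists_weak_subseq hR
  have hlim0 : ∀ L : H1 N →L[ℝ] ℝ, Tendsto (fun n => L (w (k n) - u)) atTop (𝓝 0) := by
    intro L
    have := (hlim L).sub_const (L u)
    rw [sub_self] at this
    simpa only [map_sub] using this
  have hwt := tendsto_weighted_of_weak (h := fun n => w (k n) - u) (R := R + ‖u‖)
    (fun n => (norm_sub_le _ _).trans (add_le_add_left (hR _) _)) hlim0
  have hg0 : ∀ x : Euc N, 0 < (1 + ‖x‖) ^ (-((N : ℝ) + 1)) := fun x => by positivity
  obtain ⟨j, hj, hae⟩ := exists_subseq_ae_tendsto_zero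
    (k := fun n x => (w (k n) - u).val x ^ 2 * (1 + ‖x‖) ^ (-((N : ℝ) + 1)))
    (fun n => by
      refine (integrable_val_sq (w (k n) - u)).mono'
        ((integrable_val_sq _).aestronglyMeasurable.mul
          (integrable_weight N).aestronglyMeasurable) (ae_of_all _ fun x => ?_)
      rw [Real.norm_of_nonneg (mul_nonneg (sq_nonneg _) (hg0 x).le)]
      refine mul_le_of_le_one_right (sq_nonneg _) ?_
      refine Real.rpow_le_one_of_one_le_of_nonpos (by linarith [norm_nonneg x]) ?_
      have : (0 : ℝ) ≤ N := Nat.cast_nonneg N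
      linarith)
    (fun n x => mul_nonneg (sq_nonneg _) (hg0 x).le) hwt
  refine ⟨k ∘ j, u, hk.comp hj, fun L => (hlim L).comp hj.tendsto_atTop, ?_⟩
  have hsub : ∀ᵐ x, ∀ n, (w n - u).val x = (w n).val x - u.val x :=
    ae_all_iff.2 fun n => val_sub (w n) u
  filter_upwards [hae, hsub] with x hx hs
  have h1 := hx.mul_const ((1 + ‖x‖) ^ (-((N : ℝ) + 1)))⁻¹
  simp only [mul_assoc, mul_inv_cancel₀ (hg0 x).ne', mul_one, zero_mul, hs] at h1
  have h2 : Tendsto (fun i => |(w (k (j i))).val x - u.val x|) atTop (𝓝 0) := by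
    have := h1.sqrt
    rw [Real.sqrt_zero] at this
    simpa only [Real.sqrt_sq_eq_abs] using this
  rw [tendsto_iff_norm_sub_tendsto_zero]
  exact h2

/-! ### Integrals along almost everywhere convergent sequences -/

/-- The variant for an error term that is only uniformly small: the part below the fixed majorant
tends to zero, and the rest has integral at most `δ < ε`. -/
theorem eventually_integral_lt_of_le_add {α : Type*} [MeasurableSpace α] {ν : Measure α}
    {g E : ℕ → α → ℝ} {H : α → ℝ} (hgm : ∀ n, AEMeasurable (g n) ν)
    (hg0 : ∀ n x, 0 ≤ g n x) (hH : Integrable H ν) (hE : ∀ n, Integrable (E n) ν)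
    (hE0 : ∀ n x, 0 ≤ E n x)
    (hle : ∀ n, ∀ᵐ x ∂ν, g n x ≤ H x + E n x)
    (hlim : ∀ᵐ x ∂ν, Tendsto (fun n => g n x) atTop (𝓝 0)) {δ ε : ℝ} (hδε : δ < ε)
    (hElim : ∀ n, ∫ x, E n x ∂ν ≤ δ) :
    ∀ᶠ n in atTop, ∫ x, g n x ∂ν < ε := by
  have hmm : ∀ n, AEMeasurable (fun x => min (g n x) |H x|) ν := fun n =>
    (hgm n).min hH.aemeasurable.abs
  have hm0 : ∀ n x, 0 ≤ min (g n x) |H x| := fun n x => le_min (hg0 n x) (abs_nonneg _)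
  have h1 := tendsto_integral_zero_of_le_add (E := fun _ _ => 0) hmm hm0 hH.abs
    (fun _ => integrable_zero _ _ _) (fun _ _ => le_rfl)
    (fun n => ae_of_all _ fun x => by rw [add_zero]; exact min_le_right _ _)
    (hlim.mono fun x hx => squeeze_zero (fun n => hm0 n x) (fun n => min_le_left _ _) hx)
    (by simp)
  filter_upwards [h1.eventually_lt_const (sub_pos.2 hδε)] with n hn
  have hmi : Integrable (fun x => min (g n x) |H x|) ν :=
    hH.abs.mono' (hmm n).aestronglyMeasurable (ae_of_all _ fun x => by
      rw [Real.norm_of_nonneg (hm0 n x)]; exact min_le_right _ _)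
  have h2 : ∫ x, g n x ∂ν ≤ (∫ x, min (g n x) |H x| ∂ν) + ∫ x, E n x ∂ν := by
    rw [← integral_add hmi (hE n)]
    refine integral_mono_of_nonneg (ae_of_all _ (hg0 n)) (hmi.add (hE n)) ?_
    filter_upwards [hle n] with x hx
    rcases le_total (g n x) |H x| with h | h
    · simp only [min_eq_left h]; linarith [hE0 n x]
    · simp only [min_eq_right h]; linarith [le_abs_self (H x)]
  linarith [hElim n]

/-- Fatou's lemma, and convergence of the positive parts when no mass is lost. -/
theorem fatou_scheffe {α : Type*} [MeasurableSpace α] {ν : Measure α} {h : ℕ → α → ℝ}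
    {h₀ : α → ℝ} (hi : ∀ n, Integrable (h n) ν) (hi₀ : Integrable h₀ ν)
    (hn : ∀ n, ∀ᵐ x ∂ν, 0 ≤ h n x) (hn₀ : ∀ᵐ x ∂ν, 0 ≤ h₀ x)
    (hlim : ∀ᵐ x ∂ν, Tendsto (fun n => h n x) atTop (𝓝 (h₀ x))) {l : ℝ}
    (hl : Tendsto (fun n => ∫ x, h n x ∂ν) atTop (𝓝 l)) :
    ∫ x, h₀ x ∂ν ≤ l ∧
      Tendsto (fun n => ∫ x, max (h n x - h₀ x) 0 ∂ν) atTop (𝓝 (l - ∫ x, h₀ x ∂ν)) := by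
  have hmi : ∀ n, Integrable (fun x => min (h n x) (h₀ x)) ν := fun n => (hi n).inf hi₀
  -- Truncating at the limit gives the majorant `h₀`, and the positive excess is exactly `h n - min
  -- (h n) h₀`.
  have h1 : Tendsto (fun n => ∫ x, min (h n x) (h₀ x) ∂ν) atTop (𝓝 (∫ x, h₀ x ∂ν)) := by
    refine tendsto_integral_of_dominated_convergence h₀ (fun n => (hmi n).aestronglyMeasurable)
      hi₀ (fun n => ?_) ?_
    · filter_upwards [hn n, hn₀] with x h1 h2
      rw [Real.norm_of_nonneg (le_min h1 h2)]
      exact min_le_right _ _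
    · filter_upwards [hlim] with x hx
      have := hx.min (tendsto_const_nhds (x := h₀ x))
      rwa [min_self] at this
  refine ⟨le_of_tendsto_of_tendsto' h1 hl fun n =>
    integral_mono (hmi n) (hi n) fun x => min_le_left _ _, ?_⟩
  refine (hl.sub h1).congr fun n => ?_
  rw [← integral_sub (hi n) (hmi n)]
  refine integral_congr_ae (ae_of_all _ fun x => ?_)
  simp only
  rcases le_total (h n x) (h₀ x) with h2 | h2
  · rw [min_eq_left h2, max_eq_right (by linarith), sub_self]
  · rw [min_eq_right h2, max_eq_left (by linarith)]

/-- Split according to whether `t ≤ θ s`. The small factor sits on `s`, the varying sequence, and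
the large one on the fixed test function. -/
theorem rpow_mul_le_young {p s t θ : ℝ} (hp : 1 < p) (hθ : 0 < θ) (hs : 0 ≤ s) (ht : 0 ≤ t) :
    s ^ (p - 1) * t ≤ θ * s ^ p + (θ⁻¹) ^ (p - 1) * t ^ p := by
  have hpow : ∀ a : ℝ, 0 ≤ a → a ^ (p - 1) * a = a ^ p := fun a ha => by
    rw [← Real.rpow_add_one' ha (by linarith), sub_add_cancel]
  have h1 : 0 ≤ θ * s ^ p := by positivity
  have h2 : 0 ≤ (θ⁻¹) ^ (p - 1) * t ^ p := by positivity
  rcases le_total t (θ * s) with h | h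
  · have h3 : s ^ (p - 1) * t ≤ s ^ (p - 1) * (θ * s) := by gcongr
    have h4 : s ^ (p - 1) * (θ * s) = θ * s ^ p := by rw [← hpow s hs]; ring
    linarith
  · have h3 : s ≤ θ⁻¹ * t := by rw [inv_mul_eq_div, le_div_iff₀ hθ]; linarith
    have h4 : s ^ (p - 1) ≤ (θ⁻¹ * t) ^ (p - 1) := Real.rpow_le_rpow hs h3 (by linarith)
    rw [Real.mul_rpow (by positivity) ht] at h4
    have h5 : s ^ (p - 1) * t ≤ (θ⁻¹) ^ (p - 1) * t ^ (p - 1) * t := by gcongr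
    rw [mul_assoc, hpow t ht] at h5
    linarith

/-- The superposition operator is weakly continuous along bounded, a.e. convergent sequences. -/
theorem nonlinL_tendsto_of_ae (hN : 3 ≤ N) (hf : CondF f p) {w : ℕ → H1 N} {u : H1 N} {R : ℝ}
    (hR : ∀ n, ‖w n‖ ≤ R) (hae : ∀ᵐ x, Tendsto (fun n => (w n).val x) atTop (𝓝 (u.val x)))
    (φ : H1 N) : Tendsto (fun n => nonlinL hN hf (w n) φ) atTop (𝓝 (nonlinL hN hf u φ)) := by
  obtain ⟨C, hC, hgr⟩ := hf.growth one_pos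
  obtain ⟨S, hS, hSo⟩ := exists_integral_rpow_le hN hf.two_le hf.le_critExp
  have hR0 : 0 ≤ R := (norm_nonneg _).trans (hR 0)
  have hp1 : 1 < p := by linarith [hf.two_le]
  set Q := R ^ 2 + C * (S * R ^ p) with hQ
  have hQ0 : 0 ≤ Q := by positivity
  rw [Metric.tendsto_atTop']
  intro ε hε
  -- `Q` bounds the mass of the terms carrying `θ`, so their contribution stays below `ε` for every
  -- `n`.
  set θ := ε / (2 * (Q + 1)) with hθ
  have hθ0 : 0 < θ := by positivity
  set g : ℕ → Euc N → ℝ := fun n x => |f x ((w n).val x) - f x (u.val x)| * |φ.val x| with hg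
  set H : Euc N → ℝ := fun x => |f x (u.val x) * φ.val x| + 1 / (4 * θ) * φ.val x ^ 2 +
    C * (θ⁻¹ ^ (p - 1)) * |φ.val x| ^ p with hH
  set E : ℕ → Euc N → ℝ := fun n x => θ * (w n).val x ^ 2 + C * θ * |(w n).val x| ^ p with hE
  have hgm : ∀ n, AEMeasurable (g n) volume := fun n =>
    ((hf.aemeasurable (aemeasurable_val (w n))).sub
      (hf.aemeasurable (aemeasurable_val u))).abs.mul (aemeasurable_val φ).abs
  have hHi : Integrable H := (((integrable_nonlin_mul hN hf u φ).abs).add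
    ((integrable_val_sq φ).const_mul _)).add
      ((integrable_rpow hN hf.two_le hf.le_critExp φ).const_mul _)
  have hEi1 : ∀ n, Integrable (fun x => θ * (w n).val x ^ 2) := fun n =>
    (integrable_val_sq (w n)).const_mul θ
  have hEi2 : ∀ n, Integrable (fun x => C * θ * |(w n).val x| ^ p) := fun n =>
    (integrable_rpow hN hf.two_le hf.le_critExp (w n)).const_mul _
  have hle : ∀ n x, g n x ≤ H x + E n x := by
    intro n x
    set s := (w n).val x
    set t := φ.val x
    have h1 := hgr x s
    have h2 : |f x s - f x (u.val x)| ≤ |f x s| + |f x (u.val x)| := abs_sub _ _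
    have h3 : |f x s - f x (u.val x)| * |t| ≤
        (1 * |s| + C * |s| ^ (p - 1) + |f x (u.val x)|) * |t| :=
      mul_le_mul_of_nonneg_right (by linarith) (abs_nonneg _)
    have h4 := rpow_mul_le_young hp1 hθ0 (abs_nonneg s) (abs_nonneg t)
    have h5 : |s| * |t| ≤ θ * s ^ 2 + 1 / (4 * θ) * t ^ 2 := by
      have h6 : 0 ≤ (2 * θ * |s| - |t|) ^ 2 / (4 * θ) := by positivity
      have h7 : (2 * θ * |s| - |t|) ^ 2 / (4 * θ) =
          θ * s ^ 2 - |s| * |t| + 1 / (4 * θ) * t ^ 2 := by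
        rw [← sq_abs s, ← sq_abs t]
        field_simp
        ring
      linarith
    have h8 := mul_le_mul_of_nonneg_left h4 hC
    simp only [hg, hH, hE]
    rw [abs_mul]
    change |f x s - f x (u.val x)| * |t| ≤ |f x (u.val x)| * |t| + 1 / (4 * θ) * t ^ 2 +
      C * (θ⁻¹ ^ (p - 1)) * |t| ^ p + (θ * s ^ 2 + C * θ * |s| ^ p)
    linarith
  have hEint : ∀ n, ∫ x, E n x ≤ θ * Q := by
    intro n
    simp only [hE]
    rw [integral_add (hEi1 n) (hEi2 n), integral_const_mul, integral_const_mul, integral_val_sq, hQ]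
    have h1 : ‖toL2L N (w n)‖ ^ 2 ≤ R ^ 2 :=
      pow_le_pow_left₀ (norm_nonneg _) ((norm_toL2L_le _).trans (hR n)) 2
    have h2 : ∫ x, |(w n).val x| ^ p ≤ S * R ^ p :=
      (hSo _).trans (mul_le_mul_of_nonneg_left
        (Real.rpow_le_rpow (norm_nonneg _) (hR n) (by linarith)) hS)
    have h3 := mul_le_mul_of_nonneg_left h1 hθ0.le
    have h4 := mul_le_mul_of_nonneg_left h2 (mul_nonneg hC hθ0.le)
    linarith
  have hθQ : θ * Q < ε := by
    rw [hθ, div_mul_eq_mul_div, div_lt_iff₀ (by positivity)]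
    nlinarith
  obtain ⟨n₀, hn₀⟩ := eventually_atTop.1 (eventually_integral_lt_of_le_add hgm
    (fun n x => mul_nonneg (abs_nonneg _) (abs_nonneg _)) hHi (fun n => (hEi1 n).add (hEi2 n))
    (fun n x => add_nonneg (by positivity) (by positivity)) (fun n => ae_of_all _ (hle n)) (by
      filter_upwards [hae, hf.F1.continuous] with x hx hc
      have h1 := ((hc.tendsto _).comp hx).sub_const (f x (u.val x))
      rw [sub_self] at h1
      simpa using h1.abs.mul_const |φ.val x|) hθQ hEint)
  refine ⟨n₀, fun n hn => lt_of_le_of_lt ?_ (hn₀ n hn.le)⟩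
  rw [Real.dist_eq, nonlinL_apply, nonlinL_apply, ← integral_sub (integrable_nonlin_mul hN hf _ _)
    (integrable_nonlin_mul hN hf _ _)]
  refine abs_integral_le_integral_abs.trans (le_of_eq ?_)
  refine integral_congr_ae (ae_of_all _ fun x => ?_)
  simp only [hg]
  rw [← sub_mul, abs_mul]

end

section

variable {N : ℕ} {V : Euc N → ℝ} {f : Euc N → ℝ → ℝ} {p : ℝ}

/-! ### Compactness of ground states as `μ → 0⁺` -/

/-- The energies converge by continuity of the level, so they are eventually at most `l + 1`. Each
ground state maximises its energy on its half space, which contains the ray through its positive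
part, and the uniform norm bound applies. -/
theorem groundState_seq_bounded (hN : 3 ≤ N) (hV : CondV V) (hf : CondF f p) {μ : ℕ → ℝ}
    {u : ℕ → H1 N} (hμ : ∀ n, 0 < μ n) (hμ0 : Tendsto μ atTop (𝓝 0))
    (hu : ∀ n, IsGroundState V f (μ n) (u n)) :
    ∃ l R : ℝ, 0 < l ∧ level V f 0 = (l : EReal) ∧
      Tendsto (fun n => energy V f (μ n) (u n)) atTop (𝓝 l) ∧ ∀ᶠ n in atTop, ‖u n‖ ≤ R := by
  have hmem : ∀ n, u n ∈ nehariPankov V f (μ n) := fun n =>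
    (hu n).mem_nehariPankov hf (bform_nonpos_of_nonneg hN hV (hμ n).le)
  obtain ⟨μ₁, hμ₁, hup⟩ := level_le_level_zero hN hV hf
  have hpos : 0 < level V f 0 := by
    obtain ⟨n, hn⟩ := (hμ0.eventually_lt_const hμ₁).exists
    exact (hu n).level_pos.trans_le (hup _ (hμ n).le hn.le)
  have htop : level V f 0 ≠ ⊤ := by
    obtain ⟨t, -, v, -, hm⟩ := exists_mem_nehariPankov_zero hN hV hf (hmem 0).1
    exact ne_top_of_le_ne_top (EReal.coe_ne_top _) (level_le hm)
  obtain ⟨l, hl⟩ : ∃ l : ℝ, level V f 0 = (l : EReal) :=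
    ⟨_, (EReal.coe_toReal htop (ne_bot_of_gt hpos)).symm⟩
  have hlim : Tendsto (fun n => energy V f (μ n) (u n)) atTop (𝓝 l) := by
    have h1 := (tendsto_level hN hV hf).comp
      (tendsto_nhdsWithin_iff.2 ⟨hμ0, Eventually.of_forall hμ⟩)
    rw [hl] at h1
    rw [← EReal.tendsto_coe]
    refine h1.congr fun n => ?_
    exact (hu n).energy_eq.symm
  obtain ⟨μ₂, hμ₂, R, hR⟩ := exists_norm_le_of_energy hN hV hf (l + 1)
  refine ⟨l, R, ?_, hl, hlim, ?_⟩
  · rw [hl] at hpos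
    exact_mod_cast hpos
  filter_upwards [hμ0.eventually_lt_const hμ₂, hlim.eventually_lt_const (lt_add_one l)]
    with n h1 h2
  refine hR (μ n) (hμ n).le h1.le _
    ((hu n).energy_pos.le.trans (energy_le_energy_zero hN hV (hμ n).le _)) fun s hs => ?_
  have h3 := energy_ray_le hN hV hf (hμ n).le (hmem n) zero_le_one (Xminus V).zero_mem hs
  rw [one_smul, add_zero] at h3
  exact h3.trans h2.le

/-- Vanishing forces `L^p` convergence to zero. By the Nehari identity the energy is at most half
the pairing `∫ f(x,u)u`, whose limit superior would be at most `ε R² < l`. -/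
theorem not_latticeVanishing_of_energy (hN : 3 ≤ N) (hf : CondF f p) {μ : ℕ → ℝ}
    {u : ℕ → H1 N} {R l : ℝ} (hR : ∀ n, ‖u n‖ ≤ R) (hl : 0 < l)
    (hu : ∀ n, bform V (μ n) (u n) (u n) = nonlinL hN hf (u n) (u n))
    (hlim : Tendsto (fun n => energy V f (μ n) (u n)) atTop (𝓝 l)) : ¬ LatticeVanishing u := by
  intro hv
  have hv := hv.tendsto_rpow hN hf.F2.two_lt hf.F2.lt_critical hR
  set ε := l / (R ^ 2 + 1) with hε
  have hε0 : 0 < ε := by positivity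
  obtain ⟨C, hC, hgr⟩ := hf.growth hε0
  have hle : ∀ n, energy V f (μ n) (u n) ≤ 1 / 2 * (ε * R ^ 2 + C * ∫ x, |(u n).val x| ^ p) := by
    intro n
    have h1 : nonlinL hN hf (u n) (u n) ≤ ε * R ^ 2 + C * ∫ x, |(u n).val x| ^ p := by
      have h2 : ∫ x, f x ((u n).val x) * (u n).val x ≤
          ∫ x, (ε * (u n).val x ^ 2 + C * |(u n).val x| ^ p) := by
        refine integral_mono (integrable_nonlin_mul hN hf _ _)
          (((integrable_val_sq (u n)).const_mul ε).add
            ((integrable_rpow hN hf.two_le hf.le_critExp (u n)).const_mul C)) fun x => ?_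
        have h3 := mul_le_mul_of_nonneg_right (hgr x ((u n).val x)) (abs_nonneg ((u n).val x))
        rw [← abs_mul] at h3
        have h4 : |(u n).val x| ^ (p - 1) * |(u n).val x| = |(u n).val x| ^ p := by
          rcases (abs_nonneg ((u n).val x)).eq_or_lt with h | h
          · rw [← h, mul_zero, Real.zero_rpow (by linarith [hf.two_le])]
          · rw [Real.rpow_sub_one h.ne', div_mul_cancel₀ _ h.ne']
        calc f x ((u n).val x) * (u n).val x ≤ _ := le_abs_self _
          _ ≤ _ := h3
          _ = ε * |(u n).val x| ^ 2 + C * (|(u n).val x| ^ (p - 1) * |(u n).val x|) := by ring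
          _ = _ := by rw [h4, sq_abs]
      rw [integral_add ((integrable_val_sq (u n)).const_mul ε)
        ((integrable_rpow hN hf.two_le hf.le_critExp (u n)).const_mul C), integral_const_mul,
        integral_const_mul, integral_val_sq] at h2
      have h5 : ‖toL2L N (u n)‖ ^ 2 ≤ R ^ 2 :=
        pow_le_pow_left₀ (norm_nonneg _) ((norm_toL2L_le _).trans (hR n)) 2
      rw [nonlinL_apply]
      have := mul_le_mul_of_nonneg_left h5 hε0.le
      linarith
    rw [energy_eq_potential, hu n]
    have := potential_nonneg hf (u n)
    linarith
  have h1 := le_of_tendsto_of_tendsto' hlim ((hv.const_mul C).const_add (ε * R ^ 2)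
    |>.const_mul (1 / 2)) hle
  have h2 : ε * (R ^ 2 + 1) = l := by
    rw [hε]
    field_simp
  nlinarith

/-- (F6) bounds `|w - u|^q` by a fixed integrable function plus a multiple of the positive excess,
so dominated convergence works in `L^q`. Interpolation with the bounded critical norm carries this
to `L^p`, because `q ≤ p` and `p` is strictly subcritical. -/
theorem tendsto_rpow_of_excess (hN : 3 ≤ N) (hf : CondF f p) (hF6 : CondF6 f p) {w : ℕ → H1 N}
    {u : H1 N} {R : ℝ} (hR : ∀ n, ‖w n‖ ≤ R)
    (hae : ∀ᵐ x, Tendsto (fun n => (w n).val x) atTop (𝓝 (u.val x)))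
    (hex : Tendsto (fun n => ∫ x, max
      ((1 / 2 * (f x ((w n).val x) * (w n).val x) - primitive f x ((w n).val x)) -
        (1 / 2 * (f x (u.val x) * u.val x) - primitive f x (u.val x))) 0) atTop (𝓝 0)) :
    Tendsto (fun n => ∫ x, |(w n - u).val x| ^ p) atTop (𝓝 0) := by
  obtain ⟨b, q, hb, hq, hqp, hlow⟩ := hF6.lower
  have hq' : q ≤ critExp N := hqp.trans hf.le_critExp
  have hq0 : 0 ≤ q := by linarith
  set e : H1 N → Euc N → ℝ := fun v x =>
    1 / 2 * (f x (v.val x) * v.val x) - primitive f x (v.val x) with he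
  have hei : ∀ v, Integrable (e v) := fun v =>
    ((integrable_nonlin_mul hN hf v v).const_mul _).sub (integrable_primitive hN hf v)
  have hlow' : ∀ v x, |v.val x| ^ q ≤ 2 / b * e v x := by
    intro v x
    have h1 := hlow x (v.val x)
    rw [div_mul_eq_mul_div, le_div_iff₀ hb]
    simp only [he]
    linarith
  have hqlim : Tendsto (fun n => ∫ x, |(w n - u).val x| ^ q) atTop (𝓝 0) := by
    refine tendsto_integral_zero_of_le_add (H := fun x => 2 ^ q * (2 / b) * 2 * e u x)
      (E := fun n x => 2 ^ q * (2 / b) * max (e (w n) x - e u x) 0)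
      (fun n => (aemeasurable_val _).abs.pow_const _) (fun n x => by positivity)
      ((hei u).const_mul _) (fun n => (((hei (w n)).sub (hei u)).pos_part).const_mul _)
      (fun n x => mul_nonneg (by positivity) (le_max_right _ _)) (fun n => ?_) ?_ ?_
    · filter_upwards [val_sub (w n) u] with x hx
      rw [hx]
      have h1 : |(w n).val x - u.val x| ^ q ≤ (|(w n).val x| + |u.val x|) ^ q :=
        Real.rpow_le_rpow (abs_nonneg _) (abs_sub _ _) hq0
      have h2 := add_rpow_le_two (abs_nonneg ((w n).val x)) (abs_nonneg (u.val x)) hq0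
      have h3 := hlow' (w n) x
      have h4 := hlow' u x
      have h5 : |(w n).val x| ^ q + |u.val x| ^ q ≤
          2 / b * (2 * e u x + max (e (w n) x - e u x) 0) := by
        have h6 : e (w n) x + e u x ≤ 2 * e u x + max (e (w n) x - e u x) 0 := by
          have := le_max_left (e (w n) x - e u x) 0
          linarith
        have h7 := mul_le_mul_of_nonneg_left h6 (by positivity : 0 ≤ 2 / b)
        linarith
      have h8 := mul_le_mul_of_nonneg_left h5 (by positivity : (0 : ℝ) ≤ 2 ^ q)
      calc _ ≤ _ := h1
        _ ≤ _ := h2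
        _ ≤ _ := h8
        _ = _ := by ring
    · have hv : ∀ᵐ x, ∀ n, (w n - u).val x = (w n).val x - u.val x :=
        ae_all_iff.2 fun n => val_sub (w n) u
      filter_upwards [hae, hv] with x hx hv
      simp only [hv]
      have h1 := (hx.sub_const (u.val x)).abs
      rw [sub_self, abs_zero] at h1
      have h2 := h1.rpow_const (p := q) (Or.inr hq0)
      rwa [Real.zero_rpow (by linarith)] at h2
    · have h1 := hex.const_mul (2 ^ q * (2 / b))
      rw [mul_zero] at h1
      refine h1.congr fun n => ?_
      rw [← integral_const_mul]
  obtain ⟨C, hC, hsob⟩ := integral_rpow_critExp_le hN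
  set M := (C * (R + ‖u‖)) ^ critExp N with hM
  have hr : 2 < critExp N := two_lt_critExp hN
  have hR0 : 0 ≤ R := (norm_nonneg _).trans (hR 0)
  have hM0 : 0 ≤ M := by positivity
  have hbd : ∀ n, ∀ K > 0, ∫ x, |(w n - u).val x| ^ p ≤
      K ^ (p - q) * (∫ x, |(w n - u).val x| ^ q) + K ^ (p - critExp N) * M := by
    intro n K hK
    have h1 : ∫ x, |(w n - u).val x| ^ p ≤ ∫ x, (K ^ (p - q) * |(w n - u).val x| ^ q +
        K ^ (p - critExp N) * |(w n - u).val x| ^ critExp N) :=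
      integral_mono (integrable_rpow hN hf.two_le hf.le_critExp _)
        (((integrable_rpow hN hq.le hq' _).const_mul _).add
          ((integrable_rpow_critExp hN _).const_mul _)) fun x =>
        rpow_le_interpolate hqp hf.le_critExp hK (abs_nonneg _) (by linarith [hf.two_le])
    rw [integral_add ((integrable_rpow hN hq.le hq' _).const_mul _)
      ((integrable_rpow_critExp hN _).const_mul _), integral_const_mul, integral_const_mul] at h1
    have h2 : ∫ x, |(w n - u).val x| ^ critExp N ≤ M := by
      refine (hsob _).trans (Real.rpow_le_rpow (by positivity) ?_ (by linarith))
      exact mul_le_mul_of_nonneg_left ((norm_sub_le _ _).trans (by linarith [hR n])) hC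
    have h3 := mul_le_mul_of_nonneg_left h2 (by positivity : 0 ≤ K ^ (p - critExp N))
    linarith
  rw [Metric.tendsto_atTop]
  intro ε hε
  have hexp : Tendsto (fun K : ℝ => K ^ (p - critExp N) * M) atTop (𝓝 0) := by
    have h1 := tendsto_rpow_neg_atTop (y := critExp N - p) (by
      have : p < critExp N := hf.F2.lt_critical
      linarith)
    rw [neg_sub] at h1
    simpa using h1.mul_const M
  obtain ⟨K, hK, hK0⟩ := ((hexp.eventually_lt_const (half_pos hε)).and
    (eventually_gt_atTop (0 : ℝ))).exists
  have h1 := hqlim.const_mul (K ^ (p - q))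
  rw [mul_zero] at h1
  obtain ⟨n₀, hn₀⟩ := eventually_atTop.1 (h1.eventually_lt_const (half_pos hε))
  refine ⟨n₀, fun n hn => ?_⟩
  have h2 : 0 ≤ ∫ x, |(w n - u).val x| ^ p := integral_nonneg fun x => by positivity
  rw [Real.dist_eq, sub_zero, abs_of_nonneg h2]
  have := hbd n K hK0
  have := hn₀ n hn
  linarith

theorem exists_bound_bilinear {F : Type*} [NormedAddCommGroup F] [NormedSpace ℝ F]
    (B : F →L[ℝ] F →L[ℝ] ℝ) : ∃ C : ℝ, 0 ≤ C ∧ ∀ u v : F, |B u v| ≤ C * ‖u‖ * ‖v‖ :=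
  ⟨‖B‖, B.opNorm_nonneg, B.le_opNorm₂⟩

/-- A translate of a critical point of `J_μ` is almost critical for `J_0`. -/
theorem exists_abs_bform_shift_sub_le (hN : 3 ≤ N) (hV : CondV V) (hf : CondF f p) :
    ∃ C : ℝ, 0 ≤ C ∧ ∀ μ : ℝ, 0 ≤ μ → ∀ u : H1 N, (∀ v, bform V μ u v = nonlinL hN hf u v) →
      ∀ (z : Fin N → ℤ) (ψ : H1 N), |bform V 0 (shift (latticePoint z) u) ψ -
        nonlinL hN hf (shift (latticePoint z) u) ψ| ≤ μ * (C * ‖u‖ * ‖ψ‖) := by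
  obtain ⟨C, hC, hCle⟩ := exists_bound_bilinear (hardyL hN)
  refine ⟨C, hC, fun μ hμ u hu z ψ => ?_⟩
  set φ := shift (-latticePoint z) ψ with hφ
  have hψ : ψ = shift (latticePoint z) φ := by
    rw [hφ, shift_shift, add_neg_cancel, shift_zero]
  have hn : ‖ψ‖ = ‖φ‖ := (LinearIsometry.norm_map _ _).symm
  rw [hn, hψ, bform_shift (hV.periodic z), nonlinL_shift hN hf, ← hu, bform_eq_sub hN hV.bounded μ,
    sub_sub_cancel, abs_mul, abs_of_nonneg hμ]
  exact mul_le_mul_of_nonneg_left (hCle u φ) hμ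

/-- With the test function fixed, weak convergence handles the form and almost everywhere
convergence handles the nonlinearity. -/
theorem critical_zero_of_weak_limit (hN : 3 ≤ N) (hV : CondV V) (hf : CondF f p) {w : ℕ → H1 N}
    {u : H1 N} {R : ℝ} (hR : ∀ n, ‖w n‖ ≤ R) {e : ℕ → ℝ} (he : Tendsto e atTop (𝓝 0))
    (hw : ∀ n ψ, |bform V 0 (w n) ψ - nonlinL hN hf (w n) ψ| ≤ e n * ‖ψ‖)
    (hweak : ∀ L : H1 N →L[ℝ] ℝ, Tendsto (fun n => L (w n)) atTop (𝓝 (L u)))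
    (hae : ∀ᵐ x, Tendsto (fun n => (w n).val x) atTop (𝓝 (u.val x))) (ψ : H1 N) :
    bform V 0 u ψ = nonlinL hN hf u ψ := by
  have h1 : Tendsto (fun n => bform V 0 (w n) ψ) atTop (𝓝 (bform V 0 u ψ)) := by
    have h := hweak (schrL hV.bounded ψ)
    simp only [schrL_apply] at h
    simpa only [bform_comm V 0 ψ] using h
  have h2 := h1.sub (nonlinL_tendsto_of_ae hN hf hR hae ψ)
  have h3 : Tendsto (fun n => bform V 0 (w n) ψ - nonlinL hN hf (w n) ψ) atTop (𝓝 0) := by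
    refine squeeze_zero_norm (fun n => hw n ψ) ?_
    simpa using he.mul_const ‖ψ‖
  exact sub_eq_zero.1 (tendsto_nhds_unique h2 h3)

/-- The form `B_0` detects the norm when tested against the reflected function. -/
theorem exists_norm_sq_le_bform (hV : CondV V) : ∃ c : ℝ, 0 < c ∧ ∀ h : H1 N,
    c * ‖h‖ ^ 2 ≤ bform V 0 h ((2 : ℝ) • projPlus hV h - h) := by
  obtain ⟨-, ho, c, hc, hp, hn⟩ := spectral_split hV
  refine ⟨c / 2, by positivity, fun h => ?_⟩
  have h1 := (ho _ (projPlus_mem hV h) _ (sub_projPlus_mem hV h)).2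
  have h2 := hp _ (projPlus_mem hV h)
  have h3 := hn _ (sub_projPlus_mem hV h)
  have h4 : h = projPlus hV h + (h - projPlus hV h) := by abel
  have h5 : (2 : ℝ) • projPlus hV h - h = projPlus hV h - (h - projPlus hV h) := by
    rw [two_smul]
    abel
  rw [h5]
  set a := projPlus hV h
  set b := h - a
  rw [h4]
  have h6 : ‖a + b‖ ^ 2 ≤ 2 * (‖a‖ ^ 2 + ‖b‖ ^ 2) := by
    have h7 : ‖a + b‖ ^ 2 ≤ (‖a‖ + ‖b‖) ^ 2 :=
      pow_le_pow_left₀ (norm_nonneg _) (norm_add_le a b) 2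
    nlinarith [sq_nonneg (‖a‖ - ‖b‖)]
  have h8 : bform V 0 (a + b) (a - b) = bform V 0 a a - bform V 0 b b := by
    simp only [← schrL_apply hV.bounded, map_add, map_sub, add_apply] at h1 ⊢
    have h9 : schrL hV.bounded b a = 0 := by
      rw [schrL_apply, bform_comm, ← schrL_apply hV.bounded, h1]
    rw [h1, h9]
    ring
  rw [h8]
  have := mul_le_mul_of_nonneg_left h6 hc.le
  linarith

/-- Test the difference of the two equations with the reflection of `w n - u` that changes the sign
of its `X⁻` part. The form then controls the squared norm, while the right-hand side is small
relative to the norm. -/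
theorem tendsto_of_tendsto_rpow (hN : 3 ≤ N) (hV : CondV V) (hf : CondF f p) {w : ℕ → H1 N}
    {u : H1 N} {R : ℝ} (hR : ∀ n, ‖w n‖ ≤ R) {e : ℕ → ℝ} (he : Tendsto e atTop (𝓝 0))
    (hw : ∀ n ψ, |bform V 0 (w n) ψ - nonlinL hN hf (w n) ψ| ≤ e n * ‖ψ‖)
    (hu : ∀ ψ, bform V 0 u ψ = nonlinL hN hf u ψ)
    (hlim : Tendsto (fun n => ∫ x, |(w n - u).val x| ^ p) atTop (𝓝 0)) :
    Tendsto w atTop (𝓝 u) := by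
  obtain ⟨c, hc, hcle⟩ := exists_norm_sq_le_bform hV
  obtain ⟨D, hD, hDle⟩ : ∃ D : ℝ, 0 < D ∧ ∀ h : H1 N, ‖(2 : ℝ) • projPlus hV h - h‖ ≤ D * ‖h‖ := by
    obtain ⟨D, hD, hDle⟩ := (projPlus hV).bound
    refine ⟨2 * D + 1, by positivity, fun h => (norm_sub_le _ _).trans ?_⟩
    rw [norm_smul, Real.norm_of_nonneg zero_le_two]
    linarith [hDle h]
  rw [Metric.tendsto_atTop]
  intro ε hε
  set δ := c * ε / (4 * D) with hδ
  have hδ0 : 0 < δ := by positivity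
  obtain ⟨n₀, hn₀⟩ := eventually_atTop.1 ((nonlin_tendsto hN hf
    (fun n => (norm_toL2L_le _).trans (hR n)) hlim hδ0).and (he.eventually_lt_const hδ0))
  refine ⟨n₀, fun n hn => ?_⟩
  obtain ⟨h1, h2⟩ := hn₀ n hn
  rw [dist_eq_norm]
  set h := w n - u with hh
  set ψ := (2 : ℝ) • projPlus hV h - h with hψ
  have h3 : bform V 0 h ψ = bform V 0 (w n) ψ - bform V 0 u ψ := by
    simp only [← schrL_apply hV.bounded, hh, map_sub, sub_apply]
  have h4 : |nonlinL hN hf (w n) ψ - nonlinL hN hf u ψ| ≤ δ * ‖ψ‖ := by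
    rw [nonlinL_apply, nonlinL_apply, ← integral_sub (integrable_nonlin_mul hN hf _ _)
      (integrable_nonlin_mul hN hf _ _)]
    refine abs_integral_le_integral_abs.trans (le_trans (le_of_eq ?_) (h1 ψ))
    refine integral_congr_ae (ae_of_all _ fun x => ?_)
    simp only
    rw [← sub_mul, abs_mul]
  have h5 := hw n ψ
  have h6 : e n * ‖ψ‖ ≤ δ * ‖ψ‖ := mul_le_mul_of_nonneg_right h2.le (norm_nonneg _)
  have h7 : bform V 0 h ψ ≤ 2 * δ * (D * ‖h‖) := by
    have h8 := mul_le_mul_of_nonneg_left (hDle h) hδ0.le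
    rw [h3, hu]
    have h9 := (abs_le.1 h4).2
    have h10 := (abs_le.1 h5).2
    linarith
  have h8 := (hcle h).trans h7
  have h9 : 2 * δ * (D * ‖h‖) = c * (ε / 2) * ‖h‖ := by
    rw [hδ]
    field_simp
    ring
  rw [h9] at h8
  by_contra hcon
  push Not at hcon
  have h10 : 0 < c * ‖h‖ := mul_pos hc (hε.trans_le hcon)
  nlinarith

/-- Nonvanishing selects translates with a nonzero weak limit. That limit lies on the Nehari–Pankov
set of `J_0`, so its energy is at least `l`; Fatou gives at most `l`, and equality excludes any loss
of mass. -/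
theorem groundState_compactness (hN : 3 ≤ N) (hV : CondV V) (hf : CondF f p) (hF6 : CondF6 f p)
    {μ : ℕ → ℝ} {u : ℕ → H1 N} (hμ : ∀ n, 0 < μ n) (hμ0 : Tendsto μ atTop (𝓝 0))
    (hu : ∀ n, IsGroundState V f (μ n) (u n)) :
    ∃ k : ℕ → ℕ, StrictMono k ∧ ∃ (z : ℕ → Fin N → ℤ) (u₀ : H1 N), IsGroundState V f 0 u₀ ∧
      Tendsto (fun n => shift (latticePoint (z n)) (u (k n))) atTop (𝓝 u₀) := by
  obtain ⟨l, R, hl, hlev, hE, hR⟩ := groundState_seq_bounded hN hV hf hμ hμ0 hu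
  obtain ⟨n₀, hn₀⟩ := eventually_atTop.1 hR
  have hcrit : ∀ n v, bform V (μ n) (u n) v = nonlinL hN hf (u n) v := fun n =>
    (critical_iff hN hV.bounded hf).1 (hu n).critical
  have hadd : Tendsto (fun n => n + n₀) atTop atTop := tendsto_add_atTop_nat n₀
  have hnv : ¬ LatticeVanishing fun n => u (n + n₀) :=
    not_latticeVanishing_of_energy (V := V) (μ := fun n => μ (n + n₀)) hN hf
      (fun n => hn₀ _ (Nat.le_add_left _ _)) hl (fun n => hcrit _ _) (hE.comp hadd)
  simp only [LatticeVanishing] at hnv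
  push Not at hnv
  obtain ⟨b, ε, hε, hfr⟩ := hnv
  obtain ⟨k₁, hk₁, hz⟩ := extraction_of_frequently_atTop hfr
  choose z hz using hz
  obtain ⟨k₂, u₀, hk₂, hweak, hae⟩ := exists_weak_ae_subseq
    (w := fun n => shift (latticePoint (z n)) (u (k₁ n + n₀))) (R := R) fun n => by
      rw [LinearIsometry.norm_map]
      exact hn₀ _ (Nat.le_add_left _ _)
  set k : ℕ → ℕ := fun n => k₁ (k₂ n) + n₀ with hk
  have hkm : StrictMono k := fun a c h => Nat.add_lt_add_right (hk₁ (hk₂ h)) n₀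
  set w : ℕ → H1 N := fun n => shift (latticePoint (z (k₂ n))) (u (k n)) with hw
  have hwR : ∀ n, ‖w n‖ ≤ R := fun n => by
    rw [hw, LinearIsometry.norm_map]
    exact hn₀ _ (Nat.le_add_left _ _)
  obtain ⟨C, hC, hCle⟩ := exists_abs_bform_shift_sub_le hN hV hf
  have hR0 : 0 ≤ R := (norm_nonneg _).trans (hwR 0)
  have he : Tendsto (fun n => μ (k n) * (C * R)) atTop (𝓝 0) := by
    simpa using (hμ0.comp hkm.tendsto_atTop).mul_const (C * R)
  have hwe : ∀ n ψ, |bform V 0 (w n) ψ - nonlinL hN hf (w n) ψ| ≤ μ (k n) * (C * R) * ‖ψ‖ := by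
    intro n ψ
    refine (hCle _ (hμ _).le _ (hcrit _) (z (k₂ n)) ψ).trans ?_
    rw [mul_assoc (μ (k n))]
    refine mul_le_mul_of_nonneg_left ?_ (hμ _).le
    refine mul_le_mul_of_nonneg_right (mul_le_mul_of_nonneg_left ?_ hC) (norm_nonneg _)
    exact hn₀ _ (Nat.le_add_left _ _)
  have hu₀ : ∀ ψ, bform V 0 u₀ ψ = nonlinL hN hf u₀ ψ :=
    critical_zero_of_weak_limit hN hV hf hwR he hwe hweak hae
  have hne : u₀ ≠ 0 := by
    rintro rfl
    have h1 := (hweak ((innerSL ℝ (toL2L N b)).comp (toL2L N))).abs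
    rw [map_zero, abs_zero] at h1
    refine absurd (ge_of_tendsto' h1 fun n => ?_) hε.not_ge
    have h2 := (hz (k₂ n)).le
    rw [real_inner_comm] at h2
    exact h2
  have hXm : u₀ ∉ Xminus V := by
    intro hmem
    obtain ⟨c, -, hc, -, hneg, -⟩ := exists_bform_pos_small hN hV
    have h1 := hneg u₀ hmem
    rw [hu₀] at h1
    have h2 := two_mul_potential_le hN hf u₀
    have h3 := potential_nonneg hf u₀
    have h4 : 0 < c * ‖u₀‖ ^ 2 := mul_pos hc (pow_pos (norm_pos_iff.2 hne) 2)
    linarith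
  have hmem : u₀ ∈ nehariPankov V f 0 :=
    (mem_nehariPankov_iff hN hV.bounded hf).2 ⟨hXm, hu₀ _, fun v _ => hu₀ v⟩
  have hge : l ≤ energy V f 0 u₀ := by
    have := level_le hmem
    rwa [hlev, EReal.coe_le_coe_iff] at this
  -- On solutions the energy equals the integral of this density, which is nonnegative and invariant
  -- under lattice translations. The singular term has disappeared from it, so translates of
  -- solutions for different `μ` can be compared.
  set e : H1 N → Euc N → ℝ := fun v x =>
    1 / 2 * (f x (v.val x) * v.val x) - primitive f x (v.val x) with hedef
  have hei : ∀ v, Integrable (e v) := fun v =>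
    ((integrable_nonlin_mul hN hf v v).const_mul _).sub (integrable_primitive hN hf v)
  have he0 : ∀ v, ∀ᵐ x, 0 ≤ e v x := fun v => by
    filter_upwards [hf.scalar] with x hx
    have := hx.two_mul_primitive_le (v.val x)
    simp only [hedef, primitive]
    linarith
  have heu : ∀ v, ∫ x, e v x = 1 / 2 * nonlinL hN hf v v - potential f v := fun v => by
    simp only [hedef]
    rw [integral_sub ((integrable_nonlin_mul hN hf v v).const_mul _)
      (integrable_primitive hN hf v), integral_const_mul, nonlinL_apply, potential]
  have heE : Tendsto (fun n => ∫ x, e (w n) x) atTop (𝓝 l) := by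
    refine (hE.comp hkm.tendsto_atTop).congr fun n => ?_
    rw [heu, Function.comp_apply, energy_eq_potential, hcrit]
    simp only [hw]
    rw [nonlinL_shift, potential_shift hf]
  have hfat := fatou_scheffe (fun n => hei (w n)) (hei u₀) (fun n => he0 (w n)) (he0 u₀) (by
    filter_upwards [hae, hf.F1.continuous] with x hx hc
    have hc' : Continuous (primitive f x) :=
      intervalIntegral.continuous_primitive (fun a b => hc.intervalIntegrable a b) 0
    have h1 : Continuous fun s => 1 / 2 * (f x s * s) - primitive f x s := by fun_prop
    exact (h1.tendsto _).comp hx) heE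
  have hEu : energy V f 0 u₀ = ∫ x, e u₀ x := by
    rw [heu, energy_eq_potential, hu₀]
  rw [← hEu] at hfat
  have heq : energy V f 0 u₀ = l := le_antisymm hfat.1 hge
  have hlp := tendsto_rpow_of_excess hN hf hF6 hwR hae (by
    have := hfat.2
    rw [heq, sub_self] at this
    exact this)
  exact ⟨k, hkm, fun n => z (k₂ n), u₀, ⟨hne, (critical_iff hN hV.bounded hf).2 hu₀,
    by rw [heq, hlev], by rw [hlev]; exact_mod_cast hl⟩,
    tendsto_of_tendsto_rpow hN hV hf hwR he hwe hu₀ hlp⟩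

end

end HardySchrodinger

end

/-! ### Assembly of the three parts of the theorem. -/

open HardySchrodinger in
theorem theorem1p2 (N : ℕ) (hN : 3 ≤ N) (V : Euc N → ℝ) (hV : CondV V)
    (f : Euc N → ℝ → ℝ) (p : ℝ) (hF1 : CondF1 f) (hF2 : CondF2 f p) (hF3 : CondF3 f)
    (hF4 : CondF4 f) (hF5 : CondF5 f) :
    -- (a), first comparison
    (∀ μ : ℝ, Admissible V μ → ∀ uμ : H1 N, IsGroundState V f μ uμ →
      ∃ t : ℝ, 0 < t ∧ ∃ v ∈ Xminus V, t • uμ + v ∈ nehariPankov V f 0 ∧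
        level V f 0 ≤ level V f μ + ((1 / 2 * hardyTerm μ (t • uμ + v) : ℝ) : EReal)) ∧
    -- (a), second comparison
    (∀ μ : ℝ, Admissible V μ → 0 ≤ μ → ∀ u₀ : H1 N, IsGroundState V f 0 u₀ →
      ∃ t : ℝ, 0 < t ∧ ∃ v ∈ Xminus V, t • u₀ + v ∈ nehariPankov V f μ ∧
        level V f μ ≤ level V f 0 - ((1 / 2 * hardyTerm μ (t • u₀ + v) : ℝ) : EReal)) ∧
    -- (a), limit of the levels
    Tendsto (fun μ : ℝ => level V f μ) (𝓝[>] 0) (𝓝 (level V f 0)) ∧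
    -- (b)
    (CondF6 f p → ∀ (μ : ℕ → ℝ) (u : ℕ → H1 N), (∀ n, 0 < μ n) → Tendsto μ atTop (𝓝 0) →
      (∀ n, IsGroundState V f (μ n) (u n)) →
      ∃ k : ℕ → ℕ, StrictMono k ∧ ∃ (z : ℕ → Fin N → ℤ) (w : ℕ → H1 N) (u₀ : H1 N),
        (∀ n, (w n).val =ᵐ[volume] fun x => (u (k n)).val (x + latticePoint (z n))) ∧
        IsGroundState V f 0 u₀ ∧ Tendsto w atTop (𝓝 u₀)) ∧
    -- (c)
    (∀ μ : ℝ, μ < 0 → 0 < sInf (schrodingerSpectrum V) →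
      ¬ ∃ u : H1 N, IsGroundState V f μ u) := by
  have hf : CondF f p := ⟨hF1, hF2, hF3, hF4, hF5⟩
  refine ⟨fun μ h u hu => level_zero_le_of_groundState hN hV hf h hu,
    fun μ h hμ u hu => level_le_of_groundState_zero hN hV hf h hμ hu, tendsto_level hN hV hf,
    fun hF6 μ u hμ hμ0 hu => ?_,
    fun μ hμ hpos ⟨u, hu⟩ => not_groundState_of_neg hN hV hf hμ hpos u hu⟩
  obtain ⟨k, hk, z, u₀, hu₀, hlim⟩ := groundState_compactness hN hV hf hF6 hμ hμ0 hu
  exact ⟨k, hk, z, _, u₀, fun n => val_shift _ _, hu₀, hlim⟩
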